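/- **Setting.** Let $\mathcal S=\mathbb N\times\mathbb N\times\mathcal S'$ with $\mathcal S'$ a separable metric space with metric $\rho'$, and $\rho((d^-,d^+,\mathbf a),(e^-,e^+,\mathbf b))=|d^--e^-|+|d^+-e^+|+\rho'(\mathbf a,\mathbf b)$. For every $n$ there is a random directed multigraph $G_n$ (self-loops and parallel edges allowed; sums and families over $j\to i$ run over the edges from $j$ to $i$, counted with multiplicity) on a set $V_n$ of $n$ vertices, with random attributes $\mathbf a_i\in\mathcal S'$; $\mathbf X_i=(D_i^-,D_i^+,\mathbf a_i)$ where $D_i^\mp$ are the in- and out-degree. Put $\mathscr F_n=\sigma(\mathbf a_i:i\in V_n)$, $\mathbb P_n=P(\cdot\mid\mathscr F_n)$, $\mathbb E_n=E[\cdot\mid\mathscr F_n]$, and let $I$ be uniform on $V_n$, independent of the graph and the attributes. Let $\Phi(\mathbf x,\zeta,\{v_j,\xi_j\})$ be a measurable real function of a mark, a vertex noise and a finite unordered family of pairs (real value, edge noise), $g:\mathbb R\times\mathcal S\to\mathbb R$, and $\Psi(\mathbf x,\zeta,\cdot)=g(\Phi(\mathbf x,\zeta,\cdot),\mathbf x)$.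 Given i.i.d. $R_i^{(0)}\sim\mu_0$, $$R_i^{(k+1)}=\Phi\big(\mathbf X_i,\zeta_i^{(k)},\{g(R_j^{(k)},\mathbf X_j),\xi_{j,i}^{(k)}:j\to i\}\big),$$ where the vertex noises are i.i.d., the edge noises (one for each time and each edge) are i.i.d., and noises and initial values are independent of each other and of everything else. $d_p$ is the Wasserstein metric of order $p$ on $\mathbb R$. *Limiting tree.* A delayed marked Galton–Watson tree $\mathcal T(\boldsymbol X)$ is built from independent vectors $(\mathcal N_{\mathbf i},\boldsymbol X_{\mathbf i})\in\mathbb N\times\mathcal S$, identically distributed for $\mathbf i\ne\emptyset$ (generic copy $(\mathcal N_1,\boldsymbol X_1)$); node $\mathbf i$ has offspring $(\mathbf i,1),\dots,(\mathbf i,\mathcal N_{\mathbf i})$. Write $\mathcal T^{(k)}$ for its first $k$ generations. Given such a tree, i.i.d. noises and i.i.d. $\mathcal R_{\mathbf i}^{(0)}\sim\mu_0$, all independent, set $$\mathcal R_{\mathbf i}^{(k+1)}=\Phi\big(\boldsymbol X_{\mathbf i},\zeta_{\mathbf i}^{(k)},\{g(\mathcal R_{(\mathbf i,j)}^{(k)},\boldsymbol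 X_{(\mathbf i,j)}),\xi_{(\mathbf i,j)}^{(k)}:1\le j\le\mathcal N_{\mathbf i}\}\big),$$ and let $\nu_k$ be the law of $\mathcal R_\emptyset^{(k)}$. Let $(\zeta,\{\xi_j\})$ be a generic noise vector. **Assumption [R].** There are continuous $\sigma_-,\sigma_+,\beta:\mathcal S\to\mathbb R$ and $p\in[1,\infty)$ such that: 1. At almost every realization, at each vertex $i$ of each $G_n$ and for all $\mathbf v,\tilde{\mathbf v}\in\mathbb R^{V_n}$, taking the $L^p$ norm $\|\cdot\|_p$ over the noise only, $\|\Phi(\mathbf X_i,\zeta,\{v_j,\xi_{j,i}:j\to i\})-\Phi(\mathbf X_i,\zeta,\{\tilde v_j,\xi_{j,i}:j\to i\})\|_p\le\sigma_-(\mathbf X_i)\sum_{j\to i}|v_j-\tilde v_j|$. 2. $|g(r,\mathbf x)-g(\tilde r,\mathbf x)|\le\sigma_+(\mathbf x)|r-\tilde r|$ for all $\mathbf x\in\mathcal S$ and $r,\tilde r\in\mathbb R$. 3. In the same sense as in 1, $\|\Phi(\mathbf X_i,\zeta,\{v_j,\xi_{j,i}:j\to i\})\|_p\le\sum_{j\to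 i}\sigma_-(\mathbf X_i)|v_j|+\beta(\mathbf X_i)$. The bounds 1 and 3 also hold almost surely at the marks $(\mathcal N_\emptyset,\boldsymbol X_\emptyset)$ and $(\mathcal N_1,\boldsymbol X_1)$ of the limiting tree ($\mathcal N$ values $v_j$). 4. Either (i) there are constants $K,K_0<\infty$ such that almost surely, for all $n$, the matrices with entries $C_{ij}=\sigma_-(\mathbf X_i)\sigma_+(\mathbf X_j)\,m_{ji}$ and $C^{(0)}_{ij}=\sigma_-(\mathbf X_i)|g(0,\mathbf X_j)|\,m_{ji}$, where $m_{ji}$ is the number of edges $j\to i$, have $\ell^p$ operator norms at most $K$ and $K_0$, and $\int|r|^p\mu_0(dr)<\infty$; or (ii) there is $K<\infty$ such that for each initial law supported in $[-K,K]$ one has $\max_i|R_i^{(1)}|\le K$ almost surely for all $n$, and $\operatorname{supp}\mu_0\subseteq[-K,K]$. 5. There are $H,Q,\alpha,\gamma>0$ such that for $\mathbf x=(d^-,d^+,\mathbf a)$ and $\tilde{\mathbf x}$ in $\mathcal S$ with $\rho(\mathbf x,\tilde{\mathbf x})<1$, all real $v_1,\dots,v_{d^-}$ and all $r\in\mathbb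 R$, $\|\Phi(\mathbf x,\zeta,\{v_j,\xi_j\}_{j\le d^-})-\Phi(\tilde{\mathbf x},\zeta,\{v_j,\xi_j\}_{j\le d^-})\|_p\le H\big(1\vee(\sum_{j\le d^-}\sigma_-(\mathbf x)|v_j|+\beta(\mathbf x))\big)\rho(\mathbf x,\tilde{\mathbf x})^\alpha$ and $|g(r,\mathbf x)-g(r,\tilde{\mathbf x})|\le Q(1\vee\sigma_+(\mathbf x)|r|)\rho(\mathbf x,\tilde{\mathbf x})^\gamma$. **Assumption [G].** (a) *Strong coupling:* for all $k\ge1$ and $n$ there are, on the same probability space and independent of the noises and the $R_i^{(0)}$ (jointly with the graph and $I$), a delayed marked Galton–Watson tree, with law depending neither on $n$ nor on $k$ and independent of $\mathscr F_n$, and a map $\theta$ from its nodes to $V_n$, such that, as $n\to\infty$: $\mathbb P_n(\theta$ is not an isomorphism of $\mathcal T^{(k)}$, with edges from child to parent, onto the subgraph induced on the vertices with a directed path of length at most $k$ to $I$, mapping $\emptyset$ to $I)\to0$ in probability; $\mathbb E_n[\rho(\mathbf X_I,\boldsymbol X_\emptyset)]\to0$ in probability; and $\mathbb P_n(\rho(\mathbf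 X_{\theta(\mathbf i)},\boldsymbol X_{\mathbf i})\le\epsilon\ \forall\,\mathbf i\in\mathcal T^{(k)})\to1$ in probability for every $\epsilon\in(0,1)$. (b) $\mathcal N_\emptyset\sigma_-(\boldsymbol X_\emptyset)$, $\beta(\boldsymbol X_\emptyset)$, $\mathcal N_1\sigma_-(\boldsymbol X_1)\sigma_+(\boldsymbol X_1)$, $\sigma_+(\boldsymbol X_1)\beta(\boldsymbol X_1)$, $\sigma_+(\boldsymbol X_1)$ and $g(0,\boldsymbol X_1)$ have finite $p$-th absolute moments. (c) With $f_*(d^-,d^+,\mathbf a)=\sigma_-(d^-,d^+,\mathbf a)\,d^-$, the $d_p$-distances between the conditional laws given $\mathscr F_n$ of $f_*(\mathbf X_I)$ and of $\beta(\mathbf X_I)$ and the laws of $f_*(\boldsymbol X_\emptyset)$ and of $\beta(\boldsymbol X_\emptyset)$, respectively, tend to $0$ in probability. **Theorem.** Assume [R] and [G]. For each fixed $k\ge0$ one can, on an extension of the probability spaces, put i.i.d. noises and i.i.d. initial values with law $\mu_0$ on the coupled trees (of depth $\max(k,1)$), independent of these trees, so that the resulting variables $\mathcal R_\emptyset^{(0)},\dots,\mathcal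 R_\emptyset^{(k)}$ satisfy $$\max_{0\le r\le k}\mathbb E_n\big[|R_I^{(r)}-\mathcal R_\emptyset^{(r)}|^p\big]\to0\quad\text{in probability as }n\to\infty .$$ With $\mu_{k,n}=\mathbb P_n(R_I^{(k)}\in\cdot)$, for each $k\ge0$ one has $d_p(\mu_{k,n},\nu_k)\to0$ in probability as $n\to\infty$. If moreover $E[(\mathcal N_1\sigma_-(\boldsymbol X_1)\sigma_+(\boldsymbol X_1))^p]<1$, then there is a probability measure $\nu$ with $d_p(\nu_k,\nu)\to0$ as $k\to\infty$, and $\nu$ is the law of $$\mathcal R^*=\Phi\big(\boldsymbol X_\emptyset,\zeta,\{\mathcal V_j,\xi_j:1\le j\le\mathcal N_\emptyset\}\big),$$ where the $\mathcal V_j$ are i.i.d. with law $\eta$, independent of $(\mathcal N_\emptyset,\boldsymbol X_\emptyset,\zeta,\{\xi_j\})$, and $\eta$ is the attracting endogenous solution of $$\mathcal V\stackrel{\mathcal D}{=}\Psi\big(\boldsymbol X_1,\zeta,\{\mathcal V_j,\xi_j:1\le j\le\mathcal N_1\}\big),\qquad \mathcal V_j\text{ i.i.d. copies of }\mathcal V,\text{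 independent of }(\mathcal N_1,\boldsymbol X_1,\zeta,\{\xi_j\}).$$ That is: $\eta$ solves this equation; $\eta$ is the $d_p$-limit of the laws of the $k$-fold iterations of $\Psi$ on the tree with all vectors distributed as $(\mathcal N_1,\boldsymbol X_1)$, started from $g(0,\boldsymbol X_{\mathbf i})$ at the nodes of generation $k$; and on that tree with noises there are variables $\mathcal V_{\mathbf i}$ of law $\eta$ satisfying $\mathcal V_{\mathbf i}=\Psi(\boldsymbol X_{\mathbf i},\zeta_{\mathbf i},\{\mathcal V_{(\mathbf i,j)},\xi_{(\mathbf i,j)}:1\le j\le\mathcal N_{\mathbf i}\})$ almost surely, with $\mathcal V_\emptyset$ measurable with respect to $\sigma\big((\boldsymbol X_{\mathbf i},\zeta_{\mathbf i},\{\xi_{(\mathbf i,j)}\}_{j\ge1}):\mathbf i\in\mathcal T\big)$. -/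

import Mathlib

open MeasureTheory ProbabilityTheory Filter Topology
open scoped ENNReal

universe u v w a

noncomputable section

namespace StochRec

/-! ### Vertex marks and recursion data -/

/-- Vertex marks `(d⁻, d⁺, 𝐚)`, where `𝐚` is an attribute in the metric space `A`. -/
abbrev Mark (A : Type a) := ℕ × ℕ × A

/-- The metric `ρ` on marks: `|d⁻ - e⁻| + |d⁺ - e⁺| + dist 𝐚 𝐛`. -/
def markDist {A : Type a} [MetricSpace A] (x y : Mark A) : ℝ :=
  |(x.1 : ℝ) - (y.1 : ℝ)| + |(x.2.1 : ℝ) - (y.2.1 : ℝ)| + dist x.2.2 y.2.2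

/-- The data of a stochastic recursion: the map `Φ`, whose last argument is a finite unordered
family (with repetitions) of pairs (value received from an in-neighbour, noise of the edge), the
map `g`, and the laws of the vertex noise and of the edge noise. -/
structure Recursion (A : Type a) (Z : Type v) (Ξ : Type w) [MeasurableSpace Z]
    [MeasurableSpace Ξ] where
  Φ : Mark A → Z → Multiset (ℝ × Ξ) → ℝ
  g : ℝ → Mark A → ℝ
  zetaLaw : ProbabilityMeasure Z
  xiLaw : ProbabilityMeasure Ξ

/-- The functions `σ₋, σ₊, β` on the space of marks. -/
structure Bounds (A : Type a) where
  sm : Mark A → ℝ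
  sp : Mark A → ℝ
  β : Mark A → ℝ

section Basic

variable {A : Type a} {Z : Type v} {Ξ : Type w} [MeasurableSpace Z] [MeasurableSpace Ξ]

/-- The composition `Ψ(𝐱, ζ, {v_j, ξ_j}) = g(Φ(𝐱, ζ, {v_j, ξ_j}), 𝐱)`. -/
def Recursion.Ψ (M : Recursion A Z Ξ) (x : Mark A) (z : Z) (s : Multiset (ℝ × Ξ)) : ℝ :=
  M.g (M.Φ x z s) x

/-- `Φ` is measurable: for each number `m` of in-neighbours it is a measurable function of the
mark, the vertex noise, and the `m` received values and edge noises. -/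
def Recursion.IsMeasurable [MeasurableSpace A] (M : Recursion A Z Ξ) : Prop :=
  ∀ m : ℕ, Measurable fun q : Mark A × Z × (Fin m → ℝ × Ξ) =>
    M.Φ q.1 q.2.1 (Finset.univ.val.map q.2.2)

/-- The noise used in one application of `Φ`: one vertex noise, and an i.i.d. family of edge
noises, all independent. -/
def Recursion.stepLaw (M : Recursion A Z Ξ) (E : Type*) : Measure (Z × (E → Ξ)) :=
  (M.zetaLaw : Measure Z).prod (Measure.infinitePi fun _ : E => (M.xiLaw : Measure Ξ))

/-- All noises `ζ_i^{(t)}` and `ξ_e^{(t)}` (times `t`, vertices `i ∈ V`, edges `e ∈ E`) together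
with the initial values `R_i^{(0)}`. -/
abbrev NoiseSpace (V E : Type*) (Z : Type v) (Ξ : Type w) :=
  (ℕ × V → Z) × (ℕ × E → Ξ) × (V → ℝ)

/-- The vertex noises, the edge noises and the initial values are each i.i.d. with the prescribed
law, and independent of one another. -/
def Recursion.noiseLaw (M : Recursion A Z Ξ) (μ₀ : ProbabilityMeasure ℝ) (V E : Type*) :
    Measure (NoiseSpace V E Z Ξ) :=
  (Measure.infinitePi fun _ : ℕ × V => (M.zetaLaw : Measure Z)).prod
    ((Measure.infinitePi fun _ : ℕ × E => (M.xiLaw : Measure Ξ)).prod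
      (Measure.infinitePi fun _ : V => (μ₀ : Measure ℝ)))

end Basic

/-! ### Random directed multigraphs and the recursion on them -/

/-- A random directed multigraph on the vertex set `V` with vertex attributes and a random vertex
`root` (the vertex `I`); `mult ω j i` is the number of edges from `j` to `i`. Self-loops and
parallel edges are allowed. -/
structure RandomDigraph (Ω : Type u) (V : Type*) (A : Type a) where
  att : Ω → V → A
  mult : Ω → V → V → ℕ
  root : Ω → V

section Graph

variable {Ω : Type u} {V : Type*} [Fintype V] {A : Type a} {Z : Type v} {Ξ : Type w}

/-- The mark `𝐗_i = (D_i⁻, D_i⁺, 𝐚_i)`. -/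
def RandomDigraph.mark (G : RandomDigraph Ω V A) (ω : Ω) (i : V) : Mark A :=
  (∑ j, G.mult ω j i, ∑ j, G.mult ω i j, G.att ω i)

/-- The family `{f e : e an edge j → i}`; the edges from `j` to `i` are `(j, i, l)` with
`l < mult j i`. -/
def inFamily {γ : Type*} (mult : V → V → ℕ) (i : V) (f : V → ℕ → γ) : Multiset γ :=
  (Finset.univ : Finset V).val.bind fun j => (Multiset.range (mult j i)).map (f j)

/-- The vertices are random and the vertex `I` is uniform, independently of the graph. -/
structure RandomDigraph.IsUniformlyRooted [MeasurableSpace Ω] [MeasurableSpace V]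
    [MeasurableSpace A] (G : RandomDigraph Ω V A) (P : Measure Ω) : Prop where
  measurable_att : Measurable G.att
  measurable_mult : Measurable G.mult
  measurable_root : Measurable G.root
  uniform : ∀ i : V, P {ω | G.root ω = i} = (Fintype.card V : ℝ≥0∞)⁻¹
  indep : IndepFun G.root (fun ω => (G.att ω, G.mult ω)) P

/-- The σ-algebra `ℱ = σ(𝐚_i : i ∈ V)`. -/
abbrev RandomDigraph.attAlg [MeasurableSpace A] (G : RandomDigraph Ω V A) : MeasurableSpace Ω :=
  MeasurableSpace.comap G.att inferInstance

/-- The process `R_i^{(k)}` on a fixed multigraph with marks `X`, noises and initial values `w`: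
`R_i^{(k+1)} = Φ(𝐗_i, ζ_i^{(k)}, {g(R_j^{(k)}, 𝐗_j), ξ_{j,i}^{(k)} : j → i})`. -/
def graphR [MeasurableSpace Z] [MeasurableSpace Ξ] (M : Recursion A Z Ξ) (X : V → Mark A)
    (mult : V → V → ℕ) (w : NoiseSpace V (V × V × ℕ) Z Ξ) : ℕ → V → ℝ
  | 0, i => w.2.2 i
  | k + 1, i => M.Φ (X i) (w.1 (k, i)) (inFamily mult i fun j l =>
      (M.g (graphR M X mult w k j) (X j), w.2.1 (k, (j, i, l))))

/-- The random variable `R_I^{(k)}`. -/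
def RandomDigraph.rootR [MeasurableSpace Z] [MeasurableSpace Ξ] (G : RandomDigraph Ω V A)
    (M : Recursion A Z Ξ) (W : Ω → NoiseSpace V (V × V × ℕ) Z Ξ) (k : ℕ) (ω : Ω) : ℝ :=
  graphR M (G.mark ω) (G.mult ω) (W ω) k (G.root ω)

/-- `inGen mult i r`: the vertices having a directed path of length `r` to `i`. -/
def inGen (mult : V → V → ℕ) (i : V) : ℕ → Set V
  | 0 => {i}
  | r + 1 => {j | ∃ l ∈ inGen mult i r, 0 < mult j l}

end Graph

/-! ### Marked Galton–Watson trees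

Nodes are lists of natural numbers, the root is `[]`, and the children of the node `i` are
`0 :: i, …, (N_i - 1) :: i`; so the label is read from right to left, offspring are numbered
from `0`, and the generation of a node is the length of the list. The edge between a node and its
parent is named by the child. -/

/-- `InTree N i`: the node `i` belongs to the tree with offspring numbers `N`. -/
def InTree (N : List ℕ → ℕ) : List ℕ → Prop
  | [] => True
  | j :: i => InTree N i ∧ j < N i

/-- The law of the vectors `(N_i, 𝐗_i)`, indexed by all node labels, of a delayed marked
Galton–Watson process: independent, with law `π₀` at the root and law `π₁` at other nodes. -/
def gwLaw {A : Type a} [MeasurableSpace A] (π₀ π₁ : ProbabilityMeasure (ℕ × Mark A)) :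
    Measure (List ℕ → ℕ × Mark A) :=
  Measure.infinitePi fun i : List ℕ =>
    (((if i = [] then π₀ else π₁ : ProbabilityMeasure (ℕ × Mark A))) : Measure (ℕ × Mark A))

/-- The family `{f j : j an offspring label of a node with m offspring}`. -/
def offFamily {γ : Type*} (m : ℕ) (f : ℕ → γ) : Multiset γ := (Multiset.range m).map f

section Tree

variable {A : Type a} {Z : Type v} {Ξ : Type w} [MeasurableSpace Z] [MeasurableSpace Ξ]

/-- The recursion on the marked tree `t`, with noises and initial values `w`:
`ℛ_i^{(k+1)} = Φ(𝐗_i, ζ_i^{(k)}, {g(ℛ_{(i,j)}^{(k)}, 𝐗_{(i,j)}), ξ_{(i,j)}^{(k)} : j ≤ N_i})`. -/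
def treeR (M : Recursion A Z Ξ) (t : List ℕ → ℕ × Mark A)
    (w : NoiseSpace (List ℕ) (List ℕ) Z Ξ) : ℕ → List ℕ → ℝ
  | 0, i => w.2.2 i
  | k + 1, i => M.Φ (t i).2 (w.1 (k, i)) (offFamily (t i).1 fun j =>
      (M.g (treeR M t w k (j :: i)) (t (j :: i)).2, w.2.1 (k, j :: i)))

/-- `ν_k`, the law of `ℛ_∅^{(k)}`. -/
def rootLaw [MeasurableSpace A] (M : Recursion A Z Ξ) (μ₀ : ProbabilityMeasure ℝ)
    (π₀ π₁ : ProbabilityMeasure (ℕ × Mark A)) (k : ℕ) : Measure ℝ :=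
  ((gwLaw π₀ π₁).prod (M.noiseLaw μ₀ (List ℕ) (List ℕ))).map fun q => treeR M q.1 q.2 k []

/-- The law of `F(𝐗, ζ, {V_j, ξ_j : j ≤ N})`, where `(N, 𝐗)` has law `π`, the `V_j` are i.i.d.
with law `η`, `ζ` and the `ξ_j` are noises, and all of these are independent. -/
def branchLaw [MeasurableSpace A] (M : Recursion A Z Ξ) (π : ProbabilityMeasure (ℕ × Mark A))
    (F : Mark A → Z → Multiset (ℝ × Ξ) → ℝ) (η : ProbabilityMeasure ℝ) : Measure ℝ :=
  ((π : Measure (ℕ × Mark A)).prod ((M.zetaLaw : Measure Z).prod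
    (Measure.infinitePi fun _ : ℕ => (η : Measure ℝ).prod (M.xiLaw : Measure Ξ)))).map
      fun q => F q.1.2 q.2.1 (offFamily q.1.1 q.2.2)

/-- The space of `(N_i, 𝐗_i)`, `ζ_i`, `ξ_i` for all node labels `i`, with one noise per node and
per edge. -/
abbrev BranchSpace (A : Type a) (Z : Type v) (Ξ : Type w) :=
  (List ℕ → ℕ × Mark A) × (List ℕ → Z) × (List ℕ → Ξ)

/-- The law of a (non delayed) marked Galton–Watson tree with i.i.d. noises. -/
def branchSpaceLaw [MeasurableSpace A] (M : Recursion A Z Ξ)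
    (π₁ : ProbabilityMeasure (ℕ × Mark A)) : Measure (BranchSpace A Z Ξ) :=
  (gwLaw π₁ π₁).prod ((Measure.infinitePi fun _ : List ℕ => (M.zetaLaw : Measure Z)).prod
    (Measure.infinitePi fun _ : List ℕ => (M.xiLaw : Measure Ξ)))

/-- The mark `𝐘_i = (𝐗_i, ζ_i, {ξ_{(i,j)}}_j)`. -/
def branchMark (b : BranchSpace A Z Ξ) (i : List ℕ) : Mark A × Z × (ℕ → Ξ) :=
  ((b.1 i).2, b.2.1 i, fun j => b.2.2 (j :: i))

/-- The σ-algebra `𝒢_𝒯 = σ(𝐘_i : i ∈ 𝒯)` generated by the marks of the nodes of the tree. -/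
abbrev treeAlg (A : Type a) (Z : Type v) (Ξ : Type w) [MeasurableSpace A] [MeasurableSpace Z]
    [MeasurableSpace Ξ] : MeasurableSpace (BranchSpace A Z Ξ) :=
  MeasurableSpace.generateFrom {s | ∃ (i : List ℕ) (B : Set (Mark A × Z × (ℕ → Ξ))),
    MeasurableSet B ∧ s = {b | InTree (fun l => (b.1 l).1) i ∧ branchMark b i ∈ B}}

/-- The iterations `𝒱_i^{(r)}` of `Ψ` on the tree below `i`, started with `g(0, 𝐗)` at the nodes
`r` generations below `i`. -/
def branchV (M : Recursion A Z Ξ) (b : BranchSpace A Z Ξ) : ℕ → List ℕ → ℝ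
  | 0, i => M.g 0 (b.1 i).2
  | r + 1, i => M.Ψ (b.1 i).2 (b.2.1 i) (offFamily (b.1 i).1 fun j =>
      (branchV M b r (j :: i), b.2.2 (j :: i)))

end Tree

/-! ### Wasserstein distance and convergence in probability -/

/-- The Wasserstein distance of order `p` on the real line, with values in `[0, ∞]`. -/
def wasserstein (p : ℝ) (μ ν : Measure ℝ) : ℝ≥0∞ :=
  (⨅ γ ∈ {γ : Measure (ℝ × ℝ) | γ.map Prod.fst = μ ∧ γ.map Prod.snd = ν},
    ∫⁻ q, ‖q.1 - q.2‖ₑ ^ p ∂γ) ^ (1 / p)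

/-- Convergence in probability to the constant `c`; the `n`-th variable lives on its own
probability space. In `[0, ∞]` the truncated expression `(y - c) + (c - y)` is `|y - c|`. -/
def TendstoInProb {Ω : ℕ → Type*} [∀ n, MeasurableSpace (Ω n)] (P : ∀ n, Measure (Ω n))
    (Y : ∀ n, Ω n → ℝ≥0∞) (c : ℝ≥0∞) : Prop :=
  ∀ ε : ℝ≥0∞, 0 < ε → Tendsto (fun n => P n {ω | ε ≤ (Y n ω - c) + (c - Y n ω)}) atTop (𝓝 0)

/-- The conditional probability of an event given a σ-algebra. -/
def condProb {Ω : Type*} [MeasurableSpace Ω] (P : Measure Ω) (m : MeasurableSpace Ω)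
    (s : Set Ω) : Ω → ℝ≥0∞ :=
  condLExp m P (s.indicator fun _ => 1)

/-! ### The attracting endogenous solution -/

/-- `η` is the attracting endogenous solution of `𝒱 =_D Ψ(𝐗₁, ζ, {𝒱_j, ξ_j : j ≤ N₁})`:
it solves the equation, it is the `d_p`-limit of the laws of the iterations `𝒱_∅^{(k)}` started
from `g(0, 𝐗)`, and it is endogenous: on the marked Galton–Watson tree with noises there are
variables `𝒱_i` of law `η` that satisfy the recursion at every node, and `𝒱_∅` is measurable with
respect to the marks of the tree. -/
structure IsAttractingEndogenous {A : Type a} {Z : Type v} {Ξ : Type w} [MeasurableSpace A]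
    [MeasurableSpace Z] [MeasurableSpace Ξ] (M : Recursion A Z Ξ) (p : ℝ)
    (π₁ : ProbabilityMeasure (ℕ × Mark A)) (η : ProbabilityMeasure ℝ) : Prop where
  solution : branchLaw M π₁ M.Ψ η = (η : Measure ℝ)
  attracting : Tendsto (fun k => wasserstein p
    ((branchSpaceLaw M π₁).map fun b => branchV M b k []) (η : Measure ℝ)) atTop (𝓝 0)
  endogenous : ∃ V : List ℕ → BranchSpace A Z Ξ → ℝ,
    Measurable[treeAlg A Z Ξ] (V []) ∧
    (∀ i, HasLaw (V i) (η : Measure ℝ) (branchSpaceLaw M π₁)) ∧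
    ∀ᵐ b ∂(branchSpaceLaw M π₁), ∀ i, V i b = M.Ψ (b.1 i).2 (b.2.1 i)
      (offFamily (b.1 i).1 fun j => (V (j :: i) b, b.2.2 (j :: i)))

/-! ### Strong couplings -/

/-- A random marked tree (`node ω i` is `(N_i, 𝐗_i)`) together with the map `θ` from its nodes to
the vertices of a graph. -/
structure TreeCoupling (Ω : Type u) (V : Type*) (A : Type a) where
  node : Ω → List ℕ → ℕ × Mark A
  θ : Ω → List ℕ → V

section Coupling

variable {Ω : Type u} {V : Type*} [Fintype V] {A : Type a}

/-- The nodes of the first `k` generations of the tree. -/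
def TreeCoupling.nodes (T : TreeCoupling Ω V A) (k : ℕ) (ω : Ω) : Set (List ℕ) :=
  {i | InTree (fun l => (T.node ω l).1) i ∧ i.length ≤ k}

/-- `θ` is an isomorphism from the first `k` generations of the tree (edges pointing from
child to parent) onto the depth-`k` in-neighbourhood of `I`, and maps the root to `I`. -/
def TreeCoupling.IsIso (T : TreeCoupling Ω V A) (G : RandomDigraph Ω V A) (k : ℕ) (ω : Ω) :
    Prop :=
  T.θ ω [] = G.root ω ∧
  Set.BijOn (T.θ ω) (T.nodes k ω) {x | ∃ r ≤ k, x ∈ inGen (G.mult ω) (G.root ω) r} ∧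
  ∀ i ∈ T.nodes k ω, ∀ i' ∈ T.nodes k ω,
    ((∃ j : ℕ, i = j :: i') → G.mult ω (T.θ ω i) (T.θ ω i') = 1) ∧
    ((¬ ∃ j : ℕ, i = j :: i') → G.mult ω (T.θ ω i) (T.θ ω i') = 0)

end Coupling

/-- The trees `T n` are couplings of depth `k` of the in-neighbourhoods of `I` in the graphs `G n`:
they are delayed marked Galton–Watson trees with the laws `π₀, π₁`, independent of `ℱ_n`;
the conditional probability that the coupling is not an isomorphism tends to `0`; and the
marks are close. -/
structure IsStrongCoupling {A : Type a} [MetricSpace A] [MeasurableSpace A] {Ω : ℕ → Type u}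
    [∀ n, MeasurableSpace (Ω n)] (P : ∀ n, Measure (Ω n))
    (G : ∀ n, RandomDigraph (Ω n) (Fin (n + 1)) A)
    (π₀ π₁ : ProbabilityMeasure (ℕ × Mark A)) (k : ℕ)
    (T : ∀ n, TreeCoupling (Ω n) (Fin (n + 1)) A) : Prop where
  measurable_node : ∀ n, Measurable (T n).node
  measurable_θ : ∀ n, Measurable (T n).θ
  law : ∀ n, HasLaw (T n).node (gwLaw π₀ π₁) (P n)
  indep : ∀ n, IndepFun (T n).node (G n).att (P n)
  iso : TendstoInProb P
    (fun n => condProb (P n) (G n).attAlg {ω | ¬ (T n).IsIso (G n) k ω}) 0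
  root_close : TendstoInProb P
    (fun n => condLExp (G n).attAlg (P n) fun ω =>
      ENNReal.ofReal (markDist ((G n).mark ω ((G n).root ω)) ((T n).node ω []).2)) 0
  marks_close : ∀ ε : ℝ, 0 < ε → ε < 1 → TendstoInProb P
    (fun n => condProb (P n) (G n).attAlg {ω | ∀ i ∈ (T n).nodes k ω,
      markDist ((G n).mark ω ((T n).θ ω i)) ((T n).node ω i).2 ≤ ε}) 1

/-! ### The assumptions on the recursion and on the graph sequence -/

section Assumptions

variable {A : Type a} {Z : Type v} {Ξ : Type w} [MeasurableSpace Z] [MeasurableSpace Ξ]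

/-- The Lipschitz and growth bounds on `Φ` at a vertex with mark `x` and `m` in-neighbours. -/
def BoundsAt (M : Recursion A Z Ξ) (B : Bounds A) (p : ℝ) (m : ℕ) (x : Mark A) : Prop :=
  (∀ v v' : ℕ → ℝ,
    eLpNorm (fun q : Z × (ℕ → Ξ) => M.Φ x q.1 (offFamily m fun j => (v j, q.2 j))
        - M.Φ x q.1 (offFamily m fun j => (v' j, q.2 j))) (ENNReal.ofReal p) (M.stepLaw ℕ)
      ≤ ENNReal.ofReal (B.sm x * ∑ j ∈ Finset.range m, |v j - v' j|)) ∧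
  ∀ v : ℕ → ℝ,
    eLpNorm (fun q : Z × (ℕ → Ξ) => M.Φ x q.1 (offFamily m fun j => (v j, q.2 j)))
        (ENNReal.ofReal p) (M.stepLaw ℕ)
      ≤ ENNReal.ofReal (∑ j ∈ Finset.range m, B.sm x * |v j| + B.β x)

/-- The Lipschitz and growth bounds on `Φ` at all vertices of a fixed multigraph with marks `X`. -/
def BoundsOnGraph {V : Type*} [Fintype V] (M : Recursion A Z Ξ) (B : Bounds A) (p : ℝ)
    (X : V → Mark A) (mult : V → V → ℕ) : Prop :=
  ∀ i : V,
  (∀ v v' : V → ℝ,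
    eLpNorm (fun q : Z × (V × ℕ → Ξ) =>
        M.Φ (X i) q.1 (inFamily mult i fun j l => (v j, q.2 (j, l)))
        - M.Φ (X i) q.1 (inFamily mult i fun j l => (v' j, q.2 (j, l))))
        (ENNReal.ofReal p) (M.stepLaw (V × ℕ))
      ≤ ENNReal.ofReal (B.sm (X i) * ∑ j, (mult j i : ℝ) * |v j - v' j|)) ∧
  ∀ v : V → ℝ,
    eLpNorm (fun q : Z × (V × ℕ → Ξ) =>
        M.Φ (X i) q.1 (inFamily mult i fun j l => (v j, q.2 (j, l))))
        (ENNReal.ofReal p) (M.stepLaw (V × ℕ))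
      ≤ ENNReal.ofReal (∑ j, (mult j i : ℝ) * (B.sm (X i) * |v j|) + B.β (X i))

/-- The operator norm on `ℓ^p` of the matrix `C` is at most `K`. -/
def LpOpNormLE {V : Type*} [Fintype V] (p : ℝ) (C : Matrix V V ℝ) (K : ℝ) : Prop :=
  ∀ y : V → ℝ, (∑ i, |C.mulVec y i| ^ p) ^ (1 / p) ≤ K * (∑ i, |y i| ^ p) ^ (1 / p)

/-- Uniform bounds on the `p`-norms of the matrices `C` and `C⁽⁰⁾` of the graphs. -/
def MatrixBounds {Ω : ℕ → Type u} [∀ n, MeasurableSpace (Ω n)] (P : ∀ n, Measure (Ω n))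
    (G : ∀ n, RandomDigraph (Ω n) (Fin (n + 1)) A) (M : Recursion A Z Ξ) (B : Bounds A)
    (p : ℝ) : Prop :=
  ∃ K K₀ : ℝ, ∀ n, ∀ᵐ ω ∂(P n),
    LpOpNormLE p (Matrix.of fun i j : Fin (n + 1) => B.sm ((G n).mark ω i) *
      B.sp ((G n).mark ω j) * ((G n).mult ω j i : ℝ)) K ∧
    LpOpNormLE p (Matrix.of fun i j : Fin (n + 1) => B.sm ((G n).mark ω i) *
      |M.g 0 ((G n).mark ω j)| * ((G n).mult ω j i : ℝ)) K₀

/-- If the initial law is supported in `[-K, K]`, then `‖𝐑⁽¹⁾‖_∞ ≤ K` on all the graphs. -/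
def PreservesInterval {Ω : ℕ → Type u} [∀ n, MeasurableSpace (Ω n)] (P : ∀ n, Measure (Ω n))
    (G : ∀ n, RandomDigraph (Ω n) (Fin (n + 1)) A) (M : Recursion A Z Ξ) (K : ℝ) : Prop :=
  ∀ μ : ProbabilityMeasure ℝ, (μ : Measure ℝ) (Set.Icc (-K) K)ᶜ = 0 →
    ∀ n, ∀ᵐ ω ∂(P n), ∀ᵐ w ∂(M.noiseLaw μ (Fin (n + 1)) (Fin (n + 1) × Fin (n + 1) × ℕ)),
      ∀ i, |graphR M ((G n).mark ω) ((G n).mult ω) w 1 i| ≤ K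

/-- The assumption on the recursion, except for the alternative between `MatrixBounds` and
`PreservesInterval`. The Lipschitz and growth bounds on `Φ` hold at almost all the marks that
occur: at the vertices of the graphs, at the root and at the other nodes of the limiting tree.
The conditional expectation given the graph is the integral over the noise, the graph and the
marks being fixed. -/
structure RecursionAssumption [MetricSpace A] {Ω : ℕ → Type u}
    [∀ n, MeasurableSpace (Ω n)] [MeasurableSpace A] (P : ∀ n, Measure (Ω n))
    (G : ∀ n, RandomDigraph (Ω n) (Fin (n + 1)) A)
    (π₀ π₁ : ProbabilityMeasure (ℕ × Mark A)) (M : Recursion A Z Ξ) (B : Bounds A)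
    (p : ℝ) : Prop where
  measurable_Φ : M.IsMeasurable
  continuous_sm : Continuous B.sm
  continuous_sp : Continuous B.sp
  continuous_β : Continuous B.β
  graph_bounds : ∀ n, ∀ᵐ ω ∂(P n), BoundsOnGraph M B p ((G n).mark ω) ((G n).mult ω)
  root_bounds : ∀ᵐ y ∂(π₀ : Measure (ℕ × Mark A)), BoundsAt M B p y.1 y.2
  node_bounds : ∀ᵐ y ∂(π₁ : Measure (ℕ × Mark A)), BoundsAt M B p y.1 y.2
  g_lipschitz : ∀ (x : Mark A) (r r' : ℝ), |M.g r x - M.g r' x| ≤ B.sp x * |r - r'|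
  holder : ∃ H Q α γ : ℝ, 0 < H ∧ 0 < Q ∧ 0 < α ∧ 0 < γ ∧
    ∀ x x' : Mark A, markDist x x' < 1 →
      (∀ v : ℕ → ℝ,
        eLpNorm (fun q : Z × (ℕ → Ξ) => M.Φ x q.1 (offFamily x.1 fun j => (v j, q.2 j))
            - M.Φ x' q.1 (offFamily x.1 fun j => (v j, q.2 j)))
            (ENNReal.ofReal p) (M.stepLaw ℕ)
          ≤ ENNReal.ofReal (H * max 1 (∑ j ∈ Finset.range x.1, B.sm x * |v j| + B.β x) *
              markDist x x' ^ α)) ∧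
      ∀ r : ℝ, |M.g r x - M.g r x'| ≤ Q * max 1 (B.sp x * |r|) * markDist x x' ^ γ

/-- The moment conditions on the limiting tree, and the convergence in `d_p`, conditionally on
`ℱ_n`, of `f_*(𝐗_I) = σ₋(𝐗_I) D_I⁻` and of `β(𝐗_I)`. -/
structure GraphAssumption [MeasurableSpace A] {Ω : ℕ → Type u}
    [∀ n, MeasurableSpace (Ω n)] (P : ∀ n, Measure (Ω n)) [∀ n, IsProbabilityMeasure (P n)]
    (G : ∀ n, RandomDigraph (Ω n) (Fin (n + 1)) A)
    (π₀ π₁ : ProbabilityMeasure (ℕ × Mark A)) (M : Recursion A Z Ξ) (B : Bounds A)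
    (p : ℝ) : Prop where
  root_sm : MemLp (fun y : ℕ × Mark A => (y.1 : ℝ) * B.sm y.2) (ENNReal.ofReal p)
    (π₀ : Measure (ℕ × Mark A))
  root_β : MemLp (fun y : ℕ × Mark A => B.β y.2) (ENNReal.ofReal p) (π₀ : Measure (ℕ × Mark A))
  node_smsp : MemLp (fun y : ℕ × Mark A => (y.1 : ℝ) * B.sm y.2 * B.sp y.2) (ENNReal.ofReal p)
    (π₁ : Measure (ℕ × Mark A))
  node_spβ : MemLp (fun y : ℕ × Mark A => B.sp y.2 * B.β y.2) (ENNReal.ofReal p)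
    (π₁ : Measure (ℕ × Mark A))
  node_sp : MemLp (fun y : ℕ × Mark A => B.sp y.2) (ENNReal.ofReal p)
    (π₁ : Measure (ℕ × Mark A))
  node_g : MemLp (fun y : ℕ × Mark A => M.g 0 y.2) (ENNReal.ofReal p)
    (π₁ : Measure (ℕ × Mark A))
  degree_conv : TendstoInProb P (fun n ω => wasserstein p
    (condDistrib (fun ω => B.sm ((G n).mark ω ((G n).root ω)) *
        (((G n).mark ω ((G n).root ω)).1 : ℝ)) (G n).att (P n) ((G n).att ω))
    ((π₀ : Measure (ℕ × Mark A)).map fun y => B.sm y.2 * (y.2.1 : ℝ))) 0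
  β_conv : TendstoInProb P (fun n ω => wasserstein p
    (condDistrib (fun ω => B.β ((G n).mark ω ((G n).root ω))) (G n).att (P n) ((G n).att ω))
    ((π₀ : Measure (ℕ × Mark A)).map fun y => B.β y.2)) 0

end Assumptions

end StochRec

end

noncomputable section

namespace StochRec

/-! ### Infinite product measures -/

section Products

variable {ι κ X Y : Type*} [MeasurableSpace X] [MeasurableSpace Y]

/-! For a fixed time the theorem is an `L^p` comparison, run by induction on time, between the
recursion at `I` and the recursion on the coupled tree. For time tending to infinity it is a
contraction argument on the tree alone.

Comparison. The tree receives the noises and initial values of the graph, transported by `θ`, when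
`θ` is injective on the first generations, and fresh ones elsewhere (`mergeNoise`). Injectivity
keeps the result i.i.d. and independent of graph and tree (`measurePreserving_mergeNoise`,
`measurePreserving_data_treeNoise`). On the good event, where `θ` is an isomorphism and the marks
agree up to `ε`, the value at `I` is exactly the tree recursion run with the marks of the graph
(`Matches.graphR_eq_treeR`). By Hölder continuity, returning to the marks of the tree costs a small
factor times `majorant`, a functional of the tree with finite mean (`lintegral_treeR_sub_le`,
`MomentBounds.lintegral_majorant_ne_top`).

On the bad event, whose probability vanishes, the triangle inequality is used. The tree side is
small because the majorant is integrable; the graph side needs conditional uniform integrability of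
`|R_I|^p`, which is the crux. If an interval is preserved, the recursion is bounded. With matrix
bounds, uniform integrability at time `r + 1` follows from closeness at time `r`: integrate out the
last noise and split the incoming values of `g` at a level `L`. The part below `L` gives `L σ₋ D⁻`,
uniformly integrable by the convergence in `d_p`. The excess is averaged over all vertices, since
`I` is uniform, and the matrix norms bound it by the `p`-th moment of `R_I` at time `r` on the event
that the value of `g` at `I` exceeds `L`, plus the probability of that event (`sum_large_rpow_le`,
`setLIntegral_largeG_le`). Both are small because closeness to a tree variable of fixed law makes
`R_I` at time `r` uniformly integrable and tight. `Regular.dataUI_succ` and `Regular.rootClose`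
close this loop.

Statements given the attributes are phrased as bounds on integrals over events `{att ∈ S}` of nearly
full probability (`CondNeg`, `CondUI`); Markov's inequality on such an event yields convergence in
probability. For the conditional laws, the conditional joint law of the graph value and the tree
value is a coupling whose second marginal is `ν_k`, because the tree is independent of the
attributes (`ae_wasserstein_condDistrib_le`).

Limit. A `k`-step computation at the root reads the noises of each node at one time only, so `ν_k`
may be computed with noises that do not depend on time (`rootLaw_eq_map_staticR`). The values of `g`
iterate `Ψ`, and one step multiplies `p`-th moments of differences by at most `E[(N₁ σ₋ σ₊)^p] < 1`
(`lintegral_static_Ψ_sub_le`). The iterations therefore converge almost surely and in `L^p` at every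
node to `limV`, which solves the recursion; its law is `η`, and one step of `Φ` at the root gives
`ν`. -/

theorem measurable_extend {e : κ → ι} (he : Function.Injective e) :
    Measurable fun q : (κ → X) × (ι → X) => Function.extend e q.1 q.2 := by
  refine measurable_pi_iff.2 fun i => ?_
  by_cases h : ∃ k, e k = i
  · obtain ⟨k, rfl⟩ := h
    simp only [he.extend_apply]
    fun_prop
  · simp only [Function.extend_apply' _ _ _ h]
    fun_prop

/-- Overwriting the coordinates of a product measure along an injection by a fresh sample. -/
theorem measurePreserving_extend (μ : ι → Measure X) [∀ i, IsProbabilityMeasure (μ i)]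
    {e : κ → ι} (he : Function.Injective e) :
    MeasurePreserving (fun q : (κ → X) × (ι → X) => Function.extend e q.1 q.2)
      ((Measure.infinitePi fun k => μ (e k)).prod (Measure.infinitePi μ))
      (Measure.infinitePi μ) := by
  classical
  refine ⟨measurable_extend he, Measure.eq_infinitePi _ fun s t ht => ?_⟩
  rw [Measure.map_apply (measurable_extend he) (.pi s.countable_toSet fun i _ => ht i)]
  have : (fun q : (κ → X) × (ι → X) => Function.extend e q.1 q.2) ⁻¹' (s : Set ι).pi t =
      (((s.preimage e he.injOn : Finset κ) : Set κ).pi fun k => t (e k)) ×ˢ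
        (((s.filter fun i => i ∉ Set.range e : Finset ι) : Set ι).pi t) := by
    ext q
    simp only [Set.mem_preimage, Set.mem_pi, Finset.mem_coe, Set.mem_prod, Finset.mem_preimage,
      Finset.mem_filter]
    refine ⟨fun h => ⟨fun k hk => ?_, fun i hi => ?_⟩, fun h i hi => ?_⟩
    · simpa [he.extend_apply] using h (e k) hk
    · simpa [Function.extend_apply' _ _ _ (fun ⟨k, hk⟩ => hi.2 ⟨k, hk⟩)] using h i hi.1
    · by_cases hr : ∃ k, e k = i
      · obtain ⟨k, rfl⟩ := hr
        simpa [he.extend_apply] using h.1 k hi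
      · simpa [Function.extend_apply' _ _ _ hr] using h.2 i ⟨hi, fun ⟨k, hk⟩ => hr ⟨k, hk⟩⟩
  rw [this, Measure.prod_prod, Measure.infinitePi_pi _ fun i _ => ht _,
    Measure.infinitePi_pi _ fun i _ => ht _,
    Finset.prod_preimage' e s he.injOn fun i => μ i (t i),
    Finset.prod_filter_mul_prod_filter_not]

theorem measurePreserving_extend_unit (μ : ι → Measure X) [∀ i, IsProbabilityMeasure (μ i)]
    (i : ι) :
    MeasurePreserving
      (fun q : X × (ι → X) => Function.extend (fun _ : Unit => i) (fun _ => q.1) q.2)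
      ((μ i).prod (Measure.infinitePi μ)) (Measure.infinitePi μ) := by
  have h1 : MeasurePreserving (fun (x : X) (_ : Unit) => x) (μ i)
      (Measure.infinitePi fun _ : Unit => μ i) := by
    refine ⟨by fun_prop, Measure.eq_infinitePi _ fun s t ht => ?_⟩
    rw [Measure.map_apply (by fun_prop) (.pi s.countable_toSet fun i _ => ht i)]
    rcases Finset.eq_empty_or_nonempty s with rfl | hs
    · simp
    · have : s = {()} := Finset.eq_singleton_iff_nonempty_unique_mem.2 ⟨hs, fun _ _ => rfl⟩
      subst this
      simp only [Finset.coe_singleton, Finset.prod_singleton]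
      congr 1
      ext x
      simp
  exact (measurePreserving_extend μ (e := fun _ : Unit => i)
    (fun _ _ _ => rfl)).comp (h1.prod (MeasurePreserving.id (Measure.infinitePi μ)))

theorem extend_unit_self {ι X : Type*} (i : ι) (x : X) (f : ι → X) :
    Function.extend (fun _ : Unit => i) (fun _ => x) f i = x :=
  (Function.injective_of_subsingleton (fun _ : Unit => i)).extend_apply (fun _ => x) f ()

theorem extend_unit_of_ne {ι X : Type*} {i j : ι} (h : j ≠ i) (x : X) (f : ι → X) :
    Function.extend (fun _ : Unit => i) (fun _ => x) f j = f j :=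
  Function.extend_apply' _ _ _ fun ⟨_, h'⟩ => h h'.symm

open Classical in
/-- The family that agrees with `w ∘ f` on `S` and with `w'` elsewhere. -/
def mergeOn (S : Set κ) (f : κ → ι) (w : ι → X) (w' : κ → X) (k : κ) : X :=
  if k ∈ S then w (f k) else w' k

/-- Injectivity of `f` on `S` makes the coordinates `w (f k)`, `k ∈ S`, i.i.d.; merging is then
overwriting the coordinates in `S` of an independent family. -/
theorem measurePreserving_mergeOn (μ : Measure X) [IsProbabilityMeasure μ] {S : Set κ}
    {f : κ → ι} (hf : Set.InjOn f S) :
    MeasurePreserving (fun q : (ι → X) × (κ → X) => mergeOn S f q.1 q.2)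
      ((Measure.infinitePi fun _ : ι => μ).prod (Measure.infinitePi fun _ : κ => μ))
      (Measure.infinitePi fun _ : κ => μ) := by
  have h1 : MeasurePreserving (fun (w : ι → X) (k : S) => w (f k))
      (Measure.infinitePi fun _ : ι => μ) (Measure.infinitePi fun _ : S => μ) :=
    ⟨by fun_prop, Measure.map_infinitePi_infinitePi_of_inj (P := fun _ : ι => μ)
      (f := fun k : S => f k) hf.injective⟩
  have h2 := (measurePreserving_extend (fun _ : κ => μ) (e := fun k : S => (k : κ))
    Subtype.val_injective).comp (h1.prod (MeasurePreserving.id (Measure.infinitePi fun _ : κ => μ)))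
  convert h2 using 1
  ext q k
  simp only [Function.comp, Prod.map, id, mergeOn]
  split_ifs with hk
  · exact (Subtype.val_injective.extend_apply (fun k : S => q.1 (f k)) q.2 ⟨k, hk⟩).symm
  · rw [Function.extend_apply' _ _ _ fun ⟨a, ha⟩ => hk (ha ▸ a.2)]

/-- Both laws have the same finite-dimensional marginals, where the claim is the corresponding fact
for finite products. -/
theorem measurePreserving_zip (μ : ι → Measure X) (ν : ι → Measure Y)
    [∀ i, IsProbabilityMeasure (μ i)] [∀ i, IsProbabilityMeasure (ν i)] :
    MeasurePreserving (fun (q : (ι → X) × (ι → Y)) i => (q.1 i, q.2 i))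
      ((Measure.infinitePi μ).prod (Measure.infinitePi ν))
      (Measure.infinitePi fun i => (μ i).prod (ν i)) := by
  refine ⟨by fun_prop, ?_⟩
  refine IsProjectiveLimit.unique (fun s => ?_)
    (Measure.isProjectiveLimit_infinitePi fun i => (μ i).prod (ν i))
  rw [Measure.map_map (by fun_prop) (by fun_prop)]
  have h := (measurePreserving_arrowProdEquivProdArrow X Y s (fun i => μ i) fun i => ν i).symm
  have h1 : MeasurePreserving (fun q : (ι → X) × (ι → Y) => (s.restrict q.1, s.restrict q.2))
      ((Measure.infinitePi μ).prod (Measure.infinitePi ν))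
      ((Measure.pi fun i : s => μ i).prod (Measure.pi fun i : s => ν i)) :=
    (⟨by fun_prop, Measure.infinitePi_map_restrict μ⟩ :
      MeasurePreserving s.restrict (Measure.infinitePi μ) (Measure.pi fun i : s => μ i)).prod
    ⟨by fun_prop, Measure.infinitePi_map_restrict ν⟩
  rw [← (h.comp h1).map_eq]
  rfl

variable {α β γ δ : Type*} [MeasurableSpace α] [MeasurableSpace β] [MeasurableSpace γ]
  [MeasurableSpace δ]

theorem measurePreserving_prodProdProdComm (μ : Measure α) (ν : Measure β) (ρ : Measure γ)
    (σ : Measure δ) [SFinite μ] [SFinite ν] [SFinite ρ] [SFinite σ] :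
    MeasurePreserving (fun q : (α × β) × (γ × δ) => ((q.1.1, q.2.1), (q.1.2, q.2.2)))
      ((μ.prod ν).prod (ρ.prod σ)) ((μ.prod ρ).prod (ν.prod σ)) := by
  refine ⟨by fun_prop, ?_⟩
  ext s hs
  rw [Measure.map_apply (by fun_prop) hs, ← lintegral_indicator_one hs,
    ← lintegral_indicator_one (hs.preimage (by fun_prop))]
  have hm : Measurable (s.indicator (1 : (α × γ) × β × δ → ℝ≥0∞)) :=
    measurable_one.indicator hs
  rw [lintegral_prod _ (measurable_one.indicator (hs.preimage (by fun_prop))).aemeasurable,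
    lintegral_prod _ (Measurable.aemeasurable (by
      exact (measurable_one.indicator (hs.preimage (by fun_prop))).lintegral_prod_right')),
    lintegral_prod _ hm.aemeasurable,
    lintegral_prod _ (hm.lintegral_prod_right').aemeasurable]
  refine lintegral_congr fun x => ?_
  have e1 : ∀ y, ∫⁻ q : γ × δ, ((fun q : (α × β) × (γ × δ) => ((q.1.1, q.2.1), (q.1.2, q.2.2))) ⁻¹' s).indicator
      (1 : (α × β) × (γ × δ) → ℝ≥0∞) ((x, y), q) ∂(ρ.prod σ) =
      ∫⁻ c, ∫⁻ d, s.indicator 1 ((x, c), (y, d)) ∂σ ∂ρ := fun y => by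
    rw [lintegral_prod]
    · rfl
    · exact (hm.comp (g := s.indicator (1 : (α × γ) × β × δ → ℝ≥0∞))
        (f := fun q : γ × δ => ((x, q.1), (y, q.2))) (by fun_prop)).aemeasurable
  simp_rw [e1]
  rw [lintegral_lintegral_swap]
  · refine lintegral_congr fun c => ?_
    rw [lintegral_prod]
    exact (hm.comp (g := s.indicator (1 : (α × γ) × β × δ → ℝ≥0∞))
        (f := fun q : β × δ => ((x, c), q)) (by fun_prop)).aemeasurable
  · refine Measurable.aemeasurable ?_
    exact Measurable.lintegral_prod_right' (f := fun q : (β × γ) × δ =>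
      s.indicator (1 : (α × γ) × β × δ → ℝ≥0∞) ((x, q.1.2), (q.1.1, q.2)))
        (hm.comp (by fun_prop))

/-- A product measure on node labels is the product of the law at the root and of the product
measures on the subtrees of the offspring of the root. -/
theorem measurePreserving_root_subtrees (μ : List ℕ → Measure X) (ν : Measure X)
    [∀ i, IsProbabilityMeasure (μ i)] [IsProbabilityMeasure ν] (hμ : ∀ i, i ≠ [] → μ i = ν) :
    MeasurePreserving (fun (t : List ℕ → X) => (t [], fun (j : ℕ) (l : List ℕ) => t (l ++ [j])))
      (Measure.infinitePi μ)
      ((μ []).prod (Measure.infinitePi fun _ : ℕ => Measure.infinitePi fun _ : List ℕ => ν)) := by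
  -- Labels are read from right to left: `l ++ [j]` is the node `l` of the subtree below the child
  -- `j` of the root.
  let e : ℕ × List ℕ → List ℕ := fun q => q.2 ++ [q.1]
  have he : Function.Injective e := fun q q' h => by
    have := List.append_inj' h rfl
    exact Prod.ext (by simpa using this.2) this.1
  have hne : ¬ ∃ q, e q = [] := fun ⟨q, hq⟩ => by simp [e] at hq
  have h1 := measurePreserving_extend μ he
  have hν : (fun q => μ (e q)) = fun _ => ν := funext fun q => hμ _ fun h => hne ⟨q, h⟩
  have h2 : MeasurePreserving (fun q : (ℕ × List ℕ → X) × (List ℕ → X) =>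
      (q.2 [], MeasurableEquiv.curry ℕ (List ℕ) X q.1))
      ((Measure.infinitePi fun k => μ (e k)).prod (Measure.infinitePi μ))
      ((μ []).prod (Measure.infinitePi fun _ : ℕ => Measure.infinitePi fun _ : List ℕ => ν)) := by
    have h3 : MeasurePreserving (MeasurableEquiv.curry ℕ (List ℕ) X)
        (Measure.infinitePi fun k => μ (e k))
        (Measure.infinitePi fun _ : ℕ => Measure.infinitePi fun _ : List ℕ => ν) := by
      simp only [hμ _ fun h => hne ⟨_, h⟩]
      exact ⟨by fun_prop, Measure.infinitePi_map_curry fun _ _ => ν⟩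
    exact (Measure.measurePreserving_swap (μ := Measure.infinitePi fun _ : ℕ =>
      Measure.infinitePi fun _ : List ℕ => ν) (ν := μ [])).comp
      (h3.prod (measurePreserving_eval_infinitePi μ []))
  refine ⟨by fun_prop, ?_⟩
  -- Resampling all coordinates other than the root does not change the law, and it makes them
  -- visibly independent of the coordinate `[]`.
  rw [← h1.map_eq, Measure.map_map (by fun_prop) (measurable_extend he), ← h2.map_eq]
  congr 1
  ext q
  · simp [Function.extend_apply' _ _ _ hne]
  · rename_i j l
    exact he.extend_apply q.1 q.2 (j, l)

theorem lintegral_prod_eq_of_indepFun {Ω : Type*} [MeasurableSpace Ω] {P : Measure Ω}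
    [IsProbabilityMeasure P] {D : Ω → α} {W : Ω → β} {ρ : Measure β} [IsProbabilityMeasure ρ]
    (hD : Measurable D) (hW : Measurable W) (hlaw : P.map W = ρ) (h : IndepFun W D P)
    {F : α × β → ℝ≥0∞} (hF : Measurable F) :
    ∫⁻ ω, F (D ω, W ω) ∂P = ∫⁻ ω, ∫⁻ w, F (D ω, w) ∂ρ ∂P := by
  have := (indepFun_iff_map_prod_eq_prod_map_map hD.aemeasurable hW.aemeasurable).1 h.symm
  have := Measure.isProbabilityMeasure_map (μ := P) hD.aemeasurable
  rw [← lintegral_map (f := F) hF (hD.prodMk hW)]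
  rw [(indepFun_iff_map_prod_eq_prod_map_map hD.aemeasurable hW.aemeasurable).1 h.symm, hlaw,
    lintegral_prod _ hF.aemeasurable, lintegral_map hF.lintegral_prod_right' hD]

end Products

/-! ### Powers in `[0, ∞]` -/

section Powers

variable {p : ℝ}

/-- Convexity gives the constant `n ^ (p - 1)` for a sum of `n` terms. No fixed sum below has more
than four terms, so the one constant `4 ^ p` serves throughout. -/
theorem rpow_card_le (hp : 1 ≤ p) {n : ℕ} (hn : n ≤ 4) : ((n : ℕ) : ℝ≥0∞) ^ (p - 1) ≤ 4 ^ p :=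
  calc ((n : ℕ) : ℝ≥0∞) ^ (p - 1) ≤ 4 ^ (p - 1) :=
        ENNReal.rpow_le_rpow (by exact_mod_cast hn) (by linarith)
    _ ≤ 4 ^ p := ENNReal.rpow_le_rpow_of_exponent_le (by norm_num) (by linarith)

theorem add_rpow_le (hp : 1 ≤ p) (x y : ℝ≥0∞) : (x + y) ^ p ≤ 4 ^ p * (x ^ p + y ^ p) := by
  have := ENNReal.rpow_sum_le_const_mul_sum_rpow Finset.univ ![x, y] hp
  simp only [Fin.sum_univ_two, Finset.card_univ, Fintype.card_fin] at this
  exact this.trans (mul_le_mul_left (rpow_card_le hp (by norm_num)) _)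

theorem add_add_rpow_le (hp : 1 ≤ p) (x y z : ℝ≥0∞) :
    (x + y + z) ^ p ≤ 4 ^ p * (x ^ p + y ^ p + z ^ p) := by
  have := ENNReal.rpow_sum_le_const_mul_sum_rpow Finset.univ ![x, y, z] hp
  simp only [Fin.sum_univ_three, Finset.card_univ, Fintype.card_fin] at this
  exact this.trans (mul_le_mul_left (rpow_card_le hp (by norm_num)) _)

theorem add_add_add_rpow_le (hp : 1 ≤ p) (x y z u : ℝ≥0∞) :
    (x + y + z + u) ^ p ≤ 4 ^ p * (x ^ p + y ^ p + z ^ p + u ^ p) := by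
  have := ENNReal.rpow_sum_le_const_mul_sum_rpow Finset.univ ![x, y, z, u] hp
  simp only [Fin.sum_univ_four, Finset.card_univ, Fintype.card_fin] at this
  exact this.trans (mul_le_mul_left (rpow_card_le hp (by norm_num)) _)

theorem four_rpow_ne_top (p : ℝ) (hp : 1 ≤ p) : (4 : ℝ≥0∞) ^ p ≠ ∞ :=
  ENNReal.rpow_ne_top_of_nonneg (by linarith) (by norm_num)

theorem one_le_four_rpow (p : ℝ) (hp : 1 ≤ p) : 1 ≤ (4 : ℝ≥0∞) ^ p :=
  ENNReal.one_le_rpow (by norm_num) (by linarith)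

theorem sum_range_rpow_le (hp : 1 ≤ p) (m : ℕ) (f : ℕ → ℝ≥0∞) :
    (∑ j ∈ Finset.range m, f j) ^ p ≤ (m : ℝ≥0∞) ^ (p - 1) * ∑ j ∈ Finset.range m, f j ^ p := by
  simpa using ENNReal.rpow_sum_le_const_mul_sum_rpow (Finset.range m) f hp

/-- Convexity produces `m ^ (p - 1)` and a sum of `m` equally bounded terms; together they give the
power `N ^ p` of the moment assumptions. -/
theorem natCast_rpow_sub_one_mul (hp : 1 ≤ p) (m : ℕ) :
    (m : ℝ≥0∞) ^ (p - 1) * (m : ℝ≥0∞) = (m : ℝ≥0∞) ^ p := by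
  rcases Nat.eq_zero_or_pos m with rfl | hm
  · simp [ENNReal.zero_rpow_of_pos (by linarith : 0 < p)]
  · nth_rewrite 2 [← ENNReal.rpow_one (m : ℝ≥0∞)]
    rw [← ENNReal.rpow_add _ _ (by exact_mod_cast hm.ne') (ENNReal.natCast_ne_top m)]
    simp

theorem lintegral_rpow_le_of_eLpNorm_le {α : Type*} [MeasurableSpace α] {μ : Measure α}
    (hp : 1 ≤ p) {f : α → ℝ} {C : ℝ≥0∞} (h : eLpNorm f (ENNReal.ofReal p) μ ≤ C) :
    ∫⁻ x, ‖f x‖ₑ ^ p ∂μ ≤ C ^ p := by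
  have hp0 : 0 < p := by linarith
  rw [eLpNorm_eq_lintegral_rpow_enorm_toReal (by simpa using hp0) ENNReal.ofReal_ne_top,
    ENNReal.toReal_ofReal hp0.le] at h
  have := ENNReal.rpow_le_rpow h hp0.le
  rwa [← ENNReal.rpow_mul, one_div, inv_mul_cancel₀ hp0.ne', ENNReal.rpow_one] at this

theorem ofReal_le_enorm (x : ℝ) : ENNReal.ofReal x ≤ ‖x‖ₑ := by
  rw [Real.enorm_eq_ofReal_abs]
  exact ENNReal.ofReal_le_ofReal (le_abs_self x)

theorem enorm_sum_le' {ι : Type*} (s : Finset ι) (f : ι → ℝ) : ‖∑ i ∈ s, f i‖ₑ ≤ ∑ i ∈ s, ‖f i‖ₑ :=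
  enorm_sum_le s f

theorem enorm_abs' (x : ℝ) : ‖|x|‖ₑ = ‖x‖ₑ := by
  rw [Real.enorm_eq_ofReal_abs, abs_abs, ← Real.enorm_eq_ofReal_abs]

theorem enorm_le_of_abs_le {x y : ℝ} (h : |x| ≤ y) : ‖x‖ₑ ≤ ENNReal.ofReal y := by
  rw [Real.enorm_eq_ofReal_abs]
  exact ENNReal.ofReal_le_ofReal h

end Powers

/-! ### Measurability -/

section Measurability

variable {A : Type a} {Z : Type v} {Ξ : Type w} [MeasurableSpace Z] [MeasurableSpace Ξ]
  [MeasurableSpace A] {M : Recursion A Z Ξ} {α : Type*} [MeasurableSpace α]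

/-- `IsMeasurable` speaks of families indexed by `Fin m`; a list representing the multiset provides
such an indexing. -/
theorem measurable_Φ_map (hM : M.IsMeasurable) {κ : Type*} (S : Multiset κ) {x : α → Mark A}
    {z : α → Z} {f : α → κ → ℝ × Ξ} (hx : Measurable x) (hz : Measurable z)
    (hf : ∀ k, Measurable fun q => f q k) :
    Measurable fun q => M.Φ (x q) (z q) (S.map (f q)) := by
  induction S using Quot.induction_on with
  | h L =>
    have h1 := (hM L.length).comp (g := fun q : Mark A × Z × (Fin L.length → ℝ × Ξ) =>
      M.Φ q.1 q.2.1 (Finset.univ.val.map q.2.2)) (f := fun q => (x q, z q, fun i => f q (L.get i)))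
      (hx.prodMk (hz.prodMk (measurable_pi_iff.2 fun i => hf _)))
    convert h1 using 1
    ext q
    simp only [Function.comp, Fin.univ_val_map]
    congr 1
    change Multiset.map (f q) (L : Multiset κ) = _
    rw [Multiset.map_coe]
    congr 1
    conv_lhs => rw [← List.ofFn_get L, List.map_ofFn]
    rfl

/-- The number of arguments takes countably many values, so it may be frozen. The same argument
handles the edge multiplicities of a finite graph. -/
theorem measurable_Φ_offFamily (hM : M.IsMeasurable) {x : α → Mark A} {z : α → Z} {N : α → ℕ}
    {f : α → ℕ → ℝ × Ξ} (hx : Measurable x) (hz : Measurable z) (hN : Measurable N)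
    (hf : ∀ k, Measurable fun q => f q k) :
    Measurable fun q => M.Φ (x q) (z q) (offFamily (N q) (f q)) := by
  have h : Measurable fun q : α × ℕ => M.Φ (x q.1) (z q.1) (offFamily q.2 (f q.1)) :=
    measurable_from_prod_countable_left fun m => measurable_Φ_map hM (Multiset.range m) hx hz hf
  exact h.comp (measurable_id.prodMk hN)

theorem inFamily_eq_map {V : Type*} [Fintype V] {γ : Type*} (mult : V → V → ℕ) (i : V)
    (f : V → ℕ → γ) :
    inFamily mult i f = (inFamily mult i Prod.mk).map fun e => f e.1 e.2 := by
  simp [inFamily, Multiset.map_bind]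

theorem measurable_Φ_inFamily (hM : M.IsMeasurable) {V : Type*} [Fintype V] {x : α → Mark A}
    {z : α → Z} {mult : α → V → V → ℕ} (i : V) {f : α → V → ℕ → ℝ × Ξ} (hx : Measurable x)
    (hz : Measurable z) (hm : Measurable mult) (hf : ∀ j l, Measurable fun q => f q j l) :
    Measurable fun q => M.Φ (x q) (z q) (inFamily (mult q) i (f q)) := by
  have h : Measurable fun q : α × (V → V → ℕ) =>
      M.Φ (x q.1) (z q.1) (inFamily q.2 i (f q.1)) := by
    refine measurable_from_prod_countable_left fun m => ?_
    simp only [inFamily_eq_map m i (f _)]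
    exact measurable_Φ_map hM _ hx hz fun e => hf e.1 e.2
  exact h.comp (measurable_id.prodMk hm)

theorem measurable_g_comp (hg : Measurable (Function.uncurry M.g)) {r : α → ℝ} {x : α → Mark A}
    (hr : Measurable r) (hx : Measurable x) : Measurable fun q => M.g (r q) (x q) :=
  hg.comp (hr.prodMk hx)

theorem measurable_treeR (hM : M.IsMeasurable) (hg : Measurable (Function.uncurry M.g)) (r : ℕ) :
    ∀ i, Measurable fun q : (List ℕ → ℕ × Mark A) × NoiseSpace (List ℕ) (List ℕ) Z Ξ =>
      treeR M q.1 q.2 r i := by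
  induction r with
  | zero => intro i; simp only [treeR]; fun_prop
  | succ r ih =>
    intro i
    simp only [treeR]
    refine measurable_Φ_offFamily hM (by fun_prop) (by fun_prop) (by fun_prop) fun j => ?_
    exact (measurable_g_comp hg (ih _) (by fun_prop)).prodMk (by fun_prop)

theorem measurable_treeR_noise (hM : M.IsMeasurable) (hg : Measurable (Function.uncurry M.g))
    (t : List ℕ → ℕ × Mark A) (r : ℕ) (i : List ℕ) :
    Measurable fun w : NoiseSpace (List ℕ) (List ℕ) Z Ξ => treeR M t w r i :=
  (measurable_treeR hM hg r i).comp (measurable_const.prodMk measurable_id)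

theorem measurable_branchV (hM : M.IsMeasurable) (hg : Measurable (Function.uncurry M.g)) (r : ℕ) :
    ∀ i, Measurable fun b : BranchSpace A Z Ξ => branchV M b r i := by
  induction r with
  | zero =>
    intro i
    simp only [branchV]
    exact measurable_g_comp hg measurable_const (by fun_prop)
  | succ r ih =>
    intro i
    simp only [branchV, Recursion.Ψ]
    refine measurable_g_comp hg ?_ (by fun_prop)
    refine measurable_Φ_offFamily hM (by fun_prop) (by fun_prop) (by fun_prop) fun j => ?_
    exact (ih _).prodMk (by fun_prop)

/-- The marks of a multigraph with given attributes and edge multiplicities. -/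
def graphMark {V : Type*} [Fintype V] (att : V → A) (mult : V → V → ℕ) (i : V) : Mark A :=
  (∑ j, mult j i, ∑ j, mult i j, att i)

theorem measurable_graphMark {V : Type*} [Fintype V] (i : V) :
    Measurable fun q : (V → A) × (V → V → ℕ) => graphMark q.1 q.2 i := by
  unfold graphMark
  fun_prop

theorem measurable_graphR (hM : M.IsMeasurable) (hg : Measurable (Function.uncurry M.g))
    {V : Type*} [Fintype V] (r : ℕ) :
    ∀ i, Measurable fun q : ((V → A) × (V → V → ℕ)) × NoiseSpace V (V × V × ℕ) Z Ξ =>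
      graphR M (graphMark q.1.1 q.1.2) q.1.2 q.2 r i := by
  induction r with
  | zero => intro i; simp only [graphR]; fun_prop
  | succ r ih =>
    intro i
    have hmk : ∀ i, Measurable fun q : ((V → A) × (V → V → ℕ)) × NoiseSpace V (V × V × ℕ) Z Ξ =>
      graphMark q.1.1 q.1.2 i := fun i => (measurable_graphMark i).comp measurable_fst
    simp only [graphR]
    refine measurable_Φ_inFamily hM i (hmk i) (by fun_prop) (by fun_prop) fun j l => ?_
    exact (measurable_g_comp hg (ih _) (hmk j)).prodMk (by fun_prop)

theorem measurable_graphR_noise (hM : M.IsMeasurable) (hg : Measurable (Function.uncurry M.g))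
    {V : Type*} [Fintype V] (X : V → Mark A) (mult : V → V → ℕ) (r : ℕ) :
    ∀ i, Measurable fun w : NoiseSpace V (V × V × ℕ) Z Ξ => graphR M X mult w r i := by
  induction r with
  | zero => intro i; simp only [graphR]; fun_prop
  | succ r ih =>
    intro i
    simp only [graphR]
    refine measurable_Φ_inFamily hM i (by fun_prop) (by fun_prop) (by fun_prop) fun j l => ?_
    exact (measurable_g_comp hg (ih _) (by fun_prop)).prodMk (by fun_prop)

end Measurability

/-! ### The distance of marks -/

section MarkDist

variable {A : Type a} [MetricSpace A]

theorem markDist_comm (x y : Mark A) : markDist x y = markDist y x := by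
  simp only [markDist, abs_sub_comm, dist_comm]

theorem markDist_nonneg (x y : Mark A) : 0 ≤ markDist x y := by
  unfold markDist; positivity

theorem continuous_markDist : Continuous fun q : Mark A × Mark A => markDist q.1 q.2 := by
  have h : Continuous fun n : ℕ => (n : ℝ) := continuous_of_discreteTopology
  unfold markDist
  refine ((continuous_abs.comp ?_).add (continuous_abs.comp ?_)).add ?_
  · exact (h.comp (by fun_prop)).sub (h.comp (by fun_prop))
  · exact (h.comp (by fun_prop)).sub (h.comp (by fun_prop))
  · fun_prop

theorem markDist_self (x : Mark A) : markDist x x = 0 := by simp [markDist]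

/-- Integers at distance less than one coincide. Thus close marks have the same in-degree, and `Φ`
can be compared at both with the same arguments. -/
theorem fst_eq_of_markDist_lt_one {x y : Mark A} (h : markDist x y < 1) : x.1 = y.1 := by
  have h1 : |(x.1 : ℝ) - (y.1 : ℝ)| < 1 := by
    have := abs_nonneg ((x.2.1 : ℝ) - y.2.1)
    have := dist_nonneg (x := x.2.2) (y := y.2.2)
    unfold markDist at h
    linarith
  have h2 : |(x.1 : ℤ) - (y.1 : ℤ)| < 1 := by exact_mod_cast h1
  have := Int.abs_lt_one_iff.1 h2
  omega

end MarkDist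

/-! ### Consequences of the assumption on the recursion -/

section Bounds

variable {A : Type a} {Z : Type v} {Ξ : Type w} [MeasurableSpace Z] [MeasurableSpace Ξ]
  {M : Recursion A Z Ξ} {B : Bounds A} {p : ℝ}

/-- The form of the bound used below: `p`-th moments in `[0, ∞]`. No sign is assumed for `σ₋` or
`β`, so they enter through their absolute values. -/
theorem BoundsAt.lintegral_sub_le (hp : 1 ≤ p) {m : ℕ} {x : Mark A} (h : BoundsAt M B p m x)
    (v v' : ℕ → ℝ) :
    ∫⁻ q, ‖M.Φ x q.1 (offFamily m fun j => (v j, q.2 j))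
        - M.Φ x q.1 (offFamily m fun j => (v' j, q.2 j))‖ₑ ^ p ∂(M.stepLaw ℕ)
      ≤ (‖B.sm x‖ₑ * ∑ j ∈ Finset.range m, ‖v j - v' j‖ₑ) ^ p := by
  refine lintegral_rpow_le_of_eLpNorm_le hp ((h.1 v v').trans ((ofReal_le_enorm _).trans ?_))
  rw [enorm_mul]
  gcongr
  exact (enorm_sum_le' _ _).trans_eq (by simp)

theorem BoundsAt.lintegral_le (hp : 1 ≤ p) {m : ℕ} {x : Mark A} (h : BoundsAt M B p m x)
    (v : ℕ → ℝ) :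
    ∫⁻ q, ‖M.Φ x q.1 (offFamily m fun j => (v j, q.2 j))‖ₑ ^ p ∂(M.stepLaw ℕ)
      ≤ (‖B.sm x‖ₑ * ∑ j ∈ Finset.range m, ‖v j‖ₑ + ‖B.β x‖ₑ) ^ p := by
  refine lintegral_rpow_le_of_eLpNorm_le hp ((h.2 v).trans ((ofReal_le_enorm _).trans ?_))
  refine (enorm_add_le _ _).trans ?_
  gcongr
  rw [← Finset.mul_sum, enorm_mul]
  gcongr
  exact (enorm_sum_le' _ _).trans_eq (by simp)

theorem BoundsOnGraph.lintegral_sub_le {V : Type*} [Fintype V] (hp : 1 ≤ p) {X : V → Mark A}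
    {mult : V → V → ℕ} (h : BoundsOnGraph M B p X mult) (i : V) (v v' : V → ℝ) :
    ∫⁻ q, ‖M.Φ (X i) q.1 (inFamily mult i fun j l => (v j, q.2 (j, l)))
        - M.Φ (X i) q.1 (inFamily mult i fun j l => (v' j, q.2 (j, l)))‖ₑ ^ p ∂(M.stepLaw (V × ℕ))
      ≤ (‖B.sm (X i)‖ₑ * ∑ j, (mult j i : ℝ≥0∞) * ‖v j - v' j‖ₑ) ^ p := by
  refine lintegral_rpow_le_of_eLpNorm_le hp (((h i).1 v v').trans ((ofReal_le_enorm _).trans ?_))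
  rw [enorm_mul]
  gcongr
  exact (enorm_sum_le' _ _).trans_eq (by simp [enorm_mul])

theorem BoundsOnGraph.lintegral_le {V : Type*} [Fintype V] (hp : 1 ≤ p) {X : V → Mark A}
    {mult : V → V → ℕ} (h : BoundsOnGraph M B p X mult) (i : V) (v : V → ℝ) :
    ∫⁻ q, ‖M.Φ (X i) q.1 (inFamily mult i fun j l => (v j, q.2 (j, l)))‖ₑ ^ p ∂(M.stepLaw (V × ℕ))
      ≤ (‖B.sm (X i)‖ₑ * ∑ j, (mult j i : ℝ≥0∞) * ‖v j‖ₑ + ‖B.β (X i)‖ₑ) ^ p := by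
  refine lintegral_rpow_le_of_eLpNorm_le hp (((h i).2 v).trans ((ofReal_le_enorm _).trans ?_))
  refine (enorm_add_le _ _).trans ?_
  gcongr
  refine (enorm_sum_le' _ _).trans_eq ?_
  rw [Finset.mul_sum]
  refine Finset.sum_congr rfl fun j _ => ?_
  simp only [enorm_mul, enorm_abs', Real.enorm_natCast]
  ring

theorem enorm_g_sub_le (hg : ∀ (x : Mark A) (r r' : ℝ), |M.g r x - M.g r' x| ≤ B.sp x * |r - r'|)
    (x : Mark A) (r r' : ℝ) : ‖M.g r x - M.g r' x‖ₑ ≤ ‖B.sp x‖ₑ * ‖r - r'‖ₑ := by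
  refine (enorm_le_of_abs_le (hg x r r')).trans ((ofReal_le_enorm _).trans ?_)
  rw [enorm_mul, enorm_abs']

theorem enorm_g_le (hg : ∀ (x : Mark A) (r r' : ℝ), |M.g r x - M.g r' x| ≤ B.sp x * |r - r'|)
    (x : Mark A) (r : ℝ) : ‖M.g r x‖ₑ ≤ ‖M.g 0 x‖ₑ + ‖B.sp x‖ₑ * ‖r‖ₑ := by
  have := enorm_g_sub_le hg x r 0
  rw [sub_zero] at this
  calc ‖M.g r x‖ₑ = ‖M.g 0 x + (M.g r x - M.g 0 x)‖ₑ := by ring_nf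
    _ ≤ _ := (enorm_add_le _ _).trans (by gcongr)

theorem continuous_g [MetricSpace A] {Q γ : ℝ}
    (hγ : 0 < γ) (hQ : ∀ x x' : Mark A, markDist x x' < 1 → ∀ r : ℝ,
      |M.g r x - M.g r x'| ≤ Q * max 1 (B.sp x * |r|) * markDist x x' ^ γ) (r : ℝ) :
    Continuous (M.g r) := by
  rw [continuous_iff_continuousAt]
  intro x
  have hd : Tendsto (fun y => markDist x y) (𝓝 x) (𝓝 0) := by
    have : Continuous fun y => markDist x y :=
      continuous_markDist.comp (Continuous.prodMk continuous_const continuous_id)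
    have := this.tendsto x
    rwa [markDist_self] at this
  rw [ContinuousAt, tendsto_iff_dist_tendsto_zero]
  have h1 : Tendsto (fun y => Q * max 1 (B.sp x * |r|) * markDist x y ^ γ) (𝓝 x) (𝓝 0) := by
    have := (hd.rpow_const (Or.inr hγ.le)).const_mul (Q * max 1 (B.sp x * |r|))
    rwa [Real.zero_rpow hγ.ne', mul_zero] at this
  refine squeeze_zero' (Eventually.of_forall fun _ => dist_nonneg) ?_ h1
  filter_upwards [hd.eventually (gt_mem_nhds zero_lt_one)] with y hy
  rw [dist_comm, Real.dist_eq]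
  exact hQ x y hy r

/-- `g` is a Carathéodory function: Lipschitz in the value for each mark, and continuous, hence
measurable, in the mark for each value. -/
theorem measurable_g [MetricSpace A] [TopologicalSpace.SeparableSpace A] [MeasurableSpace A]
    [BorelSpace A]
    (hg : ∀ (x : Mark A) (r r' : ℝ), |M.g r x - M.g r' x| ≤ B.sp x * |r - r'|) {Q γ : ℝ}
    (hγ : 0 < γ) (hQ : ∀ x x' : Mark A, markDist x x' < 1 → ∀ r : ℝ,
      |M.g r x - M.g r x'| ≤ Q * max 1 (B.sp x * |r|) * markDist x x' ^ γ) :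
    Measurable (Function.uncurry M.g) := by
  refine measurable_uncurry_of_continuous_of_measurable (fun x => ?_)
    fun r => (continuous_g hγ hQ r).measurable
  refine (LipschitzWith.of_dist_le_mul (K := (B.sp x).toNNReal) fun r r' => ?_).continuous
  rw [Real.dist_eq, Real.dist_eq, Real.coe_toNNReal']
  exact (hg x r r').trans (mul_le_mul_of_nonneg_right (le_max_left _ _) (abs_nonneg _))

end Bounds

/-! ### Resampling the noise of one step -/

section Resample

variable {A : Type a} {Z : Type v} {Ξ : Type w} [MeasurableSpace Z] [MeasurableSpace Ξ]
  {M : Recursion A Z Ξ} {V E E' : Type*}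

instance (E : Type*) : IsProbabilityMeasure (M.stepLaw E) := by
  unfold Recursion.stepLaw; infer_instance

instance (μ₀ : ProbabilityMeasure ℝ) (V E : Type*) :
    IsProbabilityMeasure (M.noiseLaw μ₀ V E) := by
  unfold Recursion.noiseLaw; infer_instance

/-- The noises `w`, with those at the vertex `i` and at the edges `e x` at time `r` replaced. -/
def resample (r : ℕ) (i : V) (e : E' → E) (q : (Z × (E' → Ξ)) × NoiseSpace V E Z Ξ) :
    NoiseSpace V E Z Ξ :=
  (Function.extend (fun _ : Unit => (r, i)) (fun _ => q.1.1) q.2.1,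
    Function.extend (fun x => (r, e x)) q.1.2 q.2.2.1, q.2.2.2)

/-- Independence of the noise at one time and vertex from everything else is expressed by
overwriting it with a fresh sample. No conditional expectation is then needed to integrate out the
last step. -/
theorem measurePreserving_resample (M : Recursion A Z Ξ) (μ₀ : ProbabilityMeasure ℝ) (r : ℕ)
    (i : V) {e : E' → E} (he : Function.Injective e) :
    MeasurePreserving (resample (Z := Z) (Ξ := Ξ) r i e)
      ((M.stepLaw E').prod (M.noiseLaw μ₀ V E)) (M.noiseLaw μ₀ V E) := by
  have he' : Function.Injective fun x => (r, e x) := fun x y h => he (Prod.ext_iff.1 h).2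
  have h1 := measurePreserving_prodProdProdComm (M.zetaLaw : Measure Z)
    (Measure.infinitePi fun _ : E' => (M.xiLaw : Measure Ξ))
    (Measure.infinitePi fun _ : ℕ × V => (M.zetaLaw : Measure Z))
    ((Measure.infinitePi fun _ : ℕ × E => (M.xiLaw : Measure Ξ)).prod
      (Measure.infinitePi fun _ : V => (μ₀ : Measure ℝ)))
  have h2 := measurePreserving_extend_unit (fun _ : ℕ × V => (M.zetaLaw : Measure Z)) (r, i)
  have h3 := (measurePreserving_extend (fun _ : ℕ × E => (M.xiLaw : Measure Ξ)) he').prod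
    (MeasurePreserving.id (Measure.infinitePi fun _ : V => (μ₀ : Measure ℝ)))
  have h4 : MeasurePreserving (MeasurableEquiv.prodAssoc (α := E' → Ξ) (β := ℕ × E → Ξ)
      (γ := V → ℝ)) _ _ := measurePreserving_prodAssoc
      (Measure.infinitePi fun _ : E' => (M.xiLaw : Measure Ξ))
      (Measure.infinitePi fun _ : ℕ × E => (M.xiLaw : Measure Ξ))
      (Measure.infinitePi fun _ : V => (μ₀ : Measure ℝ))
  have h := (h2.prod (h3.comp (h4.symm _))).comp h1
  exact h

/-- The noise at time `r` may be replaced by an independent copy if all the rest does not depend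
on it. -/
theorem lintegral_resample (M : Recursion A Z Ξ) (μ₀ : ProbabilityMeasure ℝ) (r : ℕ) (i : V)
    {e : E' → E} (he : Function.Injective e)
    {F : NoiseSpace V E Z Ξ → Z → (E' → Ξ) → ℝ≥0∞}
    (hF : Measurable fun q : NoiseSpace V E Z Ξ × Z × (E' → Ξ) => F q.1 q.2.1 q.2.2)
    (hres : ∀ s w, F (resample r i e (s, w)) = F w) :
    ∫⁻ w, F w (w.1 (r, i)) (fun x => w.2.1 (r, e x)) ∂(M.noiseLaw μ₀ V E) =
      ∫⁻ w, ∫⁻ s, F w s.1 s.2 ∂(M.stepLaw E') ∂(M.noiseLaw μ₀ V E) := by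
  have he' : Function.Injective fun x => (r, e x) := fun x y h => he (Prod.ext_iff.1 h).2
  have hF' : Measurable fun w : NoiseSpace V E Z Ξ =>
      F w (w.1 (r, i)) (fun x => w.2.1 (r, e x)) :=
    hF.comp (g := fun q : NoiseSpace V E Z Ξ × Z × (E' → Ξ) => F q.1 q.2.1 q.2.2)
      (f := fun w : NoiseSpace V E Z Ξ => (w, w.1 (r, i), fun x => w.2.1 (r, e x))) (by fun_prop)
  rw [← (measurePreserving_resample M μ₀ r i he).lintegral_comp hF', ← lintegral_prod_swap,
    lintegral_prod]
  · refine lintegral_congr fun w => lintegral_congr fun s => ?_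
    simp only [Prod.swap, hres]
    congr 1
    · exact extend_unit_self _ _ _
    · ext x
      exact he'.extend_apply s.2 w.2.1 x
  · exact ((hF'.comp (measurePreserving_resample M μ₀ r i he).measurable).comp
      measurable_swap).aemeasurable

/-- The step from time `k` to `k + 1` reads the noises of index `k`, so values up to and including
time `r` only involve indices below `r`. -/
theorem treeR_resample (M : Recursion A Z Ξ) (t : List ℕ → ℕ × Mark A) {r : ℕ} {i : List ℕ}
    (e : E' → List ℕ) (q : (Z × (E' → Ξ)) × NoiseSpace (List ℕ) (List ℕ) Z Ξ) :
    ∀ k ≤ r, ∀ l, treeR M t (resample r i e q) k l = treeR M t q.2 k l := by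
  intro k
  induction k with
  | zero => intro _ l; rfl
  | succ k ih =>
    intro hk l
    have h1 : (resample r i e q).1 (k, l) = q.2.1 (k, l) := by
      refine extend_unit_of_ne ?_ _ _
      simp only [ne_eq, Prod.mk.injEq, not_and]
      omega
    have h2 : ∀ x, (resample r i e q).2.1 (k, x) = q.2.2.1 (k, x) := fun x => by
      refine Function.extend_apply' _ _ _ ?_
      simp only [Prod.mk.injEq, not_exists, not_and]
      omega
    simp only [treeR, h1, h2, ih (by omega)]

theorem graphR_resample [Fintype V] (M : Recursion A Z Ξ) (X : V → Mark A) (mult : V → V → ℕ)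
    {r : ℕ} {i : V} (e : E' → V × V × ℕ)
    (q : (Z × (E' → Ξ)) × NoiseSpace V (V × V × ℕ) Z Ξ) :
    ∀ k ≤ r, ∀ l, graphR M X mult (resample r i e q) k l = graphR M X mult q.2 k l := by
  intro k
  induction k with
  | zero => intro _ l; rfl
  | succ k ih =>
    intro hk l
    have h1 : (resample r i e q).1 (k, l) = q.2.1 (k, l) := by
      refine extend_unit_of_ne ?_ _ _
      simp only [ne_eq, Prod.mk.injEq, not_and]
      omega
    have h2 : ∀ x, (resample r i e q).2.1 (k, x) = q.2.2.1 (k, x) := fun x => by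
      refine Function.extend_apply' _ _ _ ?_
      simp only [Prod.mk.injEq, not_exists, not_and]
      omega
    simp only [graphR, h1, h2, ih (by omega)]

end Resample

/-! ### Moments of the tree recursion and its stability under perturbation of the marks -/

section Perturbation

variable {A : Type a} {Z : Type v} {Ξ : Type w} [MeasurableSpace Z] [MeasurableSpace Ξ]

/-- A functional of the marked tree that dominates the `p`-th moment of `ℛ_i^{(r)}`, and, up to a
small factor, that of the change of `ℛ_i^{(r)}` under a small perturbation of the marks. -/
def majorant (M : Recursion A Z Ξ) (B : Bounds A) (p : ℝ) (c : ℝ≥0∞) (t : List ℕ → ℕ × Mark A) :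
    ℕ → List ℕ → ℝ≥0∞
  | 0, _ => c
  | r + 1, i => c * (1 + ‖B.β (t i).2‖ₑ ^ p + ‖B.sm (t i).2‖ₑ ^ p * ((t i).1 : ℝ≥0∞) ^ (p - 1) *
      ∑ j ∈ Finset.range (t i).1, (1 + ‖M.g 0 (t (j :: i)).2‖ₑ ^ p +
        ‖B.sp (t (j :: i)).2‖ₑ ^ p * majorant M B p c t r (j :: i)))

variable {M : Recursion A Z Ξ} {B : Bounds A} {p : ℝ}

theorem mul_sum_rpow_le (hp : 1 ≤ p) (s : ℝ≥0∞) (m : ℕ) (f : ℕ → ℝ≥0∞) :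
    (s * ∑ j ∈ Finset.range m, f j) ^ p ≤
      s ^ p * (m : ℝ≥0∞) ^ (p - 1) * ∑ j ∈ Finset.range m, f j ^ p := by
  rw [ENNReal.mul_rpow_of_nonneg _ _ (by linarith), mul_assoc]
  gcongr
  exact sum_range_rpow_le hp m f

theorem lintegral_mul_sum_rpow_le {α : Type*} [MeasurableSpace α] {μ : Measure α} (hp : 1 ≤ p)
    (s : ℝ≥0∞) (m : ℕ) {f : α → ℕ → ℝ≥0∞} (hf : ∀ j, Measurable fun q => f q j) {c : ℕ → ℝ≥0∞}
    (hc : ∀ j < m, ∫⁻ q, f q j ^ p ∂μ ≤ c j) :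
    ∫⁻ q, (s * ∑ j ∈ Finset.range m, f q j) ^ p ∂μ ≤
      s ^ p * (m : ℝ≥0∞) ^ (p - 1) * ∑ j ∈ Finset.range m, c j := by
  calc ∫⁻ q, (s * ∑ j ∈ Finset.range m, f q j) ^ p ∂μ
      ≤ ∫⁻ q, s ^ p * (m : ℝ≥0∞) ^ (p - 1) * ∑ j ∈ Finset.range m, f q j ^ p ∂μ :=
        lintegral_mono fun q => mul_sum_rpow_le hp s m _
    _ = s ^ p * (m : ℝ≥0∞) ^ (p - 1) * ∑ j ∈ Finset.range m, ∫⁻ q, f q j ^ p ∂μ := by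
        rw [lintegral_const_mul, lintegral_finsetSum]
        · exact fun j _ => (hf j).pow_const p
        · exact Finset.measurable_fun_sum _ fun j _ => (hf j).pow_const p
    _ ≤ _ := by
        gcongr with j hj
        exact hc j (Finset.mem_range.1 hj)

theorem lintegral_enorm_g_le (hp : 1 ≤ p) {α : Type*} [MeasurableSpace α] {μ : Measure α}
    [IsProbabilityMeasure μ]
    (hg : ∀ (x : Mark A) (r r' : ℝ), |M.g r x - M.g r' x| ≤ B.sp x * |r - r'|) {R : α → ℝ}
    (x : Mark A) :
    ∫⁻ w, ‖M.g (R w) x‖ₑ ^ p ∂μ ≤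
      4 ^ p * (‖M.g 0 x‖ₑ ^ p + ‖B.sp x‖ₑ ^ p * ∫⁻ w, ‖R w‖ₑ ^ p ∂μ) := by
  have hp0 : 0 ≤ p := by linarith
  have h4 := four_rpow_ne_top p hp
  have hs : ‖B.sp x‖ₑ ^ p ≠ ∞ := ENNReal.rpow_ne_top_of_nonneg hp0 enorm_ne_top
  calc ∫⁻ w, ‖M.g (R w) x‖ₑ ^ p ∂μ
      ≤ ∫⁻ w, 4 ^ p * (‖M.g 0 x‖ₑ ^ p + ‖B.sp x‖ₑ ^ p * ‖R w‖ₑ ^ p) ∂μ := by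
        refine lintegral_mono fun w => ?_
        refine (ENNReal.rpow_le_rpow (enorm_g_le hg x _) hp0).trans ((add_rpow_le hp _ _).trans ?_)
        rw [ENNReal.mul_rpow_of_nonneg _ _ hp0]
    _ = _ := by
        rw [lintegral_const_mul' _ _ h4, lintegral_add_left measurable_const,
          lintegral_const_mul' _ _ hs]
        simp

theorem lintegral_Φ_sub_le_of_markDist_le [MetricSpace A] (hp : 1 ≤ p) {H α ε : ℝ} (hH : 0 < H)
    (hα : 0 < α) {x x' : Mark A} (hd : markDist x x' ≤ ε) (v : ℕ → ℝ)
    (h : eLpNorm (fun q : Z × (ℕ → Ξ) => M.Φ x q.1 (offFamily x.1 fun j => (v j, q.2 j))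
            - M.Φ x' q.1 (offFamily x.1 fun j => (v j, q.2 j)))
            (ENNReal.ofReal p) (M.stepLaw ℕ)
          ≤ ENNReal.ofReal (H * max 1 (∑ j ∈ Finset.range x.1, B.sm x * |v j| + B.β x) *
              markDist x x' ^ α)) :
    ∫⁻ q, ‖M.Φ x q.1 (offFamily x.1 fun j => (v j, q.2 j))
        - M.Φ x' q.1 (offFamily x.1 fun j => (v j, q.2 j))‖ₑ ^ p ∂(M.stepLaw ℕ) ≤
      ENNReal.ofReal H ^ p * ENNReal.ofReal (ε ^ α) ^ p *
        (1 + ‖B.sm x‖ₑ * ∑ j ∈ Finset.range x.1, ‖v j‖ₑ + ‖B.β x‖ₑ) ^ p := by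
  have hp0 : 0 ≤ p := by linarith
  rw [← ENNReal.mul_rpow_of_nonneg _ _ hp0, ← ENNReal.mul_rpow_of_nonneg _ _ hp0]
  refine lintegral_rpow_le_of_eLpNorm_le hp (h.trans ?_)
  rw [mul_right_comm, ENNReal.ofReal_mul (by have := markDist_nonneg x x'; positivity),
    ENNReal.ofReal_mul hH.le]
  gcongr
  · exact markDist_nonneg x x'
  · rw [ENNReal.ofReal_max, ENNReal.ofReal_one]
    refine max_le (le_trans le_self_add le_self_add) ?_
    refine (ofReal_le_enorm _).trans ((enorm_add_le _ _).trans ?_)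
    gcongr
    rw [← Finset.mul_sum, enorm_mul]
    refine le_trans ?_ le_add_self
    gcongr
    exact (enorm_sum_le' _ _).trans_eq (by simp)

theorem enorm_g_sub_le_of_markDist_le [MetricSpace A] {Q γ ε : ℝ} (hQ : 0 < Q) (hγ : 0 < γ)
    {x x' : Mark A} (hd : markDist x x' ≤ ε) {r : ℝ}
    (h : |M.g r x - M.g r x'| ≤ Q * max 1 (B.sp x * |r|) * markDist x x' ^ γ) :
    ‖M.g r x - M.g r x'‖ₑ ≤
      ENNReal.ofReal Q * ENNReal.ofReal (ε ^ γ) * (1 + ‖B.sp x‖ₑ * ‖r‖ₑ) := by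
  refine (enorm_le_of_abs_le h).trans ?_
  rw [mul_right_comm, ENNReal.ofReal_mul (by have := markDist_nonneg x x'; positivity),
    ENNReal.ofReal_mul hQ.le]
  gcongr
  · exact markDist_nonneg x x'
  · rw [ENNReal.ofReal_max, ENNReal.ofReal_one]
    refine max_le le_self_add ?_
    refine (ofReal_le_enorm _).trans ?_
    rw [enorm_mul, enorm_abs']
    exact le_add_self

/-- The change splits into a Lipschitz part in the value and a Hölder part in the mark. In the
Hölder part `S` is written as `(S - R) + R`, so only the moment of the unperturbed `R` is needed; `e
^ p ≤ δ ≤ 1` puts a factor `δ` on each of the four resulting terms. -/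
theorem lintegral_g_sub_g_le (hp : 1 ≤ p) {α : Type*} [MeasurableSpace α] {μ : Measure α}
    [IsProbabilityMeasure μ]
    (hg : ∀ (x : Mark A) (r r' : ℝ), |M.g r x - M.g r' x| ≤ B.sp x * |r - r'|) {q e δ m : ℝ≥0∞}
    (hq : q ≠ ∞) (he : e ^ p ≤ δ) (hδ : δ ≤ 1)
    {x x' : Mark A} (hx : ∀ r, ‖M.g r x - M.g r x'‖ₑ ≤ q * e * (1 + ‖B.sp x‖ₑ * ‖r‖ₑ))
    {S R : α → ℝ} (hS : Measurable S) (hR : Measurable R)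
    (hD : ∫⁻ w, ‖S w - R w‖ₑ ^ p ∂μ ≤ δ * m) (hm : ∫⁻ w, ‖R w‖ₑ ^ p ∂μ ≤ m) :
    ∫⁻ w, ‖M.g (S w) x' - M.g (R w) x‖ₑ ^ p ∂μ ≤
      4 ^ p * δ * (2 * q ^ p + 1) * (1 + ‖B.sp x‖ₑ ^ p * m) := by
  have hp0 : 0 ≤ p := by linarith
  have h4 := four_rpow_ne_top p hp
  set s := ‖B.sp x‖ₑ with hs
  have hsp : s ^ p ≠ ∞ := ENNReal.rpow_ne_top_of_nonneg hp0 enorm_ne_top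
  have hqp : q ^ p ≠ ∞ := ENNReal.rpow_ne_top_of_nonneg hp0 hq
  have hep : e ^ p ≠ ∞ := ne_top_of_le_ne_top ENNReal.one_ne_top (he.trans hδ)
  have hpt : ∀ w, ‖M.g (S w) x' - M.g (R w) x‖ₑ ^ p ≤ 4 ^ p * (q ^ p * e ^ p +
      q ^ p * e ^ p * s ^ p * ‖S w - R w‖ₑ ^ p + q ^ p * e ^ p * s ^ p * ‖R w‖ₑ ^ p +
        s ^ p * ‖S w - R w‖ₑ ^ p) := fun w => by
    have h1 : ‖M.g (S w) x' - M.g (R w) x‖ₑ ≤ q * e + q * e * s * ‖S w - R w‖ₑ +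
        q * e * s * ‖R w‖ₑ + s * ‖S w - R w‖ₑ := by
      calc ‖M.g (S w) x' - M.g (R w) x‖ₑ
          = ‖(M.g (S w) x - M.g (R w) x) - (M.g (S w) x - M.g (S w) x')‖ₑ := by congr 1; ring
        _ ≤ s * ‖S w - R w‖ₑ + q * e * (1 + s * ‖S w‖ₑ) :=
            enorm_sub_le.trans (add_le_add (enorm_g_sub_le hg x _ _) (hx _))
        _ ≤ s * ‖S w - R w‖ₑ + q * e * (1 + s * (‖S w - R w‖ₑ + ‖R w‖ₑ)) := by
            gcongr
            calc ‖S w‖ₑ = ‖(S w - R w) + R w‖ₑ := by congr 1; ring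
              _ ≤ _ := enorm_add_le _ _
        _ = _ := by ring
    refine (ENNReal.rpow_le_rpow h1 hp0).trans ((add_add_add_rpow_le hp _ _ _ _).trans_eq ?_)
    simp only [ENNReal.mul_rpow_of_nonneg _ _ hp0]
  refine (lintegral_mono hpt).trans ?_
  have mS : Measurable fun w => ‖S w - R w‖ₑ ^ p := (hS.sub hR).enorm.pow_const p
  have mR : Measurable fun w => ‖R w‖ₑ ^ p := hR.enorm.pow_const p
  rw [lintegral_const_mul' _ _ h4, lintegral_add_right _ (mS.const_mul _),
    lintegral_add_right _ (mR.const_mul _), lintegral_add_right _ (mS.const_mul _),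
    lintegral_const_mul _ mS, lintegral_const_mul _ mR, lintegral_const_mul _ mS]
  simp only [lintegral_const, measure_univ, mul_one]
  calc 4 ^ p * (q ^ p * e ^ p + q ^ p * e ^ p * s ^ p * ∫⁻ w, ‖S w - R w‖ₑ ^ p ∂μ +
        q ^ p * e ^ p * s ^ p * ∫⁻ w, ‖R w‖ₑ ^ p ∂μ + s ^ p * ∫⁻ w, ‖S w - R w‖ₑ ^ p ∂μ)
      ≤ 4 ^ p * (q ^ p * δ + q ^ p * 1 * s ^ p * (δ * m) +
        q ^ p * δ * s ^ p * m + s ^ p * (δ * m)) := by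
        gcongr
        exact he.trans hδ
    -- The added terms are exactly those missing for the product in the last line.
    _ ≤ 4 ^ p * (q ^ p * δ + q ^ p * 1 * s ^ p * (δ * m) +
        q ^ p * δ * s ^ p * m + s ^ p * (δ * m)) + 4 ^ p * (q ^ p * δ + δ) := le_self_add
    _ = 4 ^ p * δ * (2 * q ^ p + 1) * (1 + s ^ p * m) := by ring

/-- The majorant at `l` reads labels at `l` and in later generations only. Hence the majorants at
the children of `i` are unaffected by the label of `i`, which is the independence used when moments
are computed. -/
theorem majorant_extend (c : ℝ≥0∞) (y : ℕ × Mark A) (t : List ℕ → ℕ × Mark A) {i : List ℕ}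
    (r : ℕ) : ∀ l, i.length < l.length →
      majorant M B p c (Function.extend (fun _ : Unit => i) (fun _ => y) t) r l =
        majorant M B p c t r l := by
  induction r with
  | zero => intro l _; rfl
  | succ r ih =>
    intro l hl
    have h1 : ∀ l' : List ℕ, i.length < l'.length →
        Function.extend (fun _ : Unit => i) (fun _ => y) t l' = t l' := fun l' hl' =>
      extend_unit_of_ne (fun h => by rw [h] at hl'; exact lt_irrefl _ hl') _ _
    simp only [majorant, h1 l hl]
    congr 2
    congr 1
    refine Finset.sum_congr rfl fun j _ => ?_
    have hj : i.length < (j :: l).length := hl.trans (by simp)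
    rw [h1 _ hj, ih _ hj]

variable [MeasurableSpace A]

/-- Integrating out the noise of the last step of the recursion on trees. -/
theorem lintegral_tree_step (hM : M.IsMeasurable) (μ₀ : ProbabilityMeasure ℝ) (r : ℕ)
    (i : List ℕ) {m : ℕ} {x x' : Mark A}
    {v v' : NoiseSpace (List ℕ) (List ℕ) Z Ξ → ℕ → ℝ} (hv : ∀ j, Measurable fun w => v w j)
    (hv' : ∀ j, Measurable fun w => v' w j)
    (hres : ∀ s w, v (resample r i (fun j : ℕ => j :: i) (s, w)) = v w)
    (hres' : ∀ s w, v' (resample r i (fun j : ℕ => j :: i) (s, w)) = v' w) :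
    ∫⁻ w, ‖M.Φ x (w.1 (r, i)) (offFamily m fun j => (v w j, w.2.1 (r, j :: i)))
        - M.Φ x' (w.1 (r, i)) (offFamily m fun j => (v' w j, w.2.1 (r, j :: i)))‖ₑ ^ p
          ∂(M.noiseLaw μ₀ (List ℕ) (List ℕ)) =
      ∫⁻ w, ∫⁻ s, ‖M.Φ x s.1 (offFamily m fun j => (v w j, s.2 j))
        - M.Φ x' s.1 (offFamily m fun j => (v' w j, s.2 j))‖ₑ ^ p ∂(M.stepLaw ℕ)
          ∂(M.noiseLaw μ₀ (List ℕ) (List ℕ)) := by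
  refine lintegral_resample M μ₀ r i (e := fun j : ℕ => j :: i) (fun j j' h => (List.cons.inj h).1)
    (F := fun w z ξ => ‖M.Φ x z (offFamily m fun j => (v w j, ξ j))
        - M.Φ x' z (offFamily m fun j => (v' w j, ξ j))‖ₑ ^ p) ?_
    fun s w => by simp only [hres, hres']
  refine ((Measurable.sub ?_ ?_).enorm).pow_const p
  · exact measurable_Φ_offFamily hM (by fun_prop) (by fun_prop) (by fun_prop) fun j =>
      ((hv j).comp (by fun_prop)).prodMk (by fun_prop)
  · exact measurable_Φ_offFamily hM (by fun_prop) (by fun_prop) (by fun_prop) fun j =>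
      ((hv' j).comp (by fun_prop)).prodMk (by fun_prop)

theorem lintegral_tree_step_norm (hM : M.IsMeasurable) (μ₀ : ProbabilityMeasure ℝ) (r : ℕ)
    (i : List ℕ) {m : ℕ} {x : Mark A}
    {v : NoiseSpace (List ℕ) (List ℕ) Z Ξ → ℕ → ℝ} (hv : ∀ j, Measurable fun w => v w j)
    (hres : ∀ s w, v (resample r i (fun j : ℕ => j :: i) (s, w)) = v w) :
    ∫⁻ w, ‖M.Φ x (w.1 (r, i)) (offFamily m fun j => (v w j, w.2.1 (r, j :: i)))‖ₑ ^ p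
          ∂(M.noiseLaw μ₀ (List ℕ) (List ℕ)) =
      ∫⁻ w, ∫⁻ s, ‖M.Φ x s.1 (offFamily m fun j => (v w j, s.2 j))‖ₑ ^ p ∂(M.stepLaw ℕ)
          ∂(M.noiseLaw μ₀ (List ℕ) (List ℕ)) := by
  refine lintegral_resample M μ₀ r i (e := fun j : ℕ => j :: i) (fun j j' h => (List.cons.inj h).1)
    (F := fun w z ξ => ‖M.Φ x z (offFamily m fun j => (v w j, ξ j))‖ₑ ^ p) ?_
    fun s w => by simp only [hres]
  refine (Measurable.enorm ?_).pow_const p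
  exact measurable_Φ_offFamily hM (by fun_prop) (by fun_prop) (by fun_prop) fun j =>
      ((hv j).comp (by fun_prop)).prodMk (by fun_prop)

theorem measurable_gtreeR (hM : M.IsMeasurable) (hgm : Measurable (Function.uncurry M.g))
    (t : List ℕ → ℕ × Mark A) (r : ℕ) (l : List ℕ) (x : Mark A) :
    Measurable fun w : NoiseSpace (List ℕ) (List ℕ) Z Ξ => M.g (treeR M t w r l) x :=
  measurable_g_comp hgm (measurable_treeR_noise hM hgm t r l) measurable_const

/-- The noise of the last step is integrated first, which leaves the growth bound. One factor `4 ^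
p` separates `β` from the sum over the offspring, the other separates `g(0, ·)` from the Lipschitz
part of `g`. The summands `1` of the majorant are slack here; the Hölder bounds of the perturbation
estimate need them. -/
theorem lintegral_treeR_le_majorant (hp : 1 ≤ p) (hM : M.IsMeasurable)
    (hgm : Measurable (Function.uncurry M.g))
    (hg : ∀ (x : Mark A) (r r' : ℝ), |M.g r x - M.g r' x| ≤ B.sp x * |r - r'|)
    {μ₀ : ProbabilityMeasure ℝ} {c : ℝ≥0∞} (hc₀ : ∫⁻ r, ‖r‖ₑ ^ p ∂(μ₀ : Measure ℝ) ≤ c)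
    (hc : (4 : ℝ≥0∞) ^ p * 4 ^ p ≤ c) {t : List ℕ → ℕ × Mark A}
    (ht : ∀ i, BoundsAt M B p (t i).1 (t i).2) (r : ℕ) :
    ∀ i, ∫⁻ w, ‖treeR M t w r i‖ₑ ^ p ∂(M.noiseLaw μ₀ (List ℕ) (List ℕ)) ≤
      majorant M B p c t r i := by
  induction r with
  | zero =>
    intro i
    simp only [treeR, majorant]
    refine le_trans (le_of_eq ?_) hc₀
    have h : MeasurePreserving (fun w : NoiseSpace (List ℕ) (List ℕ) Z Ξ => w.2.2 i)
        (M.noiseLaw μ₀ (List ℕ) (List ℕ)) (μ₀ : Measure ℝ) :=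
      (measurePreserving_eval_infinitePi (fun _ : List ℕ => (μ₀ : Measure ℝ)) i).comp
        (measurePreserving_snd.comp measurePreserving_snd)
    exact h.lintegral_comp (f := fun r : ℝ => ‖r‖ₑ ^ p) (by fun_prop)
  | succ r ih =>
    intro i
    have hp0 : 0 ≤ p := by linarith
    have h4 := one_le_four_rpow p hp
    simp only [treeR, majorant]
    rw [lintegral_tree_step_norm (v := fun w j => M.g (treeR M t w r (j :: i)) (t (j :: i)).2)
      hM μ₀ r i (fun j => measurable_gtreeR hM hgm t r _ _)
      (fun s w => funext fun j => by simp only [treeR_resample M t _ _ r le_rfl])]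
    have h1 : ∀ j, Measurable fun w : NoiseSpace (List ℕ) (List ℕ) Z Ξ =>
        ‖M.g (treeR M t w r (j :: i)) (t (j :: i)).2‖ₑ :=
      fun j => (measurable_gtreeR hM hgm t r _ _).enorm
    calc ∫⁻ w, ∫⁻ s, ‖M.Φ (t i).2 s.1 (offFamily (t i).1 fun j =>
            (M.g (treeR M t w r (j :: i)) (t (j :: i)).2, s.2 j))‖ₑ ^ p ∂(M.stepLaw ℕ)
            ∂(M.noiseLaw μ₀ (List ℕ) (List ℕ))
        ≤ ∫⁻ w, 4 ^ p * ((‖B.sm (t i).2‖ₑ * ∑ j ∈ Finset.range (t i).1,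
            ‖M.g (treeR M t w r (j :: i)) (t (j :: i)).2‖ₑ) ^ p + ‖B.β (t i).2‖ₑ ^ p)
              ∂(M.noiseLaw μ₀ (List ℕ) (List ℕ)) :=
          lintegral_mono fun w => ((ht i).lintegral_le hp _).trans (add_rpow_le hp _ _)
      _ = 4 ^ p * (∫⁻ w, (‖B.sm (t i).2‖ₑ * ∑ j ∈ Finset.range (t i).1,
            ‖M.g (treeR M t w r (j :: i)) (t (j :: i)).2‖ₑ) ^ p
              ∂(M.noiseLaw μ₀ (List ℕ) (List ℕ)) + ‖B.β (t i).2‖ₑ ^ p) := by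
          rw [lintegral_const_mul' _ _ (four_rpow_ne_top p hp), lintegral_add_right _
            measurable_const]
          simp
      _ ≤ 4 ^ p * (‖B.sm (t i).2‖ₑ ^ p * ((t i).1 : ℝ≥0∞) ^ (p - 1) *
            ∑ j ∈ Finset.range (t i).1, 4 ^ p * (‖M.g 0 (t (j :: i)).2‖ₑ ^ p +
              ‖B.sp (t (j :: i)).2‖ₑ ^ p * majorant M B p c t r (j :: i)) +
                ‖B.β (t i).2‖ₑ ^ p) := by
          gcongr
          refine lintegral_mul_sum_rpow_le hp _ _ h1 fun j _ => ?_
          refine (lintegral_enorm_g_le hp hg _).trans ?_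
          gcongr
          exact ih _
      _ ≤ 4 ^ p * (‖B.sm (t i).2‖ₑ ^ p * ((t i).1 : ℝ≥0∞) ^ (p - 1) *
            ∑ j ∈ Finset.range (t i).1, 4 ^ p * (1 + ‖M.g 0 (t (j :: i)).2‖ₑ ^ p +
              ‖B.sp (t (j :: i)).2‖ₑ ^ p * majorant M B p c t r (j :: i)) +
                4 ^ p * (1 + ‖B.β (t i).2‖ₑ ^ p)) := by
          gcongr
          · exact le_add_self
          · exact le_trans le_add_self (le_mul_of_one_le_left' h4)
      _ = (4 ^ p * 4 ^ p) * (1 + ‖B.β (t i).2‖ₑ ^ p +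
            ‖B.sm (t i).2‖ₑ ^ p * ((t i).1 : ℝ≥0∞) ^ (p - 1) *
            ∑ j ∈ Finset.range (t i).1, (1 + ‖M.g 0 (t (j :: i)).2‖ₑ ^ p +
              ‖B.sp (t (j :: i)).2‖ₑ ^ p * majorant M B p c t r (j :: i))) := by
          rw [← Finset.mul_sum]; ring
      _ ≤ _ := by gcongr

/-- A small perturbation of the marks in the first generations changes `ℛ_i^{(r)}` little. -/
theorem lintegral_treeR_sub_le [MetricSpace A] (hp : 1 ≤ p) (hM : M.IsMeasurable)
    (hgm : Measurable (Function.uncurry M.g))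
    (hg : ∀ (x : Mark A) (r r' : ℝ), |M.g r x - M.g r' x| ≤ B.sp x * |r - r'|)
    {H Q α γ : ℝ} (hH : 0 < H) (hQ : 0 < Q) (hα : 0 < α) (hγ : 0 < γ)
    (hhol : ∀ x x' : Mark A, markDist x x' < 1 →
      (∀ v : ℕ → ℝ,
        eLpNorm (fun q : Z × (ℕ → Ξ) => M.Φ x q.1 (offFamily x.1 fun j => (v j, q.2 j))
            - M.Φ x' q.1 (offFamily x.1 fun j => (v j, q.2 j)))
            (ENNReal.ofReal p) (M.stepLaw ℕ)
          ≤ ENNReal.ofReal (H * max 1 (∑ j ∈ Finset.range x.1, B.sm x * |v j| + B.β x) *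
              markDist x x' ^ α)) ∧
      ∀ r : ℝ, |M.g r x - M.g r x'| ≤ Q * max 1 (B.sp x * |r|) * markDist x x' ^ γ)
    {μ₀ : ProbabilityMeasure ℝ} {c δ : ℝ≥0∞} (hc₀ : ∫⁻ r, ‖r‖ₑ ^ p ∂(μ₀ : Measure ℝ) ≤ c)
    (hc : (4 : ℝ≥0∞) ^ p * 4 ^ p ≤ c)
    (hc' : 4 ^ p * (ENNReal.ofReal H ^ p * 4 ^ p * (4 ^ p * (4 ^ p * (2 * ENNReal.ofReal Q ^ p + 2))))
      + 4 ^ p * (4 ^ p * (2 * ENNReal.ofReal Q ^ p + 1)) ≤ c)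
    {ε : ℝ} (hε : ε < 1) (hδα : ENNReal.ofReal (ε ^ α) ^ p ≤ δ)
    (hδγ : ENNReal.ofReal (ε ^ γ) ^ p ≤ δ) (hδ : δ ≤ 1)
    {t : List ℕ → ℕ × Mark A} (ht : ∀ i, BoundsAt M B p (t i).1 (t i).2) {X : List ℕ → Mark A}
    {K : ℕ} (hN : ∀ i, InTree (fun l => (t l).1) i → i.length < K → (t i).1 = (t i).2.1)
    (hX : ∀ i, InTree (fun l => (t l).1) i → i.length ≤ K → markDist (t i).2 (X i) ≤ ε) (r : ℕ) :
    ∀ i, InTree (fun l => (t l).1) i → i.length + r ≤ K →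
      ∫⁻ w, ‖treeR M (fun l => ((t l).1, X l)) w r i - treeR M t w r i‖ₑ ^ p
        ∂(M.noiseLaw μ₀ (List ℕ) (List ℕ)) ≤ δ * majorant M B p c t r i := by
  have hp0 : 0 ≤ p := by linarith
  have h4 := four_rpow_ne_top p hp
  have h14 := one_le_four_rpow p hp
  induction r with
  | zero =>
    intro i _ _
    simp [treeR, ENNReal.zero_rpow_of_pos (by linarith : 0 < p)]
  | succ r ih =>
    intro i hi hik
    set ρ := M.noiseLaw μ₀ (List ℕ) (List ℕ) with hρ
    set t' : List ℕ → ℕ × Mark A := fun l => ((t l).1, X l) with ht'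
    set v : NoiseSpace (List ℕ) (List ℕ) Z Ξ → ℕ → ℝ :=
      fun w j => M.g (treeR M t' w r (j :: i)) (X (j :: i)) with hv
    set u : NoiseSpace (List ℕ) (List ℕ) Z Ξ → ℕ → ℝ :=
      fun w j => M.g (treeR M t w r (j :: i)) (t (j :: i)).2 with hu
    have mv : ∀ j, Measurable fun w => v w j := fun j => measurable_gtreeR hM hgm t' r _ _
    have mu : ∀ j, Measurable fun w => u w j := fun j => measurable_gtreeR hM hgm t r _ _
    have rv : ∀ s w, v (resample r i (fun j : ℕ => j :: i) (s, w)) = v w :=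
      fun s w => funext fun j => by simp only [hv, treeR_resample M t' _ _ r le_rfl]
    have ru : ∀ s w, u (resample r i (fun j : ℕ => j :: i) (s, w)) = u w :=
      fun s w => funext fun j => by simp only [hu, treeR_resample M t _ _ r le_rfl]
    set N := (t i).1 with hNdef
    set x := (t i).2 with hx
    set q := ENNReal.ofReal Q with hq
    set U : ℕ → ℝ≥0∞ := fun j => 1 + ‖M.g 0 (t (j :: i)).2‖ₑ ^ p +
      ‖B.sp (t (j :: i)).2‖ₑ ^ p * majorant M B p c t r (j :: i) with hU
    -- The Hölder bound is stated for as many arguments as the in-degree in the mark, while the tree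
    -- uses its offspring number. They must agree only where a step is performed, that is, strictly
    -- before generation `K`.
    have hNx : N = x.1 := hN i hi (by omega)
    have hd : markDist x (X i) ≤ ε := hX i hi (by omega)
    have hchild : ∀ j < N, InTree (fun l => (t l).1) (j :: i) := fun j hj => ⟨hi, hj⟩
    have hvu : ∀ j < N, ∫⁻ w, ‖v w j - u w j‖ₑ ^ p ∂ρ ≤ 4 ^ p * δ * (2 * q ^ p + 1) * U j := by
      intro j hj
      have hdj : markDist (t (j :: i)).2 (X (j :: i)) ≤ ε :=
        hX _ (hchild j hj) (by simp only [List.length_cons]; omega)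
      refine (lintegral_g_sub_g_le (m := majorant M B p c t r (j :: i)) hp hg
        ENNReal.ofReal_ne_top hδγ hδ
        (fun r => enorm_g_sub_le_of_markDist_le hQ hγ hdj
          ((hhol _ _ (hdj.trans_lt hε)).2 r))
        (measurable_treeR_noise hM hgm t' r _) (measurable_treeR_noise hM hgm t r _)
        (ih _ (hchild j hj) (by simp only [List.length_cons]; omega))
        (lintegral_treeR_le_majorant hp hM hgm hg hc₀ hc ht r _)).trans ?_
      simp only [hU]
      gcongr
      exact le_self_add
    have hun : ∀ j, ∫⁻ w, ‖u w j‖ₑ ^ p ∂ρ ≤ 4 ^ p * U j := fun j => by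
      refine (lintegral_enorm_g_le hp hg _).trans ?_
      simp only [hU]
      gcongr
      · exact le_add_self
      · exact lintegral_treeR_le_majorant hp hM hgm hg hc₀ hc ht r _
    have hvn : ∀ j < N, ∫⁻ w, ‖v w j‖ₑ ^ p ∂ρ ≤ 4 ^ p * (4 ^ p * (2 * q ^ p + 2)) * U j :=
      fun j hj => by
      calc ∫⁻ w, ‖v w j‖ₑ ^ p ∂ρ ≤ ∫⁻ w, 4 ^ p * (‖v w j - u w j‖ₑ ^ p + ‖u w j‖ₑ ^ p) ∂ρ := by
            refine lintegral_mono fun w => ?_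
            refine le_trans (ENNReal.rpow_le_rpow ?_ hp0) (add_rpow_le hp _ _)
            calc ‖v w j‖ₑ = ‖(v w j - u w j) + u w j‖ₑ := by congr 1; ring
              _ ≤ _ := enorm_add_le _ _
        _ = 4 ^ p * (∫⁻ w, ‖v w j - u w j‖ₑ ^ p ∂ρ + ∫⁻ w, ‖u w j‖ₑ ^ p ∂ρ) := by
            rw [lintegral_const_mul' _ _ h4, lintegral_add_right _ ((mu j).enorm.pow_const p)]
        _ ≤ 4 ^ p * (4 ^ p * 1 * (2 * q ^ p + 1) * U j + 4 ^ p * U j) := by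
            gcongr
            · exact (hvu j hj).trans (by gcongr)
            · exact hun j
        _ = _ := by ring
    set s := ‖B.sm x‖ₑ ^ p * (N : ℝ≥0∞) ^ (p - 1) with hs
    -- The cost of changing the mark in `Φ`, at the perturbed arguments `v`. Their moments are those
    -- of `u` plus the small difference, by `hvn`.
    have hT1 : ∫⁻ w, ∫⁻ z, ‖M.Φ x z.1 (offFamily N fun j => (v w j, z.2 j))
        - M.Φ (X i) z.1 (offFamily N fun j => (v w j, z.2 j))‖ₑ ^ p ∂(M.stepLaw ℕ) ∂ρ ≤
        ENNReal.ofReal H ^ p * δ * (4 ^ p * (1 + ‖B.β x‖ₑ ^ p +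
          s * (4 ^ p * (4 ^ p * (2 * q ^ p + 2)) * ∑ j ∈ Finset.range N, U j))) := by
      calc _ ≤ ∫⁻ w, ENNReal.ofReal H ^ p * δ * (4 ^ p * (1 + (‖B.sm x‖ₑ *
              ∑ j ∈ Finset.range N, ‖v w j‖ₑ) ^ p + ‖B.β x‖ₑ ^ p)) ∂ρ := by
            refine lintegral_mono fun w => ?_
            dsimp only
            rw [hNx]
            refine (lintegral_Φ_sub_le_of_markDist_le hp hH hα hd (v w)
              ((hhol _ _ (hd.trans_lt hε)).1 _)).trans ?_
            gcongr
            refine (add_add_rpow_le hp _ _ _).trans_eq ?_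
            rw [ENNReal.one_rpow]
        _ = ENNReal.ofReal H ^ p * δ * (4 ^ p * (1 + ∫⁻ w, (‖B.sm x‖ₑ *
              ∑ j ∈ Finset.range N, ‖v w j‖ₑ) ^ p ∂ρ + ‖B.β x‖ₑ ^ p)) := by
            have m1 : Measurable fun w => (‖B.sm x‖ₑ * ∑ j ∈ Finset.range N, ‖v w j‖ₑ) ^ p :=
              ((Finset.measurable_fun_sum _ fun j _ => (mv j).enorm).const_mul _).pow_const p
            have hHδ : ENNReal.ofReal H ^ p * δ ≠ ∞ := ENNReal.mul_ne_top
              (ENNReal.rpow_ne_top_of_nonneg hp0 ENNReal.ofReal_ne_top)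
              (ne_top_of_le_ne_top ENNReal.one_ne_top hδ)
            rw [lintegral_const_mul' _ _ hHδ, lintegral_const_mul' _ _ h4, lintegral_add_right _ measurable_const,
              lintegral_add_right _ m1]
            simp
        _ ≤ ENNReal.ofReal H ^ p * δ * (4 ^ p * (1 + s *
              ∑ j ∈ Finset.range N, 4 ^ p * (4 ^ p * (2 * q ^ p + 2)) * U j + ‖B.β x‖ₑ ^ p)) := by
            gcongr
            exact lintegral_mul_sum_rpow_le hp _ _ (fun j => (mv j).enorm) fun j hj => hvn j hj
        _ = _ := by rw [← Finset.mul_sum]; ring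
    -- The cost of changing the arguments from `u` to `v` at the original mark, where the Lipschitz
    -- bound is available.
    have hT2 : ∫⁻ w, ∫⁻ z, ‖M.Φ x z.1 (offFamily N fun j => (v w j, z.2 j))
        - M.Φ x z.1 (offFamily N fun j => (u w j, z.2 j))‖ₑ ^ p ∂(M.stepLaw ℕ) ∂ρ ≤
        s * (4 ^ p * δ * (2 * q ^ p + 1) * ∑ j ∈ Finset.range N, U j) := by
      calc _ ≤ ∫⁻ w, (‖B.sm x‖ₑ * ∑ j ∈ Finset.range N, ‖v w j - u w j‖ₑ) ^ p ∂ρ :=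
            lintegral_mono fun w => (ht i).lintegral_sub_le hp _ _
        _ ≤ s * ∑ j ∈ Finset.range N, 4 ^ p * δ * (2 * q ^ p + 1) * U j :=
            lintegral_mul_sum_rpow_le hp _ _ (fun j => ((mv j).sub (mu j)).enorm)
              fun j hj => hvu j hj
        _ = _ := by rw [← Finset.mul_sum]
    rw [← lintegral_tree_step hM μ₀ r i mv mv rv rv] at hT1
    rw [← lintegral_tree_step hM μ₀ r i mv mu rv ru] at hT2
    have hΦm : ∀ (y : Mark A) {f : NoiseSpace (List ℕ) (List ℕ) Z Ξ → ℕ → ℝ},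
        (∀ j, Measurable fun w => f w j) → Measurable fun w : NoiseSpace (List ℕ) (List ℕ) Z Ξ =>
          M.Φ y (w.1 (r, i)) (offFamily N fun j => (f w j, w.2.1 (r, j :: i))) := fun y f hf =>
      measurable_Φ_offFamily hM (by fun_prop) (by fun_prop) (by fun_prop)
        fun j => (hf j).prodMk (by fun_prop)
    calc ∫⁻ w, ‖treeR M t' w (r + 1) i - treeR M t w (r + 1) i‖ₑ ^ p ∂ρ
        ≤ ∫⁻ w, 4 ^ p * (‖M.Φ x (w.1 (r, i)) (offFamily N fun j => (v w j, w.2.1 (r, j :: i)))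
          - M.Φ (X i) (w.1 (r, i)) (offFamily N fun j => (v w j, w.2.1 (r, j :: i)))‖ₑ ^ p +
          ‖M.Φ x (w.1 (r, i)) (offFamily N fun j => (v w j, w.2.1 (r, j :: i)))
          - M.Φ x (w.1 (r, i)) (offFamily N fun j => (u w j, w.2.1 (r, j :: i)))‖ₑ ^ p) ∂ρ := by
          refine lintegral_mono fun w => ?_
          refine le_trans (ENNReal.rpow_le_rpow ?_ hp0) (add_rpow_le hp _ _)
          rw [enorm_sub_rev (M.Φ x (w.1 (r, i)) (offFamily N fun j => (v w j, w.2.1 (r, j :: i))))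
            (M.Φ (X i) _ _)]
          refine le_trans (le_of_eq ?_) (enorm_add_le _ _)
          congr 1
          simp only [treeR, sub_add_sub_cancel]
          rfl
      _ ≤ 4 ^ p * (ENNReal.ofReal H ^ p * δ * (4 ^ p * (1 + ‖B.β x‖ₑ ^ p +
          s * (4 ^ p * (4 ^ p * (2 * q ^ p + 2)) * ∑ j ∈ Finset.range N, U j))) +
          s * (4 ^ p * δ * (2 * q ^ p + 1) * ∑ j ∈ Finset.range N, U j)) := by
          rw [lintegral_const_mul' _ _ h4, lintegral_add_right]
          · gcongr
          · exact ((hΦm x mv).sub (hΦm x mu)).enorm.pow_const p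
      -- The coefficient of `1 + β ^ p` is enlarged to that of the sum over the offspring, so that
      -- the total factors with the constant of `hc'`.
      _ ≤ 4 ^ p * (ENNReal.ofReal H ^ p * δ * (4 ^ p * (
          (4 ^ p * (4 ^ p * (2 * q ^ p + 2))) * (1 + ‖B.β x‖ₑ ^ p) +
          s * (4 ^ p * (4 ^ p * (2 * q ^ p + 2)) * ∑ j ∈ Finset.range N, U j))) +
          s * (4 ^ p * δ * (2 * q ^ p + 1) * ∑ j ∈ Finset.range N, U j)) +
          4 ^ p * δ * (4 ^ p * (2 * q ^ p + 1)) * (1 + ‖B.β x‖ₑ ^ p) := by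
          refine le_trans ?_ le_self_add
          gcongr
          refine le_mul_of_one_le_left' ?_
          refine le_trans h14 (le_mul_of_one_le_right' (le_trans h14 (le_mul_of_one_le_right' ?_)))
          exact le_trans (by norm_num) le_add_self
      _ = δ * ((4 ^ p * (ENNReal.ofReal H ^ p * 4 ^ p * (4 ^ p * (4 ^ p * (2 * q ^ p + 2))))
          + 4 ^ p * (4 ^ p * (2 * q ^ p + 1))) *
          (1 + ‖B.β x‖ₑ ^ p + s * ∑ j ∈ Finset.range N, U j)) := by ring
      _ ≤ δ * (c * (1 + ‖B.β x‖ₑ ^ p + s * ∑ j ∈ Finset.range N, U j)) := by gcongr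
      _ = δ * majorant M B p c t (r + 1) i := by simp only [majorant]; rfl

end Perturbation

/-! ### Moments under the law of the Galton–Watson tree -/

section Moments

variable {A : Type a} {Z : Type v} {Ξ : Type w} [MeasurableSpace Z] [MeasurableSpace Ξ]
  [MeasurableSpace A]

instance (π₀ π₁ : ProbabilityMeasure (ℕ × Mark A)) : IsProbabilityMeasure (gwLaw π₀ π₁) := by
  unfold gwLaw; infer_instance

theorem measurable_sum_range {α : Type*} [MeasurableSpace α] {N : α → ℕ} (hN : Measurable N)
    {f : α → ℕ → ℝ≥0∞} (hf : ∀ j, Measurable fun q => f q j) :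
    Measurable fun q => ∑ j ∈ Finset.range (N q), f q j := by
  have h : Measurable fun q : α × ℕ => ∑ j ∈ Finset.range q.2, f q.1 j :=
    measurable_from_prod_countable_left fun m => by
      dsimp only
      exact Finset.measurable_fun_sum _ fun j _ => hf j
  exact h.comp (measurable_id.prodMk hN)

/-- The label of a node may be replaced by an independent copy if all the rest does not depend on
it. -/
theorem lintegral_gwLaw_eq (π₀ π₁ : ProbabilityMeasure (ℕ × Mark A)) (i : List ℕ)
    {F : (ℕ × Mark A) → (List ℕ → ℕ × Mark A) → ℝ≥0∞}
    (hF : Measurable fun q : (ℕ × Mark A) × (List ℕ → ℕ × Mark A) => F q.1 q.2)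
    (h : ∀ y y' t, F y (Function.extend (fun _ : Unit => i) (fun _ => y') t) = F y t) :
    ∫⁻ t, F (t i) t ∂(gwLaw π₀ π₁) = ∫⁻ y, ∫⁻ t, F y t ∂(gwLaw π₀ π₁)
      ∂(((if i = [] then π₀ else π₁ : ProbabilityMeasure (ℕ × Mark A))) : Measure (ℕ × Mark A)) := by
  have hmp := measurePreserving_extend_unit (fun i : List ℕ =>
    (((if i = [] then π₀ else π₁ : ProbabilityMeasure (ℕ × Mark A))) : Measure (ℕ × Mark A))) i
  have hF' : Measurable fun t : List ℕ → ℕ × Mark A => F (t i) t :=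
    hF.comp (f := fun t : List ℕ → ℕ × Mark A => (t i, t)) (by fun_prop)
  rw [show gwLaw π₀ π₁ = Measure.infinitePi _ from rfl, ← hmp.lintegral_comp hF', lintegral_prod]
  · refine lintegral_congr fun y => lintegral_congr fun t => ?_
    simp only [extend_unit_self, h]
  · exact (hF'.comp hmp.measurable).aemeasurable

theorem lintegral_gwLaw_eval (π₀ π₁ : ProbabilityMeasure (ℕ × Mark A)) (i : List ℕ)
    {f : (ℕ × Mark A) → ℝ≥0∞} (hf : Measurable f) :
    ∫⁻ t, f (t i) ∂(gwLaw π₀ π₁) = ∫⁻ y, f y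
      ∂(((if i = [] then π₀ else π₁ : ProbabilityMeasure (ℕ × Mark A))) : Measure (ℕ × Mark A)) := by
  rw [lintegral_gwLaw_eq π₀ π₁ i (F := fun y _ => f y) (by fun_prop) fun _ _ _ => rfl]
  simp

theorem ae_gwLaw {π₀ π₁ : ProbabilityMeasure (ℕ × Mark A)} {q : ℕ × Mark A → Prop}
    (h₀ : ∀ᵐ y ∂(π₀ : Measure (ℕ × Mark A)), q y) (h₁ : ∀ᵐ y ∂(π₁ : Measure (ℕ × Mark A)), q y) :
    ∀ᵐ t ∂(gwLaw π₀ π₁), ∀ i, q (t i) := by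
  refine ae_all_iff.2 fun i => ?_
  have hmp := measurePreserving_eval_infinitePi (fun i : List ℕ =>
    (((if i = [] then π₀ else π₁ : ProbabilityMeasure (ℕ × Mark A))) : Measure (ℕ × Mark A))) i
  refine hmp.quasiMeasurePreserving.ae (p := q) ?_
  split_ifs
  · exact h₀
  · exact h₁

/-- The label of the node and the rest of the tree are integrated separately, so the sum contributes
the factor `N` times the common bound `C`. -/
theorem lintegral_mul_sum_range_le {ι α : Type*} [MeasurableSpace ι] [MeasurableSpace α]
    {μ : Measure ι} {ν : Measure α} {p : ℝ} (hp : 1 ≤ p) {a : ι → ℝ≥0∞} {N : ι → ℕ}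
    {u : α → ℕ → ℝ≥0∞} (hu : ∀ j, Measurable fun q => u q j) {C : ℝ≥0∞}
    (hC : ∀ j, ∫⁻ q, u q j ∂ν ≤ C) (ha : Measurable a) (hN : Measurable N) :
    ∫⁻ y, ∫⁻ q, a y * ((N y : ℝ≥0∞) ^ (p - 1) * ∑ j ∈ Finset.range (N y), u q j) ∂ν ∂μ ≤
      (∫⁻ y, a y * (N y : ℝ≥0∞) ^ p ∂μ) * C := by
  have hm : Measurable fun y => a y * (N y : ℝ≥0∞) ^ p := ha.mul
    ((measurable_from_nat (f := fun n : ℕ => (n : ℝ≥0∞))|>.comp hN).pow_const p)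
  rw [← lintegral_mul_const _ hm]
  refine lintegral_mono fun y => ?_
  dsimp only
  have h1 : Measurable fun q => ∑ j ∈ Finset.range (N y), u q j :=
    Finset.measurable_fun_sum _ fun j _ => hu j
  rw [lintegral_const_mul _ (h1.const_mul _), lintegral_const_mul _ h1,
    lintegral_finsetSum _ fun j _ => hu j, mul_assoc, ← natCast_rpow_sub_one_mul hp, mul_assoc]
  gcongr
  calc ∑ j ∈ Finset.range (N y), ∫⁻ q, u q j ∂ν ≤ ∑ _j ∈ Finset.range (N y), C :=
        Finset.sum_le_sum fun j _ => hC j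
    _ = (N y : ℝ≥0∞) * C := by simp

variable {M : Recursion A Z Ξ} {B : Bounds A} {p : ℝ}

theorem measurable_majorant (hsm : Measurable B.sm) (hsp : Measurable B.sp) (hβ : Measurable B.β)
    (hg0 : Measurable (M.g 0)) (c : ℝ≥0∞) (r : ℕ) :
    ∀ i, Measurable fun t => majorant M B p c t r i := by
  induction r with
  | zero => intro i; simp only [majorant]; fun_prop
  | succ r ih =>
    intro i
    have hN : Measurable fun t : List ℕ → ℕ × Mark A => (((t i).1 : ℕ) : ℝ≥0∞) :=
      measurable_from_nat.comp (by fun_prop : Measurable fun t : List ℕ → ℕ × Mark A => (t i).1)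
    simp only [majorant]
    refine Measurable.const_mul ?_ c
    refine (measurable_const.add ?_).add ((Measurable.mul ?_ ?_).mul
      (measurable_sum_range (N := fun t : List ℕ → ℕ × Mark A => (t i).1) (by fun_prop)
        fun j => (measurable_const.add ?_).add (Measurable.mul ?_ (ih _))))
    · exact (hβ.comp (by fun_prop)).enorm.pow_const p
    · exact (hsm.comp (by fun_prop)).enorm.pow_const p
    · exact hN.pow_const _
    · exact (hg0.comp (by fun_prop)).enorm.pow_const p
    · exact (hsp.comp (by fun_prop)).enorm.pow_const p

theorem lintegral_rpow_lt_top_of_memLp {α : Type*} [MeasurableSpace α] {μ : Measure α}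
    (hp : 1 ≤ p) {f : α → ℝ} (h : MemLp f (ENNReal.ofReal p) μ) : ∫⁻ x, ‖f x‖ₑ ^ p ∂μ < ∞ := by
  have := lintegral_rpow_enorm_lt_top_of_eLpNorm_lt_top (by simp; linarith) ENNReal.ofReal_ne_top
    h.eLpNorm_lt_top
  rwa [ENNReal.toReal_ofReal (by linarith)] at this

/-- The moment conditions on the labels of the limiting tree. -/
structure MomentBounds (M : Recursion A Z Ξ) (B : Bounds A) (p : ℝ)
    (π₀ π₁ : ProbabilityMeasure (ℕ × Mark A)) : Prop where
  root_sm : ∫⁻ y, ‖B.sm y.2‖ₑ ^ p * (y.1 : ℝ≥0∞) ^ p ∂(π₀ : Measure (ℕ × Mark A)) ≠ ∞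
  root_β : ∫⁻ y, ‖B.β y.2‖ₑ ^ p ∂(π₀ : Measure (ℕ × Mark A)) ≠ ∞
  node_smsp : ∫⁻ y, ‖B.sp y.2‖ₑ ^ p * ‖B.sm y.2‖ₑ ^ p * (y.1 : ℝ≥0∞) ^ p
    ∂(π₁ : Measure (ℕ × Mark A)) ≠ ∞
  node_spβ : ∫⁻ y, ‖B.sp y.2‖ₑ ^ p * ‖B.β y.2‖ₑ ^ p ∂(π₁ : Measure (ℕ × Mark A)) ≠ ∞
  node_sp : ∫⁻ y, ‖B.sp y.2‖ₑ ^ p ∂(π₁ : Measure (ℕ × Mark A)) ≠ ∞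
  node_g : ∫⁻ y, ‖M.g 0 y.2‖ₑ ^ p ∂(π₁ : Measure (ℕ × Mark A)) ≠ ∞

/-- The expectation unrolls generation by generation. At a non-root node the majorant comes with the
weight `σ₊ ^ p` inherited from its parent, which is why the moments of `N₁ σ₋ σ₊` and `σ₊ β` are
assumed under `π₁`, but only those of `N σ₋` and `β` at the root. -/
theorem MomentBounds.lintegral_majorant_ne_top (hp : 1 ≤ p)
    {π₀ π₁ : ProbabilityMeasure (ℕ × Mark A)} (hmom : MomentBounds M B p π₀ π₁)
    (hsm : Measurable B.sm) (hsp : Measurable B.sp) (hβ : Measurable B.β)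
    (hg0 : Measurable (M.g 0)) {c : ℝ≥0∞} (hc : c ≠ ∞) (r : ℕ) :
    ∫⁻ t, majorant M B p c t r [] ∂(gwLaw π₀ π₁) ≠ ∞ := by
  have hmaj := measurable_majorant (p := p) hsm hsp hβ hg0 c
  have m1 : ∀ i, Measurable fun t : List ℕ → ℕ × Mark A => ‖B.sp (t i).2‖ₑ ^ p :=
    fun i => (hsp.comp (by fun_prop)).enorm.pow_const p
  have m2 : ∀ i, Measurable fun t : List ℕ → ℕ × Mark A => ‖M.g 0 (t i).2‖ₑ ^ p :=
    fun i => (hg0.comp (by fun_prop)).enorm.pow_const p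
  have hsp' : Measurable fun y : ℕ × Mark A => ‖B.sp y.2‖ₑ ^ p :=
    (hsp.comp measurable_snd).enorm.pow_const p
  have hsm' : Measurable fun y : ℕ × Mark A => ‖B.sm y.2‖ₑ ^ p :=
    (hsm.comp measurable_snd).enorm.pow_const p
  have hβ' : Measurable fun y : ℕ × Mark A => ‖B.β y.2‖ₑ ^ p :=
    (hβ.comp measurable_snd).enorm.pow_const p
  have hg0' : Measurable fun y : ℕ × Mark A => ‖M.g 0 y.2‖ₑ ^ p :=
    (hg0.comp measurable_snd).enorm.pow_const p
  set u : ℕ → List ℕ → (List ℕ → ℕ × Mark A) → ℕ → ℝ≥0∞ := fun r i t j =>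
    1 + ‖M.g 0 (t (j :: i)).2‖ₑ ^ p + ‖B.sp (t (j :: i)).2‖ₑ ^ p * majorant M B p c t r (j :: i)
    with hu
  have mu : ∀ r i j, Measurable fun t => u r i t j := fun r i j =>
    (measurable_const.add (m2 _)).add ((m1 _).mul (hmaj r _))
  have hN : Measurable fun y : ℕ × Mark A => ((y.1 : ℕ) : ℝ≥0∞) :=
    measurable_from_nat.comp measurable_fst
  -- The weight `f` is `σ₊ ^ p` below the root and `1` at the root.
  have hstep : ∀ (f : ℕ × Mark A → ℝ≥0∞) (_ : Measurable f) (r : ℕ) (i : List ℕ) (C : ℝ≥0∞),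
      (∀ j, ∫⁻ t, u r i t j ∂(gwLaw π₀ π₁) ≤ C) →
      ∫⁻ t, f (t i) * majorant M B p c t (r + 1) i ∂(gwLaw π₀ π₁) ≤
        c * (∫⁻ y, f y ∂(((if i = [] then π₀ else π₁ : ProbabilityMeasure (ℕ × Mark A))) :
          Measure (ℕ × Mark A)) + ∫⁻ y, f y * ‖B.β y.2‖ₑ ^ p
          ∂(((if i = [] then π₀ else π₁ : ProbabilityMeasure (ℕ × Mark A))) :
          Measure (ℕ × Mark A)) + (∫⁻ y, f y * ‖B.sm y.2‖ₑ ^ p * (y.1 : ℝ≥0∞) ^ p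
          ∂(((if i = [] then π₀ else π₁ : ProbabilityMeasure (ℕ × Mark A))) :
          Measure (ℕ × Mark A))) * C) := by
    intro f hf r i C hC
    have e1 : ∀ t, f (t i) * majorant M B p c t (r + 1) i = c * (f (t i) +
        f (t i) * ‖B.β (t i).2‖ₑ ^ p + (f (t i) * ‖B.sm (t i).2‖ₑ ^ p) *
          (((t i).1 : ℝ≥0∞) ^ (p - 1) * ∑ j ∈ Finset.range (t i).1, u r i t j)) := fun t => by
      simp only [majorant, hu]; ring
    simp_rw [e1]
    have hi : Measurable fun t : List ℕ → ℕ × Mark A => t i := by fun_prop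
    have ma : Measurable fun t : List ℕ → ℕ × Mark A => f (t i) := hf.comp hi
    have mb : Measurable fun t : List ℕ → ℕ × Mark A => f (t i) * ‖B.β (t i).2‖ₑ ^ p :=
      (hf.mul hβ').comp hi
    have mab : Measurable fun t : List ℕ → ℕ × Mark A => f (t i) + f (t i) * ‖B.β (t i).2‖ₑ ^ p :=
      ma.add mb
    rw [lintegral_const_mul' _ _ hc, lintegral_add_left mab, lintegral_add_left ma,
      lintegral_gwLaw_eval π₀ π₁ i hf,
      lintegral_gwLaw_eval π₀ π₁ i (f := fun y => f y * ‖B.β y.2‖ₑ ^ p) (hf.mul hβ')]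
    gcongr
    rw [lintegral_gwLaw_eq π₀ π₁ i (F := fun y t => (f y * ‖B.sm y.2‖ₑ ^ p) *
      ((y.1 : ℝ≥0∞) ^ (p - 1) * ∑ j ∈ Finset.range y.1, u r i t j))]
    · exact lintegral_mul_sum_range_le hp (mu r i) hC (hf.mul hsm') measurable_fst
    · refine ((hf.mul hsm').comp measurable_fst).mul
        (((hN.comp measurable_fst).pow_const _).mul (measurable_sum_range (by fun_prop) fun j =>
          (mu r i j).comp measurable_snd))
    · intro y y' t
      have : ∀ j, u r i (Function.extend (fun _ : Unit => i) (fun _ => y') t) j = u r i t j :=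
        fun j => by
          simp only [hu]
          rw [majorant_extend c y' t r (j :: i) (by simp), extend_unit_of_ne (by simp)]
      simp only [this]
  have h1 : ∀ r i j, ∫⁻ t, u r i t j ∂(gwLaw π₀ π₁) =
      1 + ∫⁻ y, ‖M.g 0 y.2‖ₑ ^ p ∂(π₁ : Measure (ℕ × Mark A)) +
        ∫⁻ t, ‖B.sp (t (j :: i)).2‖ₑ ^ p * majorant M B p c t r (j :: i) ∂(gwLaw π₀ π₁) := by
    intro r i j
    have m12 : Measurable fun t : List ℕ → ℕ × Mark A => 1 + ‖M.g 0 (t (j :: i)).2‖ₑ ^ p :=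
      measurable_const.add (m2 _)
    simp only [hu]
    rw [lintegral_add_left m12, lintegral_add_left measurable_const,
      lintegral_gwLaw_eval π₀ π₁ (j :: i) hg0']
    simp
  -- The bound can be uniform over the tree because every child `j :: i` has a label of law `π₁`.
  have hind : ∀ r, ∃ C : ℝ≥0∞, C ≠ ∞ ∧ ∀ i j, ∫⁻ t, u r i t j ∂(gwLaw π₀ π₁) ≤ C := by
    intro r
    induction r with
    | zero =>
      refine ⟨1 + ∫⁻ y, ‖M.g 0 y.2‖ₑ ^ p ∂(π₁ : Measure (ℕ × Mark A)) +
        (∫⁻ y, ‖B.sp y.2‖ₑ ^ p ∂(π₁ : Measure (ℕ × Mark A))) * c, ?_, fun i j => ?_⟩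
      · exact ENNReal.add_ne_top.2 ⟨ENNReal.add_ne_top.2 ⟨ENNReal.one_ne_top, hmom.node_g⟩,
          ENNReal.mul_ne_top hmom.node_sp hc⟩
      · rw [h1]
        simp only [majorant]
        rw [lintegral_mul_const _ (m1 _), lintegral_gwLaw_eval π₀ π₁ (j :: i) hsp']
        simp
    | succ r ih =>
      obtain ⟨C, hC, hCb⟩ := ih
      refine ⟨1 + ∫⁻ y, ‖M.g 0 y.2‖ₑ ^ p ∂(π₁ : Measure (ℕ × Mark A)) +
        c * (∫⁻ y, ‖B.sp y.2‖ₑ ^ p ∂(π₁ : Measure (ℕ × Mark A)) +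
          ∫⁻ y, ‖B.sp y.2‖ₑ ^ p * ‖B.β y.2‖ₑ ^ p ∂(π₁ : Measure (ℕ × Mark A)) +
          (∫⁻ y, ‖B.sp y.2‖ₑ ^ p * ‖B.sm y.2‖ₑ ^ p * (y.1 : ℝ≥0∞) ^ p
            ∂(π₁ : Measure (ℕ × Mark A))) * C), ?_, fun i j => ?_⟩
      · exact ENNReal.add_ne_top.2 ⟨ENNReal.add_ne_top.2 ⟨ENNReal.one_ne_top, hmom.node_g⟩,
          ENNReal.mul_ne_top hc (ENNReal.add_ne_top.2 ⟨ENNReal.add_ne_top.2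
            ⟨hmom.node_sp, hmom.node_spβ⟩, ENNReal.mul_ne_top hmom.node_smsp hC⟩)⟩
      · rw [h1]
        gcongr
        simpa using hstep _ hsp' r (j :: i) C fun j' => hCb _ _
  cases r with
  | zero => simpa [majorant] using hc
  | succ r =>
    obtain ⟨C, hC, hCb⟩ := hind r
    have := hstep (fun _ => 1) measurable_const r [] C (hCb [])
    simp only [one_mul, if_true, lintegral_const, measure_univ, mul_one] at this
    refine ne_top_of_le_ne_top ?_ this
    exact ENNReal.mul_ne_top hc (ENNReal.add_ne_top.2 ⟨ENNReal.add_ne_top.2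
      ⟨ENNReal.one_ne_top, hmom.root_β⟩, ENNReal.mul_ne_top hmom.root_sm hC⟩)

end Moments

/-! ### Marked Galton–Watson trees with one noise per node and per edge -/

section Static

variable {A : Type a} {Z : Type v} {Ξ : Type w} [MeasurableSpace Z] [MeasurableSpace Ξ]

/-- The labels and noises `b`, with the label and the noise of the node `i` and the noises of the
edges to its offspring replaced. -/
def nodeResample (i : List ℕ) (q : ((ℕ × Mark A) × Z × (ℕ → Ξ)) × BranchSpace A Z Ξ) :
    BranchSpace A Z Ξ :=
  (Function.extend (fun _ : Unit => i) (fun _ => q.1.1) q.2.1,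
    Function.extend (fun _ : Unit => i) (fun _ => q.1.2.1) q.2.2.1,
    Function.extend (fun j : ℕ => j :: i) q.1.2.2 q.2.2.2)

theorem injective_cons (i : List ℕ) : Function.Injective fun j : ℕ => j :: i :=
  fun _ _ h => (List.cons.inj h).1

/-- At a node below generation `|i|` the iteration reads edge noises only of generations at least
`|i| + 2`; the replaced edge noises, those of the children of `i`, have generation `|i| + 1`. -/
theorem branchV_nodeResample (M : Recursion A Z Ξ) (i : List ℕ)
    (q : ((ℕ × Mark A) × Z × (ℕ → Ξ)) × BranchSpace A Z Ξ) (r : ℕ) :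
    ∀ l, i.length < l.length → branchV M (nodeResample i q) r l = branchV M q.2 r l := by
  have h1 : ∀ l : List ℕ, i.length < l.length → (nodeResample i q).1 l = q.2.1 l := fun l hl =>
    extend_unit_of_ne (fun h => by rw [h] at hl; exact lt_irrefl _ hl) _ _
  have h2 : ∀ l : List ℕ, i.length < l.length → (nodeResample i q).2.1 l = q.2.2.1 l := fun l hl =>
    extend_unit_of_ne (fun h => by rw [h] at hl; exact lt_irrefl _ hl) _ _
  have h3 : ∀ l : List ℕ, i.length + 1 < l.length → (nodeResample i q).2.2 l = q.2.2.2 l :=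
    fun l hl => Function.extend_apply' _ _ _ fun ⟨j, hj⟩ => by
      rw [← hj] at hl; simp at hl
  induction r with
  | zero => intro l hl; simp only [branchV, h1 l hl]
  | succ r ih =>
    intro l hl
    have hj : ∀ j, i.length < (j :: l).length := fun j => by simp only [List.length_cons]; omega
    have hj' : ∀ j, i.length + 1 < (j :: l).length := fun j => by
      simp only [List.length_cons]; omega
    simp only [branchV, h1 l hl, h2 l hl, ih _ (hj _), h3 _ (hj' _)]

variable [MeasurableSpace A]

/-- The law of a delayed marked Galton–Watson tree with i.i.d. noises. -/
def staticLaw (M : Recursion A Z Ξ) (π₀ π₁ : ProbabilityMeasure (ℕ × Mark A)) :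
    Measure (BranchSpace A Z Ξ) :=
  (gwLaw π₀ π₁).prod ((Measure.infinitePi fun _ : List ℕ => (M.zetaLaw : Measure Z)).prod
    (Measure.infinitePi fun _ : List ℕ => (M.xiLaw : Measure Ξ)))

/-- The law of the label of the node `i`. -/
abbrev labelLaw (π₀ π₁ : ProbabilityMeasure (ℕ × Mark A)) (i : List ℕ) : Measure (ℕ × Mark A) :=
  (((if i = [] then π₀ else π₁ : ProbabilityMeasure (ℕ × Mark A))) : Measure (ℕ × Mark A))

variable {M : Recursion A Z Ξ} {π₀ π₁ : ProbabilityMeasure (ℕ × Mark A)}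

instance : IsProbabilityMeasure (staticLaw M π₀ π₁) := by
  unfold staticLaw; infer_instance

theorem measurePreserving_nodeResample (M : Recursion A Z Ξ)
    (π₀ π₁ : ProbabilityMeasure (ℕ × Mark A)) (i : List ℕ) :
    MeasurePreserving (nodeResample (A := A) (Z := Z) (Ξ := Ξ) i)
      (((labelLaw π₀ π₁ i).prod (M.stepLaw ℕ)).prod (staticLaw M π₀ π₁)) (staticLaw M π₀ π₁) := by
  have h1 := measurePreserving_prodProdProdComm (labelLaw π₀ π₁ i) (M.stepLaw ℕ) (gwLaw π₀ π₁)
    ((Measure.infinitePi fun _ : List ℕ => (M.zetaLaw : Measure Z)).prod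
      (Measure.infinitePi fun _ : List ℕ => (M.xiLaw : Measure Ξ)))
  have h2 := measurePreserving_prodProdProdComm (M.zetaLaw : Measure Z)
    (Measure.infinitePi fun _ : ℕ => (M.xiLaw : Measure Ξ))
    (Measure.infinitePi fun _ : List ℕ => (M.zetaLaw : Measure Z))
    (Measure.infinitePi fun _ : List ℕ => (M.xiLaw : Measure Ξ))
  have h3 := measurePreserving_extend_unit (fun i : List ℕ => labelLaw π₀ π₁ i) i
  have h4 := measurePreserving_extend_unit (fun _ : List ℕ => (M.zetaLaw : Measure Z)) i
  have h5 := measurePreserving_extend (fun _ : List ℕ => (M.xiLaw : Measure Ξ)) (injective_cons i)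
  exact (h3.prod ((h4.prod h5).comp h2)).comp h1

variable {Θ : Type*} [MeasurableSpace Θ] {τ : Measure Θ} [IsProbabilityMeasure τ]

/-- The label and the noises at `i` may be integrated separately when the remaining data do not read
them. The factor `Θ` carries extra independent randomness: the initial values for the laws at the
root, nothing otherwise. -/
theorem lintegral_staticLaw_eq (i : List ℕ)
    {F : (ℕ × Mark A) → Z → (ℕ → Ξ) → BranchSpace A Z Ξ × Θ → ℝ≥0∞}
    (hF : Measurable fun q : ((ℕ × Mark A) × Z × (ℕ → Ξ)) × (BranchSpace A Z Ξ × Θ) =>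
      F q.1.1 q.1.2.1 q.1.2.2 q.2)
    (hres : ∀ y z ξ q b θ, F y z ξ (nodeResample i (q, b), θ) = F y z ξ (b, θ)) :
    ∫⁻ q, F (q.1.1 i) (q.1.2.1 i) (fun j => q.1.2.2 (j :: i)) q ∂((staticLaw M π₀ π₁).prod τ) =
      ∫⁻ y, ∫⁻ q, ∫⁻ s, F y s.1 s.2 q ∂(M.stepLaw ℕ) ∂((staticLaw M π₀ π₁).prod τ)
        ∂(labelLaw π₀ π₁ i) := by
  have h1 : MeasurePreserving (MeasurableEquiv.prodAssoc
      (α := (ℕ × Mark A) × Z × (ℕ → Ξ)) (β := BranchSpace A Z Ξ) (γ := Θ)) _ _ :=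
    measurePreserving_prodAssoc ((labelLaw π₀ π₁ i).prod (M.stepLaw ℕ)) (staticLaw M π₀ π₁) τ
  have hmp := ((measurePreserving_nodeResample M π₀ π₁ i).prod (MeasurePreserving.id τ)).comp
    (h1.symm _)
  have hG : Measurable fun q : BranchSpace A Z Ξ × Θ =>
      F (q.1.1 i) (q.1.2.1 i) (fun j => q.1.2.2 (j :: i)) q :=
    hF.comp (f := fun q : BranchSpace A Z Ξ × Θ =>
      ((q.1.1 i, q.1.2.1 i, fun j => q.1.2.2 (j :: i)), q)) (by fun_prop)
  have e1 : ∀ q : ((ℕ × Mark A) × Z × (ℕ → Ξ)) × (BranchSpace A Z Ξ × Θ),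
      (fun q : BranchSpace A Z Ξ × Θ => F (q.1.1 i) (q.1.2.1 i) (fun j => q.1.2.2 (j :: i)) q)
        ((Prod.map (nodeResample i) id ∘ MeasurableEquiv.prodAssoc.symm) q) =
      F q.1.1 q.1.2.1 q.1.2.2 q.2 := by
    rintro ⟨⟨y, z, ξ⟩, b, θ⟩
    change F (Function.extend (fun _ : Unit => i) (fun _ => y) b.1 i)
      (Function.extend (fun _ : Unit => i) (fun _ => z) b.2.1 i)
      (fun j => Function.extend (fun j : ℕ => j :: i) ξ b.2.2 (j :: i))
      (nodeResample i ((y, z, ξ), b), θ) = F y z ξ (b, θ)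
    rw [extend_unit_self, extend_unit_self, hres]
    congr 1
    ext j
    exact (injective_cons i).extend_apply ξ b.2.2 j
  rw [← hmp.lintegral_comp hG]
  simp only [e1]
  have hF2 : Measurable fun q : (ℕ × Mark A) × (Z × (ℕ → Ξ)) =>
      ∫⁻ b, F q.1 q.2.1 q.2.2 b ∂((staticLaw M π₀ π₁).prod τ) := hF.lintegral_prod_right'
  rw [lintegral_prod _ hF.aemeasurable, lintegral_prod _ hF2.aemeasurable]
  refine lintegral_congr fun y => ?_
  dsimp only
  rw [lintegral_lintegral_swap]
  exact (hF.comp (f := fun q : (Z × (ℕ → Ξ)) × (BranchSpace A Z Ξ × Θ) => ((y, q.1), q.2))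
    (by fun_prop)).aemeasurable

/-- One step of the recursion contracts `p`-th moments of differences. -/
theorem lintegral_static_sub_le (hM : M.IsMeasurable) {p : ℝ} (hp : 1 ≤ p) (i : List ℕ)
    {ℓ : ℕ × Mark A → ℝ≥0∞} (hℓm : Measurable ℓ)
    (hℓ : ∀ᵐ y ∂(labelLaw π₀ π₁ i), ∀ v v' : ℕ → ℝ,
      ∫⁻ q, ‖M.Φ y.2 q.1 (offFamily y.1 fun j => (v j, q.2 j))
        - M.Φ y.2 q.1 (offFamily y.1 fun j => (v' j, q.2 j))‖ₑ ^ p ∂(M.stepLaw ℕ)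
      ≤ (ℓ y * ∑ j ∈ Finset.range y.1, ‖v j - v' j‖ₑ) ^ p)
    {v v' : BranchSpace A Z Ξ × Θ → ℕ → ℝ} (hv : ∀ j, Measurable fun q => v q j)
    (hv' : ∀ j, Measurable fun q => v' q j)
    (hres : ∀ q b θ, v (nodeResample i (q, b), θ) = v (b, θ))
    (hres' : ∀ q b θ, v' (nodeResample i (q, b), θ) = v' (b, θ)) {C : ℝ≥0∞}
    (hC : ∀ j, ∫⁻ q, ‖v q j - v' q j‖ₑ ^ p ∂((staticLaw M π₀ π₁).prod τ) ≤ C) :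
    ∫⁻ q, ‖M.Φ (q.1.1 i).2 (q.1.2.1 i) (offFamily (q.1.1 i).1 fun j => (v q j, q.1.2.2 (j :: i)))
      - M.Φ (q.1.1 i).2 (q.1.2.1 i) (offFamily (q.1.1 i).1 fun j => (v' q j, q.1.2.2 (j :: i)))‖ₑ ^ p
        ∂((staticLaw M π₀ π₁).prod τ) ≤
      (∫⁻ y, ℓ y ^ p * (y.1 : ℝ≥0∞) ^ p ∂(labelLaw π₀ π₁ i)) * C := by
  rw [lintegral_staticLaw_eq i (F := fun y z ξ q =>
    ‖M.Φ y.2 z (offFamily y.1 fun j => (v q j, ξ j))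
      - M.Φ y.2 z (offFamily y.1 fun j => (v' q j, ξ j))‖ₑ ^ p)]
  · calc _ ≤ ∫⁻ y, ∫⁻ q, ℓ y ^ p * ((y.1 : ℝ≥0∞) ^ (p - 1) *
          ∑ j ∈ Finset.range y.1, ‖v q j - v' q j‖ₑ ^ p) ∂((staticLaw M π₀ π₁).prod τ)
            ∂(labelLaw π₀ π₁ i) := by
          refine lintegral_mono_ae ?_
          filter_upwards [hℓ] with y hy
          refine lintegral_mono fun q => (hy _ _).trans ((mul_sum_rpow_le hp _ _ _).trans_eq ?_)
          rw [mul_assoc]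
      _ ≤ _ := lintegral_mul_sum_range_le hp
          (fun j => ((hv j).sub (hv' j)).enorm.pow_const p) hC (hℓm.pow_const p) measurable_fst
  · refine ((Measurable.sub ?_ ?_).enorm).pow_const p
    · exact measurable_Φ_offFamily hM (by fun_prop) (by fun_prop) (by fun_prop) fun j =>
        ((hv j).comp (by fun_prop)).prodMk (by fun_prop)
    · exact measurable_Φ_offFamily hM (by fun_prop) (by fun_prop) (by fun_prop) fun j =>
        ((hv' j).comp (by fun_prop)).prodMk (by fun_prop)
  · intro y z ξ q b θ
    simp only [hres, hres']

/-- The recursion with `Ψ` in place of `Φ`. -/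
abbrev Recursion.toΨ (M : Recursion A Z Ξ) : Recursion A Z Ξ where
  Φ := M.Ψ
  g := M.g
  zetaLaw := M.zetaLaw
  xiLaw := M.xiLaw

theorem Recursion.IsMeasurable.toΨ (hM : M.IsMeasurable) (hg : Measurable (Function.uncurry M.g)) :
    M.toΨ.IsMeasurable := fun m => measurable_g_comp hg (hM m) measurable_fst

theorem BoundsAt.lintegral_Ψ_sub_le {B : Bounds A} {p : ℝ} (hp : 1 ≤ p)
    (hg : ∀ (x : Mark A) (r r' : ℝ), |M.g r x - M.g r' x| ≤ B.sp x * |r - r'|)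
    {m : ℕ} {x : Mark A} (h : BoundsAt M B p m x) (v v' : ℕ → ℝ) :
    ∫⁻ q, ‖M.Ψ x q.1 (offFamily m fun j => (v j, q.2 j))
        - M.Ψ x q.1 (offFamily m fun j => (v' j, q.2 j))‖ₑ ^ p ∂(M.stepLaw ℕ)
      ≤ (‖B.sp x‖ₑ * ‖B.sm x‖ₑ * ∑ j ∈ Finset.range m, ‖v j - v' j‖ₑ) ^ p := by
  have hp0 : 0 ≤ p := by linarith
  rw [mul_assoc, ENNReal.mul_rpow_of_nonneg _ _ hp0]
  refine le_trans ?_ (mul_le_mul_right (h.lintegral_sub_le hp v v') _)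
  rw [← lintegral_const_mul' _ _ (ENNReal.rpow_ne_top_of_nonneg hp0 enorm_ne_top)]
  refine lintegral_mono fun q => ?_
  dsimp only
  rw [← ENNReal.mul_rpow_of_nonneg _ _ hp0]
  exact ENNReal.rpow_le_rpow (enorm_g_sub_le hg _ _ _) hp0

/-- With vanishing inputs the growth bound reduces to `β`; this controls the first increment of the
iterations. -/
theorem BoundsAt.lintegral_Ψ_zero_le {B : Bounds A} {p : ℝ} (hp : 1 ≤ p)
    (hg : ∀ (x : Mark A) (r r' : ℝ), |M.g r x - M.g r' x| ≤ B.sp x * |r - r'|)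
    {m : ℕ} {x : Mark A} (h : BoundsAt M B p m x) :
    ∫⁻ q, ‖M.Ψ x q.1 (offFamily m fun j => (0, q.2 j))‖ₑ ^ p ∂(M.stepLaw ℕ)
      ≤ 4 ^ p * (‖M.g 0 x‖ₑ ^ p + ‖B.sp x‖ₑ ^ p * ‖B.β x‖ₑ ^ p) := by
  refine (lintegral_enorm_g_le hp hg x).trans ?_
  gcongr
  refine (h.lintegral_le hp fun _ => 0).trans_eq ?_
  simp

end Static

/-! ### Limits of the iterations -/

section GeometricLimit

variable {α : Type*} [MeasurableSpace α] {μ : Measure α} {p : ℝ}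

theorem eLpNorm_rpow_eq_lintegral (hp : 1 ≤ p) (f : α → ℝ) :
    eLpNorm f (ENNReal.ofReal p) μ ^ p = ∫⁻ x, ‖f x‖ₑ ^ p ∂μ := by
  have hp0 : 0 < p := by linarith
  rw [eLpNorm_eq_lintegral_rpow_enorm_toReal (by simpa using hp0) ENNReal.ofReal_ne_top,
    ENNReal.toReal_ofReal hp0.le, ← ENNReal.rpow_mul, one_div, inv_mul_cancel₀ hp0.ne',
    ENNReal.rpow_one]

theorem eLpNorm_le_iff_lintegral_le (hp : 1 ≤ p) (f : α → ℝ) (C : ℝ≥0∞) :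
    eLpNorm f (ENNReal.ofReal p) μ ≤ C ↔ ∫⁻ x, ‖f x‖ₑ ^ p ∂μ ≤ C ^ p := by
  rw [← eLpNorm_rpow_eq_lintegral hp, ENNReal.rpow_le_rpow_iff (by linarith)]

/-- The factor relating the increments of a sequence with geometrically decreasing increments to
the distance to its limit. -/
def geomConst (p : ℝ) (c : ℝ≥0∞) : ℝ≥0∞ := ((1 - c ^ (1 / p))⁻¹) ^ p

theorem geomConst_ne_top (hp : 1 ≤ p) {c : ℝ≥0∞} (hc : c < 1) : geomConst p c ≠ ∞ := by
  refine ENNReal.rpow_ne_top_of_nonneg (by linarith) (ENNReal.inv_ne_top.2 ?_)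
  exact (tsub_pos_of_lt (ENNReal.rpow_lt_one hc (by positivity))).ne'

/-- Minkowski's inequality and a geometric series of ratio `c ^ (1 / p)`. Summing norms rather than
`p`-th moments allows every `c < 1`, without a loss of `4 ^ p` at each step. -/
theorem lintegral_sub_le_of_geometric (hp : 1 ≤ p) {f : ℕ → α → ℝ} (hf : ∀ r, Measurable (f r))
    {c D : ℝ≥0∞} (h : ∀ r, ∫⁻ x, ‖f (r + 1) x - f r x‖ₑ ^ p ∂μ ≤ c ^ r * D) (r n : ℕ) :
    ∫⁻ x, ‖f (r + n) x - f r x‖ₑ ^ p ∂μ ≤ c ^ r * (D * geomConst p c) := by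
  have hp0 : 0 < p := by linarith
  set a := c ^ (1 / p) with ha
  set d := D ^ (1 / p) with hd
  have hap : a ^ p = c := by rw [ha, ← ENNReal.rpow_mul, one_div, inv_mul_cancel₀ hp0.ne', ENNReal.rpow_one]
  have hdp : d ^ p = D := by rw [hd, ← ENNReal.rpow_mul, one_div, inv_mul_cancel₀ hp0.ne', ENNReal.rpow_one]
  have hpow : ∀ r : ℕ, (a ^ r) ^ p = c ^ r := fun r => by
    rw [← ENNReal.rpow_natCast, ← ENNReal.rpow_mul, mul_comm, ENNReal.rpow_mul, hap,
      ENNReal.rpow_natCast]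
  have h1 : ∀ r, eLpNorm (f (r + 1) - f r) (ENNReal.ofReal p) μ ≤ a ^ r * d := fun r => by
    rw [eLpNorm_le_iff_lintegral_le hp, ENNReal.mul_rpow_of_nonneg _ _ hp0.le, hpow, hdp]
    exact h r
  have h2 : ∀ n, eLpNorm (f (r + n) - f r) (ENNReal.ofReal p) μ ≤
      a ^ r * d * ∑ k ∈ Finset.range n, a ^ k := by
    intro n
    induction n with
    | zero => simp
    | succ n ih =>
      have e : f (r + (n + 1)) - f r = (f (r + n + 1) - f (r + n)) + (f (r + n) - f r) := by
        rw [← add_assoc]; simp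
      rw [e, Finset.sum_range_succ, mul_add, add_comm (a ^ r * d * _)]
      refine (eLpNorm_add_le ((hf _).sub (hf _)).aestronglyMeasurable
        ((hf _).sub (hf _)).aestronglyMeasurable (by simpa using hp)).trans (add_le_add ?_ ih)
      refine (h1 _).trans_eq ?_
      rw [pow_add]; ring
  have h3 := (eLpNorm_le_iff_lintegral_le hp _ _).1 ((h2 n).trans
    (mul_le_mul_right (ENNReal.sum_le_tsum _) _))
  rw [ENNReal.tsum_geometric, mul_assoc, ENNReal.mul_rpow_of_nonneg _ _ hp0.le,
    ENNReal.mul_rpow_of_nonneg _ _ hp0.le, hpow, hdp] at h3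
  exact h3

/-- A sequence whose increments decrease geometrically in `L^p` converges almost surely. -/
theorem ae_tendsto_of_geometric (hp : 1 ≤ p) {f : ℕ → α → ℝ} (hf : ∀ r, Measurable (f r))
    {c D : ℝ≥0∞} (hc : c < 1) (hD : D ≠ ∞)
    (h : ∀ r, ∫⁻ x, ‖f (r + 1) x - f r x‖ₑ ^ p ∂μ ≤ c ^ r * D) :
    ∀ᵐ x ∂μ, Tendsto (fun r => f r x) atTop (𝓝 (liminf (fun r => f r x) atTop)) := by
  have hp0 : 0 < p := by linarith
  set a := c ^ (1 / p) with ha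
  have ha1 : a < 1 := ENNReal.rpow_lt_one hc (by positivity)
  set d := (D * geomConst p c) ^ (1 / p) with hd
  have hd_top : d ≠ ∞ := ENNReal.rpow_ne_top_of_nonneg (by positivity)
    (ENNReal.mul_ne_top hD (geomConst_ne_top hp hc))
  have hap : a ^ p = c := by rw [ha, ← ENNReal.rpow_mul, one_div, inv_mul_cancel₀ hp0.ne', ENNReal.rpow_one]
  have hdp : d ^ p = D * geomConst p c := by
    rw [hd, ← ENNReal.rpow_mul, one_div, inv_mul_cancel₀ hp0.ne', ENNReal.rpow_one]
  have hpow : ∀ r : ℕ, (a ^ r) ^ p = c ^ r := fun r => by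
    rw [← ENNReal.rpow_natCast, ← ENNReal.rpow_mul, mul_comm, ENNReal.rpow_mul, hap,
      ENNReal.rpow_natCast]
  have h1 : ∀ N n, N ≤ n → eLpNorm (f n - f N) (ENNReal.ofReal p) μ ≤ a ^ N * d := by
    intro N n hn
    obtain ⟨m, rfl⟩ := Nat.exists_eq_add_of_le hn
    rw [eLpNorm_le_iff_lintegral_le hp, ENNReal.mul_rpow_of_nonneg _ _ hp0.le, hpow, hdp]
    exact lintegral_sub_le_of_geometric hp hf h N m
  have h2 : ∀ N n m, N ≤ n → N ≤ m → eLpNorm (f n - f m) (ENNReal.ofReal p) μ ≤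
      a ^ N * d + a ^ N * d := by
    intro N n m hn hm
    have e : f n - f m = (f n - f N) - (f m - f N) := by simp
    rw [e]
    exact (eLpNorm_sub_le ((hf _).sub (hf _)).aestronglyMeasurable
        ((hf _).sub (hf _)).aestronglyMeasurable (by simpa using hp)).trans
        (add_le_add (h1 N n hn) (h1 N m hm))
  -- The Cauchy criterion asks for strict inequalities; the summable term `2⁻¹ ^ N` makes the bound
  -- strict.
  have hB : ∑' N : ℕ, ((a ^ N * d + a ^ N * d) + (2⁻¹ : ℝ≥0∞) ^ N) ≠ ∞ := by
    rw [ENNReal.tsum_add, ENNReal.tsum_add, ENNReal.tsum_mul_right, ENNReal.tsum_geometric,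
      ENNReal.tsum_geometric]
    have h4 : (1 - a)⁻¹ * d ≠ ∞ := ENNReal.mul_ne_top
      (ENNReal.inv_ne_top.2 (tsub_pos_of_lt ha1).ne') hd_top
    refine ENNReal.add_ne_top.2 ⟨ENNReal.add_ne_top.2 ⟨h4, h4⟩, ?_⟩
    simp
  have h5 : ∀ N : ℕ, a ^ N * d + a ^ N * d ≠ ∞ := fun N =>
    have h4 : a ^ N * d ≠ ∞ := ENNReal.mul_ne_top (ENNReal.pow_ne_top ha1.ne_top) hd_top
    ENNReal.add_ne_top.2 ⟨h4, h4⟩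
  filter_upwards [Lp.ae_tendsto_of_cauchy_eLpNorm (μ := μ) (p := ENNReal.ofReal p)
    (fun n => (hf n).aestronglyMeasurable) (by simpa using hp) hB fun N n m hn hm =>
      (h2 N n m hn hm).trans_lt (ENNReal.lt_add_right (h5 N) (by simp))] with x ⟨l, hl⟩
  rw [hl.liminf_eq]; exact hl

/-- Fatou's lemma applied to the bounds for `f (r + n) - f r`, as `n` tends to infinity. -/
theorem lintegral_sub_liminf_le_of_geometric (hp : 1 ≤ p) {f : ℕ → α → ℝ}
    (hf : ∀ r, Measurable (f r)) {c D : ℝ≥0∞} (hc : c < 1) (hD : D ≠ ∞)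
    (h : ∀ r, ∫⁻ x, ‖f (r + 1) x - f r x‖ₑ ^ p ∂μ ≤ c ^ r * D) (r : ℕ) :
    ∫⁻ x, ‖liminf (fun r => f r x) atTop - f r x‖ₑ ^ p ∂μ ≤ c ^ r * (D * geomConst p c) := by
  have hp0 : 0 < p := by linarith
  calc _ ≤ ∫⁻ x, liminf (fun n => ‖f (r + n) x - f r x‖ₑ ^ p) atTop ∂μ := by
        refine lintegral_mono_ae ?_
        filter_upwards [ae_tendsto_of_geometric hp hf hc hD h] with x hx
        refine le_of_eq (Tendsto.liminf_eq ?_).symm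
        refine (ENNReal.continuous_rpow_const.tendsto _).comp ((continuous_enorm.tendsto _).comp ?_)
        refine Tendsto.sub_const ?_ _
        simpa [add_comm r] using (tendsto_add_atTop_iff_nat r).2 hx
    _ ≤ liminf (fun n => ∫⁻ x, ‖f (r + n) x - f r x‖ₑ ^ p ∂μ) atTop :=
        lintegral_liminf_le fun n => (((hf _).sub (hf _)).enorm).pow_const p
    _ ≤ liminf (fun _ : ℕ => c ^ r * (D * geomConst p c)) atTop :=
        liminf_le_liminf (Eventually.of_forall fun n =>
          lintegral_sub_le_of_geometric hp hf h r n)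
    _ = _ := by simp

end GeometricLimit

/-! ### The pointwise limit of the iterations of `Ψ`, and the contraction -/

section Contraction

variable {A : Type a} {Z : Type v} {Ξ : Type w} [MeasurableSpace Z] [MeasurableSpace Ξ]

/-- The limit of the iterations `𝒱_i^{(r)}`. -/
def limV (M : Recursion A Z Ξ) (b : BranchSpace A Z Ξ) (i : List ℕ) : ℝ :=
  liminf (fun r => branchV M b r i) atTop

theorem limV_nodeResample (M : Recursion A Z Ξ) (i : List ℕ)
    (q : ((ℕ × Mark A) × Z × (ℕ → Ξ)) × BranchSpace A Z Ξ) {l : List ℕ}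
    (hl : i.length < l.length) : limV M (nodeResample i q) l = limV M q.2 l := by
  simp only [limV, branchV_nodeResample M i q _ l hl]

variable [MeasurableSpace A]

theorem measurable_limV {M : Recursion A Z Ξ} (hM : M.IsMeasurable)
    (hg : Measurable (Function.uncurry M.g)) (i : List ℕ) :
    Measurable fun b : BranchSpace A Z Ξ => limV M b i :=
  Measurable.liminf fun r => measurable_branchV hM hg r i

/-- The contraction factor `E[(N₁ σ₋(𝐗₁) σ₊(𝐗₁))^p]` of the iterations of `Ψ`. -/
def contr (B : Bounds A) (p : ℝ) (π₁ : ProbabilityMeasure (ℕ × Mark A)) : ℝ≥0∞ :=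
  ∫⁻ y, (‖B.sp y.2‖ₑ * ‖B.sm y.2‖ₑ) ^ p * (y.1 : ℝ≥0∞) ^ p ∂(π₁ : Measure (ℕ × Mark A))

variable {M : Recursion A Z Ξ} {B : Bounds A} {p : ℝ} {π₀ π₁ : ProbabilityMeasure (ℕ × Mark A)}
variable {Θ : Type*} [MeasurableSpace Θ] {τ : Measure Θ} [IsProbabilityMeasure τ]

theorem labelLaw_cons (π₀ π₁ : ProbabilityMeasure (ℕ × Mark A)) (j : ℕ) (i : List ℕ) :
    labelLaw π₀ π₁ (j :: i) = π₁ := by simp [labelLaw]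

/-- The recursion `toΨ` has Lipschitz factor `σ₊ σ₋`. Integrating its `p`-th power times `N ^ p`
over a label of law `π₁` gives `contr`. -/
theorem lintegral_static_Ψ_sub_le (hM : M.IsMeasurable) (hp : 1 ≤ p)
    (hgm : Measurable (Function.uncurry M.g)) (hsm : Measurable B.sm) (hsp : Measurable B.sp)
    (hg : ∀ (x : Mark A) (r r' : ℝ), |M.g r x - M.g r' x| ≤ B.sp x * |r - r'|)
    (hb : ∀ᵐ y ∂(π₁ : Measure (ℕ × Mark A)), BoundsAt M B p y.1 y.2) {i : List ℕ}
    (hi : labelLaw π₀ π₁ i = π₁)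
    {v v' : BranchSpace A Z Ξ × Θ → ℕ → ℝ} (hv : ∀ j, Measurable fun q => v q j)
    (hv' : ∀ j, Measurable fun q => v' q j)
    (hres : ∀ q b θ, v (nodeResample i (q, b), θ) = v (b, θ))
    (hres' : ∀ q b θ, v' (nodeResample i (q, b), θ) = v' (b, θ)) {C : ℝ≥0∞}
    (hC : ∀ j, ∫⁻ q, ‖v q j - v' q j‖ₑ ^ p ∂((staticLaw M π₀ π₁).prod τ) ≤ C) :
    ∫⁻ q, ‖M.Ψ (q.1.1 i).2 (q.1.2.1 i) (offFamily (q.1.1 i).1 fun j => (v q j, q.1.2.2 (j :: i)))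
      - M.Ψ (q.1.1 i).2 (q.1.2.1 i) (offFamily (q.1.1 i).1 fun j => (v' q j, q.1.2.2 (j :: i)))‖ₑ ^ p
        ∂((staticLaw M π₀ π₁).prod τ) ≤ contr B p π₁ * C := by
  have := lintegral_static_sub_le (M := M.toΨ) (π₀ := π₀) (π₁ := π₁) (τ := τ) (hM.toΨ hgm) hp i
    (ℓ := fun y => ‖B.sp y.2‖ₑ * ‖B.sm y.2‖ₑ) (by fun_prop)
    (by rw [hi]; filter_upwards [hb] with y hy using fun v v' => hy.lintegral_Ψ_sub_le hp hg v v')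
    hv hv' hres hres' hC
  rw [hi] at this
  exact this

theorem measurable_Ψ_offFamily {α : Type*} [MeasurableSpace α] (hM : M.IsMeasurable)
    (hgm : Measurable (Function.uncurry M.g)) {x : α → Mark A} {z : α → Z} {N : α → ℕ}
    {f : α → ℕ → ℝ × Ξ} (hx : Measurable x) (hz : Measurable z) (hN : Measurable N)
    (hf : ∀ j, Measurable fun q => f q j) :
    Measurable fun q => M.Ψ (x q) (z q) (offFamily (N q) (f q)) :=
  measurable_g_comp hgm (measurable_Φ_offFamily hM hx hz hN hf) hx

end Contraction

/-! ### Convergence of the iterations on the tree and the endogenous recursion -/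

section Endogenous

variable {A : Type a} {Z : Type v} {Ξ : Type w} [MeasurableSpace Z] [MeasurableSpace Ξ]
  [MeasurableSpace A]
  {M : Recursion A Z Ξ} {B : Bounds A} {p : ℝ} {π₀ π₁ : ProbabilityMeasure (ℕ × Mark A)}

/-- The regularity and the moments needed for the convergence of the iterations of `Ψ`. -/
structure IterationBounds (M : Recursion A Z Ξ) (B : Bounds A) (p : ℝ)
    (π₁ : ProbabilityMeasure (ℕ × Mark A)) : Prop where
  one_le : 1 ≤ p
  meas : M.IsMeasurable
  meas_g : Measurable (Function.uncurry M.g)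
  meas_sm : Measurable B.sm
  meas_sp : Measurable B.sp
  meas_β : Measurable B.β
  lip : ∀ (x : Mark A) (r r' : ℝ), |M.g r x - M.g r' x| ≤ B.sp x * |r - r'|
  bounds : ∀ᵐ y ∂(π₁ : Measure (ℕ × Mark A)), BoundsAt M B p y.1 y.2
  contr_lt : contr B p π₁ < 1
  node_spβ : ∫⁻ y, ‖B.sp y.2‖ₑ ^ p * ‖B.β y.2‖ₑ ^ p ∂(π₁ : Measure (ℕ × Mark A)) ≠ ∞
  node_g : ∫⁻ y, ‖M.g 0 y.2‖ₑ ^ p ∂(π₁ : Measure (ℕ × Mark A)) ≠ ∞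
  node_sp : ∫⁻ y, ‖B.sp y.2‖ₑ ^ p ∂(π₁ : Measure (ℕ × Mark A)) ≠ ∞

theorem lintegral_staticLaw_node {f : ℕ × Mark A → ℝ≥0∞} (hf : Measurable f) (i : List ℕ) :
    ∫⁻ b, f (b.1 i) ∂(staticLaw M π₀ π₁) = ∫⁻ y, f y ∂(labelLaw π₀ π₁ i) := by
  have h : MeasurePreserving (fun b : BranchSpace A Z Ξ => b.1) (staticLaw M π₀ π₁)
      (gwLaw π₀ π₁) := measurePreserving_fst
  rw [← lintegral_gwLaw_eval π₀ π₁ i hf,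
    ← h.lintegral_comp (f := fun t => f (t i)) (by fun_prop)]

theorem lintegral_staticLaw_prod_unit (f : BranchSpace A Z Ξ → ℝ≥0∞) (hf : Measurable f) :
    ∫⁻ q, f q.1 ∂((staticLaw M π₀ π₁).prod (Measure.dirac ())) =
      ∫⁻ b, f b ∂(staticLaw M π₀ π₁) :=
  (measurePreserving_fst (μ := staticLaw M π₀ π₁) (ν := Measure.dirac ())).lintegral_comp hf

namespace IterationBounds

theorem lintegral_Ψ_sub_le (h : IterationBounds M B p π₁) {i : List ℕ} (hi : labelLaw π₀ π₁ i = π₁)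
    {v v' : BranchSpace A Z Ξ → ℕ → ℝ} (hv : ∀ j, Measurable fun q => v q j)
    (hv' : ∀ j, Measurable fun q => v' q j)
    (hres : ∀ q b, v (nodeResample i (q, b)) = v b)
    (hres' : ∀ q b, v' (nodeResample i (q, b)) = v' b) {C : ℝ≥0∞}
    (hC : ∀ j, ∫⁻ b, ‖v b j - v' b j‖ₑ ^ p ∂(staticLaw M π₀ π₁) ≤ C) :
    ∫⁻ b, ‖M.Ψ (b.1 i).2 (b.2.1 i) (offFamily (b.1 i).1 fun j => (v b j, b.2.2 (j :: i)))
      - M.Ψ (b.1 i).2 (b.2.1 i) (offFamily (b.1 i).1 fun j => (v' b j, b.2.2 (j :: i)))‖ₑ ^ p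
        ∂(staticLaw M π₀ π₁) ≤ contr B p π₁ * C := by
  have := lintegral_static_Ψ_sub_le (τ := Measure.dirac ()) h.meas h.one_le h.meas_g h.meas_sm
    h.meas_sp h.lip h.bounds hi (v := fun q => v q.1) (v' := fun q => v' q.1)
    (fun j => (hv j).comp measurable_fst) (fun j => (hv' j).comp measurable_fst)
    (fun q b _ => hres q b) (fun q b _ => hres' q b) (C := C) fun j => by
      rw [lintegral_staticLaw_prod_unit (fun b => ‖v b j - v' b j‖ₑ ^ p)
        ((((hv j).sub (hv' j)).enorm).pow_const p)]
      exact hC j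
  rwa [lintegral_staticLaw_prod_unit (fun b => ‖M.Ψ (b.1 i).2 (b.2.1 i) (offFamily (b.1 i).1
      fun j => (v b j, b.2.2 (j :: i))) - M.Ψ (b.1 i).2 (b.2.1 i) (offFamily (b.1 i).1
      fun j => (v' b j, b.2.2 (j :: i)))‖ₑ ^ p)] at this
  refine ((Measurable.sub ?_ ?_).enorm).pow_const p
  · exact measurable_Ψ_offFamily h.meas h.meas_g (by fun_prop) (by fun_prop) (by fun_prop)
      fun j => (hv j).prodMk (by fun_prop)
  · exact measurable_Ψ_offFamily h.meas h.meas_g (by fun_prop) (by fun_prop) (by fun_prop)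
      fun j => (hv' j).prodMk (by fun_prop)

/-- Each step contracts by `contr`, so only the first increment has to be bounded. The condition on
the label law covers the non-root nodes of a delayed tree and all nodes of an undelayed one. -/
theorem exists_lintegral_branchV_succ_sub_le (h : IterationBounds M B p π₁) (π₀ : ProbabilityMeasure (ℕ × Mark A)) :
    ∃ D : ℝ≥0∞, D ≠ ∞ ∧ ∀ i, labelLaw π₀ π₁ i = π₁ → ∀ r,
      ∫⁻ b, ‖branchV M b (r + 1) i - branchV M b r i‖ₑ ^ p ∂(staticLaw M π₀ π₁) ≤
        contr B p π₁ ^ r * D := by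
  have hp := h.one_le
  have hp0 : 0 ≤ p := by linarith
  set G := ∫⁻ y, ‖M.g 0 y.2‖ₑ ^ p ∂(π₁ : Measure (ℕ × Mark A)) with hG
  have hg0 : Measurable fun y : ℕ × Mark A => ‖M.g 0 y.2‖ₑ ^ p :=
    ((measurable_g_comp h.meas_g measurable_const measurable_snd).enorm).pow_const p
  have hgi : ∀ i, labelLaw π₀ π₁ i = π₁ →
      ∫⁻ b, ‖M.g 0 (b.1 i).2‖ₑ ^ p ∂(staticLaw M π₀ π₁) = G := fun i hi => by
    rw [lintegral_staticLaw_node (f := fun y => ‖M.g 0 y.2‖ₑ ^ p) hg0, hi]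
  set S := ∫⁻ y, ‖B.sp y.2‖ₑ ^ p * ‖B.β y.2‖ₑ ^ p ∂(π₁ : Measure (ℕ × Mark A)) with hS
  refine ⟨4 ^ p * (contr B p π₁ * G + 4 ^ p * (G + S) + G), ?_, ?_⟩
  · refine ENNReal.mul_ne_top (four_rpow_ne_top p hp) (ENNReal.add_ne_top.2
      ⟨ENNReal.add_ne_top.2 ⟨ENNReal.mul_ne_top h.contr_lt.ne_top h.node_g, ?_⟩, h.node_g⟩)
    exact ENNReal.mul_ne_top (four_rpow_ne_top p hp)
      (ENNReal.add_ne_top.2 ⟨h.node_g, h.node_spβ⟩)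
  · intro i hi r
    have hmV := fun r i => measurable_branchV h.meas h.meas_g r i
    have hres : ∀ r i j q b, branchV M (nodeResample i (q, b)) r (j :: i) = branchV M b r (j :: i) :=
      fun r i j q b => branchV_nodeResample M i (q, b) r (j :: i) (by simp)
    induction r generalizing i with
    | zero =>
      rw [pow_zero, one_mul]
      set a : BranchSpace A Z Ξ → ℝ := fun b => branchV M b 1 i
      -- `Ψ` with zero inputs is the intermediate term: the first iterate differs from it by a
      -- contraction of `g(0, ·)`, and its own moment comes from the growth bound.
      set z : BranchSpace A Z Ξ → ℝ := fun b => M.Ψ (b.1 i).2 (b.2.1 i)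
        (offFamily (b.1 i).1 fun j => (0, b.2.2 (j :: i)))
      have hz : Measurable z := measurable_Ψ_offFamily h.meas h.meas_g (by fun_prop)
        (by fun_prop) (by fun_prop) fun j => by fun_prop
      have h1 : ∫⁻ b, ‖a b - z b‖ₑ ^ p ∂(staticLaw M π₀ π₁) ≤ contr B p π₁ * G := by
        refine h.lintegral_Ψ_sub_le hi (v := fun b j => branchV M b 0 (j :: i)) (v' := fun _ _ => 0)
          (fun j => hmV _ _) (fun j => measurable_const)
          (fun q b => funext fun j => hres 0 i j q b) (fun _ _ => rfl) fun j => ?_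
        simp only [sub_zero, branchV]
        exact (hgi _ (labelLaw_cons _ _ _ _)).le
      have h2 : ∫⁻ b, ‖z b‖ₑ ^ p ∂(staticLaw M π₀ π₁) ≤ 4 ^ p * (G + S) := by
        have e := lintegral_staticLaw_eq (M := M) (π₀ := π₀) (π₁ := π₁) (τ := Measure.dirac ()) i
          (F := fun y z ξ _ => ‖M.Ψ y.2 z (offFamily y.1 fun j => (0, ξ j))‖ₑ ^ p)
          (((measurable_Ψ_offFamily h.meas h.meas_g (by fun_prop)
            (by fun_prop) (by fun_prop) fun j => by fun_prop).enorm).pow_const p)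
          (fun _ _ _ _ _ _ => rfl)
        rw [lintegral_staticLaw_prod_unit (fun b => ‖z b‖ₑ ^ p) (hz.enorm.pow_const p)] at e
        rw [e, hi]
        have hsm : Measurable fun y : ℕ × Mark A => ‖B.sp y.2‖ₑ ^ p * ‖B.β y.2‖ₑ ^ p :=
          ((h.meas_sp.comp measurable_snd).enorm.pow_const p).mul
            ((h.meas_β.comp measurable_snd).enorm.pow_const p)
        rw [hG, hS, ← lintegral_add_left hg0, ← lintegral_const_mul' _ _ (four_rpow_ne_top p hp)]
        refine lintegral_mono_ae ?_
        filter_upwards [h.bounds] with y hy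
        rw [lintegral_const, measure_univ, mul_one]
        exact hy.lintegral_Ψ_zero_le hp h.lip
      have e3 : ∀ b, ‖branchV M b (0 + 1) i - branchV M b 0 i‖ₑ ^ p ≤
          4 ^ p * (‖a b - z b‖ₑ ^ p + ‖z b‖ₑ ^ p + ‖M.g 0 (b.1 i).2‖ₑ ^ p) := fun b => by
        refine le_trans (ENNReal.rpow_le_rpow ?_ hp0) (add_add_rpow_le hp _ _ _)
        have : branchV M b (0 + 1) i - branchV M b 0 i =
            (a b - z b) + z b - M.g 0 (b.1 i).2 := by simp [a, branchV]
        rw [this]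
        exact (enorm_sub_le).trans (add_le_add_left (enorm_add_le _ _) _)
      refine (lintegral_mono e3).trans ?_
      rw [lintegral_const_mul' _ _ (four_rpow_ne_top p hp), lintegral_add_left, lintegral_add_left,
        hgi i hi]
      · gcongr
      · exact ((hmV _ _).sub hz).enorm.pow_const p
      · exact (((hmV _ _).sub hz).enorm.pow_const p).add (hz.enorm.pow_const p)
    | succ r ih =>
      refine (h.lintegral_Ψ_sub_le hi (v := fun b j => branchV M b (r + 1) (j :: i))
        (v' := fun b j => branchV M b r (j :: i)) (fun j => hmV _ _) (fun j => hmV _ _)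
        (fun q b => funext fun j => hres _ i j q b) (fun q b => funext fun j => hres _ i j q b)
        fun j => ih (j :: i) (labelLaw_cons _ _ _ _)).trans_eq ?_
      rw [pow_succ]; ring

theorem exists_lintegral_limV_sub_le (h : IterationBounds M B p π₁) (π₀ : ProbabilityMeasure (ℕ × Mark A)) :
    ∃ D : ℝ≥0∞, D ≠ ∞ ∧ ∀ i, labelLaw π₀ π₁ i = π₁ → ∀ r,
      ∫⁻ b, ‖limV M b i - branchV M b r i‖ₑ ^ p ∂(staticLaw M π₀ π₁) ≤
        contr B p π₁ ^ r * D := by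
  obtain ⟨D, hD, hb⟩ := h.exists_lintegral_branchV_succ_sub_le π₀
  exact ⟨D * geomConst p (contr B p π₁),
    ENNReal.mul_ne_top hD (geomConst_ne_top h.one_le h.contr_lt), fun i hi r =>
      lintegral_sub_liminf_le_of_geometric h.one_le
        (fun r => measurable_branchV h.meas h.meas_g r i) h.contr_lt hD (hb i hi) r⟩

/-- The limits of the iterations solve the recursion almost surely. -/
theorem ae_limV_eq (h : IterationBounds M B p π₁) (π₀ : ProbabilityMeasure (ℕ × Mark A)) {i : List ℕ}
    (hi : labelLaw π₀ π₁ i = π₁) :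
    ∀ᵐ b ∂(staticLaw M π₀ π₁), limV M b i = M.Ψ (b.1 i).2 (b.2.1 i)
      (offFamily (b.1 i).1 fun j => (limV M b (j :: i), b.2.2 (j :: i))) := by
  have hp := h.one_le
  have hp0 : 0 < p := by linarith
  obtain ⟨D, hD, hb⟩ := h.exists_lintegral_limV_sub_le π₀
  set s : BranchSpace A Z Ξ → ℝ := fun b => M.Ψ (b.1 i).2 (b.2.1 i)
      (offFamily (b.1 i).1 fun j => (limV M b (j :: i), b.2.2 (j :: i)))
  have hmV := fun r i => measurable_branchV h.meas h.meas_g r i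
  have hmL := fun i => measurable_limV (A := A) h.meas h.meas_g i
  have hs : Measurable s := measurable_Ψ_offFamily h.meas h.meas_g (by fun_prop)
    (by fun_prop) (by fun_prop) fun j => (hmL _).prodMk (by fun_prop)
  set c := contr B p π₁
  have h1 : ∀ r, ∫⁻ b, ‖s b - branchV M b (r + 1) i‖ₑ ^ p ∂(staticLaw M π₀ π₁) ≤ c * (c ^ r * D) :=
    fun r => h.lintegral_Ψ_sub_le hi (v := fun b j => limV M b (j :: i))
      (v' := fun b j => branchV M b r (j :: i)) (fun j => hmL _) (fun j => hmV _ _)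
      (fun q b => funext fun j => limV_nodeResample M i (q, b) (by simp))
      (fun q b => funext fun j => branchV_nodeResample M i (q, b) r (j :: i) (by simp))
      fun j => hb _ (labelLaw_cons _ _ _ _) r
  -- The limit and its image under one step are both close to the iterate `r + 1`, for every `r`.
  have h2 : ∀ r, ∫⁻ b, ‖limV M b i - s b‖ₑ ^ p ∂(staticLaw M π₀ π₁) ≤
      c ^ (r + 1) * (4 ^ p * (D + D)) := by
    intro r
    calc _ ≤ ∫⁻ b, 4 ^ p * (‖limV M b i - branchV M b (r + 1) i‖ₑ ^ p +
          ‖s b - branchV M b (r + 1) i‖ₑ ^ p) ∂(staticLaw M π₀ π₁) := by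
          refine lintegral_mono fun b =>
            le_trans (ENNReal.rpow_le_rpow ?_ hp0.le) (add_rpow_le hp _ _)
          have : limV M b i - s b =
            (limV M b i - branchV M b (r + 1) i) - (s b - branchV M b (r + 1) i) := by ring
          rw [this]
          exact enorm_sub_le
      _ ≤ 4 ^ p * (c ^ (r + 1) * D + c * (c ^ r * D)) := by
          rw [lintegral_const_mul' _ _ (four_rpow_ne_top p hp), lintegral_add_left]
          · gcongr
            · exact hb i hi _
            · exact h1 r
          · exact ((hmL _).sub (hmV _ _)).enorm.pow_const p
      _ = _ := by rw [pow_succ]; ring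
  have h3 : ∫⁻ b, ‖limV M b i - s b‖ₑ ^ p ∂(staticLaw M π₀ π₁) = 0 := by
    refine le_antisymm (ge_of_tendsto' (x := atTop) ?_ h2) zero_le
    have h4 := (ENNReal.tendsto_pow_atTop_nhds_zero_of_lt_one h.contr_lt).comp (tendsto_add_atTop_nat 1)
    have := ENNReal.Tendsto.mul_const (b := 4 ^ p * (D + D)) h4
      (Or.inr (ENNReal.mul_ne_top (four_rpow_ne_top p hp) (ENNReal.add_ne_top.2 ⟨hD, hD⟩)))
    simpa using this
  have hm : Measurable fun b => ‖limV M b i - s b‖ₑ ^ p := ((hmL i).sub hs).enorm.pow_const p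
  rw [lintegral_eq_zero_iff hm] at h3
  filter_upwards [h3] with b hb
  have := (ENNReal.rpow_eq_zero_iff_of_pos hp0).1 hb
  rwa [enorm_eq_zero, sub_eq_zero] at this

end IterationBounds

end Endogenous

/-! ### Subtrees and the law of the limit -/

section Subtrees

variable {A : Type a} {Z : Type v} {Ξ : Type w}

/-- The labels and noises of the subtree below the node `i`. -/
def shiftBranch (b : BranchSpace A Z Ξ) (i : List ℕ) : BranchSpace A Z Ξ :=
  (fun l => b.1 (l ++ i), fun l => b.2.1 (l ++ i), fun l => b.2.2 (l ++ i))

variable [MeasurableSpace Z] [MeasurableSpace Ξ]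

theorem branchV_shift (M : Recursion A Z Ξ) (b : BranchSpace A Z Ξ) (i : List ℕ) (r : ℕ) :
    ∀ l, branchV M (shiftBranch b i) r l = branchV M b r (l ++ i) := by
  induction r with
  | zero => intro l; rfl
  | succ r ih =>
    intro l
    simp only [branchV, ih]
    rfl

theorem limV_shift (M : Recursion A Z Ξ) (b : BranchSpace A Z Ξ) (i l : List ℕ) :
    limV M (shiftBranch b i) l = limV M b (l ++ i) := by
  simp only [limV, branchV_shift]

theorem branchV_congr (M : Recursion A Z Ξ) {b b' : BranchSpace A Z Ξ} (h1 : b.1 = b'.1)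
    (h2 : b.2.1 = b'.2.1) (h3 : ∀ i, i ≠ [] → b.2.2 i = b'.2.2 i) (r : ℕ) :
    ∀ l, branchV M b r l = branchV M b' r l := by
  induction r with
  | zero => intro l; simp only [branchV, h1]
  | succ r ih =>
    intro l
    have h4 : ∀ j, b.2.2 (j :: l) = b'.2.2 (j :: l) := fun j => h3 _ (by simp)
    simp only [branchV, h1, h2, ih, h4]

theorem measurePreserving_append_right {X : Type*} [MeasurableSpace X] (μ : Measure X)
    [IsProbabilityMeasure μ] (i : List ℕ) :
    MeasurePreserving (fun (t : List ℕ → X) l => t (l ++ i)) (Measure.infinitePi fun _ => μ)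
      (Measure.infinitePi fun _ => μ) :=
  ⟨by fun_prop, Measure.map_infinitePi_infinitePi_of_inj (P := fun _ : List ℕ => μ)
    (f := fun l => l ++ i) fun _ _ h => List.append_cancel_right h⟩

variable [MeasurableSpace A] {M : Recursion A Z Ξ} {π₀ π₁ : ProbabilityMeasure (ℕ × Mark A)}

theorem measurePreserving_shiftBranch (i : List ℕ) :
    MeasurePreserving (fun b : BranchSpace A Z Ξ => shiftBranch b i) (staticLaw M π₁ π₁)
      (staticLaw M π₁ π₁) := by
  have e : gwLaw π₁ π₁ = Measure.infinitePi fun _ : List ℕ => (π₁ : Measure (ℕ × Mark A)) := by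
    simp [gwLaw]
  unfold staticLaw
  rw [e]
  exact (measurePreserving_append_right _ i).prod
    ((measurePreserving_append_right _ i).prod (measurePreserving_append_right _ i))

/-- The noise of the edge above the child `[j]` becomes the edge noise at the root of the subtree of
`[j]`, and the noise of the label `[]`, which belongs to no edge, is discarded. The pairs of limit
and edge noise at the children are thus functions of i.i.d. subtrees. -/
theorem measurePreserving_root_shiftBranch :
    MeasurePreserving
      (fun b : BranchSpace A Z Ξ => ((b.1 [], b.2.1 []), fun j : ℕ => shiftBranch b [j]))
      (staticLaw M π₀ π₁)
      (((π₀ : Measure (ℕ × Mark A)).prod (M.zetaLaw : Measure Z)).prod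
        (Measure.infinitePi fun _ : ℕ => staticLaw M π₁ π₁)) := by
  have e : gwLaw π₁ π₁ = Measure.infinitePi fun _ : List ℕ => (π₁ : Measure (ℕ × Mark A)) := by
    simp [gwLaw]
  have d1 := measurePreserving_root_subtrees (fun i : List ℕ => labelLaw π₀ π₁ i)
    (π₁ : Measure (ℕ × Mark A)) (fun i hi => by simp only [labelLaw, if_neg hi])
  rw [← e] at d1
  have d2 := measurePreserving_root_subtrees (fun _ : List ℕ => (M.zetaLaw : Measure Z))
    (M.zetaLaw : Measure Z) (fun i hi => rfl)
  have d3 := measurePreserving_root_subtrees (fun _ : List ℕ => (M.xiLaw : Measure Ξ))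
    (M.xiLaw : Measure Ξ) (fun i hi => rfl)
  have c1 := measurePreserving_prodProdProdComm (M.zetaLaw : Measure Z)
    (Measure.infinitePi fun _ : ℕ => Measure.infinitePi fun _ : List ℕ => (M.zetaLaw : Measure Z))
    (M.xiLaw : Measure Ξ)
    (Measure.infinitePi fun _ : ℕ => Measure.infinitePi fun _ : List ℕ => (M.xiLaw : Measure Ξ))
  have z1 := measurePreserving_zip
    (fun _ : ℕ => Measure.infinitePi fun _ : List ℕ => (M.zetaLaw : Measure Z))
    (fun _ : ℕ => Measure.infinitePi fun _ : List ℕ => (M.xiLaw : Measure Ξ))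
  have f1 : MeasurePreserving (Prod.fst : Z × Ξ → Z)
      ((M.zetaLaw : Measure Z).prod (M.xiLaw : Measure Ξ)) (M.zetaLaw : Measure Z) :=
    measurePreserving_fst
  have s1 := (f1.prod z1).comp (c1.comp (d2.prod d3))
  have c2 := measurePreserving_prodProdProdComm (labelLaw π₀ π₁ [])
    (Measure.infinitePi fun _ : ℕ => gwLaw π₁ π₁) (M.zetaLaw : Measure Z)
    (Measure.infinitePi fun _ : ℕ => (Measure.infinitePi fun _ : List ℕ =>
      (M.zetaLaw : Measure Z)).prod (Measure.infinitePi fun _ : List ℕ => (M.xiLaw : Measure Ξ)))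
  have z2 := measurePreserving_zip (fun _ : ℕ => gwLaw π₁ π₁)
    (fun _ : ℕ => (Measure.infinitePi fun _ : List ℕ =>
      (M.zetaLaw : Measure Z)).prod (Measure.infinitePi fun _ : List ℕ => (M.xiLaw : Measure Ξ)))
  exact ((MeasurePreserving.id _).prod z2).comp (c2.comp (d1.prod s1))

/-- The law of the limit of the iterations at the root. -/
def limLaw (hM : M.IsMeasurable) (hg : Measurable (Function.uncurry M.g))
    (π₁ : ProbabilityMeasure (ℕ × Mark A)) : ProbabilityMeasure ℝ :=
  ⟨(staticLaw M π₁ π₁).map fun b => limV M b [],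
    Measure.isProbabilityMeasure_map (measurable_limV hM hg []).aemeasurable⟩

theorem map_limV_eq_limLaw (hM : M.IsMeasurable) (hg : Measurable (Function.uncurry M.g))
    (i : List ℕ) :
    (staticLaw M π₁ π₁).map (fun b => limV M b i) = (limLaw hM hg π₁ : Measure ℝ) := by
  have h : (fun b : BranchSpace A Z Ξ => limV M b i) =
      (fun b => limV M b []) ∘ fun b => shiftBranch b i := funext fun b => by
    simp [Function.comp, limV_shift]
  rw [h, ← Measure.map_map (measurable_limV hM hg []) (measurePreserving_shiftBranch
    (M := M) (π₁ := π₁) i).measurable, (measurePreserving_shiftBranch i).map_eq]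
  rfl

/-- The limit at the root never reads the edge noise of the label `[]`. Overwriting that noise by a
fresh one therefore shows the independence of the two components. -/
theorem measurePreserving_limV_xi (hM : M.IsMeasurable) (hg : Measurable (Function.uncurry M.g)) :
    MeasurePreserving (fun b : BranchSpace A Z Ξ => (limV M b [], b.2.2 []))
      (staticLaw M π₁ π₁) ((limLaw hM hg π₁ : Measure ℝ).prod (M.xiLaw : Measure Ξ)) := by
  have hm := measurable_limV hM hg (A := A) []
  refine ⟨by fun_prop, ?_⟩
  let e : Ξ × BranchSpace A Z Ξ → BranchSpace A Z Ξ := fun q =>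
    (q.2.1, q.2.2.1, Function.extend (fun _ : Unit => ([] : List ℕ)) (fun _ => q.1) q.2.2.2)
  have he : MeasurePreserving e ((M.xiLaw : Measure Ξ).prod (staticLaw M π₁ π₁))
      (staticLaw M π₁ π₁) := by
    have h5 := measurePreserving_extend_unit (fun _ : List ℕ => (M.xiLaw : Measure Ξ)) []
    let X := (M.xiLaw : Measure Ξ)
    let Zs := (Measure.infinitePi fun _ : List ℕ => (M.zetaLaw : Measure Z))
    let Xs := (Measure.infinitePi fun _ : List ℕ => (M.xiLaw : Measure Ξ))
    have b1 : MeasurePreserving (fun q : Ξ × ((List ℕ → Z) × (List ℕ → Ξ)) =>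
        (q.2.1, (q.1, q.2.2))) (X.prod (Zs.prod Xs)) (Zs.prod (X.prod Xs)) := by
      have u1 := (measurePreserving_prodAssoc X Zs Xs).symm
      have u2 := (Measure.measurePreserving_swap (μ := X) (ν := Zs)).prod (MeasurePreserving.id Xs)
      exact (measurePreserving_prodAssoc Zs X Xs).comp (u2.comp u1)
    have b2 : MeasurePreserving (fun q : Ξ × BranchSpace A Z Ξ =>
        (q.2.1, (q.1, q.2.2))) (X.prod ((gwLaw π₁ π₁).prod (Zs.prod Xs)))
          ((gwLaw π₁ π₁).prod (X.prod (Zs.prod Xs))) := by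
      have u1 := (measurePreserving_prodAssoc X (gwLaw π₁ π₁) (Zs.prod Xs)).symm
      have u2 := (Measure.measurePreserving_swap (μ := X) (ν := gwLaw π₁ π₁)).prod
        (MeasurePreserving.id (Zs.prod Xs))
      exact (measurePreserving_prodAssoc (gwLaw π₁ π₁) X (Zs.prod Xs)).comp (u2.comp u1)
    exact ((MeasurePreserving.id (gwLaw π₁ π₁)).prod (((MeasurePreserving.id Zs).prod h5).comp
      b1)).comp b2
  have hV : ∀ q, limV M (e q) [] = limV M q.2 [] := fun q => by
    have : ∀ r, branchV M (e q) r [] = branchV M q.2 r [] := fun r =>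
      branchV_congr M (b := e q) (b' := q.2) rfl rfl (fun i hi => extend_unit_of_ne hi _ _) r []
    simp only [limV, this]
  have hx : ∀ q, (e q).2.2 [] = q.1 := fun q => extend_unit_self _ _ _
  rw [← he.map_eq, Measure.map_map (by fun_prop) he.measurable]
  have hc : ((fun b : BranchSpace A Z Ξ => (limV M b [], b.2.2 [])) ∘ e) =
      Prod.map (fun b => limV M b []) id ∘ Prod.swap := funext fun q => by
    simp only [Function.comp, hV, hx]
    rfl
  rw [hc, ← Measure.map_map (hm.prodMap measurable_id) measurable_swap, Measure.prod_swap]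
  exact (((⟨hm, rfl⟩ : MeasurePreserving (fun b : BranchSpace A Z Ξ => limV M b [])
    (staticLaw M π₁ π₁) (limLaw hM hg π₁ : Measure ℝ))).prod (MeasurePreserving.id _)).map_eq

/-- Above the roots of the subtrees the tree with the limits of the iterations has the law in
the definition of `branchLaw`. -/
theorem map_static_eq_branchLaw (hM : M.IsMeasurable) (hg : Measurable (Function.uncurry M.g))
    {F : Mark A → Z → Multiset (ℝ × Ξ) → ℝ}
    (hF : Measurable fun q : (ℕ × Mark A) × (Z × (ℕ → ℝ × Ξ)) =>
      F q.1.2 q.2.1 (offFamily q.1.1 q.2.2)) :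
    (staticLaw M π₀ π₁).map (fun b => F (b.1 []).2 (b.2.1 []) (offFamily (b.1 []).1 fun j =>
      (limV M b [j], b.2.2 [j]))) = branchLaw M π₀ F (limLaw hM hg π₁) := by
  have h1 := Measure.infinitePi_map_pi (μ := fun _ : ℕ => staticLaw M π₁ π₁)
    (f := fun _ (b : BranchSpace A Z Ξ) => (limV M b [], b.2.2 []))
    (fun _ => (measurePreserving_limV_xi (π₁ := π₁) hM hg).measurable)
  have h2 : MeasurePreserving (fun (x : ℕ → BranchSpace A Z Ξ) j => (limV M (x j) [], (x j).2.2 []))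
      (Measure.infinitePi fun _ : ℕ => staticLaw M π₁ π₁)
      (Measure.infinitePi fun _ : ℕ => (limLaw hM hg π₁ : Measure ℝ).prod (M.xiLaw : Measure Ξ)) := by
    have hm := measurable_limV hM hg (A := A) []
    refine ⟨by fun_prop, ?_⟩
    rw [h1]
    congr 1
    ext1 j
    exact (measurePreserving_limV_xi hM hg).map_eq
  have h3 := (measurePreserving_prodAssoc (π₀ : Measure (ℕ × Mark A)) (M.zetaLaw : Measure Z)
    (Measure.infinitePi fun _ : ℕ => (limLaw hM hg π₁ : Measure ℝ).prod (M.xiLaw : Measure Ξ))).comp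
    (((MeasurePreserving.id _).prod h2).comp (measurePreserving_root_shiftBranch
      (M := M) (π₀ := π₀) (π₁ := π₁)))
  unfold branchLaw
  rw [← h3.map_eq, Measure.map_map hF h3.measurable]
  congr 1
  ext b
  simp only [Function.comp, Prod.map, MeasurableEquiv.prodAssoc, MeasurableEquiv.coe_mk,
    Equiv.prodAssoc_apply, id, limV_shift]
  rfl

end Subtrees

/-! ### Wasserstein distance of two images of one measure -/

section Wasserstein

theorem wasserstein_map_le {α : Type*} [MeasurableSpace α] {μ : Measure α} {p : ℝ} (hp : 0 ≤ p)
    {f g : α → ℝ} (hf : Measurable f) (hg : Measurable g) :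
    wasserstein p (μ.map f) (μ.map g) ≤ (∫⁻ x, ‖f x - g x‖ₑ ^ p ∂μ) ^ (1 / p) := by
  refine ENNReal.rpow_le_rpow ?_ (by positivity)
  have h1 : Measurable fun x => (f x, g x) := hf.prodMk hg
  have h2 : μ.map (fun x => (f x, g x)) ∈
      {γ : Measure (ℝ × ℝ) | γ.map Prod.fst = μ.map f ∧ γ.map Prod.snd = μ.map g} :=
    ⟨Measure.map_map measurable_fst h1, Measure.map_map measurable_snd h1⟩
  refine (iInf₂_le _ h2).trans_eq ?_
  exact lintegral_map (by fun_prop) h1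

theorem tendsto_wasserstein_of_lintegral {α : Type*} [MeasurableSpace α] {μ : Measure α} {p : ℝ}
    (hp : 1 ≤ p) {f : ℕ → α → ℝ} {g : α → ℝ} (hf : ∀ n, Measurable (f n)) (hg : Measurable g)
    (h : Tendsto (fun n => ∫⁻ x, ‖f n x - g x‖ₑ ^ p ∂μ) atTop (𝓝 0)) :
    Tendsto (fun n => wasserstein p (μ.map (f n)) (μ.map g)) atTop (𝓝 0) := by
  have hp0 : 0 < p := by linarith
  refine tendsto_of_tendsto_of_tendsto_of_le_of_le tendsto_const_nhds ?_ (fun _ => zero_le)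
    fun n => wasserstein_map_le hp0.le (hf n) hg
  have := ((ENNReal.continuous_rpow_const (y := 1 / p)).tendsto 0).comp h
  rwa [ENNReal.zero_rpow_of_pos (by positivity)] at this

end Wasserstein

/-! ### Endogeny -/

section Endogeny

variable {A : Type a} {Z : Type v} {Ξ : Type w} [MeasurableSpace Z] [MeasurableSpace Ξ]
  [MeasurableSpace A] {M : Recursion A Z Ξ}

open scoped Classical in
/-- The iterations at the nodes of the tree are measurable with respect to the marks of the
tree. -/
theorem measurable_branchV_of_tree (hM : M.IsMeasurable) (hg : Measurable (Function.uncurry M.g))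
    {α : Type*} [MeasurableSpace α] (b : α → BranchSpace A Z Ξ)
    (h : ∀ (i : List ℕ) (B : Set (Mark A × Z × (ℕ → Ξ))), MeasurableSet B →
      MeasurableSet {x | InTree (fun l => ((b x).1 l).1) i ∧ branchMark (b x) i ∈ B}) (r : ℕ) :
    ∀ i, Measurable fun x => if InTree (fun l => ((b x).1 l).1) i then branchV M (b x) r i else 0 := by
  rcases isEmpty_or_nonempty α with hα | ⟨⟨x₀⟩⟩
  · exact fun i => measurable_of_empty _
  have hT : ∀ i, MeasurableSet {x | InTree (fun l => ((b x).1 l).1) i} := fun i => by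
    simpa using h i Set.univ MeasurableSet.univ
  -- Off the tree the mark is not observable, so it is replaced by a constant; the result is
  -- measurable for the σ-algebra of the marks of the tree.
  set Y : List ℕ → α → Mark A × Z × (ℕ → Ξ) := fun i x =>
    if InTree (fun l => ((b x).1 l).1) i then branchMark (b x) i else branchMark (b x₀) i with hY
  have hYm : ∀ i, Measurable (Y i) := fun i B hB => by
    by_cases hc : branchMark (b x₀) i ∈ B
    · convert (h i B hB).union (hT i).compl using 1
      ext x
      by_cases hx : InTree (fun l => ((b x).1 l).1) i <;> simp [hY, hx, hc]
    · convert h i B hB using 1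
      ext x
      by_cases hx : InTree (fun l => ((b x).1 l).1) i <;> simp [hY, hx, hc]
  set N : List ℕ → α → ℕ := fun i x =>
    if InTree (fun l => ((b x).1 l).1) i then ((b x).1 i).1 else 0 with hN
  -- The offspring number is not part of the mark, but on the tree `N_i > j` says that the child `j
  -- :: i` belongs to the tree.
  have hNm : ∀ i, Measurable (N i) := fun i => by
    refine measurable_of_Ioi fun j => ?_
    convert hT (j :: i) using 1
    ext x
    by_cases hx : InTree (fun l => ((b x).1 l).1) i <;> simp [hN, hx, InTree]
  induction r with
  | zero =>
    intro i
    have h1 : Measurable fun x => if InTree (fun l => ((b x).1 l).1) i then M.g 0 (Y i x).1 else 0 :=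
      Measurable.ite (hT i) (measurable_g_comp hg measurable_const (hYm i).fst) measurable_const
    convert h1 using 2 with x
    split_ifs with hx
    · simp only [branchV, hY, if_pos hx]; rfl
    · rfl
  | succ r ih =>
    intro i
    have h1 : Measurable fun x => if InTree (fun l => ((b x).1 l).1) i then
        M.Ψ (Y i x).1 (Y i x).2.1 (offFamily (N i x) fun j =>
          ((if InTree (fun l => ((b x).1 l).1) (j :: i) then branchV M (b x) r (j :: i) else 0),
            (Y i x).2.2 j)) else 0 :=
      Measurable.ite (hT i) (measurable_Ψ_offFamily hM hg (hYm i).fst (hYm i).snd.fst (hNm i)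
        fun j => (ih (j :: i)).prodMk ((measurable_pi_apply j).comp (hYm i).snd.snd))
        measurable_const
    convert h1 using 2 with x
    split_ifs with hx
    · have e1 : Y i x = branchMark (b x) i := if_pos hx
      have e2 : N i x = ((b x).1 i).1 := if_pos hx
      rw [e1, e2]
      simp only [branchV, branchMark]
      congr 1
      refine Multiset.map_congr rfl fun j hj => ?_
      have : InTree (fun l => ((b x).1 l).1) (j :: i) := ⟨hx, by simpa using hj⟩
      simp only [if_pos this]
    · rfl

/-- `limV` is a pointwise `liminf` rather than a class of functions up to null sets, so
measurability passes to it without completing the σ-algebra. -/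
theorem measurable_treeAlg_limV (hM : M.IsMeasurable) (hg : Measurable (Function.uncurry M.g)) :
    Measurable[treeAlg A Z Ξ] fun b : BranchSpace A Z Ξ => limV M b [] := by
  have h1 : ∀ r, Measurable[treeAlg A Z Ξ] fun b : BranchSpace A Z Ξ => branchV M b r [] := by
    intro r
    have := @measurable_branchV_of_tree A Z Ξ _ _ _ M hM hg _ (treeAlg A Z Ξ) id
      (fun i B hB => MeasurableSpace.measurableSet_generateFrom ⟨i, B, hB, rfl⟩) r []
    simpa [InTree] using this
  exact Measurable.liminf h1

theorem ae_limV_eq_all {B : Bounds A} {p : ℝ} {π₁ : ProbabilityMeasure (ℕ × Mark A)}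
    (h : IterationBounds M B p π₁) :
    ∀ᵐ b ∂(branchSpaceLaw M π₁), ∀ i, limV M b i = M.Ψ (b.1 i).2 (b.2.1 i)
      (offFamily (b.1 i).1 fun j => (limV M b (j :: i), b.2.2 (j :: i))) :=
  ae_all_iff.2 fun i => h.ae_limV_eq π₁ (by simp [labelLaw])

theorem IterationBounds.isAttractingEndogenous {B : Bounds A} {p : ℝ}
    {π₁ : ProbabilityMeasure (ℕ × Mark A)} (h : IterationBounds M B p π₁) :
    IsAttractingEndogenous M p π₁ (limLaw h.meas h.meas_g π₁) where
  solution := by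
    rw [← map_static_eq_branchLaw h.meas h.meas_g
      (measurable_Ψ_offFamily h.meas h.meas_g (by fun_prop) (by fun_prop) (by fun_prop)
        fun j => by fun_prop)]
    refine Measure.map_congr ?_
    filter_upwards [h.ae_limV_eq π₁ (i := []) (by simp [labelLaw])] with b hb using hb.symm
  attracting := by
    obtain ⟨D, hD, hb⟩ := h.exists_lintegral_limV_sub_le π₁
    refine tendsto_wasserstein_of_lintegral h.one_le
      (fun r => measurable_branchV h.meas h.meas_g r []) (measurable_limV h.meas h.meas_g []) ?_
    refine tendsto_of_tendsto_of_tendsto_of_le_of_le (h := fun r => contr B p π₁ ^ r * D)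
      tendsto_const_nhds ?_ (fun _ => zero_le) fun r => ?_
    · simpa using ENNReal.Tendsto.mul_const (b := D)
        (ENNReal.tendsto_pow_atTop_nhds_zero_of_lt_one h.contr_lt) (Or.inr hD)
    · refine le_trans (le_of_eq ?_) (hb [] (by simp [labelLaw]) r)
      refine lintegral_congr fun b => ?_
      rw [← enorm_neg, neg_sub]
  endogenous := ⟨fun i b => limV M b i, measurable_treeAlg_limV h.meas h.meas_g,
    fun i => ⟨(measurable_limV h.meas h.meas_g i).aemeasurable,
      map_limV_eq_limLaw h.meas h.meas_g i⟩, ae_limV_eq_all h⟩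

end Endogeny

/-! ### Convergence of the laws at the root -/

section RootLaw

variable {A : Type a} {Z : Type v} {Ξ : Type w} [MeasurableSpace Z] [MeasurableSpace Ξ]

/-- The recursion on a marked tree with noises that do not depend on time. -/
def staticR (M : Recursion A Z Ξ) (q : BranchSpace A Z Ξ × (List ℕ → ℝ)) : ℕ → List ℕ → ℝ
  | 0, i => q.2 i
  | k + 1, i => M.Φ (q.1.1 i).2 (q.1.2.1 i) (offFamily (q.1.1 i).1 fun j =>
      (M.g (staticR M q k (j :: i)) (q.1.1 (j :: i)).2, q.1.2.2 (j :: i)))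

/-- In a computation of depth `k` at the root, a node of generation `m` applies `Φ` to its offspring
at time `k - 1 - m` only. One vertex noise per node and one edge noise per child are thus ever read.
-/
theorem treeR_eq_staticR (M : Recursion A Z Ξ) (t : List ℕ → ℕ × Mark A)
    (w : NoiseSpace (List ℕ) (List ℕ) Z Ξ) {k : ℕ} (r : ℕ) :
    ∀ i, i.length + r = k → treeR M t w r i = staticR M ((t, (fun i => w.1 (k - 1 - i.length, i)),
      fun i => w.2.1 (k - i.length, i)), w.2.2) r i := by
  induction r with
  | zero => intro i _; rfl
  | succ r ih =>
    intro i hi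
    have e1 : k - 1 - i.length = r := by omega
    have e2 : k - (i.length + 1) = r := by omega
    simp only [treeR, staticR, e1, List.length_cons, e2]
    congr 2
    ext j
    · rw [ih (j :: i) (by simp only [List.length_cons]; omega)]
    · rfl

theorem staticR_nodeResample (M : Recursion A Z Ξ) (i : List ℕ)
    (q : (ℕ × Mark A) × Z × (ℕ → Ξ)) (b : BranchSpace A Z Ξ) (θ : List ℕ → ℝ) (r : ℕ) :
    ∀ l, i.length < l.length →
      staticR M (nodeResample i (q, b), θ) r l = staticR M (b, θ) r l := by
  have h1 : ∀ l : List ℕ, i.length < l.length → (nodeResample i (q, b)).1 l = b.1 l := fun l hl =>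
    extend_unit_of_ne (fun h => by rw [h] at hl; exact lt_irrefl _ hl) _ _
  have h2 : ∀ l : List ℕ, i.length < l.length → (nodeResample i (q, b)).2.1 l = b.2.1 l :=
    fun l hl => extend_unit_of_ne (fun h => by rw [h] at hl; exact lt_irrefl _ hl) _ _
  have h3 : ∀ l : List ℕ, i.length + 1 < l.length → (nodeResample i (q, b)).2.2 l = b.2.2 l :=
    fun l hl => Function.extend_apply' _ _ _ fun ⟨j, hj⟩ => by
      rw [← hj] at hl; simp at hl
  induction r with
  | zero => intro l hl; rfl
  | succ r ih =>
    intro l hl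
    have hj : ∀ j, i.length < (j :: l).length := fun j => by simp only [List.length_cons]; omega
    have hj' : ∀ j, i.length + 1 < (j :: l).length := fun j => by
      simp only [List.length_cons]; omega
    simp only [staticR, h1 l hl, h2 l hl, ih _ (hj _), h1 _ (hj _), h3 _ (hj' _)]

variable [MeasurableSpace A] {M : Recursion A Z Ξ}

theorem measurable_staticR (hM : M.IsMeasurable) (hg : Measurable (Function.uncurry M.g)) (r : ℕ) :
    ∀ i, Measurable fun q : BranchSpace A Z Ξ × (List ℕ → ℝ) => staticR M q r i := by
  induction r with
  | zero => intro i; simp only [staticR]; fun_prop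
  | succ r ih =>
    intro i
    simp only [staticR]
    refine measurable_Φ_offFamily hM (by fun_prop) (by fun_prop) (by fun_prop) fun j => ?_
    exact (measurable_g_comp hg (ih _) (by fun_prop)).prodMk (by fun_prop)

/-- Choosing one time for each node selects coordinates of an i.i.d. family along an injective map,
since the node itself is retained; truncated subtraction in the time index is harmless. -/
theorem rootLaw_eq_map_staticR (hM : M.IsMeasurable) (hg : Measurable (Function.uncurry M.g))
    (μ₀ : ProbabilityMeasure ℝ) (π₀ π₁ : ProbabilityMeasure (ℕ × Mark A)) (k : ℕ) :
    rootLaw M μ₀ π₀ π₁ k = ((staticLaw M π₀ π₁).prod (Measure.infinitePi fun _ : List ℕ =>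
      (μ₀ : Measure ℝ))).map fun q => staticR M q k [] := by
  have h1 : MeasurePreserving (fun (f : ℕ × List ℕ → Z) i => f (k - 1 - i.length, i))
      (Measure.infinitePi fun _ => (M.zetaLaw : Measure Z))
      (Measure.infinitePi fun _ : List ℕ => (M.zetaLaw : Measure Z)) :=
    ⟨by fun_prop, Measure.map_infinitePi_infinitePi_of_inj
      (P := fun _ : ℕ × List ℕ => (M.zetaLaw : Measure Z))
      (f := fun i : List ℕ => (k - 1 - i.length, i)) fun _ _ h => (Prod.ext_iff.1 h).2⟩
  have h2 : MeasurePreserving (fun (f : ℕ × List ℕ → Ξ) i => f (k - i.length, i))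
      (Measure.infinitePi fun _ => (M.xiLaw : Measure Ξ))
      (Measure.infinitePi fun _ : List ℕ => (M.xiLaw : Measure Ξ)) :=
    ⟨by fun_prop, Measure.map_infinitePi_infinitePi_of_inj
      (P := fun _ : ℕ × List ℕ => (M.xiLaw : Measure Ξ))
      (f := fun i : List ℕ => (k - i.length, i)) fun _ _ h => (Prod.ext_iff.1 h).2⟩
  have h3 := (MeasurePreserving.id (gwLaw π₀ π₁)).prod ((measurePreserving_prodAssoc _ _ _).symm.comp
    (h1.prod (h2.prod (MeasurePreserving.id (Measure.infinitePi fun _ : List ℕ =>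
      (μ₀ : Measure ℝ))))))
  have h4 := (measurePreserving_prodAssoc _ _ _).symm.comp h3
  rw [show (staticLaw M π₀ π₁).prod (Measure.infinitePi fun _ : List ℕ => (μ₀ : Measure ℝ)) =
    _ from h4.map_eq.symm, Measure.map_map (measurable_staticR hM hg k []) h4.measurable]
  unfold rootLaw
  congr 1
  ext q
  exact treeR_eq_staticR M q.1 q.2 k [] (by simp)

variable {B : Bounds A} {p : ℝ} {π₁ : ProbabilityMeasure (ℕ × Mark A)}

/-- The values `g(ℛ_i, 𝐗_i)` iterate the same map `Ψ` as `branchV`, starting from `g(ℛ_i^{(0)},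
𝐗_i)` instead of `g(0, 𝐗_i)`. The initial difference is at most `σ₊ |ℛ_i^{(0)}|`, and it contracts.
-/
theorem IterationBounds.lintegral_g_staticR_sub_branchV_le (h : IterationBounds M B p π₁)
    (μ₀ : ProbabilityMeasure ℝ) (π₀ : ProbabilityMeasure (ℕ × Mark A)) (r : ℕ) :
    ∀ i, i ≠ [] → ∫⁻ q, ‖M.g (staticR M q r i) (q.1.1 i).2 - branchV M q.1 r i‖ₑ ^ p
      ∂((staticLaw M π₀ π₁).prod (Measure.infinitePi fun _ : List ℕ => (μ₀ : Measure ℝ))) ≤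
      contr B p π₁ ^ r * ((∫⁻ y, ‖B.sp y.2‖ₑ ^ p ∂(π₁ : Measure (ℕ × Mark A))) *
        ∫⁻ x, ‖x‖ₑ ^ p ∂(μ₀ : Measure ℝ)) := by
  have hp0 : 0 ≤ p := by linarith [h.one_le]
  have hmV := fun r i => (measurable_branchV (A := A) h.meas h.meas_g r i).comp
    (measurable_fst : Measurable (Prod.fst : BranchSpace A Z Ξ × (List ℕ → ℝ) → _))
  have hmS := fun r i => measurable_g_comp h.meas_g (measurable_staticR h.meas h.meas_g r i)
    (x := fun q => (q.1.1 i).2) (by fun_prop)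
  induction r with
  | zero =>
    intro i hi
    rw [pow_zero, one_mul]
    have hsp : Measurable fun y : ℕ × Mark A => ‖B.sp y.2‖ₑ ^ p :=
      (h.meas_sp.comp measurable_snd).enorm.pow_const p
    have e1 : ∫⁻ θ : List ℕ → ℝ, ‖θ i‖ₑ ^ p ∂(Measure.infinitePi fun _ : List ℕ =>
        (μ₀ : Measure ℝ)) = ∫⁻ x, ‖x‖ₑ ^ p ∂(μ₀ : Measure ℝ) :=
      (measurePreserving_eval_infinitePi (fun _ : List ℕ => (μ₀ : Measure ℝ)) i).lintegral_comp
        (f := fun x => ‖x‖ₑ ^ p) (by fun_prop)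
    have e2 := lintegral_staticLaw_node (M := M) (π₀ := π₀) (π₁ := π₁) hsp i
    rw [show labelLaw π₀ π₁ i = (π₁ : Measure (ℕ × Mark A)) by simp only [labelLaw, if_neg hi]] at e2
    have hf1 : Measurable fun b : BranchSpace A Z Ξ => ‖B.sp (b.1 i).2‖ₑ ^ p :=
      hsp.comp (by fun_prop : Measurable fun b : BranchSpace A Z Ξ => b.1 i)
    have hf2 : Measurable fun θ : List ℕ → ℝ => ‖θ i‖ₑ ^ p := by fun_prop
    rw [← e1, ← e2, ← lintegral_prod_mul hf1.aemeasurable hf2.aemeasurable]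
    refine lintegral_mono fun q => ?_
    dsimp only
    rw [← ENNReal.mul_rpow_of_nonneg _ _ hp0]
    refine ENNReal.rpow_le_rpow ?_ hp0
    simpa [staticR, branchV] using enorm_g_sub_le h.lip (q.1.1 i).2 (q.2 i) 0
  | succ r ih =>
    intro i hi
    have := lintegral_static_Ψ_sub_le (M := M) (π₀ := π₀) (π₁ := π₁)
      (τ := Measure.infinitePi fun _ : List ℕ => (μ₀ : Measure ℝ)) h.meas h.one_le h.meas_g
      h.meas_sm h.meas_sp h.lip h.bounds (i := i) (by simp only [labelLaw, if_neg hi])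
      (v := fun q j => M.g (staticR M q r (j :: i)) (q.1.1 (j :: i)).2)
      (v' := fun q j => branchV M q.1 r (j :: i)) (fun j => hmS _ _) (fun j => hmV _ _)
      (fun q b θ => funext fun j => by
        dsimp only
        rw [staticR_nodeResample M i q b θ r _ (by simp)]
        congr 2
        exact extend_unit_of_ne (by simp) _ _)
      (fun q b θ => funext fun j => branchV_nodeResample M i (q, b) r _ (by simp))
      (fun j => ih (j :: i) (by simp))
    refine this.trans_eq ?_
    rw [pow_succ]; ring

/-- The laws at the root converge if the iterations contract. -/
theorem IterationBounds.tendsto_wasserstein_rootLaw (h : IterationBounds M B p π₁)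
    {μ₀ : ProbabilityMeasure ℝ} {π₀ : ProbabilityMeasure (ℕ × Mark A)}
    (hb : ∀ᵐ y ∂(π₀ : Measure (ℕ × Mark A)), BoundsAt M B p y.1 y.2)
    (hμ₀ : ∫⁻ x, ‖x‖ₑ ^ p ∂(μ₀ : Measure ℝ) ≠ ∞)
    (hs : ∫⁻ y, ‖B.sm y.2‖ₑ ^ p * (y.1 : ℝ≥0∞) ^ p ∂(π₀ : Measure (ℕ × Mark A)) ≠ ∞) :
    Tendsto (fun k => wasserstein p (rootLaw M μ₀ π₀ π₁ k)
      (branchLaw M π₀ M.Φ (limLaw h.meas h.meas_g π₁))) atTop (𝓝 0) := by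
  have hp := h.one_le
  have hp0 : 0 < p := by linarith
  obtain ⟨D, hD, hV⟩ := h.exists_lintegral_limV_sub_le π₀
  set τ := Measure.infinitePi fun _ : List ℕ => (μ₀ : Measure ℝ)
  set E := (∫⁻ y, ‖B.sp y.2‖ₑ ^ p ∂(π₁ : Measure (ℕ × Mark A))) * ∫⁻ x, ‖x‖ₑ ^ p ∂(μ₀ : Measure ℝ)
  have hE : E ≠ ∞ := ENNReal.mul_ne_top h.node_sp hμ₀
  set c := contr B p π₁
  have hmL := fun i => (measurable_limV (A := A) h.meas h.meas_g i)
  have hmV := fun r i => (measurable_branchV (A := A) h.meas h.meas_g r i)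
  have hmS := fun r i => measurable_g_comp h.meas_g (measurable_staticR h.meas h.meas_g r i)
    (x := fun q => (q.1.1 i).2) (by fun_prop)
  have hF : Measurable fun q : (ℕ × Mark A) × (Z × (ℕ → ℝ × Ξ)) =>
      M.Φ q.1.2 q.2.1 (offFamily q.1.1 q.2.2) :=
    measurable_Φ_offFamily h.meas (by fun_prop) (by fun_prop) (by fun_prop) fun j => by fun_prop
  set s : BranchSpace A Z Ξ → ℝ := fun b => M.Φ (b.1 []).2 (b.2.1 [])
      (offFamily (b.1 []).1 fun j => (limV M b [j], b.2.2 [j])) with hs_def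
  have hsm : Measurable s := measurable_Φ_offFamily h.meas (by fun_prop) (by fun_prop)
    (by fun_prop) fun j => (hmL _).prodMk (by fun_prop)
  have h0 : branchLaw M π₀ M.Φ (limLaw h.meas h.meas_g π₁) =
      ((staticLaw M π₀ π₁).prod τ).map fun q => s q.1 := by
    rw [← map_static_eq_branchLaw h.meas h.meas_g hF]
    have : (fun q : BranchSpace A Z Ξ × (List ℕ → ℝ) => s q.1) = s ∘ Prod.fst := rfl
    rw [this, ← Measure.map_map hsm measurable_fst, (measurePreserving_fst (ν := τ)).map_eq]
  rw [h0]
  simp only [rootLaw_eq_map_staticR h.meas h.meas_g]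
  refine tendsto_wasserstein_of_lintegral hp (fun k => measurable_staticR h.meas h.meas_g k [])
    (hsm.comp measurable_fst) ?_
  -- The root value at time `r + 1` is one application of `Φ` to the values of `g` after `r` steps.
  refine (tendsto_add_atTop_iff_nat 1).1 ?_
  have h1 : ∀ r j, ∫⁻ q, ‖M.g (staticR M q r [j]) (q.1.1 [j]).2 - limV M q.1 [j]‖ₑ ^ p
      ∂((staticLaw M π₀ π₁).prod τ) ≤ c ^ r * (4 ^ p * (E + D)) := by
    intro r j
    calc _ ≤ ∫⁻ q, 4 ^ p * (‖M.g (staticR M q r [j]) (q.1.1 [j]).2 - branchV M q.1 r [j]‖ₑ ^ p +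
          ‖limV M q.1 [j] - branchV M q.1 r [j]‖ₑ ^ p) ∂((staticLaw M π₀ π₁).prod τ) := by
          refine lintegral_mono fun q =>
            le_trans (ENNReal.rpow_le_rpow ?_ hp0.le) (add_rpow_le hp _ _)
          have : M.g (staticR M q r [j]) (q.1.1 [j]).2 - limV M q.1 [j] =
            (M.g (staticR M q r [j]) (q.1.1 [j]).2 - branchV M q.1 r [j]) -
              (limV M q.1 [j] - branchV M q.1 r [j]) := by ring
          rw [this]
          exact enorm_sub_le
      _ ≤ 4 ^ p * (c ^ r * E + c ^ r * D) := by
          rw [lintegral_const_mul' _ _ (four_rpow_ne_top p hp), lintegral_add_left]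
          · gcongr
            · exact h.lintegral_g_staticR_sub_branchV_le μ₀ π₀ r [j] (by simp)
            · refine le_trans (le_of_eq ?_) (hV [j] (labelLaw_cons _ _ _ _) r)
              exact (measurePreserving_fst (ν := τ)).lintegral_comp
                (f := fun b => ‖limV M b [j] - branchV M b r [j]‖ₑ ^ p)
                (((hmL _).sub (hmV _ _)).enorm.pow_const p)
          · exact ((hmS _ _).sub ((hmV _ _).comp measurable_fst)).enorm.pow_const p
      _ = _ := by ring
  refine tendsto_of_tendsto_of_tendsto_of_le_of_le (h := fun r =>
    (∫⁻ y, ‖B.sm y.2‖ₑ ^ p * (y.1 : ℝ≥0∞) ^ p ∂(π₀ : Measure (ℕ × Mark A))) *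
      (c ^ r * (4 ^ p * (E + D)))) tendsto_const_nhds ?_ (fun _ => zero_le) fun r => ?_
  · have h4 := ENNReal.Tendsto.mul_const (b := 4 ^ p * (E + D))
      (ENNReal.tendsto_pow_atTop_nhds_zero_of_lt_one h.contr_lt)
      (Or.inr (ENNReal.mul_ne_top (four_rpow_ne_top p hp) (ENNReal.add_ne_top.2 ⟨hE, hD⟩)))
    simpa using ENNReal.Tendsto.const_mul h4 (Or.inr hs)
  -- At the root the factor is the moment of `N_∅ σ₋(𝐗_∅)` under `π₀`. It is applied once, so it
  -- need only be finite.
  · exact lintegral_static_sub_le (M := M) (π₀ := π₀) (π₁ := π₁) (τ := τ) h.meas hp []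
      (ℓ := fun y => ‖B.sm y.2‖ₑ) ((h.meas_sm.comp measurable_snd).enorm)
      (by simp only [labelLaw, if_true]
          filter_upwards [hb] with y hy using fun v v' => hy.lintegral_sub_le hp v v')
      (v := fun q j => M.g (staticR M q r [j]) (q.1.1 [j]).2)
      (v' := fun q j => limV M q.1 [j]) (fun j => hmS _ _) (fun j => (hmL _).comp measurable_fst)
      (fun q b θ => funext fun j => by
        dsimp only
        rw [staticR_nodeResample M [] q b θ r _ (by simp)]
        congr 2
        exact extend_unit_of_ne (by simp) _ _)
      (fun q b θ => funext fun j => limV_nodeResample M [] (q, b) (by simp))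
      (h1 r)

end RootLaw

/-! ### The recursion on a graph that matches a tree near its root -/

section Matching

variable {A : Type a} {Z : Type v} {Ξ : Type w} {V : Type*}

/-- The nodes of the first `K` generations of the marked tree `t`. -/
def treeNodes (t : List ℕ → ℕ × Mark A) (K : ℕ) : Set (List ℕ) :=
  {i | InTree (fun l => (t l).1) i ∧ i.length ≤ K}

/-- `θ` is an isomorphism from the first `K` generations of the tree `t` onto the depth-`K`
in-neighbourhood of `x` in a multigraph. -/
def Matches (t : List ℕ → ℕ × Mark A) (θ : List ℕ → V) (mult : V → V → ℕ) (x : V) (K : ℕ) :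
    Prop :=
  θ [] = x ∧ Set.BijOn θ (treeNodes t K) {y | ∃ r ≤ K, y ∈ inGen mult x r} ∧
  ∀ i ∈ treeNodes t K, ∀ i' ∈ treeNodes t K,
    ((∃ j : ℕ, i = j :: i') → mult (θ i) (θ i') = 1) ∧
    ((¬ ∃ j : ℕ, i = j :: i') → mult (θ i) (θ i') = 0)

namespace Matches

variable {t : List ℕ → ℕ × Mark A} {θ : List ℕ → V} {mult : V → V → ℕ} {x : V} {K : ℕ}

theorem mem_inGen (h : Matches t θ mult x K) :
    ∀ i, i ∈ treeNodes t K → θ i ∈ inGen mult x i.length := by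
  intro i
  induction i with
  | nil => intro _; simpa [inGen] using h.1
  | cons j i ih =>
    rintro ⟨hi, hl⟩
    simp only [List.length_cons] at hl
    have hi' : i ∈ treeNodes t K := ⟨hi.1, by omega⟩
    refine ⟨θ i, ih hi', ?_⟩
    rw [(h.2.2 _ ⟨hi, by simpa using hl⟩ _ hi').1 ⟨j, rfl⟩]
    exact one_pos

/-- As `i` lies strictly before generation `K`, each in-neighbour of `θ i` is still in the matched
neighbourhood, hence the image of a tree node; the isomorphism leaves an edge only if that node is a
child of `i`. -/
theorem exists_child (h : Matches t θ mult x K) {i : List ℕ}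
    (hi : InTree (fun l => (t l).1) i) (hl : i.length < K) {y : V} (hy : 0 < mult y (θ i)) :
    ∃ j < (t i).1, θ (j :: i) = y := by
  have hi' : i ∈ treeNodes t K := ⟨hi, hl.le⟩
  obtain ⟨i', hi'', rfl⟩ := h.2.1.surjOn (show y ∈ {y | ∃ r ≤ K, y ∈ inGen mult x r} from
    ⟨i.length + 1, hl, θ i, h.mem_inGen i hi', hy⟩)
  by_cases hc : ∃ j : ℕ, i' = j :: i
  · obtain ⟨j, rfl⟩ := hc
    exact ⟨j, hi''.1.2, rfl⟩
  · rw [(h.2.2 _ hi'' _ hi').2 hc] at hy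
    exact absurd hy (lt_irrefl _)

theorem child_mem {i : List ℕ} (hi : InTree (fun l => (t l).1) i)
    (hl : i.length < K) {j : ℕ} (hj : j < (t i).1) : j :: i ∈ treeNodes t K :=
  ⟨⟨hi, hj⟩, hl⟩

theorem mult_child (h : Matches t θ mult x K) {i : List ℕ}
    (hi : InTree (fun l => (t l).1) i) (hl : i.length < K) {j : ℕ} (hj : j < (t i).1) :
    mult (θ (j :: i)) (θ i) = 1 :=
  (h.2.2 _ (child_mem hi hl hj) _ ⟨hi, hl.le⟩).1 ⟨j, rfl⟩

/-- The edges into `θ i` are exactly one for each child of `i`, so each of them has edge index `0`.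
-/
theorem inFamily_eq [Fintype V] (h : Matches t θ mult x K) {i : List ℕ}
    (hi : InTree (fun l => (t l).1) i) (hl : i.length < K) {γ : Type*} (f : V → ℕ → γ) :
    inFamily mult (θ i) f = offFamily (t i).1 fun j => f (θ (j :: i)) 0 := by
  classical
  have e1 : inFamily mult (θ i) f = ∑ y, (Multiset.range (mult y (θ i))).map (f y) := rfl
  have hinj : Set.InjOn (fun j => θ (j :: i)) (Finset.range (t i).1 : Set ℕ) := by
    intro j hj j' hj' hjj
    have := h.2.1.injOn (child_mem hi hl (by simpa using hj)) (child_mem hi hl (by simpa using hj'))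
      hjj
    exact (List.cons.inj this).1
  rw [e1, ← Finset.sum_subset (Finset.subset_univ ((Finset.range (t i).1).image
    fun j => θ (j :: i))), Finset.sum_image hinj]
  · have e2 : ∀ j ∈ Finset.range (t i).1, (Multiset.range (mult (θ (j :: i)) (θ i))).map
        (f (θ (j :: i))) = {f (θ (j :: i)) 0} := fun j hj => by
      rw [h.mult_child hi hl (by simpa using hj)]
      rfl
    rw [Finset.sum_congr rfl e2]
    simp only [offFamily, Finset.sum, Finset.range_val]
    rw [← Multiset.sum_map_singleton (Multiset.map (fun j => f (θ (j :: i)) 0) _),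
      Multiset.map_map]
    rfl
  · intro y _ hy
    rcases Nat.eq_zero_or_pos (mult y (θ i)) with h0 | h0
    · simp [h0]
    · obtain ⟨j, hj, rfl⟩ := h.exists_child hi hl h0
      exact absurd (Finset.mem_image.2 ⟨j, by simpa using hj, rfl⟩) hy

theorem sum_mult_eq [Fintype V] (h : Matches t θ mult x K) {i : List ℕ}
    (hi : InTree (fun l => (t l).1) i) (hl : i.length < K) : ∑ y, mult y (θ i) = (t i).1 := by
  have := congrArg Multiset.card (h.inFamily_eq hi hl fun _ _ => ())
  simpa [inFamily, offFamily, Multiset.card_bind] using this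

end Matches

/-- The nodes at which the noises of the graph are used on the tree. -/
def coupledNodes (t : List ℕ → ℕ × Mark A) (θ : List ℕ → V) (K : ℕ) : Set (List ℕ) :=
  {i | i ∈ treeNodes t K ∧ Set.InjOn θ (treeNodes t K)}

/-- When `θ` is not injective on the first generations the set is empty. The merged noises therefore
have the right law for all data, including the bad event. -/
theorem injOn_coupledNodes (t : List ℕ → ℕ × Mark A) (θ : List ℕ → V) (K : ℕ) :
    Set.InjOn θ (coupledNodes t θ K) := fun _ hi _ hi' h => hi.2 hi.1 hi'.1 h

/-- The noises on the tree: those of the graph at the nodes in `S`, and fresh ones elsewhere. -/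
def mergeNoise (S : Set (List ℕ)) (θ : List ℕ → V)
    (q : NoiseSpace V (V × V × ℕ) Z Ξ × NoiseSpace (List ℕ) (List ℕ) Z Ξ) :
    NoiseSpace (List ℕ) (List ℕ) Z Ξ :=
  (mergeOn {k : ℕ × List ℕ | k.2 ∈ S} (fun k => (k.1, θ k.2)) q.1.1 q.2.1,
    mergeOn {k : ℕ × List ℕ | k.2 ∈ S} (fun k => (k.1, (θ k.2, θ k.2.tail, 0))) q.1.2.1 q.2.2.1,
    mergeOn S θ q.1.2.2 q.2.2.2)

variable [MeasurableSpace Z] [MeasurableSpace Ξ]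

/-- On a matched neighbourhood the two recursions have the same families of arguments and, through
`mergeNoise`, the same noises; they are identical as long as the tree carries the marks of the
graph. Each step uses up one generation. -/
theorem Matches.graphR_eq_treeR [Fintype V] (M : Recursion A Z Ξ) {t : List ℕ → ℕ × Mark A}
    {θ : List ℕ → V} {mult : V → V → ℕ} {x : V} {K : ℕ} (h : Matches t θ mult x K)
    (X : V → Mark A)
    (q : NoiseSpace V (V × V × ℕ) Z Ξ × NoiseSpace (List ℕ) (List ℕ) Z Ξ) (r : ℕ) :
    ∀ i, InTree (fun l => (t l).1) i → i.length + r ≤ K →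
      graphR M X mult q.1 r (θ i) = treeR M (fun l => ((t l).1, X (θ l)))
        (mergeNoise (coupledNodes t θ K) θ q) r i := by
  have hmem : ∀ i ∈ treeNodes t K, i ∈ coupledNodes t θ K := fun i hi => ⟨hi, h.2.1.injOn⟩
  induction r with
  | zero =>
    intro i hi hl
    exact (if_pos (hmem i ⟨hi, by omega⟩)).symm
  | succ r ih =>
    intro i hi hl
    have hl' : i.length < K := by omega
    simp only [graphR, treeR]
    rw [h.inFamily_eq hi hl']
    have e1 : (mergeNoise (coupledNodes t θ K) θ q).1 (r, i) = q.1.1 (r, θ i) :=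
      if_pos (hmem i ⟨hi, hl'.le⟩)
    rw [e1]
    congr 1
    refine Multiset.map_congr rfl fun j hj => ?_
    have hj' : j < (t i).1 := by simpa using hj
    have e2 : (mergeNoise (coupledNodes t θ K) θ q).2.1 (r, j :: i) =
        q.1.2.1 (r, (θ (j :: i), θ i, 0)) := if_pos (hmem _ (Matches.child_mem hi hl' hj'))
    rw [e2, ih (j :: i) ⟨hi, hj'⟩ (by simp only [List.length_cons]; omega)]

/-- The tree edge named by the child `i` reads the graph edge from `θ i` to `θ i.tail`. The image of
the child alone already distinguishes these edges, so injectivity on nodes suffices. -/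
theorem measurePreserving_mergeNoise (M : Recursion A Z Ξ) (μ₀ : ProbabilityMeasure ℝ)
    {S : Set (List ℕ)} {θ : List ℕ → V} (hθ : Set.InjOn θ S) :
    MeasurePreserving (mergeNoise (Z := Z) (Ξ := Ξ) S θ)
      ((M.noiseLaw μ₀ V (V × V × ℕ)).prod (M.noiseLaw μ₀ (List ℕ) (List ℕ)))
      (M.noiseLaw μ₀ (List ℕ) (List ℕ)) := by
  have h1 : Set.InjOn (fun k : ℕ × List ℕ => (k.1, θ k.2)) {k : ℕ × List ℕ | k.2 ∈ S} :=
    fun k hk k' hk' e => Prod.ext (Prod.ext_iff.1 e).1 (hθ hk hk' (Prod.ext_iff.1 e).2)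
  have h2 : Set.InjOn (fun k : ℕ × List ℕ => (k.1, (θ k.2, θ k.2.tail, 0)))
      {k : ℕ × List ℕ | k.2 ∈ S} := fun k hk k' hk' e =>
    Prod.ext (Prod.ext_iff.1 e).1 (hθ hk hk' (Prod.ext_iff.1 (Prod.ext_iff.1 e).2).1)
  have m1 := measurePreserving_mergeOn (M.zetaLaw : Measure Z) h1
  have m2 := measurePreserving_mergeOn (M.xiLaw : Measure Ξ) h2
  have m3 := measurePreserving_mergeOn (μ₀ : Measure ℝ) hθ
  have c1 := measurePreserving_prodProdProdComm
    (Measure.infinitePi fun _ : ℕ × (V × V × ℕ) => (M.xiLaw : Measure Ξ))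
    (Measure.infinitePi fun _ : V => (μ₀ : Measure ℝ))
    (Measure.infinitePi fun _ : ℕ × List ℕ => (M.xiLaw : Measure Ξ))
    (Measure.infinitePi fun _ : List ℕ => (μ₀ : Measure ℝ))
  have c2 := measurePreserving_prodProdProdComm
    (Measure.infinitePi fun _ : ℕ × V => (M.zetaLaw : Measure Z))
    ((Measure.infinitePi fun _ : ℕ × (V × V × ℕ) => (M.xiLaw : Measure Ξ)).prod
      (Measure.infinitePi fun _ : V => (μ₀ : Measure ℝ)))
    (Measure.infinitePi fun _ : ℕ × List ℕ => (M.zetaLaw : Measure Z))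
    ((Measure.infinitePi fun _ : ℕ × List ℕ => (M.xiLaw : Measure Ξ)).prod
      (Measure.infinitePi fun _ : List ℕ => (μ₀ : Measure ℝ)))
  exact (m1.prod ((m2.prod m3).comp c1)).comp c2

/-! ### Measurability of the matching event and of the merged noises -/

section Measurability

variable {α : Type*} [MeasurableSpace α] [MeasurableSpace A]

theorem measurable_eval_of_countable {ι X : Type*} [Countable ι] [MeasurableSpace ι]
    [MeasurableSingletonClass ι] [MeasurableSpace X] {f : α → ι → X} {g : α → ι}
    (hf : Measurable f) (hg : Measurable g) : Measurable fun x => f x (g x) :=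
  (measurable_from_prod_countable_left (f := fun q : (ι → X) × ι => q.1 q.2)
    fun i => measurable_pi_apply i).comp (hf.prodMk hg)

theorem measurableSet_inTree {t : α → List ℕ → ℕ × Mark A} (ht : Measurable t) (i : List ℕ) :
    MeasurableSet {x | InTree (fun l => (t x l).1) i} := by
  induction i with
  | nil => simp [InTree]
  | cons j i ih =>
    have h1 : Measurable fun x => (t x i).1 := by fun_prop
    exact ih.inter (measurableSet_lt measurable_const h1)

theorem measurableSet_treeNodes {t : α → List ℕ → ℕ × Mark A} (ht : Measurable t) (K : ℕ)
    (i : List ℕ) : MeasurableSet {x | i ∈ treeNodes (t x) K} :=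
  (measurableSet_inTree ht i).inter (MeasurableSet.const _)

variable [Finite V] [MeasurableSpace V] [MeasurableSingletonClass V]

theorem measurableSet_coupledNodes {t : α → List ℕ → ℕ × Mark A} {θ : α → List ℕ → V}
    (ht : Measurable t) (hθ : Measurable θ) (K : ℕ) (i : List ℕ) :
    MeasurableSet {x | i ∈ coupledNodes (t x) (θ x) K} := by
  refine (measurableSet_treeNodes ht K i).inter ?_
  have hθi : ∀ i, Measurable fun x => θ x i := fun i => by fun_prop
  have e : {x | Set.InjOn (θ x) (treeNodes (t x) K)} =
      ⋂ i, ({x | i ∈ treeNodes (t x) K}ᶜ ∪ ⋂ i', ({x | i' ∈ treeNodes (t x) K}ᶜ ∪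
        ({x | θ x i = θ x i'}ᶜ ∪ {_x | i = i'}))) := by
    ext x
    simp only [Set.InjOn, Set.mem_ofPred_eq, Set.mem_union, Set.mem_compl_iff, Set.mem_iInter,
      imp_iff_not_or]
  change MeasurableSet {x | Set.InjOn (θ x) (treeNodes (t x) K)}
  rw [e]
  refine MeasurableSet.iInter fun i => ?_
  exact (measurableSet_treeNodes ht K i).compl.union (MeasurableSet.iInter fun i' =>
    (measurableSet_treeNodes ht K i').compl.union
      ((measurableSet_eq_fun (hθi i) (hθi i')).compl.union (MeasurableSet.const _)))

theorem measurable_mergeNoise {t : α → List ℕ → ℕ × Mark A} {θ : α → List ℕ → V}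
    {q : α → NoiseSpace V (V × V × ℕ) Z Ξ × NoiseSpace (List ℕ) (List ℕ) Z Ξ}
    (ht : Measurable t) (hθ : Measurable θ) (hq : Measurable q) (K : ℕ) :
    Measurable fun x => mergeNoise (coupledNodes (t x) (θ x) K) (θ x) (q x) := by
  classical
  have hθi : ∀ i, Measurable fun x => θ x i := fun i => by fun_prop
  have hS := measurableSet_coupledNodes ht hθ K
  unfold mergeNoise mergeOn
  refine Measurable.prodMk (measurable_pi_iff.2 fun k => ?_)
    (Measurable.prodMk (measurable_pi_iff.2 fun k => ?_) (measurable_pi_iff.2 fun i => ?_))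
  · refine Measurable.ite (hS k.2) ?_ (by fun_prop)
    exact measurable_eval_of_countable (by fun_prop) (measurable_const.prodMk (hθi _))
  · refine Measurable.ite (hS k.2) ?_ (by fun_prop)
    exact measurable_eval_of_countable (by fun_prop)
      (measurable_const.prodMk ((hθi _).prodMk ((hθi _).prodMk measurable_const)))
  · refine Measurable.ite (hS i) ?_ (by fun_prop)
    exact measurable_eval_of_countable (by fun_prop) (hθi _)

theorem measurableSet_matches {t : α → List ℕ → ℕ × Mark A} {θ : α → List ℕ → V}
    {mult : α → V → V → ℕ} {y : α → V} (ht : Measurable t) (hθ : Measurable θ)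
    (hm : Measurable mult) (hy : Measurable y) (K : ℕ) :
    MeasurableSet {x | Matches (t x) (θ x) (mult x) (y x) K} := by
  have hθi : ∀ i, Measurable fun x => θ x i := fun i => by fun_prop
  have hT := measurableSet_treeNodes ht K
  have hcc : ∀ s : Set ((V × V) × (V → V → ℕ) × V), MeasurableSet s := fun s =>
    s.to_countable.measurableSet
  have hP : ∀ (P : V → V → (V → V → ℕ) → V → Prop) (u u' : α → V), Measurable u → Measurable u' →
      MeasurableSet {x | P (u x) (u' x) (mult x) (y x)} := fun P u u' hu hu' =>
    (hcc {q | P q.1.1 q.1.2 q.2.1 q.2.2}).preimage ((hu.prodMk hu').prodMk (hm.prodMk hy))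
  have e : {x | Matches (t x) (θ x) (mult x) (y x) K} =
      {x | θ x [] = y x} ∩ (((⋂ i, ({x | i ∈ treeNodes (t x) K}ᶜ ∪
        {x | ∃ r ≤ K, θ x i ∈ inGen (mult x) (y x) r})) ∩ {x | Set.InjOn (θ x) (treeNodes (t x) K)}) ∩
        ⋂ u : V, ({x | ∃ r ≤ K, u ∈ inGen (mult x) (y x) r}ᶜ ∪
          ⋃ i, ({x | i ∈ treeNodes (t x) K} ∩ {x | θ x i = u}))) ∩
      ⋂ i, ⋂ i', ({x | i ∈ treeNodes (t x) K}ᶜ ∪ ({x | i' ∈ treeNodes (t x) K}ᶜ ∪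
        {x | ((∃ j : ℕ, i = j :: i') → mult x (θ x i) (θ x i') = 1) ∧
          ((¬ ∃ j : ℕ, i = j :: i') → mult x (θ x i) (θ x i') = 0)})) := by
    ext x
    simp only [Matches, Set.BijOn, Set.MapsTo, Set.SurjOn, Set.subset_def, Set.mem_ofPred_eq,
      Set.mem_inter_iff, Set.mem_iInter, Set.mem_union, Set.mem_compl_iff, Set.mem_iUnion,
      Set.mem_image, imp_iff_not_or, and_assoc, forall_or_left]
  have hinj : MeasurableSet {x | Set.InjOn (θ x) (treeNodes (t x) K)} := by
    convert measurableSet_coupledNodes ht hθ K [] using 1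
    ext x
    simp [coupledNodes, treeNodes, InTree]
  rw [e]
  refine ((hP (fun a _ _ b => a = b) _ _ (hθi []) (hθi [])).inter
    ((MeasurableSet.inter (MeasurableSet.iInter fun i => (hT i).compl.union ?_) hinj).inter
      (MeasurableSet.iInter fun u => MeasurableSet.union (MeasurableSet.compl ?_)
        (MeasurableSet.iUnion fun i => (hT i).inter ?_)))).inter
    (MeasurableSet.iInter fun i => MeasurableSet.iInter fun i' => (hT i).compl.union
      ((hT i').compl.union ?_))
  · exact hP (fun a _ m b => ∃ r ≤ K, a ∈ inGen m b r) _ _ (hθi i) (hθi i)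
  · exact hP (fun a _ m b => ∃ r ≤ K, a ∈ inGen m b r) _ _ (measurable_const (a := u)) (hθi [])
  · exact hP (fun a _ _ _ => a = u) _ _ (hθi i) (hθi i)
  · exact hP (fun a a' m _ => ((∃ j : ℕ, i = j :: i') → m a a' = 1) ∧
      ((¬ ∃ j : ℕ, i = j :: i') → m a a' = 0)) _ _ (hθi i) (hθi i')

end Measurability

end Matching

/-! ### One step of the recursion on a fixed graph -/

section GraphStep

variable {A : Type a} {Z : Type v} {Ξ : Type w} [MeasurableSpace Z] [MeasurableSpace Ξ]
  {V : Type*} {M : Recursion A Z Ξ} {B : Bounds A} {p : ℝ}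

theorem injective_edge (i : V) : Function.Injective fun x : V × ℕ => (x.1, i, x.2) :=
  fun x y h => by
    obtain ⟨h1, h2⟩ := Prod.ext_iff.1 h
    exact Prod.ext h1 (Prod.ext_iff.1 h2).2

theorem continuous_g_left (hg : ∀ (x : Mark A) (r r' : ℝ), |M.g r x - M.g r' x| ≤ B.sp x * |r - r'|)
    (x : Mark A) : Continuous fun r => M.g r x := by
  refine (LipschitzWith.of_dist_le_mul (K := (B.sp x).toNNReal) fun r r' => ?_).continuous
  rw [Real.dist_eq, Real.dist_eq]
  exact (hg x r r').trans (mul_le_mul_of_nonneg_right (Real.le_coe_toNNReal _) (abs_nonneg _))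

variable [Fintype V]

/-- A law whose support is the interval `[-K, K]`. -/
def clampLaw (K : ℝ) : ProbabilityMeasure ℝ :=
  ⟨(gaussianReal 0 1).map fun x => max (-K) (min K x),
    Measure.isProbabilityMeasure_map (by fun_prop)⟩

theorem clampLaw_compl_Icc {K : ℝ} (hK : 0 ≤ K) : (clampLaw K : Measure ℝ) (Set.Icc (-K) K)ᶜ = 0 := by
  change (gaussianReal 0 1).map (fun x => max (-K) (min K x)) _ = 0
  rw [Measure.map_apply (by fun_prop) measurableSet_Icc.compl]
  convert measure_empty (μ := gaussianReal 0 1)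
  ext x
  simp [hK]

/-- A Gaussian vector charges every nonempty open set, in particular the preimage of `U` under
coordinatewise clamping; clamping fixes `v`, so `v` lies in that preimage. -/
theorem noiseLaw_clampLaw_pos (M : Recursion A Z Ξ) {K : ℝ} {U : Set (V → ℝ)} (hU : IsOpen U)
    {v : V → ℝ} (hv : v ∈ U) (hvK : ∀ j, |v j| ≤ K) (E : Type*) :
    M.noiseLaw (clampLaw K) V E {w | w.2.2 ∈ U} ≠ 0 := by
  have : (gaussianReal 0 1).IsOpenPosMeasure :=
    (gaussianReal_absolutelyContinuous' 0 one_ne_zero).isOpenPosMeasure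
  have h1 : MeasurePreserving (fun w : NoiseSpace V E Z Ξ => w.2.2) (M.noiseLaw (clampLaw K) V E)
      (Measure.infinitePi fun _ : V => (clampLaw K : Measure ℝ)) :=
    measurePreserving_snd.comp measurePreserving_snd
  have hc : MeasurePreserving (fun x : ℝ => max (-K) (min K x)) (gaussianReal 0 1)
      (clampLaw K : Measure ℝ) := ⟨by fun_prop, rfl⟩
  have h2 := measurePreserving_pi (fun _ : V => gaussianReal 0 1)
    (fun _ => (clampLaw K : Measure ℝ)) fun _ => hc
  have e : {w : NoiseSpace V E Z Ξ | w.2.2 ∈ U} = (fun w => w.2.2) ⁻¹' U := rfl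
  rw [e, h1.measure_preimage hU.measurableSet.nullMeasurableSet, Measure.infinitePi_eq_pi,
    ← h2.measure_preimage hU.measurableSet.nullMeasurableSet]
  refine (IsOpen.measure_pos _ (hU.preimage (by fun_prop)) ⟨v, ?_⟩).ne'
  change (fun j => max (-K) (min K (v j))) ∈ U
  convert hv using 1
  ext j
  have := abs_le.1 (hvK j)
  rw [min_eq_right this.2, max_eq_right this.1]

variable [MeasurableSpace A] {X : V → Mark A} {mult : V → V → ℕ}

theorem measurable_Φ_graph (hM : M.IsMeasurable) (x : Mark A) (mult : V → V → ℕ) (i : V)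
    {α : Type*} [MeasurableSpace α] {z : α → Z} {v : α → V → ℝ} {ξ : α → V × ℕ → Ξ}
    (hz : Measurable z) (hv : ∀ j, Measurable fun a => v a j) (hξ : Measurable ξ) :
    Measurable fun a => M.Φ x (z a) (inFamily mult i fun j l => (v a j, ξ a (j, l))) :=
  measurable_Φ_inFamily hM i measurable_const hz (by fun_prop) fun j l =>
    (hv j).prodMk (by fun_prop)

/-- The noise of the last step of the recursion on a graph may be integrated out first. -/
theorem lintegral_graphR_succ (hM : M.IsMeasurable) (hgm : Measurable (Function.uncurry M.g))
    (μ₀ : ProbabilityMeasure ℝ) (X : V → Mark A) (mult : V → V → ℕ) {φ : ℝ → ℝ≥0∞}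
    (hφ : Measurable φ) (r : ℕ) (i : V) :
    ∫⁻ w, φ (graphR M X mult w (r + 1) i) ∂(M.noiseLaw μ₀ V (V × V × ℕ)) =
      ∫⁻ w, ∫⁻ s, φ (M.Φ (X i) s.1 (inFamily mult i fun j l =>
        (M.g (graphR M X mult w r j) (X j), s.2 (j, l)))) ∂(M.stepLaw (V × ℕ))
        ∂(M.noiseLaw μ₀ V (V × V × ℕ)) := by
  have hv : ∀ j, Measurable fun w : NoiseSpace V (V × V × ℕ) Z Ξ =>
      M.g (graphR M X mult w r j) (X j) := fun j =>
    measurable_g_comp hgm (measurable_graphR_noise hM hgm X mult r j) measurable_const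
  refine lintegral_resample M μ₀ r i (injective_edge i) (F := fun w z ξ =>
    φ (M.Φ (X i) z (inFamily mult i fun j l => (M.g (graphR M X mult w r j) (X j), ξ (j, l)))))
    (hφ.comp ?_) ?_
  · exact measurable_Φ_graph hM (X i) mult i (v := fun (q : NoiseSpace V (V × V × ℕ) Z Ξ × Z ×
      (V × ℕ → Ξ)) j => M.g (graphR M X mult q.1 r j) (X j)) (by fun_prop)
      (fun j => (hv j).comp measurable_fst) (by fun_prop)
  · intro s w
    funext z ξ
    simp only [graphR_resample M X mult _ (s, w) r le_rfl]

theorem BoundsOnGraph.lintegral_graphR_succ_le (hM : M.IsMeasurable)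
    (hgm : Measurable (Function.uncurry M.g)) (hp : 1 ≤ p) (h : BoundsOnGraph M B p X mult)
    (μ₀ : ProbabilityMeasure ℝ) (r : ℕ) (i : V) :
    ∫⁻ w, ‖graphR M X mult w (r + 1) i‖ₑ ^ p ∂(M.noiseLaw μ₀ V (V × V × ℕ)) ≤
      ∫⁻ w, (‖B.sm (X i)‖ₑ * ∑ j, (mult j i : ℝ≥0∞) * ‖M.g (graphR M X mult w r j) (X j)‖ₑ
        + ‖B.β (X i)‖ₑ) ^ p ∂(M.noiseLaw μ₀ V (V × V × ℕ)) := by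
  rw [lintegral_graphR_succ hM hgm μ₀ X mult (φ := fun x => ‖x‖ₑ ^ p) (by fun_prop)]
  exact lintegral_mono fun w => h.lintegral_le hp i _

/-! ### Preservation of an interval -/

/-- The hypothesis concerns almost every initial vector, but later values of the recursion need not
be i.i.d., so the bound is needed at every vector `v` of the cube. Vectors `v'` with the bound exist
arbitrarily close to `v`, because the clamped Gaussian charges each neighbourhood, and the `L^p`
Lipschitz bound shows that the expected `p`-th power of the overshoot at `v` is at most `d v'`,
hence zero. -/
theorem stepLaw_Φ_le_of_ae (hM : M.IsMeasurable) (hgm : Measurable (Function.uncurry M.g))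
    (hp : 1 ≤ p) (hg : ∀ (x : Mark A) (r r' : ℝ), |M.g r x - M.g r' x| ≤ B.sp x * |r - r'|)
    (h : BoundsOnGraph M B p X mult) {K : ℝ}
    (hK : ∀ᵐ w ∂(M.noiseLaw (clampLaw K) V (V × V × ℕ)), ∀ i, |graphR M X mult w 1 i| ≤ K)
    {v : V → ℝ} (hv : ∀ j, |v j| ≤ K) (i : V) :
    ∀ᵐ s ∂(M.stepLaw (V × ℕ)),
      |M.Φ (X i) s.1 (inFamily mult i fun j l => (M.g (v j) (X j), s.2 (j, l)))| ≤ K := by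
  have hp0 : 0 < p := by linarith
  set φ : ℝ → ℝ≥0∞ := fun x => ENNReal.ofReal (|x| - K) ^ p with hφ
  have hφm : Measurable φ := by fun_prop
  have hφ0 : ∀ x, φ x = 0 ↔ |x| ≤ K := fun x => by
    simp [hφ, ENNReal.rpow_eq_zero_iff_of_pos hp0]
  set f : (V → ℝ) → Z × (V × ℕ → Ξ) → ℝ := fun v s =>
    M.Φ (X i) s.1 (inFamily mult i fun j l => (M.g (v j) (X j), s.2 (j, l)))
  have hfm : ∀ v, Measurable (f v) := fun v =>
    measurable_Φ_graph hM (X i) mult i (by fun_prop) (fun j => measurable_const) (by fun_prop)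
  have h0 : ∫⁻ w, φ (graphR M X mult w 1 i) ∂(M.noiseLaw (clampLaw K) V (V × V × ℕ)) = 0 := by
    refine (lintegral_eq_zero_iff (hφm.comp (measurable_graphR_noise hM hgm X mult 1 i))).2 ?_
    filter_upwards [hK] with w hw using (hφ0 _).2 (hw i)
  rw [show (1 : ℕ) = 0 + 1 from rfl, lintegral_graphR_succ hM hgm _ X mult hφm,
    lintegral_eq_zero_iff] at h0
  swap
  · refine Measurable.lintegral_prod_right' (f := fun q : NoiseSpace V (V × V × ℕ) Z Ξ ×
      (Z × (V × ℕ → Ξ)) => φ (M.Φ (X i) q.2.1 (inFamily mult i fun j l =>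
        (M.g (graphR M X mult q.1 0 j) (X j), q.2.2 (j, l))))) (hφm.comp ?_)
    exact measurable_Φ_graph hM (X i) mult i (v := fun (q : NoiseSpace V (V × V × ℕ) Z Ξ × Z ×
      (V × ℕ → Ξ)) j => M.g (graphR M X mult q.1 0 j) (X j)) (by fun_prop)
      (fun j => measurable_g_comp hgm ((measurable_graphR_noise hM hgm X mult 0 j).comp
        measurable_fst) measurable_const) (by fun_prop)
  set d : (V → ℝ) → ℝ≥0∞ := fun v' =>
    (‖B.sm (X i)‖ₑ * ∑ j, (mult j i : ℝ≥0∞) * ‖M.g (v j) (X j) - M.g (v' j) (X j)‖ₑ) ^ p with hd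
  have hdc : Continuous d := by
    have hgc := fun j => continuous_g_left hg (X j)
    refine ENNReal.continuous_rpow_const.comp (ENNReal.continuous_const_mul enorm_ne_top |>.comp ?_)
    refine continuous_finsetSum _ fun j _ =>
      (ENNReal.continuous_const_mul (ENNReal.natCast_ne_top _)).comp ?_
    exact continuous_enorm.comp (continuous_const.sub ((hgc j).comp (continuous_apply j)))
  have hd0 : d v = 0 := by simp [hd, hp0]
  have hmain : ∫⁻ s, φ (f v s) ∂(M.stepLaw (V × ℕ)) = 0 := by
    refine le_antisymm (le_of_forall_gt fun ε hε => ?_) zero_le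
    have hU : IsOpen {v' | d v' < ε} := isOpen_lt hdc continuous_const
    have hvU : v ∈ {v' | d v' < ε} := by
      change d v < ε
      rw [hd0]; exact hε
    have hne := noiseLaw_clampLaw_pos M hU hvU hv (V × V × ℕ)
    obtain ⟨w, hw1, hw2⟩ : ∃ w : NoiseSpace V (V × V × ℕ) Z Ξ, w.2.2 ∈ {v' | d v' < ε} ∧
        ∫⁻ s, φ (f w.2.2 s) ∂(M.stepLaw (V × ℕ)) = 0 := by
      by_contra hcon
      refine hne (measure_mono_null (fun w hw => ?_) h0)
      exact fun h1 => hcon ⟨w, hw, h1⟩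
    refine lt_of_le_of_lt ?_ hw1
    refine le_trans ?_ (h.lintegral_sub_le hp i (fun j => M.g (v j) (X j))
      fun j => M.g (w.2.2 j) (X j))
    refine lintegral_mono_ae ?_
    filter_upwards [(lintegral_eq_zero_iff (hφm.comp (hfm _))).1 hw2] with s hs
    have hs' := (hφ0 _).1 hs
    refine ENNReal.rpow_le_rpow ?_ hp0.le
    rw [Real.enorm_eq_ofReal_abs]
    refine ENNReal.ofReal_le_ofReal ?_
    have h3 := abs_sub_abs_le_abs_sub (f v s) (f w.2.2 s)
    change |f v s| - K ≤ |f v s - f w.2.2 s|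
    linarith
  filter_upwards [(lintegral_eq_zero_iff (hφm.comp (hfm _))).1 hmain] with s hs
  exact (hφ0 _).1 hs

/-- If one step of the recursion preserves the interval `[-K, K]` then so does the recursion. -/
theorem ae_abs_graphR_le (hM : M.IsMeasurable) (hgm : Measurable (Function.uncurry M.g))
    (hp : 1 ≤ p) (hg : ∀ (x : Mark A) (r r' : ℝ), |M.g r x - M.g r' x| ≤ B.sp x * |r - r'|)
    (h : BoundsOnGraph M B p X mult) {K : ℝ}
    (hK : ∀ᵐ w ∂(M.noiseLaw (clampLaw K) V (V × V × ℕ)), ∀ i, |graphR M X mult w 1 i| ≤ K)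
    {μ₀ : ProbabilityMeasure ℝ} (hμ₀ : (μ₀ : Measure ℝ) (Set.Icc (-K) K)ᶜ = 0) (r : ℕ) :
    ∀ᵐ w ∂(M.noiseLaw μ₀ V (V × V × ℕ)), ∀ i, |graphR M X mult w r i| ≤ K := by
  induction r with
  | zero =>
    have h1 : MeasurePreserving (fun w : NoiseSpace V (V × V × ℕ) Z Ξ => w.2.2)
        (M.noiseLaw μ₀ V (V × V × ℕ)) (Measure.infinitePi fun _ : V => (μ₀ : Measure ℝ)) :=
      measurePreserving_snd.comp measurePreserving_snd
    refine ae_all_iff.2 fun i => ?_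
    have h2 := (measurePreserving_eval_infinitePi (fun _ : V => (μ₀ : Measure ℝ)) i).comp h1
    refine h2.quasiMeasurePreserving.ae (p := fun x => |x| ≤ K) ?_
    refine measure_mono_null (fun x hx => ?_) hμ₀
    exact fun h3 => hx (abs_le.2 h3)
  | succ r ih =>
    refine ae_all_iff.2 fun i => ?_
    have hset : MeasurableSet {x : ℝ | |x| ≤ K}ᶜ :=
      (measurableSet_le measurable_id.abs measurable_const).compl
    have hφ : Measurable ({x : ℝ | |x| ≤ K}ᶜ.indicator (1 : ℝ → ℝ≥0∞)) :=
      measurable_one.indicator hset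
    have h0 := lintegral_graphR_succ hM hgm μ₀ X mult hφ r i
    have h1 : ∫⁻ w, {x : ℝ | |x| ≤ K}ᶜ.indicator (1 : ℝ → ℝ≥0∞) (graphR M X mult w (r + 1) i)
        ∂(M.noiseLaw μ₀ V (V × V × ℕ)) = 0 := by
      rw [h0]
      refine (lintegral_congr_ae (g := fun _ => (0 : ℝ≥0∞)) ?_).trans lintegral_zero
      filter_upwards [ih] with w hw
      refine (lintegral_congr_ae (g := fun _ => (0 : ℝ≥0∞)) ?_).trans lintegral_zero
      filter_upwards [stepLaw_Φ_le_of_ae hM hgm hp hg h hK hw i] with s hs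
      have hs' : M.Φ (X i) s.1 (inFamily mult i fun j l =>
        (M.g (graphR M X mult w r j) (X j), s.2 (j, l))) ∉ {x : ℝ | |x| ≤ K}ᶜ :=
        Set.notMem_compl_iff.2 hs
      exact Set.indicator_of_notMem (f := (1 : ℝ → ℝ≥0∞)) hs'
    filter_upwards [(lintegral_eq_zero_iff
      (hφ.comp (measurable_graphR_noise hM hgm X mult (r + 1) i))).1 h1] with w hw
    by_contra hcon
    simp [hcon] at hw

/-! ### Matrix norms and the uniform vertex -/

/-- The norm bound is applied to `|y|`. As `b` is nonnegative, the entries of a row all have the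
sign of `s i`, so nothing cancels in the row sums. -/
theorem LpOpNormLE.sum_rpow_le (hp : 1 ≤ p) {s b : V → ℝ} (hb : ∀ j, 0 ≤ b j) {K : ℝ}
    (h : LpOpNormLE p (Matrix.of fun i j : V => s i * b j * (mult j i : ℝ)) K) (y : V → ℝ) :
    ∑ i, (‖s i‖ₑ * ∑ j, (mult j i : ℝ≥0∞) * (‖b j‖ₑ * ‖y j‖ₑ)) ^ p ≤
      ENNReal.ofReal K ^ p * ∑ j, ‖y j‖ₑ ^ p := by
  have hp0 : 0 < p := by linarith
  have h1 := h fun j => |y j|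
  set C : Matrix V V ℝ := Matrix.of fun i j : V => s i * b j * (mult j i : ℝ)
  have hC : ∀ i, ‖s i‖ₑ * ∑ j, (mult j i : ℝ≥0∞) * (‖b j‖ₑ * ‖y j‖ₑ) =
      ENNReal.ofReal |C.mulVec (fun j => |y j|) i| := fun i => by
    have e1 : C.mulVec (fun j => |y j|) i = s i * ∑ j, (mult j i : ℝ) * (b j * |y j|) := by
      simp only [Matrix.mulVec, dotProduct, C, Matrix.of_apply, Finset.mul_sum]
      exact Finset.sum_congr rfl fun j _ => by ring
    have e2 : 0 ≤ ∑ j, (mult j i : ℝ) * (b j * |y j|) := Finset.sum_nonneg fun j _ =>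
      mul_nonneg (Nat.cast_nonneg _) (mul_nonneg (hb j) (abs_nonneg _))
    rw [e1, abs_mul, abs_of_nonneg e2, ENNReal.ofReal_mul (abs_nonneg _), Real.enorm_eq_ofReal_abs,
      ENNReal.ofReal_sum_of_nonneg fun j _ =>
        mul_nonneg (Nat.cast_nonneg _) (mul_nonneg (hb j) (abs_nonneg _))]
    congr 1
    refine Finset.sum_congr rfl fun j _ => ?_
    rw [ENNReal.ofReal_mul (Nat.cast_nonneg _), ENNReal.ofReal_mul (hb j), ENNReal.ofReal_natCast,
      Real.enorm_eq_ofReal_abs, Real.enorm_eq_ofReal_abs, abs_of_nonneg (hb j)]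
  have e3 : ∀ z : V → ℝ, ∑ i, ENNReal.ofReal |z i| ^ p = ENNReal.ofReal (∑ i, |z i| ^ p) := fun z => by
    rw [ENNReal.ofReal_sum_of_nonneg fun i _ => by positivity]
    exact Finset.sum_congr rfl fun i _ => ENNReal.ofReal_rpow_of_nonneg (abs_nonneg _) hp0.le
  simp only [hC]
  rw [e3]
  simp only [Real.enorm_eq_ofReal_abs]
  rw [e3]
  set a := ∑ i, |C.mulVec (fun j => |y j|) i| ^ p with ha
  set d := ∑ i, |y i| ^ p with hd
  have ha0 : 0 ≤ a := Finset.sum_nonneg fun i _ => by positivity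
  have hd0 : 0 ≤ d := Finset.sum_nonneg fun i _ => by positivity
  simp only [abs_abs] at h1
  -- `K` is not assumed nonnegative; replacing it by `max K 0` does not change `ENNReal.ofReal K`.
  have h2 : a ^ (1 / p) ≤ max K 0 * d ^ (1 / p) :=
    h1.trans (mul_le_mul_of_nonneg_right (le_max_left _ _) (by positivity))
  have h3 : a ≤ max K 0 ^ p * d := by
    have h4 := Real.rpow_le_rpow (by positivity) h2 hp0.le
    rwa [Real.mul_rpow (le_max_right _ _) (by positivity), ← Real.rpow_mul ha0,
      ← Real.rpow_mul hd0, one_div, inv_mul_cancel₀ hp0.ne', Real.rpow_one, Real.rpow_one] at h4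
  have h5 : ENNReal.ofReal K = ENNReal.ofReal (max K 0) := by simp
  rw [h5, ENNReal.ofReal_rpow_of_nonneg (le_max_right _ _) hp0.le,
    ← ENNReal.ofReal_mul (Real.rpow_nonneg (le_max_right _ _) _)]
  exact ENNReal.ofReal_le_ofReal h3

theorem lintegral_uniform {Ω : Type*} [MeasurableSpace Ω] {P : Measure Ω} [IsProbabilityMeasure P]
    {𝒟 : Type*} [MeasurableSpace 𝒟] [MeasurableSpace V] [MeasurableSingletonClass V]
    {I : Ω → V} {D : Ω → 𝒟} (hI : Measurable I) (hD : Measurable D)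
    (hu : ∀ i, P {ω | I ω = i} = (Fintype.card V : ℝ≥0∞)⁻¹) (hind : IndepFun I D P)
    {F : V → 𝒟 → ℝ≥0∞} (hF : ∀ i, Measurable (F i)) :
    ∫⁻ ω, F (I ω) (D ω) ∂P = (Fintype.card V : ℝ≥0∞)⁻¹ * ∑ i, ∫⁻ ω, F i (D ω) ∂P := by
  have : IsProbabilityMeasure (P.map I) := Measure.isProbabilityMeasure_map hI.aemeasurable
  rw [lintegral_prod_eq_of_indepFun (F := fun q : 𝒟 × V => F q.2 q.1) hD hI rfl hind
    (measurable_from_prod_countable_left fun i => hF i)]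
  have e : ∀ ω, ∫⁻ i, F i (D ω) ∂(P.map I) = ∑ i, F i (D ω) * (Fintype.card V : ℝ≥0∞)⁻¹ := fun ω => by
    rw [lintegral_fintype]
    refine Finset.sum_congr rfl fun i _ => ?_
    rw [Measure.map_apply hI (measurableSet_singleton i), ← hu i]
    rfl
  simp only [e]
  have hm : ∀ i, Measurable fun ω => F i (D ω) * (Fintype.card V : ℝ≥0∞)⁻¹ := fun i =>
    ((hF i).comp hD).mul_const _
  rw [lintegral_finsetSum _ fun i _ => hm i, Finset.mul_sum]
  refine Finset.sum_congr rfl fun i _ => ?_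
  have hm' : Measurable fun ω => F i (D ω) := (hF i).comp hD
  rw [lintegral_mul_const _ hm', mul_comm]

end GraphStep

/-! ### Conditional smallness and conditional uniform integrability -/

section Tail

variable {α : Type*} [MeasurableSpace α]

/-- Dominated convergence. The truncated difference `h - L` replaces the tail `h 1_{h > L}`; it
interacts better with sums and with `setLIntegral_le_tsub_add`. -/
theorem exists_lintegral_tsub_le {ρ : Measure α} {h : α → ℝ≥0∞} (hm : Measurable h)
    (hh : ∫⁻ x, h x ∂ρ ≠ ∞) {ε : ℝ≥0∞} (hε : ε ≠ 0) :
    ∃ L : ℕ, ∫⁻ x, h x - L ∂ρ ≤ ε := by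
  have h1 : Tendsto (fun L : ℕ => ∫⁻ x, h x - L ∂ρ) atTop (𝓝 (∫⁻ _, 0 ∂ρ)) := by
    refine tendsto_lintegral_of_dominated_convergence h (fun n => hm.sub_const _)
      (fun n => Eventually.of_forall fun x => tsub_le_self) hh ?_
    filter_upwards [ae_lt_top hm hh] with x hx
    refine tendsto_const_nhds.congr' ?_
    obtain ⟨n, hn⟩ := ENNReal.exists_nat_gt hx.ne
    filter_upwards [eventually_ge_atTop n] with m hmn
    exact (tsub_eq_zero_of_le (hn.le.trans (by exact_mod_cast hmn))).symm
  rw [lintegral_zero] at h1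
  exact ((ENNReal.tendsto_nhds_zero.1 h1) ε (pos_iff_ne_zero.2 hε)).exists

theorem setLIntegral_le_tsub_add {μ : Measure α} (f : α → ℝ≥0∞) (L : ℝ≥0∞) (S B : Set α) :
    ∫⁻ x in S ∩ B, f x ∂μ ≤ ∫⁻ x in S, f x - L ∂μ + L * μ B := by
  calc ∫⁻ x in S ∩ B, f x ∂μ ≤ ∫⁻ x in S ∩ B, ((f x - L) + L) ∂μ :=
        lintegral_mono fun x => le_tsub_add
    _ = ∫⁻ x in S ∩ B, (f x - L) ∂μ + ∫⁻ _ in S ∩ B, L ∂μ := lintegral_add_right _ measurable_const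
    _ ≤ _ := by
        rw [setLIntegral_const]
        gcongr
        · exact Set.inter_subset_left
        · exact Set.inter_subset_right

end Tail

section CondCalculus

variable {Ω : ℕ → Type*} [∀ n, MeasurableSpace (Ω n)] {P : ∀ n, Measure (Ω n)}
  {𝒳 : ℕ → Type*} [∀ n, MeasurableSpace (𝒳 n)] {X : ∀ n, Ω n → 𝒳 n}

/-- The integrals `y n S` over `X n ∈ S` are small for sets `S` with `P n (X n ∈ S)` close
to `1`. -/
def CondNeg (P : ∀ n, Measure (Ω n)) (X : ∀ n, Ω n → 𝒳 n) (y : ∀ n, Set (𝒳 n) → ℝ≥0∞) : Prop :=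
  ∀ ε : ℝ≥0∞, ε ≠ 0 → ∀ᶠ n in atTop, ∃ S : Set (𝒳 n), MeasurableSet S ∧
    P n (X n ⁻¹' Sᶜ) ≤ ε ∧ y n S ≤ ε

/-- Uniform integrability after conditioning on `X n`, up to events of small probability. -/
def CondUI (P : ∀ n, Measure (Ω n)) (X : ∀ n, Ω n → 𝒳 n) (f : ∀ n, Ω n → ℝ≥0∞) : Prop :=
  ∀ ε : ℝ≥0∞, ε ≠ 0 → ∃ δ : ℝ≥0∞, δ ≠ 0 ∧ ∀ᶠ n in atTop, ∃ S : Set (𝒳 n), MeasurableSet S ∧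
    P n (X n ⁻¹' Sᶜ) ≤ ε ∧ ∀ B, MeasurableSet B → P n B ≤ δ →
      ∫⁻ ω in X n ⁻¹' S ∩ B, f n ω ∂P n ≤ ε

theorem exists_mul_le {C ε : ℝ≥0∞} (hC : C ≠ ∞) (hε : ε ≠ 0) :
    ∃ δ : ℝ≥0∞, δ ≠ 0 ∧ δ ≤ ε ∧ C * δ ≤ ε := by
  rcases eq_or_ne ε ∞ with rfl | hε'
  · exact ⟨1, one_ne_zero, le_top, le_top⟩
  · refine ⟨ε / (C + 1), ?_, ?_, ?_⟩
    · exact (ENNReal.div_pos hε (ENNReal.add_ne_top.2 ⟨hC, ENNReal.one_ne_top⟩)).ne'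
    · exact ENNReal.div_le_of_le_mul (le_mul_of_one_le_right zero_le le_add_self)
    · rw [← mul_div_assoc]
      refine ENNReal.div_le_of_le_mul ?_
      rw [mul_comm]
      gcongr
      exact le_self_add

/-- Integrals of functions of variables with a fixed law are conditionally uniformly integrable. -/
theorem condUI_of_law {𝒯 : Type*} [MeasurableSpace 𝒯] {ρ : Measure 𝒯} {h : 𝒯 → ℝ≥0∞}
    (hm : Measurable h) (hh : ∫⁻ x, h x ∂ρ ≠ ∞) {T : ∀ n, Ω n → 𝒯}
    (hT : ∀ n, MeasurePreserving (T n) (P n) ρ) : CondUI P X fun n ω => h (T n ω) := by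
  intro ε hε
  have hε2 : ε / 2 ≠ 0 := (ENNReal.half_pos hε).ne'
  obtain ⟨L, hL⟩ := exists_lintegral_tsub_le hm hh hε2
  obtain ⟨δ, hδ, -, hδL⟩ := exists_mul_le (ENNReal.natCast_ne_top L) hε2
  refine ⟨δ, hδ, Eventually.of_forall fun n => ⟨Set.univ, MeasurableSet.univ, by simp, ?_⟩⟩
  intro B _ hB
  refine (setLIntegral_le_tsub_add _ (L : ℝ≥0∞) _ _).trans ?_
  rw [Set.preimage_univ, Measure.restrict_univ, ← ENNReal.add_halves ε,
    (hT n).lintegral_comp (f := fun x => h x - L) (hm.sub_const _)]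
  exact add_le_add hL ((mul_le_mul_right hB _).trans hδL)

theorem tendstoInProb_zero_iff (Y : ∀ n, Ω n → ℝ≥0∞) : TendstoInProb P Y 0 ↔
    ∀ ε : ℝ≥0∞, ε ≠ 0 → ∀ η : ℝ≥0∞, η ≠ 0 → ∀ᶠ n in atTop, P n {ω | ε ≤ Y n ω} ≤ η := by
  unfold TendstoInProb
  simp only [tsub_zero, zero_tsub, add_zero, ENNReal.tendsto_nhds_zero, pos_iff_ne_zero]

theorem measure_ge_le_of_setLIntegral {α : Type*} [MeasurableSpace α] {μ : Measure α}
    {Y : α → ℝ≥0∞} (hY : Measurable Y) {S : Set α} {ε η : ℝ≥0∞} (hS : μ Sᶜ ≤ η)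
    (hε : ε ≠ 0) (hε' : ε ≠ ∞) (h : ∫⁻ x in S, Y x ∂μ ≤ ε * η) : μ {x | ε ≤ Y x} ≤ η + η := by
  have h1 : ε * μ ({x | ε ≤ Y x} ∩ S) ≤ ε * η := by
    rw [← Measure.restrict_apply (measurableSet_le measurable_const hY)]
    exact (mul_meas_ge_le_lintegral hY ε).trans h
  have h2 : μ ({x | ε ≤ Y x} ∩ S) ≤ η := (ENNReal.mul_le_mul_iff_right hε hε').1 h1
  calc μ {x | ε ≤ Y x} ≤ μ (({x | ε ≤ Y x} ∩ S) ∪ Sᶜ) := measure_mono fun x hx => by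
        by_cases hxS : x ∈ S
        · exact Or.inl ⟨hx, hxS⟩
        · exact Or.inr hxS
    _ ≤ η + η := (measure_union_le _ _).trans (add_le_add h2 hS)

/-- The events `X n ∈ S` are measurable for the conditioning σ-algebra, so the conditional
expectation has the same integral there as `Y n`, and Markov's inequality applies. A threshold `∞`
is reduced to the threshold `1`. -/
theorem tendstoInProb_condLExp [∀ n, IsProbabilityMeasure (P n)] (hX : ∀ n, Measurable (X n))
    (Y : ∀ n, Ω n → ℝ≥0∞) (h : CondNeg P X fun n S => ∫⁻ ω in X n ⁻¹' S, Y n ω ∂P n) :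
    TendstoInProb P (fun n => condLExp (MeasurableSpace.comap (X n) inferInstance) (P n) (Y n)) 0 := by
  rw [tendstoInProb_zero_iff]
  have key : ∀ ε : ℝ≥0∞, ε ≠ 0 → ε ≠ ∞ → ∀ η : ℝ≥0∞, η ≠ 0 → ∀ᶠ n in atTop, P n {ω | ε ≤
      condLExp (MeasurableSpace.comap (X n) inferInstance) (P n) (Y n) ω} ≤ η := by
    intro ε hε hε' η hη
    have hη2 : η / 2 ≠ 0 := (ENNReal.half_pos hη).ne'
    filter_upwards [h (min (η / 2) (ε * (η / 2))) (by simp [hη2, hε])] with n ⟨S, hS, h1, h2⟩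
    rw [← ENNReal.add_halves η]
    refine measure_ge_le_of_setLIntegral (measurable_condLExp' _ _ _) (S := X n ⁻¹' S)
      (h1.trans (min_le_left _ _)) hε hε' ?_
    rw [setLIntegral_condLExp (hX n).comap_le _ _ ⟨S, hS, rfl⟩]
    exact h2.trans (min_le_right _ _)
  intro ε hε η hη
  rcases eq_or_ne ε ∞ with rfl | hε'
  · filter_upwards [key 1 one_ne_zero ENNReal.one_ne_top η hη] with n hn
    refine le_trans (measure_mono fun ω (hω : ∞ ≤ _) => ?_) hn
    exact le_trans le_top hω
  · exact key ε hε hε' η hη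

theorem tendstoInProb_sup (Y : ℕ → ∀ n, Ω n → ℝ≥0∞) (s : Finset ℕ)
    (h : ∀ r ∈ s, TendstoInProb P (Y r) 0) :
    TendstoInProb P (fun n ω => s.sup fun r => Y r n ω) 0 := by
  rw [tendstoInProb_zero_iff]
  intro ε hε η hη
  have hη' : η / (s.card + 1 : ℕ) ≠ 0 := by
    simp only [ne_eq, ENNReal.div_eq_zero_iff, hη, false_or]
    exact ENNReal.natCast_ne_top _
  have h1 : ∀ᶠ n in atTop, ∀ r ∈ s, P n {ω | ε ≤ Y r n ω} ≤ η / (s.card + 1 : ℕ) :=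
    (Finset.eventually_all s).2 fun r hr => (tendstoInProb_zero_iff _).1 (h r hr) ε hε _ hη'
  filter_upwards [h1] with n hn
  calc P n {ω | ε ≤ s.sup fun r => Y r n ω} ≤ P n (⋃ r ∈ s, {ω | ε ≤ Y r n ω}) := by
        refine measure_mono fun ω hω => ?_
        have hω' : ε ≤ s.sup fun r => Y r n ω := hω
        rw [Finset.le_sup_iff (pos_iff_ne_zero.2 hε)] at hω'
        obtain ⟨r, hr, hr'⟩ := hω'
        exact Set.mem_iUnion₂.2 ⟨r, hr, hr'⟩
    _ ≤ ∑ r ∈ s, P n {ω | ε ≤ Y r n ω} := measure_biUnion_finset_le _ _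
    _ ≤ ∑ r ∈ s, η / (s.card + 1 : ℕ) := Finset.sum_le_sum hn
    _ = s.card * (η / (s.card + 1 : ℕ)) := by rw [Finset.sum_const, nsmul_eq_mul]
    _ ≤ η := by
        rw [← mul_div_assoc]
        refine ENNReal.div_le_of_le_mul ?_
        rw [mul_comm]
        gcongr
        simp

/-- Where the conditional probability is below `ε / 2` it integrates to at most `ε / 2`, and the
complementary event has probability at most `ε / 2`. Conditional smallness in probability thus
becomes unconditional smallness. -/
theorem measure_le_of_condProb {α : Type*} {m m₀ : MeasurableSpace α} (hm : m ≤ m₀)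
    {μ : Measure α} [IsProbabilityMeasure μ] {E : Set α} (hE : MeasurableSet E) {ε : ℝ≥0∞}
    (hn : μ {x | ε / 2 ≤ condProb μ m E x} ≤ ε / 2) : μ E ≤ ε := by
  set q := condProb μ m E with hq
  have hqm : Measurable[m] q := measurable_condLExp _ _ _
  set G : Set α := {ω | ε / 2 ≤ q ω} with hG
  have hGm : MeasurableSet[m] G := @measurableSet_le _ _ _ _ _ m _ _ _ _ _ measurable_const hqm
  have hGm' : MeasurableSet G := hm _ hGm
  have h1 : ∀ S : Set α, MeasurableSet[m] S → μ (E ∩ S) = ∫⁻ ω in S, q ω ∂μ := by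
    intro S hS
    rw [hq, condProb, setLIntegral_condLExp hm _ _ hS, lintegral_indicator hE,
      setLIntegral_const, one_mul, Measure.restrict_apply hE]
  calc μ E ≤ μ (E ∩ Gᶜ ∪ G) := measure_mono fun ω hω => by
        by_cases hc : ω ∈ G
        · exact Or.inr hc
        · exact Or.inl ⟨hω, hc⟩
    _ ≤ μ (E ∩ Gᶜ) + μ G := measure_union_le _ _
    _ ≤ ε / 2 + ε / 2 := by
        refine add_le_add ?_ hn
        rw [h1 _ hGm.compl]
        calc ∫⁻ ω in Gᶜ, q ω ∂μ ≤ ∫⁻ _ in Gᶜ, ε / 2 ∂μ := by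
              refine setLIntegral_mono' hGm'.compl fun ω hω => ?_
              exact (not_le.1 (show ¬ ε / 2 ≤ q ω from hω)).le
          _ ≤ ε / 2 := by
              rw [setLIntegral_const]
              exact (mul_le_mul_right prob_le_one _).trans_eq (mul_one _)
    _ = ε := ENNReal.add_halves ε

theorem measure_compl_le_of_condProb {α : Type*} {m m₀ : MeasurableSpace α} (hm : m ≤ m₀)
    {μ : Measure α} [IsProbabilityMeasure μ] {E : Set α} (hE : MeasurableSet E) {ε : ℝ≥0∞}
    (hn : μ {x | ε / 2 ≤ (condProb μ m E x - 1) + (1 - condProb μ m E x)} ≤ ε / 2) :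
    μ Eᶜ ≤ ε := by
  set q := condProb μ m E with hq
  set G : Set α := {ω | ε / 2 ≤ (q ω - 1) + (1 - q ω)} with hG
  have h1 : μ E = ∫⁻ ω, q ω ∂μ := by
    have := setLIntegral_condLExp hm μ (E.indicator fun _ => 1) (@MeasurableSet.univ _ m)
    rw [Measure.restrict_univ, lintegral_indicator hE, setLIntegral_const,
      one_mul] at this
    exact this.symm
  have hqm : Measurable q := measurable_condLExp' _ _ _
  have hGm : MeasurableSet G :=
    measurableSet_le measurable_const ((hqm.sub_const 1).add (hqm.const_sub 1))
  have h2 : (1 : ℝ≥0∞) ≤ μ E + ε := by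
    calc (1 : ℝ≥0∞) = ∫⁻ _, 1 ∂μ := by simp
      _ ≤ ∫⁻ ω, (q ω + (ε / 2 + G.indicator 1 ω)) ∂μ := by
          refine lintegral_mono fun ω => ?_
          by_cases hω : ω ∈ G
          · simp only [Set.indicator_of_mem hω, Pi.one_apply]
            exact le_add_of_le_right le_add_self
          · have h3 : (q ω - 1) + (1 - q ω) < ε / 2 := not_le.1 hω
            have h4 : 1 - q ω ≤ ε / 2 := le_add_self.trans h3.le
            calc (1 : ℝ≥0∞) ≤ q ω + ε / 2 := tsub_le_iff_left.1 h4
              _ ≤ _ := by gcongr; exact le_self_add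
      _ = μ E + (ε / 2 + μ G) := by
          rw [lintegral_add_left hqm, lintegral_add_left measurable_const, ← h1,
            lintegral_indicator_one hGm]
          simp
      _ ≤ μ E + (ε / 2 + ε / 2) := by gcongr
      _ = _ := by rw [ENNReal.add_halves]
  rw [prob_compl_eq_one_sub hE]
  exact tsub_le_iff_left.2 h2

/-- A nearly optimal coupling exists because the inequality is strict. Along it `|x|^p ≤ 4^p (|x -
y|^p + |y|^p)`, and `L` is subtracted from the last term. -/
theorem lintegral_tsub_le_of_wasserstein_lt {p : ℝ} (hp : 1 ≤ p) {μ ν : Measure ℝ} {η : ℝ≥0∞}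
    (h : wasserstein p μ ν < η) (L : ℝ≥0∞) :
    ∫⁻ x, ‖x‖ₑ ^ p - 4 ^ p * L ∂μ ≤ 4 ^ p * (η ^ p + ∫⁻ x, ‖x‖ₑ ^ p - L ∂ν) := by
  have hp0 : 0 < p := by linarith
  unfold wasserstein at h
  have h1 : (⨅ γ ∈ {γ : Measure (ℝ × ℝ) | γ.map Prod.fst = μ ∧ γ.map Prod.snd = ν},
      ∫⁻ q, ‖q.1 - q.2‖ₑ ^ p ∂γ) < η ^ p := by
    have := ENNReal.rpow_lt_rpow h hp0
    rwa [← ENNReal.rpow_mul, one_div, inv_mul_cancel₀ hp0.ne', ENNReal.rpow_one] at this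
  obtain ⟨γ, h2⟩ := iInf_lt_iff.1 h1
  obtain ⟨⟨rfl, rfl⟩, h3⟩ := iInf_lt_iff.1 h2
  have m1 : Measurable fun x : ℝ => ‖x‖ₑ ^ p - 4 ^ p * L := by fun_prop
  have m2 : Measurable fun x : ℝ => ‖x‖ₑ ^ p - L := by fun_prop
  rw [lintegral_map m1 measurable_fst, lintegral_map m2 measurable_snd]
  calc ∫⁻ q, ‖q.1‖ₑ ^ p - 4 ^ p * L ∂γ ≤
        ∫⁻ q, 4 ^ p * (‖q.1 - q.2‖ₑ ^ p + (‖q.2‖ₑ ^ p - L)) ∂γ := by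
        refine lintegral_mono fun q => tsub_le_iff_right.2 ?_
        have : ‖q.1‖ₑ ^ p ≤ 4 ^ p * (‖q.1 - q.2‖ₑ ^ p + ‖q.2‖ₑ ^ p) := by
          refine le_trans (ENNReal.rpow_le_rpow ?_ hp0.le) (add_rpow_le hp _ _)
          calc ‖q.1‖ₑ = ‖(q.1 - q.2) + q.2‖ₑ := by ring_nf
            _ ≤ _ := enorm_add_le _ _
        refine this.trans ?_
        rw [← mul_add, add_assoc]
        gcongr
        exact le_tsub_add
    _ ≤ _ := by
        rw [lintegral_const_mul' _ _ (four_rpow_ne_top p hp), lintegral_add_left (by fun_prop)]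
        gcongr

/-- Convergence in `d_p` of conditional laws implies conditional uniform integrability. -/
theorem condUI_of_wasserstein [∀ n, IsProbabilityMeasure (P n)] (hX : ∀ n, Measurable (X n))
    {p : ℝ} (hp : 1 ≤ p) {f : ∀ n, Ω n → ℝ} (hf : ∀ n, Measurable (f n)) {ν : Measure ℝ}
    (hν : ∫⁻ x, ‖x‖ₑ ^ p ∂ν ≠ ∞)
    (h : TendstoInProb P (fun n ω => wasserstein p
      (condDistrib (f n) (X n) (P n) (X n ω)) ν) 0) :
    CondUI P X fun n ω => ‖f n ω‖ₑ ^ p := by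
  have hp0 : 0 < p := by linarith
  intro ε hε
  have hε2 : ε / 2 ≠ 0 := (ENNReal.half_pos hε).ne'
  obtain ⟨ε₁, hε₁, -, hε₁'⟩ := exists_mul_le (C := 4 ^ p * (1 + 1))
    (ENNReal.mul_ne_top (four_rpow_ne_top p hp) (by simp)) hε2
  obtain ⟨L, hL⟩ := exists_lintegral_tsub_le (ρ := ν) (h := fun x : ℝ => ‖x‖ₑ ^ p) (by fun_prop)
    hν hε₁
  set L' : ℝ≥0∞ := 4 ^ p * L with hL'
  obtain ⟨δ, hδ, -, hδL⟩ := exists_mul_le (C := L')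
    (ENNReal.mul_ne_top (four_rpow_ne_top p hp) (ENNReal.natCast_ne_top L)) hε2
  have hη : ε₁ ^ (1 / p) ≠ 0 := by
    simp only [ne_eq, ENNReal.rpow_eq_zero_iff]
    rintro (⟨h1, -⟩ | ⟨-, h1⟩)
    · exact hε₁ h1
    · have : 0 < 1 / p := by positivity
      linarith
  refine ⟨δ, hδ, ?_⟩
  filter_upwards [(tendstoInProb_zero_iff _).1 h _ hη _ hε] with n hn
  set κ := condDistrib (f n) (X n) (P n)
  have mφ : Measurable fun x : ℝ => ‖x‖ₑ ^ p - L' := by fun_prop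
  -- The conditioning values at which the conditional law has a small tail. Outside `S` its distance
  -- to `ν` is at least `ε₁ ^ (1 / p)`, which is improbable.
  set S : Set (𝒳 n) := {x | ∫⁻ y, ‖y‖ₑ ^ p - L' ∂(κ x) ≤ ε / 2} with hS
  have hSm : MeasurableSet S := measurableSet_le (mφ.lintegral_kernel) measurable_const
  refine ⟨S, hSm, (measure_mono fun ω hω => ?_).trans hn, fun B _ hB => ?_⟩
  · change ε₁ ^ (1 / p) ≤ wasserstein p (κ (X n ω)) ν
    by_contra hcon
    refine hω ?_
    change ∫⁻ y, ‖y‖ₑ ^ p - L' ∂(κ (X n ω)) ≤ ε / 2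
    refine (lintegral_tsub_le_of_wasserstein_lt hp (not_le.1 hcon) L).trans (le_trans ?_ hε₁')
    rw [← ENNReal.rpow_mul, one_div, inv_mul_cancel₀ hp0.ne', ENNReal.rpow_one, mul_assoc, add_mul,
      one_mul]
    gcongr
  · refine (setLIntegral_le_tsub_add _ L' _ _).trans ?_
    rw [← ENNReal.add_halves ε]
    refine add_le_add ?_ ((mul_le_mul_right hB _).trans hδL)
    have hF : Measurable fun q : 𝒳 n × ℝ => S.indicator (fun _ => (1 : ℝ≥0∞)) q.1 *
        (‖q.2‖ₑ ^ p - L') :=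
      ((measurable_const.indicator hSm).comp measurable_fst).mul (mφ.comp measurable_snd)
    have e1 : ∫⁻ ω in X n ⁻¹' S, (‖f n ω‖ₑ ^ p - L') ∂(P n) =
        ∫⁻ q, S.indicator (fun _ => (1 : ℝ≥0∞)) q.1 * (‖q.2‖ₑ ^ p - L')
          ∂((P n).map fun ω => (X n ω, f n ω)) := by
      rw [lintegral_map hF ((hX n).prodMk (hf n)), ← lintegral_indicator ((hX n) hSm)]
      refine lintegral_congr fun ω => ?_
      by_cases hω : X n ω ∈ S
      · rw [Set.indicator_of_mem (show ω ∈ X n ⁻¹' S from hω), Set.indicator_of_mem hω, one_mul]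
      · rw [Set.indicator_of_notMem (show ω ∉ X n ⁻¹' S from hω), Set.indicator_of_notMem hω,
          zero_mul]
    have : IsProbabilityMeasure ((P n).map (X n)) :=
      Measure.isProbabilityMeasure_map (hX n).aemeasurable
    rw [e1, ← compProd_map_condDistrib (hf n).aemeasurable, Measure.lintegral_compProd hF]
    calc _ ≤ ∫⁻ _, ε / 2 ∂((P n).map (X n)) := by
          refine lintegral_mono fun x => ?_
          dsimp only
          by_cases hx : x ∈ S
          · simp only [Set.indicator_of_mem hx, one_mul]
            exact hx
          · simp [Set.indicator_of_notMem hx]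
      _ = ε / 2 := by simp

end CondCalculus

/-! ### The coupling of the recursions on the graph and on the tree -/

section Regular

variable {A : Type a} {Z : Type v} {Ξ : Type w} [MeasurableSpace Z] [MeasurableSpace Ξ]
  [MetricSpace A] [MeasurableSpace A]

/-- The assumptions that concern only the recursion and the limiting tree. -/
structure Regular (M : Recursion A Z Ξ) (B : Bounds A) (p : ℝ) (μ₀ : ProbabilityMeasure ℝ)
    (π₀ π₁ : ProbabilityMeasure (ℕ × Mark A)) : Prop where
  one_le : 1 ≤ p
  meas : M.IsMeasurable
  meas_g : Measurable (Function.uncurry M.g)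
  meas_sm : Measurable B.sm
  meas_sp : Measurable B.sp
  meas_β : Measurable B.β
  lip : ∀ (x : Mark A) (r r' : ℝ), |M.g r x - M.g r' x| ≤ B.sp x * |r - r'|
  root_bounds : ∀ᵐ y ∂(π₀ : Measure (ℕ × Mark A)), BoundsAt M B p y.1 y.2
  node_bounds : ∀ᵐ y ∂(π₁ : Measure (ℕ × Mark A)), BoundsAt M B p y.1 y.2
  holder : ∃ H Q α γ : ℝ, 0 < H ∧ 0 < Q ∧ 0 < α ∧ 0 < γ ∧
    ∀ x x' : Mark A, markDist x x' < 1 →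
      (∀ v : ℕ → ℝ,
        eLpNorm (fun q : Z × (ℕ → Ξ) => M.Φ x q.1 (offFamily x.1 fun j => (v j, q.2 j))
            - M.Φ x' q.1 (offFamily x.1 fun j => (v j, q.2 j)))
            (ENNReal.ofReal p) (M.stepLaw ℕ)
          ≤ ENNReal.ofReal (H * max 1 (∑ j ∈ Finset.range x.1, B.sm x * |v j| + B.β x) *
              markDist x x' ^ α)) ∧
      ∀ r : ℝ, |M.g r x - M.g r x'| ≤ Q * max 1 (B.sp x * |r|) * markDist x x' ^ γ
  mom : MomentBounds M B p π₀ π₁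
  init : ∫⁻ r, ‖r‖ₑ ^ p ∂(μ₀ : Measure ℝ) ≠ ∞

variable {M : Recursion A Z Ξ} {B : Bounds A} {p : ℝ} {μ₀ : ProbabilityMeasure ℝ}
  {π₀ π₁ : ProbabilityMeasure (ℕ × Mark A)}

theorem exists_rpow_le {p α γ : ℝ} (hp : 1 ≤ p) (hα : 0 < α) (hγ : 0 < γ) {η : ℝ≥0∞} (hη : η ≠ 0) :
    ∃ ε : ℝ, 0 < ε ∧ ε < 1 ∧ ENNReal.ofReal (ε ^ α) ^ p ≤ η ∧ ENNReal.ofReal (ε ^ γ) ^ p ≤ η := by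
  have h1 : ∀ α : ℝ, 0 < α → Tendsto (fun ε : ℝ => ENNReal.ofReal (ε ^ α) ^ p) (𝓝 0) (𝓝 0) := by
    intro α hα
    have h2 : Tendsto (fun ε : ℝ => ENNReal.ofReal (ε ^ α)) (𝓝 0) (𝓝 (ENNReal.ofReal ((0 : ℝ) ^ α))) :=
      (ENNReal.continuous_ofReal.tendsto _).comp ((Real.continuousAt_rpow_const 0 α (Or.inr hα.le)))
    rw [Real.zero_rpow hα.ne', ENNReal.ofReal_zero] at h2
    have h3 := ((ENNReal.continuous_rpow_const (y := p)).tendsto 0).comp h2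
    rwa [ENNReal.zero_rpow_of_pos (by linarith)] at h3
  have h4 : ∀ᶠ ε : ℝ in 𝓝[>] 0, 0 < ε ∧ ε < 1 ∧ ENNReal.ofReal (ε ^ α) ^ p ≤ η ∧
      ENNReal.ofReal (ε ^ γ) ^ p ≤ η := by
    have h5 := ENNReal.tendsto_nhds_zero.1 ((h1 α hα).mono_left (nhdsWithin_le_nhds (s := Set.Ioi (0:ℝ)))) η
      (pos_iff_ne_zero.2 hη)
    have h6 := ENNReal.tendsto_nhds_zero.1 ((h1 γ hγ).mono_left (nhdsWithin_le_nhds (s := Set.Ioi (0:ℝ)))) η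
      (pos_iff_ne_zero.2 hη)
    filter_upwards [h5, h6, self_mem_nhdsWithin,
      nhdsWithin_le_nhds (Iio_mem_nhds (zero_lt_one' ℝ))] with ε a b c d using ⟨c, d, a, b⟩
  exact h4.exists

/-- The recursion on the tree is bounded in `L^p` by an integrable function of the tree, and it is
stable under small perturbations of the marks. -/
theorem Regular.exists_majorant (h : Regular M B p μ₀ π₀ π₁) :
    ∃ m : ℕ → (List ℕ → ℕ × Mark A) → ℝ≥0∞, (∀ r, Measurable (m r)) ∧
      (∀ r, ∫⁻ t, m r t ∂(gwLaw π₀ π₁) ≠ ∞) ∧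
      (∀ᵐ t ∂(gwLaw π₀ π₁), ∀ r,
        ∫⁻ w, ‖treeR M t w r []‖ₑ ^ p ∂(M.noiseLaw μ₀ (List ℕ) (List ℕ)) ≤ m r t) ∧
      ∀ η : ℝ≥0∞, η ≠ 0 → ∃ ε : ℝ, 0 < ε ∧ ε < 1 ∧ ∀ᵐ t ∂(gwLaw π₀ π₁),
        ∀ (X : List ℕ → Mark A) (K : ℕ),
          (∀ i ∈ treeNodes t K, i.length < K → (t i).1 = (t i).2.1) →
          (∀ i ∈ treeNodes t K, markDist (t i).2 (X i) ≤ ε) → ∀ r ≤ K,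
            ∫⁻ w, ‖treeR M (fun l => ((t l).1, X l)) w r [] - treeR M t w r []‖ₑ ^ p
              ∂(M.noiseLaw μ₀ (List ℕ) (List ℕ)) ≤ η * m r t := by
  obtain ⟨H, Q, α, γ, hH, hQ, hα, hγ, hhol⟩ := h.holder
  have hp := h.one_le
  have hp0 : 0 ≤ p := by linarith
  have h4 := four_rpow_ne_top p hp
  have hr : ∀ x : ℝ, ENNReal.ofReal x ^ p ≠ ∞ := fun x =>
    ENNReal.rpow_ne_top_of_nonneg hp0 ENNReal.ofReal_ne_top
  set c₁ : ℝ≥0∞ := 4 ^ p * (ENNReal.ofReal H ^ p * 4 ^ p *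
    (4 ^ p * (4 ^ p * (2 * ENNReal.ofReal Q ^ p + 2)))) +
      4 ^ p * (4 ^ p * (2 * ENNReal.ofReal Q ^ p + 1)) with hc₁
  have hc₁' : c₁ ≠ ∞ := by
    have h5 : (2 * ENNReal.ofReal Q ^ p + 2) ≠ ∞ := ENNReal.add_ne_top.2
      ⟨ENNReal.mul_ne_top (by simp) (hr Q), by simp⟩
    have h6 : (2 * ENNReal.ofReal Q ^ p + 1) ≠ ∞ := ENNReal.add_ne_top.2
      ⟨ENNReal.mul_ne_top (by simp) (hr Q), by simp⟩
    refine ENNReal.add_ne_top.2 ⟨ENNReal.mul_ne_top h4 (ENNReal.mul_ne_top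
      (ENNReal.mul_ne_top (hr H) h4) (ENNReal.mul_ne_top h4 (ENNReal.mul_ne_top h4 h5))),
      ENNReal.mul_ne_top h4 (ENNReal.mul_ne_top h4 h6)⟩
  -- The sum dominates at once the three quantities required by the moment bound and by the
  -- perturbation bound.
  set c : ℝ≥0∞ := ∫⁻ r, ‖r‖ₑ ^ p ∂(μ₀ : Measure ℝ) + 4 ^ p * 4 ^ p + c₁ with hc
  have hc' : c ≠ ∞ := ENNReal.add_ne_top.2 ⟨ENNReal.add_ne_top.2
    ⟨h.init, ENNReal.mul_ne_top h4 h4⟩, hc₁'⟩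
  have hca : ∫⁻ r, ‖r‖ₑ ^ p ∂(μ₀ : Measure ℝ) ≤ c := by
    rw [hc, add_assoc]; exact le_self_add
  have hcb : (4 : ℝ≥0∞) ^ p * 4 ^ p ≤ c := by
    rw [hc, add_comm (∫⁻ r, ‖r‖ₑ ^ p ∂(μ₀ : Measure ℝ)), add_assoc]; exact le_self_add
  have hcc : c₁ ≤ c := le_add_self
  have hg0 : Measurable (M.g 0) := measurable_g_comp h.meas_g measurable_const measurable_id
  have hbd := ae_gwLaw (q := fun y => BoundsAt M B p y.1 y.2) h.root_bounds h.node_bounds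
  refine ⟨fun r t => majorant M B p c t r [], fun r =>
    measurable_majorant h.meas_sm h.meas_sp h.meas_β hg0 c r [], fun r =>
    h.mom.lintegral_majorant_ne_top hp h.meas_sm h.meas_sp h.meas_β hg0 hc' r, ?_, ?_⟩
  · filter_upwards [hbd] with t ht r using
      lintegral_treeR_le_majorant hp h.meas h.meas_g h.lip hca hcb ht r []
  · intro η hη
    obtain ⟨ε, hε0, hε1, hεα, hεγ⟩ := exists_rpow_le hp hα hγ
      (show min η 1 ≠ 0 by simp [hη])
    refine ⟨ε, hε0, hε1, ?_⟩
    filter_upwards [hbd] with t ht X K hN hX r hrK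
    refine (lintegral_treeR_sub_le hp h.meas h.meas_g h.lip hH hQ hα hγ hhol hca hcb hcc hε1 hεα hεγ
      (min_le_right _ _) ht (K := K) (fun i hi hl => hN i ⟨hi, hl.le⟩ hl)
      (fun i hi hl => hX i ⟨hi, hl⟩) r [] trivial (by simpa using hrK)).trans ?_
    gcongr
    exact min_le_left _ _

end Regular

theorem measurable_markDist {A : Type a} [MetricSpace A] [TopologicalSpace.SeparableSpace A]
    [MeasurableSpace A] [BorelSpace A] :
    Measurable fun q : Mark A × Mark A => markDist q.1 q.2 := by
  have : SecondCountableTopology A := UniformSpace.secondCountable_of_separable A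
  exact continuous_markDist.measurable

/-! ### A graph with noises and its coupled tree as one random system -/

section CoupledSystem

/-- A multigraph with vertex attributes and a root, and a marked tree with a map from its nodes to
the vertices. -/
abbrev CouplingData (V : Type*) (A : Type a) :=
  ((V → A) × (V → V → ℕ) × V) × (List ℕ → ℕ × Mark A) × (List ℕ → V)

variable {A : Type a} {Z : Type v} {Ξ : Type w} [MeasurableSpace Z] [MeasurableSpace Ξ]
  {V : Type*} {Ω : Type u}

/-- The graph and the coupled tree. -/
def couplingData (G : RandomDigraph Ω V A) (T : TreeCoupling Ω V A) (ω : Ω) : CouplingData V A :=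
  ((G.att ω, G.mult ω, G.root ω), T.node ω, T.θ ω)

/-- The marks of the vertices of the graph. -/
def CouplingData.mark [Fintype V] (d : CouplingData V A) (i : V) : Mark A :=
  graphMark d.1.1 d.1.2.1 i

/-- The graph and the tree agree up to generation `K`, with marks at distance at most `ε`. -/
def goodData (V : Type*) [Fintype V] {A : Type a} [MetricSpace A] (K : ℕ) (ε : ℝ) : Set (CouplingData V A) :=
  {d | Matches d.2.1 d.2.2 d.1.2.1 d.1.2.2 K ∧
    ∀ i ∈ treeNodes d.2.1 K, markDist (d.mark (d.2.2 i)) (d.2.1 i).2 ≤ ε}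

/-- The noises on the tree, on the product of the probability space with a space of noises. -/
def treeNoise (T : TreeCoupling Ω V A) (W : Ω → NoiseSpace V (V × V × ℕ) Z Ξ) (K : ℕ)
    (q : Ω × NoiseSpace (List ℕ) (List ℕ) Z Ξ) : NoiseSpace (List ℕ) (List ℕ) Z Ξ :=
  mergeNoise (coupledNodes (T.node q.1) (T.θ q.1) K) (T.θ q.1) (W q.1, q.2)

variable [MeasurableSpace Ω] [MeasurableSpace A] [MeasurableSpace V]

/-- A random multigraph with noises, and a marked Galton–Watson tree that is independent of the
vertex attributes; the noises are independent of the graph and of the tree. -/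
structure IsCoupledSystem [Fintype V] (M : Recursion A Z Ξ) (μ₀ : ProbabilityMeasure ℝ)
    (π₀ π₁ : ProbabilityMeasure (ℕ × Mark A)) (P : Measure Ω) (G : RandomDigraph Ω V A)
    (W : Ω → NoiseSpace V (V × V × ℕ) Z Ξ) (T : TreeCoupling Ω V A) : Prop where
  rooted : G.IsUniformlyRooted P
  measurable_noise : Measurable W
  map_noise : P.map W = M.noiseLaw μ₀ V (V × V × ℕ)
  indep_noise : IndepFun W (couplingData G T) P
  measurable_node : Measurable T.node
  measurable_θ : Measurable T.θ
  map_node : P.map T.node = gwLaw π₀ π₁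
  indep_node : IndepFun T.node G.att P

variable {M : Recursion A Z Ξ} {μ₀ : ProbabilityMeasure ℝ}
  {π₀ π₁ : ProbabilityMeasure (ℕ × Mark A)} {P : Measure Ω} [IsProbabilityMeasure P]
  {G : RandomDigraph Ω V A} {W : Ω → NoiseSpace V (V × V × ℕ) Z Ξ} {T : TreeCoupling Ω V A}

section MeasurableSets

variable [Fintype V] [MeasurableSingletonClass V]

theorem measurable_mark (i : V) : Measurable fun d : CouplingData V A => d.mark i :=
  (measurable_graphMark i).comp (f := fun d : CouplingData V A => (d.1.1, d.1.2.1))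
    (g := fun q : (V → A) × (V → V → ℕ) => graphMark q.1 q.2 i) (by fun_prop)

theorem measurable_mark_comp {α : Type*} [MeasurableSpace α] {d : α → CouplingData V A}
    {y : α → V} (hd : Measurable d) (hy : Measurable y) :
    Measurable fun x => (d x).mark (y x) :=
  measurable_eval_of_countable (f := fun x => (d x).mark)
    (measurable_pi_iff.2 fun i => (measurable_mark i).comp hd) hy

theorem measurable_rootR_data (hM : M.IsMeasurable) (hg : Measurable (Function.uncurry M.g))
    (r : ℕ) : Measurable fun q : CouplingData V A × NoiseSpace V (V × V × ℕ) Z Ξ =>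
      graphR M q.1.mark q.1.1.2.1 q.2 r q.1.1.2.2 := by
  have h1 : Measurable fun q : CouplingData V A × NoiseSpace V (V × V × ℕ) Z Ξ =>
      graphR M q.1.mark q.1.1.2.1 q.2 r :=
    measurable_pi_iff.2 fun i => (measurable_graphR hM hg r i).comp
      (f := fun q : CouplingData V A × NoiseSpace V (V × V × ℕ) Z Ξ =>
        ((q.1.1.1, q.1.1.2.1), q.2)) (by fun_prop)
  exact measurable_eval_of_countable h1 (by fun_prop)

theorem measurableSet_closeMarks [MetricSpace A] [TopologicalSpace.SeparableSpace A] [BorelSpace A]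
    (K : ℕ) (ε : ℝ) : MeasurableSet {d : CouplingData V A |
      ∀ i ∈ treeNodes d.2.1 K, markDist (d.mark (d.2.2 i)) (d.2.1 i).2 ≤ ε} := by
  have e : {d : CouplingData V A |
      ∀ i ∈ treeNodes d.2.1 K, markDist (d.mark (d.2.2 i)) (d.2.1 i).2 ≤ ε} =
        ⋂ i, ({d : CouplingData V A | i ∈ treeNodes d.2.1 K}ᶜ ∪
          {d : CouplingData V A | markDist (d.mark (d.2.2 i)) (d.2.1 i).2 ≤ ε}) := by
    ext d
    simp only [Set.mem_ofPred_eq, Set.mem_iInter, Set.mem_union, Set.mem_compl_iff, imp_iff_not_or]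
  have h3 : ∀ i : List ℕ, MeasurableSet {d : CouplingData V A | i ∈ treeNodes d.2.1 K} := fun i =>
    measurableSet_treeNodes (t := fun d : CouplingData V A => d.2.1) (by fun_prop) K i
  have h4 : ∀ i : List ℕ, Measurable fun d : CouplingData V A => d.mark (d.2.2 i) := fun i =>
    measurable_mark_comp (d := fun d : CouplingData V A => d) (y := fun d => d.2.2 i)
      measurable_id (by fun_prop)
  have h5 : ∀ i : List ℕ, MeasurableSet
      {d : CouplingData V A | markDist (d.mark (d.2.2 i)) (d.2.1 i).2 ≤ ε} := by
    intro i
    have h6 : Measurable fun d : CouplingData V A => (d.2.1 i).2 := by fun_prop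
    have h7 := (h4 i).prodMk h6
    have h8 := measurable_markDist.comp h7
    exact h8 measurableSet_Iic
  rw [e]
  exact MeasurableSet.iInter fun i => (h3 i).compl.union (h5 i)

theorem measurableSet_goodData [MetricSpace A] [TopologicalSpace.SeparableSpace A] [BorelSpace A]
    (K : ℕ) (ε : ℝ) : MeasurableSet (goodData (A := A) V K ε) := by
  have h1 : MeasurableSet {d : CouplingData V A | Matches d.2.1 d.2.2 d.1.2.1 d.1.2.2 K} :=
    measurableSet_matches (t := fun d : CouplingData V A => d.2.1) (θ := fun d => d.2.2)
      (mult := fun d => d.1.2.1) (y := fun d => d.1.2.2) (by fun_prop) (by fun_prop) (by fun_prop)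
      (by fun_prop) K
  exact h1.inter (measurableSet_closeMarks K ε)

end MeasurableSets

namespace IsCoupledSystem

section Integrals

variable [Fintype V] [MeasurableSingletonClass V] 

theorem measurable_data (h : IsCoupledSystem M μ₀ π₀ π₁ P G W T) :
    Measurable (couplingData G T) := by
  have := h.rooted.measurable_att
  have := h.rooted.measurable_mult
  have := h.rooted.measurable_root
  have := h.measurable_node
  have := h.measurable_θ
  unfold couplingData
  fun_prop

theorem setLIntegral_graph (h : IsCoupledSystem M μ₀ π₀ π₁ P G W T) {C : Set (CouplingData V A)}
    (hC : MeasurableSet C) {F : CouplingData V A × NoiseSpace V (V × V × ℕ) Z Ξ → ℝ≥0∞}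
    (hF : Measurable F) :
    ∫⁻ ω in couplingData G T ⁻¹' C, F (couplingData G T ω, W ω) ∂P =
      ∫⁻ ω in couplingData G T ⁻¹' C, ∫⁻ w, F (couplingData G T ω, w)
        ∂(M.noiseLaw μ₀ V (V × V × ℕ)) ∂P := by
  have hm := h.measurable_data
  rw [← lintegral_indicator (hm hC), ← lintegral_indicator (hm hC)]
  have := lintegral_prod_eq_of_indepFun hm h.measurable_noise h.map_noise h.indep_noise
    (F := (Prod.fst ⁻¹' C).indicator F) (hF.indicator (measurable_fst hC))
  refine Eq.trans ?_ (this.trans ?_)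
  · rfl
  · refine lintegral_congr fun ω => ?_
    by_cases hω : couplingData G T ω ∈ C
    · rw [Set.indicator_of_mem (by exact hω)]
      exact lintegral_congr fun w => Set.indicator_of_mem (by exact hω) _
    · rw [Set.indicator_of_notMem (by exact hω)]
      rw [← lintegral_zero (μ := M.noiseLaw μ₀ V (V × V × ℕ))]
      exact lintegral_congr fun w => Set.indicator_of_notMem (by exact hω) _

theorem setLIntegral_graph_tree (h : IsCoupledSystem M μ₀ π₀ π₁ P G W T)
    {C : Set (CouplingData V A)} (hC : MeasurableSet C)
    {F : CouplingData V A × NoiseSpace V (V × V × ℕ) Z Ξ × NoiseSpace (List ℕ) (List ℕ) Z Ξ → ℝ≥0∞}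
    (hF : Measurable F) :
    ∫⁻ q in Prod.fst ⁻¹' (couplingData G T ⁻¹' C), F (couplingData G T q.1, W q.1, q.2)
        ∂(P.prod (M.noiseLaw μ₀ (List ℕ) (List ℕ))) =
      ∫⁻ ω in couplingData G T ⁻¹' C, ∫⁻ w, F (couplingData G T ω, w)
        ∂((M.noiseLaw μ₀ V (V × V × ℕ)).prod (M.noiseLaw μ₀ (List ℕ) (List ℕ))) ∂P := by
  have hm := h.measurable_data
  have hW := h.measurable_noise
  have hmF : Measurable fun q : Ω × NoiseSpace (List ℕ) (List ℕ) Z Ξ =>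
      F (couplingData G T q.1, W q.1, q.2) :=
    hF.comp ((hm.comp measurable_fst).prodMk ((hW.comp measurable_fst).prodMk measurable_snd))
  have e : Prod.fst ⁻¹' (couplingData G T ⁻¹' C) =
      (couplingData G T ⁻¹' C) ×ˢ (Set.univ : Set (NoiseSpace (List ℕ) (List ℕ) Z Ξ)) := by
    ext; simp
  rw [e, ← Measure.prod_restrict, Measure.restrict_univ, lintegral_prod _ hmF.aemeasurable]
  have hF' : Measurable fun x : (CouplingData V A × NoiseSpace V (V × V × ℕ) Z Ξ) ×
      NoiseSpace (List ℕ) (List ℕ) Z Ξ => F (x.1.1, x.1.2, x.2) :=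
    hF.comp (by fun_prop)
  rw [h.setLIntegral_graph hC (F := fun x => ∫⁻ w, F (x.1, x.2, w)
    ∂(M.noiseLaw μ₀ (List ℕ) (List ℕ))) hF'.lintegral_prod_right']
  refine lintegral_congr fun ω => ?_
  rw [lintegral_prod]
  exact (hF.comp (measurable_const.prodMk measurable_id)).aemeasurable

/-- For fixed graph, tree and `θ`, the graph noises and the fresh noises merge into noises of the
prescribed law, which does not depend on these data. -/
theorem setLIntegral_tree (h : IsCoupledSystem M μ₀ π₀ π₁ P G W T) (K : ℕ)
    {C : Set (CouplingData V A)} (hC : MeasurableSet C)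
    {F : CouplingData V A × NoiseSpace (List ℕ) (List ℕ) Z Ξ → ℝ≥0∞} (hF : Measurable F) :
    ∫⁻ q in Prod.fst ⁻¹' (couplingData G T ⁻¹' C), F (couplingData G T q.1, treeNoise T W K q)
        ∂(P.prod (M.noiseLaw μ₀ (List ℕ) (List ℕ))) =
      ∫⁻ ω in couplingData G T ⁻¹' C, ∫⁻ w, F (couplingData G T ω, w)
        ∂(M.noiseLaw μ₀ (List ℕ) (List ℕ)) ∂P := by
  have hmerge : Measurable fun x : CouplingData V A × NoiseSpace V (V × V × ℕ) Z Ξ ×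
      NoiseSpace (List ℕ) (List ℕ) Z Ξ =>
      mergeNoise (coupledNodes x.1.2.1 x.1.2.2 K) x.1.2.2 x.2 :=
    measurable_mergeNoise (by fun_prop) (by fun_prop) (by fun_prop) K
  have := h.setLIntegral_graph_tree hC (F := fun x => F (x.1,
    mergeNoise (coupledNodes x.1.2.1 x.1.2.2 K) x.1.2.2 x.2))
    (hF.comp (measurable_fst.prodMk hmerge))
  refine Eq.trans ?_ (this.trans ?_)
  · rfl
  · refine lintegral_congr fun ω => ?_
    exact (measurePreserving_mergeNoise M μ₀ (injOn_coupledNodes (T.node ω) (T.θ ω) K)).lintegral_comp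
      (f := fun w => F (couplingData G T ω, w)) (hF.comp (measurable_const.prodMk measurable_id))

theorem measurable_treeNoise (h : IsCoupledSystem M μ₀ π₀ π₁ P G W T) (K : ℕ) :
    Measurable (treeNoise T W K) := by
  have h1 := h.measurable_node
  have h2 := h.measurable_θ
  have h3 := h.measurable_noise
  exact measurable_mergeNoise (by fun_prop) (by fun_prop) (by fun_prop) K

/-- The merged noises are built with `θ`, yet they are independent of graph and tree, since their
conditional law given these data is always the same. -/
theorem measurePreserving_data_treeNoise (h : IsCoupledSystem M μ₀ π₀ π₁ P G W T) (K : ℕ) :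
    MeasurePreserving (fun q => (couplingData G T q.1, treeNoise T W K q))
      (P.prod (M.noiseLaw μ₀ (List ℕ) (List ℕ)))
      ((P.map (couplingData G T)).prod (M.noiseLaw μ₀ (List ℕ) (List ℕ))) := by
  have hm := h.measurable_data
  have hmm : Measurable fun q : Ω × NoiseSpace (List ℕ) (List ℕ) Z Ξ =>
      (couplingData G T q.1, treeNoise T W K q) :=
    (hm.comp measurable_fst).prodMk (h.measurable_treeNoise K)
  refine ⟨hmm, Measure.ext_of_lintegral _ fun F hF => ?_⟩
  have := Measure.isProbabilityMeasure_map (μ := P) hm.aemeasurable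
  rw [lintegral_map hF hmm, lintegral_prod _ hF.aemeasurable,
    lintegral_map hF.lintegral_prod_right' hm]
  simpa using h.setLIntegral_tree K MeasurableSet.univ hF

theorem measurePreserving_node_treeNoise (h : IsCoupledSystem M μ₀ π₀ π₁ P G W T) (K : ℕ) :
    MeasurePreserving (fun q => (T.node q.1, treeNoise T W K q))
      (P.prod (M.noiseLaw μ₀ (List ℕ) (List ℕ)))
      ((gwLaw π₀ π₁).prod (M.noiseLaw μ₀ (List ℕ) (List ℕ))) := by
  have hm := h.measurable_data
  have := Measure.isProbabilityMeasure_map (μ := P) hm.aemeasurable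
  have h1 : MeasurePreserving (fun d : CouplingData V A => d.2.1) (P.map (couplingData G T))
      (gwLaw π₀ π₁) := by
    refine ⟨by fun_prop, ?_⟩
    rw [Measure.map_map (by fun_prop) hm, ← h.map_node]
    rfl
  exact (h1.prod (MeasurePreserving.id _)).comp (h.measurePreserving_data_treeNoise K)

/-- Tree and tree noises together are independent of the attributes. Hence the conditional law of
the tree value given the attributes is the unconditional one. -/
theorem measurePreserving_att_treeR (h : IsCoupledSystem M μ₀ π₀ π₁ P G W T)
    (hM : M.IsMeasurable) (hg : Measurable (Function.uncurry M.g)) (K r : ℕ) :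
    MeasurePreserving (fun q => (G.att q.1, treeR M (T.node q.1) (treeNoise T W K q) r []))
      (P.prod (M.noiseLaw μ₀ (List ℕ) (List ℕ)))
      ((P.map G.att).prod (rootLaw M μ₀ π₀ π₁ r)) := by
  have hm := h.measurable_data
  have hatt := h.rooted.measurable_att
  have hnode := h.measurable_node
  have := Measure.isProbabilityMeasure_map (μ := P) hm.aemeasurable
  have := Measure.isProbabilityMeasure_map (μ := P) hatt.aemeasurable
  have h1 : MeasurePreserving (fun d : CouplingData V A => (d.1.1, d.2.1))
      (P.map (couplingData G T)) ((P.map G.att).prod (gwLaw π₀ π₁)) := by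
    refine ⟨by fun_prop, ?_⟩
    rw [Measure.map_map (by fun_prop) hm, ← h.map_node,
      ← (indepFun_iff_map_prod_eq_prod_map_map hatt.aemeasurable hnode.aemeasurable).1
        h.indep_node.symm]
    rfl
  have h2 : MeasurePreserving (fun q : (List ℕ → ℕ × Mark A) × NoiseSpace (List ℕ) (List ℕ) Z Ξ =>
      treeR M q.1 q.2 r []) ((gwLaw π₀ π₁).prod (M.noiseLaw μ₀ (List ℕ) (List ℕ)))
      (rootLaw M μ₀ π₀ π₁ r) := ⟨measurable_treeR hM hg r [], rfl⟩
  have : SFinite (rootLaw M μ₀ π₀ π₁ r) := by unfold rootLaw; infer_instance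
  have h3 := ((MeasurePreserving.id (P.map G.att)).prod h2).comp
    ((measurePreserving_prodAssoc (P.map G.att) (gwLaw π₀ π₁)
      (M.noiseLaw μ₀ (List ℕ) (List ℕ))).comp ((h1.prod (MeasurePreserving.id _)).comp
      (h.measurePreserving_data_treeNoise K)))
  exact h3

end Integrals

end IsCoupledSystem

end CoupledSystem

/-! ### The distance of the two recursions on the good and the bad event -/

namespace IsCoupledSystem

variable {A : Type a} {Z : Type v} {Ξ : Type w} [MeasurableSpace Z] [MeasurableSpace Ξ]
  {V : Type*} {Ω : Type u} [MeasurableSpace Ω] [MeasurableSpace A] [MeasurableSpace V]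
  {M : Recursion A Z Ξ} {μ₀ : ProbabilityMeasure ℝ} {B : Bounds A} {p : ℝ}
  {π₀ π₁ : ProbabilityMeasure (ℕ × Mark A)} {P : Measure Ω} [IsProbabilityMeasure P]
  {G : RandomDigraph Ω V A} {W : Ω → NoiseSpace V (V × V × ℕ) Z Ξ} {T : TreeCoupling Ω V A}
  [Fintype V] [MeasurableSingletonClass V]

theorem measurable_rootR (h : IsCoupledSystem M μ₀ π₀ π₁ P G W T) (hM : M.IsMeasurable)
    (hg : Measurable (Function.uncurry M.g)) (r : ℕ) : Measurable (G.rootR M W r) :=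
  (measurable_rootR_data hM hg r).comp (h.measurable_data.prodMk h.measurable_noise)

theorem measurable_treeR_treeNoise (h : IsCoupledSystem M μ₀ π₀ π₁ P G W T) (hM : M.IsMeasurable)
    (hg : Measurable (Function.uncurry M.g)) (K r : ℕ) :
    Measurable fun q => treeR M (T.node q.1) (treeNoise T W K q) r [] :=
  (measurable_treeR hM hg r []).comp
    ((h.measurable_node.comp measurable_fst).prodMk (h.measurable_treeNoise K))

/-- The distance between the recursions on the graph and on the tree. -/
theorem setLIntegral_sub_le [MetricSpace A] [TopologicalSpace.SeparableSpace A] [BorelSpace A]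
    (h : IsCoupledSystem M μ₀ π₀ π₁ P G W T) (hM : M.IsMeasurable)
    (hg : Measurable (Function.uncurry M.g)) (hp : 1 ≤ p) {K r : ℕ} (hr : r ≤ K) {ε : ℝ}
    (hε : ε < 1) {η : ℝ≥0∞} {m : (List ℕ → ℕ × Mark A) → ℝ≥0∞} (hm : Measurable m)
    (hb : ∀ᵐ t ∂(gwLaw π₀ π₁),
      ∫⁻ w, ‖treeR M t w r []‖ₑ ^ p ∂(M.noiseLaw μ₀ (List ℕ) (List ℕ)) ≤ m t)
    (hc : ∀ᵐ t ∂(gwLaw π₀ π₁), ∀ X : List ℕ → Mark A,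
      (∀ i ∈ treeNodes t K, i.length < K → (t i).1 = (t i).2.1) →
      (∀ i ∈ treeNodes t K, markDist (t i).2 (X i) ≤ ε) →
      ∫⁻ w, ‖treeR M (fun l => ((t l).1, X l)) w r [] - treeR M t w r []‖ₑ ^ p
        ∂(M.noiseLaw μ₀ (List ℕ) (List ℕ)) ≤ η * m t)
    {S : Set (V → A)} (hS : MeasurableSet S) :
    ∫⁻ q in Prod.fst ⁻¹' (G.att ⁻¹' S),
        ‖G.rootR M W r q.1 - treeR M (T.node q.1) (treeNoise T W K q) r []‖ₑ ^ p
        ∂(P.prod (M.noiseLaw μ₀ (List ℕ) (List ℕ))) ≤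
      η * ∫⁻ t, m t ∂(gwLaw π₀ π₁) +
        4 ^ p * (∫⁻ ω in G.att ⁻¹' S ∩ couplingData G T ⁻¹' (goodData V K ε)ᶜ,
          ‖G.rootR M W r ω‖ₑ ^ p ∂P +
          ∫⁻ ω in couplingData G T ⁻¹' (goodData V K ε)ᶜ, m (T.node ω) ∂P) := by
  have hD := h.measurable_data
  have hnode := h.measurable_node
  have hgood := measurableSet_goodData (A := A) (V := V) K ε
  set S' : Set (CouplingData V A) := (fun d => d.1.1) ⁻¹' S with hS'
  have hS'm : MeasurableSet S' := by
    have : Measurable fun d : CouplingData V A => d.1.1 := by fun_prop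
    exact this hS
  have hR := h.measurable_rootR hM hg r
  have hT := h.measurable_treeR_treeNoise hM hg K r
  have hRT : Measurable fun q : CouplingData V A × NoiseSpace (List ℕ) (List ℕ) Z Ξ =>
      treeR M q.1.2.1 q.2 r [] := (measurable_treeR hM hg r []).comp
    (f := fun q : CouplingData V A × NoiseSpace (List ℕ) (List ℕ) Z Ξ => (q.1.2.1, q.2))
    (by fun_prop)
  -- On the good data the perturbation bound applies to the tree with the marks of the graph; on the
  -- bad data the two values are estimated separately.
  have e : Prod.fst ⁻¹' (G.att ⁻¹' S) =
      (Prod.fst ⁻¹' (couplingData G T ⁻¹' (S' ∩ goodData V K ε)) ∪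
        Prod.fst ⁻¹' (couplingData G T ⁻¹' (S' ∩ (goodData V K ε)ᶜ)) :
          Set (Ω × NoiseSpace (List ℕ) (List ℕ) Z Ξ)) := by
    rw [← Set.preimage_union, ← Set.preimage_union, Set.inter_union_compl]
    rfl
  rw [e]
  refine (lintegral_union_le _ _ _).trans (add_le_add ?_ ?_)
  · have hmerge : Measurable fun x : CouplingData V A × NoiseSpace V (V × V × ℕ) Z Ξ ×
        NoiseSpace (List ℕ) (List ℕ) Z Ξ =>
        mergeNoise (coupledNodes x.1.2.1 x.1.2.2 K) x.1.2.2 x.2 :=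
      measurable_mergeNoise (by fun_prop) (by fun_prop) (by fun_prop) K
    have hF : Measurable fun x : CouplingData V A × NoiseSpace V (V × V × ℕ) Z Ξ ×
        NoiseSpace (List ℕ) (List ℕ) Z Ξ =>
        ‖graphR M x.1.mark x.1.1.2.1 x.2.1 r x.1.1.2.2 - treeR M x.1.2.1
          (mergeNoise (coupledNodes x.1.2.1 x.1.2.2 K) x.1.2.2 x.2) r []‖ₑ ^ p := by
      have h1 := (measurable_rootR_data (V := V) hM hg r).comp
        (f := fun x : CouplingData V A × NoiseSpace V (V × V × ℕ) Z Ξ ×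
        NoiseSpace (List ℕ) (List ℕ) Z Ξ => (x.1, x.2.1)) (by fun_prop)
      have h2 := hRT.comp (measurable_fst.prodMk hmerge)
      exact (h1.sub h2).enorm.pow_const p
    have h3 := h.setLIntegral_graph_tree (hS'm.inter hgood) hF
    refine (le_of_eq h3).trans ?_
    have hqmp : Measure.QuasiMeasurePreserving T.node P (gwLaw π₀ π₁) :=
      ⟨hnode, h.map_node.le.absolutelyContinuous⟩
    calc _ ≤ ∫⁻ ω in couplingData G T ⁻¹' (S' ∩ goodData V K ε), η * m (T.node ω) ∂P := by
          refine lintegral_mono_ae ?_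
          filter_upwards [ae_restrict_of_ae (hqmp.ae hc),
            ae_restrict_mem (hD (hS'm.inter hgood))] with ω hω hωm
          obtain ⟨-, hmat, hmark⟩ := hωm
          have hmark' : ∀ i ∈ treeNodes (T.node ω) K,
              markDist (T.node ω i).2 (G.mark ω (T.θ ω i)) ≤ ε := fun i hi => by
            rw [markDist_comm]; exact hmark i hi
          have hmat' : Matches (T.node ω) (T.θ ω) (G.mult ω) (G.root ω) K := hmat
          refine le_trans (le_of_eq ?_) (hω (fun i => G.mark ω (T.θ ω i)) (fun i hi hl => ?_) hmark')
          · have h4 := (measurePreserving_mergeNoise M μ₀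
              (injOn_coupledNodes (T.node ω) (T.θ ω) K)).lintegral_comp
              (f := fun w => ‖treeR M (fun l => ((T.node ω l).1, G.mark ω (T.θ ω l))) w r [] -
                treeR M (T.node ω) w r []‖ₑ ^ p)
              (((measurable_treeR_noise hM hg _ r []).sub
                (measurable_treeR_noise hM hg _ r [])).enorm.pow_const p)
            rw [← h4]
            refine lintegral_congr fun w => ?_
            have h5 := hmat'.graphR_eq_treeR M (G.mark ω) w r [] trivial (by simpa using hr)
            have h6 : T.θ ω [] = G.root ω := hmat'.1
            rw [h6] at h5
            rw [← h5]
            rfl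
          -- The matching identifies the offspring number with the in-degree in the graph, and marks
          -- at distance below one share their in-degree.
          · have h7 := hmat'.sum_mult_eq hi.1 hl
            have h8 := fst_eq_of_markDist_lt_one ((hmark' i hi).trans_lt hε)
            exact h7.symm.trans h8.symm
      _ ≤ ∫⁻ ω, η * m (T.node ω) ∂P := setLIntegral_le_lintegral _ _
      _ = η * ∫⁻ t, m t ∂(gwLaw π₀ π₁) := by
          have hmn : Measurable fun ω => m (T.node ω) := hm.comp hnode
          rw [lintegral_const_mul _ hmn, ← h.map_node, lintegral_map hm hnode]
  · have hbad := hD (hS'm.inter hgood.compl)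
    have h1 : Measurable fun q : Ω × NoiseSpace (List ℕ) (List ℕ) Z Ξ =>
        ‖G.rootR M W r q.1‖ₑ ^ p := (hR.comp measurable_fst).enorm.pow_const p
    calc _ ≤ ∫⁻ q in Prod.fst ⁻¹' (couplingData G T ⁻¹' (S' ∩ (goodData V K ε)ᶜ)),
          4 ^ p * (‖G.rootR M W r q.1‖ₑ ^ p +
            ‖treeR M (T.node q.1) (treeNoise T W K q) r []‖ₑ ^ p)
          ∂(P.prod (M.noiseLaw μ₀ (List ℕ) (List ℕ))) := by
          refine lintegral_mono fun q => ?_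
          refine le_trans ?_ (add_rpow_le hp _ _)
          gcongr
          exact enorm_sub_le
      _ ≤ _ := by
          have h2 : Measurable fun q : Ω × NoiseSpace (List ℕ) (List ℕ) Z Ξ =>
            ‖G.rootR M W r q.1‖ₑ ^ p + ‖treeR M (T.node q.1) (treeNoise T W K q) r []‖ₑ ^ p :=
            h1.add (hT.enorm.pow_const p)
          rw [lintegral_const_mul _ h2, lintegral_add_left h1]
          refine mul_le_mul_right (add_le_add ?_ ?_) _
          · have h3 := (measurePreserving_fst (μ := P)
              (ν := M.noiseLaw μ₀ (List ℕ) (List ℕ))).setLIntegral_comp_preimage hbad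
              (hR.enorm.pow_const p)
            exact le_of_eq h3
          · have h4 := h.setLIntegral_tree K (hS'm.inter hgood.compl)
              (F := fun q => ‖treeR M q.1.2.1 q.2 r []‖ₑ ^ p) (hRT.enorm.pow_const p)
            refine (le_of_eq h4).trans ?_
            have hqmp : Measure.QuasiMeasurePreserving T.node P (gwLaw π₀ π₁) :=
              ⟨hnode, h.map_node.le.absolutelyContinuous⟩
            refine (lintegral_mono_ae (ae_restrict_of_ae (hqmp.ae hb))).trans ?_
            exact lintegral_mono_set (Set.preimage_mono Set.inter_subset_right)

/-- `I` is uniform and independent of the graph, so on an event determined by the attributes an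
integral at `I` is an average over vertices. An inequality between sums over all vertices, such as
an `ℓ^p` matrix bound, therefore gives one at `I`. -/
theorem setLIntegral_root_le (h : IsCoupledSystem M μ₀ π₀ π₁ P G W T)
    {Q Q' : V → ((V → A) × (V → V → ℕ)) × NoiseSpace V (V × V × ℕ) Z Ξ → ℝ≥0∞}
    (hQ : ∀ i, Measurable (Q i)) (hQ' : ∀ i, Measurable (Q' i))
    (hle : ∀ᵐ ω ∂P, ∀ w, ∑ i, Q i ((G.att ω, G.mult ω), w) ≤ ∑ i, Q' i ((G.att ω, G.mult ω), w))
    {S : Set (V → A)} (hS : MeasurableSet S) :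
    ∫⁻ ω in G.att ⁻¹' S, ∫⁻ w, Q (G.root ω) ((G.att ω, G.mult ω), w)
        ∂(M.noiseLaw μ₀ V (V × V × ℕ)) ∂P ≤
      ∫⁻ ω in G.att ⁻¹' S, ∫⁻ w, Q' (G.root ω) ((G.att ω, G.mult ω), w)
        ∂(M.noiseLaw μ₀ V (V × V × ℕ)) ∂P := by
  have hatt := h.rooted.measurable_att
  have hmult := h.rooted.measurable_mult
  have hD : Measurable fun ω => (G.att ω, G.mult ω) := hatt.prodMk hmult
  have key : ∀ Q : V → ((V → A) × (V → V → ℕ)) × NoiseSpace V (V × V × ℕ) Z Ξ → ℝ≥0∞,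
      (∀ i, Measurable (Q i)) →
      ∫⁻ ω in G.att ⁻¹' S, ∫⁻ w, Q (G.root ω) ((G.att ω, G.mult ω), w)
        ∂(M.noiseLaw μ₀ V (V × V × ℕ)) ∂P = (Fintype.card V : ℝ≥0∞)⁻¹ *
        ∫⁻ ω in G.att ⁻¹' S, ∫⁻ w, ∑ i, Q i ((G.att ω, G.mult ω), w)
        ∂(M.noiseLaw μ₀ V (V × V × ℕ)) ∂P := by
    intro Q hQ
    have hF : ∀ i, Measurable ((Prod.fst ⁻¹' S).indicator fun D : (V → A) × (V → V → ℕ) =>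
        ∫⁻ w, Q i (D, w) ∂(M.noiseLaw μ₀ V (V × V × ℕ))) := fun i =>
      (hQ i).lintegral_prod_right'.indicator (measurable_fst hS)
    have h1 := lintegral_uniform h.rooted.measurable_root hD h.rooted.uniform h.rooted.indep hF
    have hQ1 : ∀ i, Measurable fun ω => ∫⁻ w, Q i ((G.att ω, G.mult ω), w)
        ∂(M.noiseLaw μ₀ V (V × V × ℕ)) := fun i => (hQ i).lintegral_prod_right'.comp hD
    have h2 : ∀ ω, ∫⁻ w, ∑ i, Q i ((G.att ω, G.mult ω), w) ∂(M.noiseLaw μ₀ V (V × V × ℕ)) =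
        ∑ i, ∫⁻ w, Q i ((G.att ω, G.mult ω), w) ∂(M.noiseLaw μ₀ V (V × V × ℕ)) := fun ω =>
      lintegral_finsetSum _ fun i _ => (hQ i).comp (measurable_const.prodMk measurable_id)
    simp only [h2]
    rw [lintegral_finsetSum _ fun i _ => hQ1 i, ← lintegral_indicator (hatt hS)]
    simp only [← lintegral_indicator (hatt hS)]
    exact h1
  rw [key Q hQ, key Q' hQ']
  refine mul_le_mul_right ?_ _
  refine lintegral_mono_ae (ae_restrict_of_ae ?_)
  filter_upwards [hle] with ω hω using lintegral_mono hω

end IsCoupledSystem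

/-! ### Moments of the recursion on the graph, and the role of the matrix norms -/

namespace IsCoupledSystem

variable {A : Type a} {Z : Type v} {Ξ : Type w} [MeasurableSpace Z] [MeasurableSpace Ξ]
  {V : Type*} [Fintype V] {M : Recursion A Z Ξ} {μ₀ : ProbabilityMeasure ℝ} {B : Bounds A} {p : ℝ}
/-- A bound on the sum over the vertices of the `p`-th powers of the contributions of large values
of `g` to the growth bound. -/
theorem sum_large_rpow_le (hp : 1 ≤ p)
    (hlip : ∀ (x : Mark A) (r r' : ℝ), |M.g r x - M.g r' x| ≤ B.sp x * |r - r'|)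
    {X : V → Mark A} {mult : V → V → ℕ} {K K₀ : ℝ}
    (hK : LpOpNormLE p (Matrix.of fun i j => B.sm (X i) * B.sp (X j) * (mult j i : ℝ)) K)
    (hK₀ : LpOpNormLE p (Matrix.of fun i j => B.sm (X i) * |M.g 0 (X j)| * (mult j i : ℝ)) K₀)
    (R : V → ℝ) (L : ℝ≥0∞) :
    ∑ i, (‖B.sm (X i)‖ₑ * ∑ j, (mult j i : ℝ≥0∞) *
        (if L < ‖M.g (R j) (X j)‖ₑ then ‖M.g (R j) (X j)‖ₑ else 0)) ^ p ≤
      ∑ j, 4 ^ p * (ENNReal.ofReal K ^ p * (if L < ‖M.g (R j) (X j)‖ₑ then ‖R j‖ₑ ^ p else 0) +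
        ENNReal.ofReal K₀ ^ p * (if L < ‖M.g (R j) (X j)‖ₑ then 1 else 0)) := by
  have hp0 : 0 < p := by linarith
  -- The indicator of large values is put into two vectors: `|g|` on that event is at most `σ₊ |y| +
  -- |g(0, ·)| y₀`, and each summand falls under one of the two matrix norms.
  set y : V → ℝ := fun j => if L < ‖M.g (R j) (X j)‖ₑ then R j else 0 with hy
  set y₀ : V → ℝ := fun j => if L < ‖M.g (R j) (X j)‖ₑ then 1 else 0 with hy₀
  -- Nonnegativity of `σ₊` follows from the Lipschitz bound at the points `1` and `0`.
  have hsp : ∀ x, 0 ≤ B.sp x := fun x => by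
    have := (abs_nonneg _).trans (hlip x 1 0)
    simpa using this
  have h1 := LpOpNormLE.sum_rpow_le hp (fun j => hsp (X j)) hK y
  have h2 := LpOpNormLE.sum_rpow_le hp (fun j => abs_nonneg (M.g 0 (X j))) hK₀ y₀
  have e1 : ∀ j, ‖y j‖ₑ ^ p = if L < ‖M.g (R j) (X j)‖ₑ then ‖R j‖ₑ ^ p else 0 := fun j => by
    simp only [hy]; split_ifs <;> simp [hp0]
  have e2 : ∀ j, ‖y₀ j‖ₑ ^ p = if L < ‖M.g (R j) (X j)‖ₑ then 1 else 0 := fun j => by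
    simp only [hy₀]; split_ifs <;> simp [hp0]
  have h3 : ∀ j, (if L < ‖M.g (R j) (X j)‖ₑ then ‖M.g (R j) (X j)‖ₑ else 0) ≤
      ‖B.sp (X j)‖ₑ * ‖y j‖ₑ + ‖|M.g 0 (X j)|‖ₑ * ‖y₀ j‖ₑ := fun j => by
    simp only [hy, hy₀]
    split_ifs
    · rw [enorm_abs', enorm_one, mul_one, add_comm]
      exact enorm_g_le hlip _ _
    · simp
  calc _ ≤ ∑ i, (‖B.sm (X i)‖ₑ * ∑ j, (mult j i : ℝ≥0∞) * (‖B.sp (X j)‖ₑ * ‖y j‖ₑ) +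
        ‖B.sm (X i)‖ₑ * ∑ j, (mult j i : ℝ≥0∞) * (‖|M.g 0 (X j)|‖ₑ * ‖y₀ j‖ₑ)) ^ p := by
        gcongr with i
        rw [← mul_add, ← Finset.sum_add_distrib]
        gcongr with j
        rw [← mul_add]
        gcongr
        exact h3 j
    _ ≤ ∑ i, 4 ^ p * ((‖B.sm (X i)‖ₑ * ∑ j, (mult j i : ℝ≥0∞) * (‖B.sp (X j)‖ₑ * ‖y j‖ₑ)) ^ p +
        (‖B.sm (X i)‖ₑ * ∑ j, (mult j i : ℝ≥0∞) * (‖|M.g 0 (X j)|‖ₑ * ‖y₀ j‖ₑ)) ^ p) :=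
        Finset.sum_le_sum fun i _ => add_rpow_le hp _ _
    _ ≤ 4 ^ p * (ENNReal.ofReal K ^ p * ∑ j, ‖y j‖ₑ ^ p +
        ENNReal.ofReal K₀ ^ p * ∑ j, ‖y₀ j‖ₑ ^ p) := by
        rw [← Finset.mul_sum, Finset.sum_add_distrib]
        gcongr
    _ = _ := by
        simp only [e1, e2]
        rw [← Finset.mul_sum, Finset.sum_add_distrib, Finset.mul_sum, Finset.mul_sum]

/-- The values of `g` at the vertices that exceed `L`, and `0` where they do not. -/
def largeG (M : Recursion A Z Ξ) (L : ℝ≥0∞) (r : ℕ) (X : V → Mark A) (mult : V → V → ℕ)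
    (w : NoiseSpace V (V × V × ℕ) Z Ξ) (j : V) : ℝ≥0∞ :=
  if L < ‖M.g (graphR M X mult w r j) (X j)‖ₑ then ‖M.g (graphR M X mult w r j) (X j)‖ₑ else 0

theorem le_add_largeG (M : Recursion A Z Ξ) (L : ℝ≥0∞) (r : ℕ) (X : V → Mark A)
    (mult : V → V → ℕ) (w : NoiseSpace V (V × V × ℕ) Z Ξ) (j : V) :
    ‖M.g (graphR M X mult w r j) (X j)‖ₑ ≤ L + largeG M L r X mult w j := by
  unfold largeG
  split_ifs with hj
  · exact le_add_self
  · simpa using hj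

variable [MeasurableSpace A]

theorem measurable_gAt (hM : M.IsMeasurable) (hg : Measurable (Function.uncurry M.g)) (r : ℕ)
    (j : V) : Measurable fun q : ((V → A) × (V → V → ℕ)) × NoiseSpace V (V × V × ℕ) Z Ξ =>
      ‖M.g (graphR M (graphMark q.1.1 q.1.2) q.1.2 q.2 r j) (graphMark q.1.1 q.1.2 j)‖ₑ :=
  (measurable_g_comp hg (measurable_graphR hM hg r j)
    ((measurable_graphMark j).comp measurable_fst)).enorm

theorem measurable_largeG (hM : M.IsMeasurable) (hg : Measurable (Function.uncurry M.g))
    (L : ℝ≥0∞) (r : ℕ) (j : V) :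
    Measurable fun q : ((V → A) × (V → V → ℕ)) × NoiseSpace V (V × V × ℕ) Z Ξ =>
      largeG M L r (graphMark q.1.1 q.1.2) q.1.2 q.2 j :=
  Measurable.ite (measurableSet_lt measurable_const (measurable_gAt hM hg r j))
    (measurable_gAt hM hg r j) measurable_const

theorem measurable_sum_largeG (hM : M.IsMeasurable) (hg : Measurable (Function.uncurry M.g))
    (hsm : Measurable B.sm) (p : ℝ) (L : ℝ≥0∞) (r : ℕ) (i : V) :
    Measurable fun q : ((V → A) × (V → V → ℕ)) × NoiseSpace V (V × V × ℕ) Z Ξ =>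
      (‖B.sm (graphMark q.1.1 q.1.2 i)‖ₑ * ∑ j, (q.1.2 j i : ℝ≥0∞) *
        largeG M L r (graphMark q.1.1 q.1.2) q.1.2 q.2 j) ^ p := by
  have hn : Measurable fun n : ℕ => (n : ℝ≥0∞) := measurable_from_top
  have hX : Measurable fun q : ((V → A) × (V → V → ℕ)) × NoiseSpace V (V × V × ℕ) Z Ξ =>
      graphMark q.1.1 q.1.2 i := (measurable_graphMark i).comp measurable_fst
  have hmult : ∀ j, Measurable fun q : ((V → A) × (V → V → ℕ)) × NoiseSpace V (V × V × ℕ) Z Ξ =>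
      (q.1.2 j i : ℝ≥0∞) := fun j => hn.comp (by fun_prop)
  exact ((hsm.comp hX).enorm.mul (Finset.measurable_fun_sum _ fun j _ =>
    (hmult j).mul (measurable_largeG hM hg L r j))).pow_const p

variable {Ω : Type u} [MeasurableSpace Ω] [MeasurableSpace V]
  {π₀ π₁ : ProbabilityMeasure (ℕ × Mark A)} {P : Measure Ω} [IsProbabilityMeasure P]
  {G : RandomDigraph Ω V A} {W : Ω → NoiseSpace V (V × V × ℕ) Z Ξ} {T : TreeCoupling Ω V A}
  [MeasurableSingletonClass V]

/-- The contribution of large values of `g` to the moments of the recursion. -/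
theorem setLIntegral_largeG_le (h : IsCoupledSystem M μ₀ π₀ π₁ P G W T)
    (hM : M.IsMeasurable) (hg : Measurable (Function.uncurry M.g)) (hsm : Measurable B.sm)
    (hp : 1 ≤ p)
    (hlip : ∀ (x : Mark A) (r r' : ℝ), |M.g r x - M.g r' x| ≤ B.sp x * |r - r'|) {K K₀ : ℝ}
    (hK : ∀ᵐ ω ∂P, LpOpNormLE p (Matrix.of fun i j => B.sm (G.mark ω i) * B.sp (G.mark ω j) *
        (G.mult ω j i : ℝ)) K ∧
      LpOpNormLE p (Matrix.of fun i j => B.sm (G.mark ω i) * |M.g 0 (G.mark ω j)| *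
        (G.mult ω j i : ℝ)) K₀) (L : ℝ≥0∞) (r : ℕ) {S : Set (V → A)} (hS : MeasurableSet S) :
    ∫⁻ ω in G.att ⁻¹' S, ∫⁻ w, (‖B.sm (G.mark ω (G.root ω))‖ₑ *
        ∑ j, (G.mult ω j (G.root ω) : ℝ≥0∞) * largeG M L r (G.mark ω) (G.mult ω) w j) ^ p
        ∂(M.noiseLaw μ₀ V (V × V × ℕ)) ∂P ≤
      4 ^ p * (ENNReal.ofReal K ^ p * ∫⁻ ω in G.att ⁻¹' S ∩
            {ω | L < ‖M.g (G.rootR M W r ω) (G.mark ω (G.root ω))‖ₑ}, ‖G.rootR M W r ω‖ₑ ^ p ∂P +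
          ENNReal.ofReal K₀ ^ p *
            P {ω | L < ‖M.g (G.rootR M W r ω) (G.mark ω (G.root ω))‖ₑ}) := by
  have hD := h.measurable_data
  have hatt := h.rooted.measurable_att
  have hR := h.measurable_rootR hM hg r
  have hmark : Measurable fun ω => G.mark ω (G.root ω) :=
    measurable_mark_comp (d := couplingData G T) hD h.rooted.measurable_root
  let Q' : V → ((V → A) × (V → V → ℕ)) × NoiseSpace V (V × V × ℕ) Z Ξ → ℝ≥0∞ := fun j q =>
    4 ^ p * (ENNReal.ofReal K ^ p *
      (if L < ‖M.g (graphR M (graphMark q.1.1 q.1.2) q.1.2 q.2 r j) (graphMark q.1.1 q.1.2 j)‖ₑ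
        then ‖graphR M (graphMark q.1.1 q.1.2) q.1.2 q.2 r j‖ₑ ^ p else 0) +
      ENNReal.ofReal K₀ ^ p *
      (if L < ‖M.g (graphR M (graphMark q.1.1 q.1.2) q.1.2 q.2 r j) (graphMark q.1.1 q.1.2 j)‖ₑ
        then 1 else 0))
  have hQ' : ∀ i, Measurable (Q' i) := fun i => by
    have h1 := measurableSet_lt (measurable_const (a := L)) (measurable_gAt (V := V) hM hg r i)
    exact (((Measurable.ite h1 ((measurable_graphR hM hg r i).enorm.pow_const p)
      measurable_const).const_mul _).add
      ((Measurable.ite h1 measurable_const measurable_const).const_mul _)).const_mul _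
  have hQ'd : Measurable fun q : CouplingData V A × NoiseSpace V (V × V × ℕ) Z Ξ =>
      Q' q.1.1.2.2 ((q.1.1.1, q.1.1.2.1), q.2) := by
    have h1 : Measurable fun q : CouplingData V A × NoiseSpace V (V × V × ℕ) Z Ξ =>
        ((q.1.1.1, q.1.1.2.1), q.2) := by fun_prop
    have h2 : Measurable fun q : CouplingData V A × NoiseSpace V (V × V × ℕ) Z Ξ =>
        q.1.1.2.2 := by fun_prop
    have h3 : Measurable fun q : CouplingData V A × NoiseSpace V (V × V × ℕ) Z Ξ =>
        fun i => Q' i ((q.1.1.1, q.1.1.2.1), q.2) :=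
      measurable_pi_iff.2 fun i => (hQ' i).comp h1
    exact measurable_eval_of_countable (f := fun q : CouplingData V A ×
      NoiseSpace V (V × V × ℕ) Z Ξ => fun i => Q' i ((q.1.1.1, q.1.1.2.1), q.2)) h3 h2
  have hle := h.setLIntegral_root_le (fun i => measurable_sum_largeG (B := B) hM hg hsm p L r i)
    hQ' (by
    filter_upwards [hK] with ω hω w
    exact sum_large_rpow_le hp hlip hω.1 hω.2 (fun j => graphR M (G.mark ω) (G.mult ω) w r j) L) hS
  refine le_trans hle ?_
  set S' : Set (CouplingData V A) := (fun d => d.1.1) ⁻¹' S with hS'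
  have hS'm : MeasurableSet S' := by
    have : Measurable fun d : CouplingData V A => d.1.1 := by fun_prop
    exact this hS
  set U : Set Ω := {ω | L < ‖M.g (G.rootR M W r ω) (G.mark ω (G.root ω))‖ₑ} with hU
  have hUm : MeasurableSet U := measurableSet_lt measurable_const (measurable_g_comp hg hR hmark).enorm
  have e1 : ∀ ω, Q' (G.root ω) ((G.att ω, G.mult ω), W ω) =
      4 ^ p * (ENNReal.ofReal K ^ p * U.indicator (fun ω => ‖G.rootR M W r ω‖ₑ ^ p) ω +
        ENNReal.ofReal K₀ ^ p * U.indicator 1 ω) := by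
    intro ω
    simp only [Q', Set.indicator_apply, hU, Set.mem_ofPred_eq]
    rfl
  have h2 : ∫⁻ ω in G.att ⁻¹' S, Q' (G.root ω) ((G.att ω, G.mult ω), W ω) ∂P =
      ∫⁻ ω in G.att ⁻¹' S, ∫⁻ w, Q' (G.root ω) ((G.att ω, G.mult ω), w)
      ∂(M.noiseLaw μ₀ V (V × V × ℕ)) ∂P := h.setLIntegral_graph hS'm hQ'd
  rw [← h2, lintegral_congr e1]
  have h3 : Measurable (U.indicator (fun ω => ‖G.rootR M W r ω‖ₑ ^ p)) :=
    (hR.enorm.pow_const p).indicator hUm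
  have h4 : Measurable (U.indicator (1 : Ω → ℝ≥0∞)) := measurable_one.indicator hUm
  have h5 : Measurable fun ω => ENNReal.ofReal K ^ p *
    U.indicator (fun ω => ‖G.rootR M W r ω‖ₑ ^ p) ω := h3.const_mul _
  have h6 : Measurable fun ω => ENNReal.ofReal K₀ ^ p * U.indicator (1 : Ω → ℝ≥0∞) ω :=
    h4.const_mul _
  have h7 : Measurable fun ω => ENNReal.ofReal K ^ p *
    U.indicator (fun ω => ‖G.rootR M W r ω‖ₑ ^ p) ω +
    ENNReal.ofReal K₀ ^ p * U.indicator (1 : Ω → ℝ≥0∞) ω := h5.add h6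
  rw [lintegral_const_mul _ h7, lintegral_add_left h5, lintegral_const_mul _ h3,
    lintegral_const_mul _ h4, setLIntegral_indicator hUm, Set.inter_comm,
    lintegral_indicator_one hUm]
  exact mul_le_mul_right (add_le_add le_rfl (mul_le_mul_right (Measure.restrict_apply_le _ _) _)) _

/-- In the growth bound each incoming value of `g` is at most `L` plus its excess. The constant part
sums to `L σ₋ D⁻`, which the convergence of degrees controls, and the excess is left for the matrix
norms. -/
theorem lintegral_graphR_succ_le_add (hM : M.IsMeasurable)
    (hg : Measurable (Function.uncurry M.g)) (hp : 1 ≤ p) {att : V → A} {mult : V → V → ℕ}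
    (hsm : Measurable B.sm) (hb : BoundsOnGraph M B p (graphMark att mult) mult) (L : ℝ≥0∞)
    (r : ℕ) (i : V) :
    ∫⁻ w, ‖graphR M (graphMark att mult) mult w (r + 1) i‖ₑ ^ p ∂(M.noiseLaw μ₀ V (V × V × ℕ)) ≤
      4 ^ p * (L ^ p * ‖B.sm (graphMark att mult i) * ((graphMark att mult i).1 : ℝ)‖ₑ ^ p +
        ∫⁻ w, (‖B.sm (graphMark att mult i)‖ₑ * ∑ j, (mult j i : ℝ≥0∞) *
          largeG M L r (graphMark att mult) mult w j) ^ p ∂(M.noiseLaw μ₀ V (V × V × ℕ)) +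
        ‖B.β (graphMark att mult i)‖ₑ ^ p) := by
  have hp0 : 0 < p := by linarith
  refine (hb.lintegral_graphR_succ_le hM hg hp μ₀ r i).trans ?_
  have hm : Measurable fun w => (‖B.sm (graphMark att mult i)‖ₑ * ∑ j, (mult j i : ℝ≥0∞) *
      largeG M L r (graphMark att mult) mult w j) ^ p := by
    have h0 : Measurable fun w : NoiseSpace V (V × V × ℕ) Z Ξ => ((att, mult), w) := by fun_prop
    have h3 := (measurable_sum_largeG (B := B) hM hg hsm p L r i).comp h0
    exact h3
  have h2 : ∀ w, (‖B.sm (graphMark att mult i)‖ₑ * ∑ j, (mult j i : ℝ≥0∞) *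
      ‖M.g (graphR M (graphMark att mult) mult w r j) (graphMark att mult j)‖ₑ +
      ‖B.β (graphMark att mult i)‖ₑ) ^ p ≤ 4 ^ p * (L ^ p *
      ‖B.sm (graphMark att mult i) * ((graphMark att mult i).1 : ℝ)‖ₑ ^ p +
      (‖B.sm (graphMark att mult i)‖ₑ * ∑ j, (mult j i : ℝ≥0∞) *
        largeG M L r (graphMark att mult) mult w j) ^ p + ‖B.β (graphMark att mult i)‖ₑ ^ p) := by
    intro w
    have e2 : L * ‖B.sm (graphMark att mult i) * ((graphMark att mult i).1 : ℝ)‖ₑ =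
        ‖B.sm (graphMark att mult i)‖ₑ * ∑ j, (mult j i : ℝ≥0∞) * L := by
      have e3 : (graphMark att mult i).1 = ∑ j, mult j i := rfl
      rw [enorm_mul, Real.enorm_natCast, ← Finset.sum_mul, e3]
      push_cast
      ring
    rw [← ENNReal.mul_rpow_of_nonneg _ _ hp0.le, e2]
    refine le_trans (ENNReal.rpow_le_rpow ?_ hp0.le) (add_add_rpow_le hp _ _ _)
    gcongr
    rw [← mul_add, ← Finset.sum_add_distrib]
    gcongr with j
    rw [← mul_add]
    gcongr
    exact le_add_largeG M L r _ mult w j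
  refine (lintegral_mono h2).trans (le_of_eq ?_)
  have h4 : Measurable fun w : NoiseSpace V (V × V × ℕ) Z Ξ => L ^ p *
      ‖B.sm (graphMark att mult i) * ((graphMark att mult i).1 : ℝ)‖ₑ ^ p +
      (‖B.sm (graphMark att mult i)‖ₑ * ∑ j, (mult j i : ℝ≥0∞) *
        largeG M L r (graphMark att mult) mult w j) ^ p := hm.const_add _
  have h5 : Measurable fun w : NoiseSpace V (V × V × ℕ) Z Ξ => L ^ p *
      ‖B.sm (graphMark att mult i) * ((graphMark att mult i).1 : ℝ)‖ₑ ^ p +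
      (‖B.sm (graphMark att mult i)‖ₑ * ∑ j, (mult j i : ℝ≥0∞) *
        largeG M L r (graphMark att mult) mult w j) ^ p + ‖B.β (graphMark att mult i)‖ₑ ^ p :=
    h4.add_const _
  rw [lintegral_const_mul _ h5, lintegral_add_left h4, lintegral_const, measure_univ, mul_one,
    lintegral_add_right _ hm, lintegral_const, measure_univ, mul_one]

/-- The `p`-th moment of the recursion on an event of small probability. -/
theorem setLIntegral_rootR_succ_le (h : IsCoupledSystem M μ₀ π₀ π₁ P G W T)
    (hM : M.IsMeasurable) (hg : Measurable (Function.uncurry M.g)) (hsm : Measurable B.sm)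
    (hβ : Measurable B.β) (hp : 1 ≤ p)
    (hlip : ∀ (x : Mark A) (r r' : ℝ), |M.g r x - M.g r' x| ≤ B.sp x * |r - r'|)
    (hbd : ∀ᵐ ω ∂P, BoundsOnGraph M B p (G.mark ω) (G.mult ω)) {K K₀ : ℝ}
    (hK : ∀ᵐ ω ∂P, LpOpNormLE p (Matrix.of fun i j => B.sm (G.mark ω i) * B.sp (G.mark ω j) *
        (G.mult ω j i : ℝ)) K ∧
      LpOpNormLE p (Matrix.of fun i j => B.sm (G.mark ω i) * |M.g 0 (G.mark ω j)| *
        (G.mult ω j i : ℝ)) K₀) (L : ℝ≥0∞) (r : ℕ) {S : Set (V → A)} (hS : MeasurableSet S)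
    {E : Set (CouplingData V A)} (hE : MeasurableSet E) :
    ∫⁻ ω in G.att ⁻¹' S ∩ couplingData G T ⁻¹' E, ‖G.rootR M W (r + 1) ω‖ₑ ^ p ∂P ≤
      4 ^ p * (L ^ p * ∫⁻ ω in G.att ⁻¹' S ∩ couplingData G T ⁻¹' E,
          ‖B.sm (G.mark ω (G.root ω)) * ((G.mark ω (G.root ω)).1 : ℝ)‖ₑ ^ p ∂P +
        4 ^ p * (ENNReal.ofReal K ^ p * ∫⁻ ω in G.att ⁻¹' S ∩
            {ω | L < ‖M.g (G.rootR M W r ω) (G.mark ω (G.root ω))‖ₑ}, ‖G.rootR M W r ω‖ₑ ^ p ∂P +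
          ENNReal.ofReal K₀ ^ p *
            P {ω | L < ‖M.g (G.rootR M W r ω) (G.mark ω (G.root ω))‖ₑ}) +
        ∫⁻ ω in G.att ⁻¹' S ∩ couplingData G T ⁻¹' E, ‖B.β (G.mark ω (G.root ω))‖ₑ ^ p ∂P) := by
  have hp0 : 0 < p := by linarith
  have hD := h.measurable_data
  set S' : Set (CouplingData V A) := (fun d => d.1.1) ⁻¹' S with hS'
  have hS'm : MeasurableSet S' := by
    have : Measurable fun d : CouplingData V A => d.1.1 := by fun_prop
    exact this hS
  have hmark : Measurable fun ω => G.mark ω (G.root ω) :=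
    measurable_mark_comp (d := couplingData G T) hD h.rooted.measurable_root
  set C : Set Ω := G.att ⁻¹' S ∩ couplingData G T ⁻¹' E with hC
  have hRd : Measurable fun q : CouplingData V A × NoiseSpace V (V × V × ℕ) Z Ξ =>
      ‖graphR M q.1.mark q.1.1.2.1 q.2 (r + 1) q.1.1.2.2‖ₑ ^ p :=
    (measurable_rootR_data hM hg (r + 1)).enorm.pow_const p
  have h1 : ∫⁻ ω in C, ‖G.rootR M W (r + 1) ω‖ₑ ^ p ∂P =
      ∫⁻ ω in C, ∫⁻ w, ‖graphR M (G.mark ω) (G.mult ω) w (r + 1) (G.root ω)‖ₑ ^ p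
        ∂(M.noiseLaw μ₀ V (V × V × ℕ)) ∂P := h.setLIntegral_graph (hS'm.inter hE) hRd
  rw [h1]
  have hsmm : Measurable fun ω => ‖B.sm (G.mark ω (G.root ω)) * ((G.mark ω (G.root ω)).1 : ℝ)‖ₑ ^ p := by
    have h2 : Measurable fun n : ℕ => (n : ℝ) := measurable_from_top
    exact ((hsm.comp hmark).mul (h2.comp hmark.fst)).enorm.pow_const p
  have hβm : Measurable fun ω => ‖B.β (G.mark ω (G.root ω))‖ₑ ^ p :=
    (hβ.comp hmark).enorm.pow_const p
  have hQm : Measurable fun ω => ∫⁻ w, (‖B.sm (G.mark ω (G.root ω))‖ₑ *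
      ∑ j, (G.mult ω j (G.root ω) : ℝ≥0∞) * largeG M L r (G.mark ω) (G.mult ω) w j) ^ p
      ∂(M.noiseLaw μ₀ V (V × V × ℕ)) := by
    have h2 : ∀ i, Measurable fun ω => ∫⁻ w, (‖B.sm (G.mark ω i)‖ₑ *
        ∑ j, (G.mult ω j i : ℝ≥0∞) * largeG M L r (G.mark ω) (G.mult ω) w j) ^ p
        ∂(M.noiseLaw μ₀ V (V × V × ℕ)) := fun i => by
      have h0 : Measurable fun ω => (G.att ω, G.mult ω) :=
        h.rooted.measurable_att.prodMk h.rooted.measurable_mult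
      have h3 := (measurable_sum_largeG (B := B) hM hg hsm p L r i).lintegral_prod_right'
        (ν := M.noiseLaw μ₀ V (V × V × ℕ))
      have h4 := h3.comp h0
      exact h4
    exact measurable_eval_of_countable (f := fun ω i => ∫⁻ w, (‖B.sm (G.mark ω i)‖ₑ *
        ∑ j, (G.mult ω j i : ℝ≥0∞) * largeG M L r (G.mark ω) (G.mult ω) w j) ^ p
        ∂(M.noiseLaw μ₀ V (V × V × ℕ))) (measurable_pi_iff.2 h2) h.rooted.measurable_root
  calc _ ≤ ∫⁻ ω in C, 4 ^ p * (L ^ p *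
        ‖B.sm (G.mark ω (G.root ω)) * ((G.mark ω (G.root ω)).1 : ℝ)‖ₑ ^ p +
        ∫⁻ w, (‖B.sm (G.mark ω (G.root ω))‖ₑ *
          ∑ j, (G.mult ω j (G.root ω) : ℝ≥0∞) * largeG M L r (G.mark ω) (G.mult ω) w j) ^ p
          ∂(M.noiseLaw μ₀ V (V × V × ℕ)) +
        ‖B.β (G.mark ω (G.root ω))‖ₑ ^ p) ∂P := by
        refine lintegral_mono_ae (ae_restrict_of_ae ?_)
        filter_upwards [hbd] with ω hω
        exact lintegral_graphR_succ_le_add hM hg hp hsm hω L r (G.root ω)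
    _ = 4 ^ p * (L ^ p * ∫⁻ ω in C,
        ‖B.sm (G.mark ω (G.root ω)) * ((G.mark ω (G.root ω)).1 : ℝ)‖ₑ ^ p ∂P +
        ∫⁻ ω in C, ∫⁻ w, (‖B.sm (G.mark ω (G.root ω))‖ₑ *
          ∑ j, (G.mult ω j (G.root ω) : ℝ≥0∞) * largeG M L r (G.mark ω) (G.mult ω) w j) ^ p
          ∂(M.noiseLaw μ₀ V (V × V × ℕ)) ∂P +
        ∫⁻ ω in C, ‖B.β (G.mark ω (G.root ω))‖ₑ ^ p ∂P) := by
        rw [lintegral_const_mul' _ _ (four_rpow_ne_top p hp), lintegral_add_right _ hβm, lintegral_add_right _ hQm,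
          lintegral_const_mul _ hsmm]
    _ ≤ _ := by
        refine mul_le_mul_right (add_le_add (add_le_add le_rfl ?_) le_rfl) _
        -- The excess term will be averaged over vertices, so the event `E`, which may depend on `I`
        -- and on the tree, has to be dropped; only the event of the attributes survives.
        exact (lintegral_mono_set Set.inter_subset_left).trans
          (h.setLIntegral_largeG_le hM hg hsm hp hlip hK L r hS)

/-- If the recursion preserves an interval, it is bounded. -/
theorem ae_enorm_rootR_le (h : IsCoupledSystem M μ₀ π₀ π₁ P G W T)
    (hM : M.IsMeasurable) (hg : Measurable (Function.uncurry M.g)) (hp : 1 ≤ p)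
    (hlip : ∀ (x : Mark A) (r r' : ℝ), |M.g r x - M.g r' x| ≤ B.sp x * |r - r'|)
    (hbd : ∀ᵐ ω ∂P, BoundsOnGraph M B p (G.mark ω) (G.mult ω)) {K : ℝ}
    (hK : ∀ᵐ ω ∂P, ∀ᵐ w ∂(M.noiseLaw (clampLaw K) V (V × V × ℕ)),
      ∀ i, |graphR M (G.mark ω) (G.mult ω) w 1 i| ≤ K)
    (hμ₀ : (μ₀ : Measure ℝ) (Set.Icc (-K) K)ᶜ = 0) (r : ℕ) {E : Set (CouplingData V A)}
    (hE : MeasurableSet E) :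
    ∫⁻ ω in couplingData G T ⁻¹' E, ‖G.rootR M W r ω‖ₑ ^ p ∂P ≤
      ENNReal.ofReal K ^ p * P (couplingData G T ⁻¹' E) := by
  have hRd : Measurable fun q : CouplingData V A × NoiseSpace V (V × V × ℕ) Z Ξ =>
      ‖graphR M q.1.mark q.1.1.2.1 q.2 r q.1.1.2.2‖ₑ ^ p :=
    (measurable_rootR_data hM hg r).enorm.pow_const p
  have h1 : ∫⁻ ω in couplingData G T ⁻¹' E, ‖G.rootR M W r ω‖ₑ ^ p ∂P =
      ∫⁻ ω in couplingData G T ⁻¹' E, ∫⁻ w, ‖graphR M (G.mark ω) (G.mult ω) w r (G.root ω)‖ₑ ^ p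
        ∂(M.noiseLaw μ₀ V (V × V × ℕ)) ∂P := h.setLIntegral_graph hE hRd
  rw [h1, ← setLIntegral_const]
  refine lintegral_mono_ae (ae_restrict_of_ae ?_)
  filter_upwards [hbd, hK] with ω hω hKω
  have h2 := ae_abs_graphR_le hM hg hp hlip hω hKω hμ₀ r
  calc _ ≤ ∫⁻ _, ENNReal.ofReal K ^ p ∂(M.noiseLaw μ₀ V (V × V × ℕ)) := by
        refine lintegral_mono_ae ?_
        filter_upwards [h2] with w hw
        exact ENNReal.rpow_le_rpow (enorm_le_of_abs_le (hw _)) (by linarith)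
    _ = _ := by simp

end IsCoupledSystem

/-! ### The bad event, and tightness of the mark of `I` -/

section Sequence

variable {A : Type a} {Z : Type v} {Ξ : Type w} [MeasurableSpace Z] [MeasurableSpace Ξ]
  [MetricSpace A] [TopologicalSpace.SeparableSpace A] [MeasurableSpace A] [BorelSpace A]
  {Ω : ℕ → Type u} [∀ n, MeasurableSpace (Ω n)]
  {M : Recursion A Z Ξ} {μ₀ : ProbabilityMeasure ℝ} {B : Bounds A} {p : ℝ}
  {π₀ π₁ : ProbabilityMeasure (ℕ × Mark A)} {P : ∀ n, Measure (Ω n)}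
  [∀ n, IsProbabilityMeasure (P n)] {G : ∀ n, RandomDigraph (Ω n) (Fin (n + 1)) A}
  {W : ∀ n, Ω n → NoiseSpace (Fin (n + 1)) (Fin (n + 1) × Fin (n + 1) × ℕ) Z Ξ}
  {T : ∀ n, TreeCoupling (Ω n) (Fin (n + 1)) A} {K : ℕ}

theorem IsStrongCoupling.eventually_bad_le
    (hs : ∀ n, IsCoupledSystem M μ₀ π₀ π₁ (P n) (G n) (W n) (T n))
    (hT : IsStrongCoupling P G π₀ π₁ K T) {ε : ℝ} (hε : 0 < ε) (hε1 : ε < 1) {δ : ℝ≥0∞}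
    (hδ : δ ≠ 0) : ∀ᶠ n in atTop,
      P n (couplingData (G n) (T n) ⁻¹' (goodData (Fin (n + 1)) K ε)ᶜ) ≤ δ := by
  have hδ4 : δ / 2 / 2 ≠ 0 := by simp [hδ]
  have h1 := (tendstoInProb_zero_iff _).1 hT.iso (δ / 2 / 2) hδ4 (δ / 2 / 2) hδ4
  have h2 := ENNReal.tendsto_nhds_zero.1 (hT.marks_close ε hε hε1 (δ / 2 / 2)
    (pos_iff_ne_zero.2 hδ4)) (δ / 2 / 2) (pos_iff_ne_zero.2 hδ4)
  filter_upwards [h1, h2] with n hn1 hn2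
  have hD := (hs n).measurable_data
  have hle : (G n).attAlg ≤ (inferInstance : MeasurableSpace (Ω n)) :=
    (hs n).rooted.measurable_att.comap_le
  have hm1 : MeasurableSet {ω | (T n).IsIso (G n) K ω} :=
    measurableSet_matches (hs n).measurable_node (hs n).measurable_θ (hs n).rooted.measurable_mult
      (hs n).rooted.measurable_root K
  have hm2 : MeasurableSet {ω | ∀ i ∈ (T n).nodes K ω,
      markDist ((G n).mark ω ((T n).θ ω i)) ((T n).node ω i).2 ≤ ε} :=
    hD (measurableSet_closeMarks K ε)
  have h3 := measure_le_of_condProb hle hm1.compl hn1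
  have h4 := measure_compl_le_of_condProb hle hm2 hn2
  calc _ ≤ P n ({ω | (T n).IsIso (G n) K ω}ᶜ ∪ {ω | ∀ i ∈ (T n).nodes K ω,
      markDist ((G n).mark ω ((T n).θ ω i)) ((T n).node ω i).2 ≤ ε}ᶜ) := by
        refine measure_mono fun ω hω => ?_
        by_contra hc
        rw [Set.mem_union, not_or, Set.notMem_compl_iff, Set.notMem_compl_iff] at hc
        exact hω ⟨hc.1, hc.2⟩
    _ ≤ δ / 2 + δ / 2 := (measure_union_le _ _).trans (add_le_add h3 h4)
    _ = δ := ENNReal.add_halves δ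

/-- The number of offspring of the root is the in-degree in its mark. -/
theorem IsStrongCoupling.ae_root_fst (hK : 1 ≤ K)
    (hs : ∀ n, IsCoupledSystem M μ₀ π₀ π₁ (P n) (G n) (W n) (T n))
    (hT : IsStrongCoupling P G π₀ π₁ K T) :
    ∀ᵐ y ∂(π₀ : Measure (ℕ × Mark A)), y.1 = y.2.1 := by
  have hev : MeasurePreserving (fun t : List ℕ → ℕ × Mark A => t []) (gwLaw π₀ π₁)
      (π₀ : Measure (ℕ × Mark A)) := by
    have := measurePreserving_eval_infinitePi (fun i : List ℕ =>
      (((if i = [] then π₀ else π₁ : ProbabilityMeasure (ℕ × Mark A))) : Measure (ℕ × Mark A))) []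
    rwa [if_pos rfl] at this
  have hm : MeasurableSet {y : ℕ × Mark A | y.1 = y.2.1}ᶜ :=
    (measurableSet_eq_fun (by fun_prop) (by fun_prop)).compl
  rw [ae_iff]
  change (π₀ : Measure (ℕ × Mark A)) {y : ℕ × Mark A | y.1 = y.2.1}ᶜ = 0
  -- The probability in question does not depend on `n`, while for each `n` the event is contained
  -- in the bad event, whose probability tends to zero.
  refine le_antisymm (ENNReal.le_of_forall_pos_le_add fun δ hδ _ => ?_) bot_le
  obtain ⟨n, hn⟩ := (hT.eventually_bad_le hs (ε := 1 / 2) (by norm_num) (by norm_num)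
    (δ := (δ : ℝ≥0∞)) (by simpa using hδ.ne')).exists
  rw [← hev.measure_preimage hm.nullMeasurableSet, ← (hs n).map_node,
    Measure.map_apply (hs n).measurable_node (hev.measurable hm), zero_add]
  refine (measure_mono ?_).trans hn
  intro ω hω hgood
  refine hω ?_
  obtain ⟨hmat, hmark⟩ := hgood
  have hmat' : Matches ((T n).node ω) ((T n).θ ω) ((G n).mult ω) ((G n).root ω) K := hmat
  have h1 := hmat'.sum_mult_eq (i := []) trivial (by rw [List.length_nil]; exact hK)
  have h2 := hmark [] ⟨trivial, by simp⟩
  have h3 := fst_eq_of_markDist_lt_one (h2.trans_lt (by norm_num))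
  exact h1.symm.trans h3

/-- The product type carries the maximum metric; the comparison turns convergence in `markDist` into
topological convergence. -/
theorem dist_le_markDist (x y : Mark A) : dist y x ≤ markDist x y := by
  have h1 := abs_nonneg ((x.1 : ℝ) - y.1)
  have h2 := abs_nonneg ((x.2.1 : ℝ) - y.2.1)
  have h3 := dist_nonneg (x := x.2.2) (y := y.2.2)
  rw [dist_comm, Prod.dist_eq, Prod.dist_eq, Nat.dist_eq, Nat.dist_eq]
  unfold markDist
  refine max_le ?_ (max_le ?_ ?_) <;> linarith

/-- These sets enlarge the region `|u| > m` by the radius `1 / (m + 1)`. If `|u|` exceeds `m` at the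
mark of `I`, then the nearby mark of the tree root lies in the enlarged set, whose probability is
small by a fixed law; no uniform continuity of `u` is needed. -/
theorem isOpen_setOf_exists_markDist_lt (u : Mark A → ℝ) (m : ℕ) :
    IsOpen {x : Mark A | ∃ y, markDist x y < 1 / ((m : ℝ) + 1) ∧ (m : ℝ) < |u y|} := by
  have e : {x : Mark A | ∃ y, markDist x y < 1 / ((m : ℝ) + 1) ∧ (m : ℝ) < |u y|} =
      ⋃ y ∈ {y | (m : ℝ) < |u y|}, {x | markDist x y < 1 / ((m : ℝ) + 1)} := by
    ext x
    simp only [Set.mem_ofPred_eq, Set.mem_iUnion, exists_prop]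
    exact exists_congr fun y => and_comm
  rw [e]
  refine isOpen_biUnion fun y _ => ?_
  have h1 : Continuous fun x : Mark A => markDist x y :=
    continuous_markDist.comp (continuous_id.prodMk continuous_const)
  exact isOpen_lt h1 continuous_const

/-- A point of the intersection would be the limit of points at which `|u|` tends to infinity,
contradicting continuity. -/
theorem iInter_setOf_exists_markDist_lt {u : Mark A → ℝ} (hu : Continuous u) :
    ⋂ m : ℕ, {x : Mark A | ∃ y, markDist x y < 1 / ((m : ℝ) + 1) ∧ (m : ℝ) < |u y|} = ∅ := by
  refine Set.eq_empty_iff_forall_notMem.2 fun x hx => ?_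
  rw [Set.mem_iInter] at hx
  choose y hy1 hy2 using hx
  have h1 : Tendsto (fun m => markDist x (y m)) atTop (𝓝 0) :=
    squeeze_zero (fun m => markDist_nonneg _ _) (fun m => (hy1 m).le)
      tendsto_one_div_add_atTop_nhds_zero_nat
  have h2 : Tendsto y atTop (𝓝 x) := tendsto_iff_dist_tendsto_zero.2
    (squeeze_zero (fun m => dist_nonneg) (fun m => dist_le_markDist _ _) h1)
  have h3 : Tendsto (fun m => |u (y m)|) atTop (𝓝 |u x|) :=
    ((continuous_abs.comp hu).tendsto x).comp h2
  have h4 : Tendsto (fun m => |u (y m)|) atTop atTop :=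
    tendsto_atTop_mono (fun m => (hy2 m).le) tendsto_natCast_atTop_atTop
  exact not_tendsto_atTop_of_tendsto_nhds h3 h4

/-- Continuous functions of the mark of `I` are tight. -/
theorem IsStrongCoupling.exists_tight
    (hs : ∀ n, IsCoupledSystem M μ₀ π₀ π₁ (P n) (G n) (W n) (T n))
    (hT : IsStrongCoupling P G π₀ π₁ K T) {u : Mark A → ℝ} (hu : Continuous u) {ε : ℝ≥0∞}
    (hε : ε ≠ 0) : ∃ L : ℕ, ∀ᶠ n in atTop,
      P n {ω | (L : ℝ≥0∞) < ‖u ((G n).mark ω ((G n).root ω))‖ₑ} ≤ ε := by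
  have : SecondCountableTopology A := UniformSpace.secondCountable_of_separable A
  set U : ℕ → Set (Mark A) := fun m =>
    {x : Mark A | ∃ y, markDist x y < 1 / ((m : ℝ) + 1) ∧ (m : ℝ) < |u y|} with hU
  have hUm : ∀ m, MeasurableSet (U m) := fun m =>
    (isOpen_setOf_exists_markDist_lt u m).measurableSet
  have hanti : Antitone U := by
    intro m m' hmm x hx
    obtain ⟨y, hy1, hy2⟩ := hx
    have hc : (m : ℝ) ≤ m' := by exact_mod_cast hmm
    refine ⟨y, hy1.trans_le ?_, hc.trans_lt hy2⟩
    exact one_div_le_one_div_of_le (by positivity) (by linarith)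
  have hev : MeasurePreserving (fun t : List ℕ → ℕ × Mark A => t []) (gwLaw π₀ π₁)
      (π₀ : Measure (ℕ × Mark A)) := by
    have := measurePreserving_eval_infinitePi (fun i : List ℕ =>
      (((if i = [] then π₀ else π₁ : ProbabilityMeasure (ℕ × Mark A))) : Measure (ℕ × Mark A))) []
    rwa [if_pos rfl] at this
  set ρ : Measure (Mark A) := (gwLaw π₀ π₁).map fun t => (t []).2 with hρ
  have htm : Measurable fun t : List ℕ → ℕ × Mark A => (t []).2 := by fun_prop
  have : IsProbabilityMeasure ρ := Measure.isProbabilityMeasure_map htm.aemeasurable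
  have hlim := tendsto_measure_iInter_atTop (μ := ρ) (fun m => (hUm m).nullMeasurableSet) hanti
    ⟨0, measure_ne_top _ _⟩
  rw [iInter_setOf_exists_markDist_lt hu, measure_empty] at hlim
  obtain ⟨m, hm⟩ := (ENNReal.tendsto_nhds_zero.1 hlim (ε / 2) (by simp [pos_iff_ne_zero, hε])).exists
  have hm2 : (0 : ℝ) < (m : ℝ) + 2 := by positivity
  refine ⟨m, ?_⟩
  -- The radius `1 / (m + 2)` is strictly below both `1 / (m + 1)` and `1`, the latter also for `m =
  -- 0`.
  filter_upwards [hT.eventually_bad_le hs (ε := 1 / ((m : ℝ) + 2)) (by positivity)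
    (by rw [div_lt_one hm2]; have : (0 : ℝ) ≤ m := by positivity
        linarith) (δ := ε / 2) (by simp [hε])] with n hn
  have h1 : P n ((T n).node ⁻¹' ((fun t => (t []).2) ⁻¹' U m)) ≤ ε / 2 := by
    rw [← Measure.map_apply (hs n).measurable_node (htm (hUm m)), (hs n).map_node,
      ← Measure.map_apply htm (hUm m)]
    exact hm
  calc _ ≤ P n ((T n).node ⁻¹' ((fun t => (t []).2) ⁻¹' U m) ∪
        couplingData (G n) (T n) ⁻¹' (goodData (Fin (n + 1)) K (1 / ((m : ℝ) + 2)))ᶜ) := by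
        refine measure_mono fun ω hω => ?_
        by_contra hc
        rw [Set.mem_union, not_or] at hc
        obtain ⟨hc1, hc2⟩ := hc
        have hgood : couplingData (G n) (T n) ω ∈ goodData (Fin (n + 1)) K (1 / ((m : ℝ) + 2)) := by
          by_contra h; exact hc2 h
        have h2 := hgood.2 [] ⟨trivial, by simp⟩
        have h3 : (T n).θ ω [] = (G n).root ω := hgood.1.1
        refine hc1 ⟨(G n).mark ω ((G n).root ω), ?_, ?_⟩
        · rw [markDist_comm, ← h3]
          refine lt_of_le_of_lt h2 ?_
          exact one_div_lt_one_div_of_lt (by positivity) (by linarith)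
        · have h4 : (m : ℝ≥0∞) < ‖u ((G n).mark ω ((G n).root ω))‖ₑ := hω
          rw [← ofReal_norm, Real.norm_eq_abs, ← ENNReal.ofReal_natCast,
            ENNReal.ofReal_lt_ofReal_iff_of_nonneg (by positivity)] at h4
          exact h4
    _ ≤ ε / 2 + ε / 2 := (measure_union_le _ _).trans (add_le_add h1 hn)
    _ = ε := ENNReal.add_halves ε

end Sequence

/-! ### Closeness, uniform integrability and tightness at one fixed time -/

section Sequence

variable {A : Type a} {Z : Type v} {Ξ : Type w} [MeasurableSpace Z] [MeasurableSpace Ξ]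
  [MetricSpace A] [TopologicalSpace.SeparableSpace A] [MeasurableSpace A] [BorelSpace A]
  {Ω : ℕ → Type u} [∀ n, MeasurableSpace (Ω n)]
  {M : Recursion A Z Ξ} {μ₀ : ProbabilityMeasure ℝ} {B : Bounds A} {p : ℝ}
  {π₀ π₁ : ProbabilityMeasure (ℕ × Mark A)} {P : ∀ n, Measure (Ω n)}
  [∀ n, IsProbabilityMeasure (P n)] {G : ∀ n, RandomDigraph (Ω n) (Fin (n + 1)) A}
  {W : ∀ n, Ω n → NoiseSpace (Fin (n + 1)) (Fin (n + 1) × Fin (n + 1) × ℕ) Z Ξ}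
  {T : ∀ n, TreeCoupling (Ω n) (Fin (n + 1)) A} {K r : ℕ}

/-- Uniform integrability after conditioning on the vertex attributes, with respect to events that
are determined by the graph and the tree. -/
def DataUI (P : ∀ n, Measure (Ω n)) (G : ∀ n, RandomDigraph (Ω n) (Fin (n + 1)) A)
    (T : ∀ n, TreeCoupling (Ω n) (Fin (n + 1)) A) (f : ∀ n, Ω n → ℝ≥0∞) : Prop :=
  ∀ ε : ℝ≥0∞, ε ≠ 0 → ∃ δ : ℝ≥0∞, δ ≠ 0 ∧ ∀ᶠ n in atTop, ∃ S : Set (Fin (n + 1) → A),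
    MeasurableSet S ∧ P n ((G n).att ⁻¹' Sᶜ) ≤ ε ∧
    ∀ E : Set (CouplingData (Fin (n + 1)) A), MeasurableSet E →
      P n (couplingData (G n) (T n) ⁻¹' E) ≤ δ →
      ∫⁻ ω in (G n).att ⁻¹' S ∩ couplingData (G n) (T n) ⁻¹' E, f n ω ∂P n ≤ ε

/-- The recursions on the graph and on the tree are close in `L^p`, conditionally on the vertex
attributes. -/
def RootClose (M : Recursion A Z Ξ) (μ₀ : ProbabilityMeasure ℝ) (p : ℝ) (P : ∀ n, Measure (Ω n))
    (G : ∀ n, RandomDigraph (Ω n) (Fin (n + 1)) A)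
    (W : ∀ n, Ω n → NoiseSpace (Fin (n + 1)) (Fin (n + 1) × Fin (n + 1) × ℕ) Z Ξ)
    (T : ∀ n, TreeCoupling (Ω n) (Fin (n + 1)) A) (K r : ℕ) : Prop :=
  CondNeg P (fun n => (G n).att) fun n S => ∫⁻ q in Prod.fst ⁻¹' ((G n).att ⁻¹' S),
    ‖(G n).rootR M (W n) r q.1 - treeR M ((T n).node q.1) (treeNoise (T n) (W n) K q) r []‖ₑ ^ p
    ∂((P n).prod (M.noiseLaw μ₀ (List ℕ) (List ℕ)))

/-- The good event contributes at most `η` times the mean of the majorant. The bad event is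
determined by graph and tree, so `DataUI` bounds the graph side there, and integrability of the
majorant bounds the tree side. -/
theorem Regular.rootClose_of_dataUI (h : Regular M B p μ₀ π₀ π₁)
    (hs : ∀ n, IsCoupledSystem M μ₀ π₀ π₁ (P n) (G n) (W n) (T n))
    (hT : IsStrongCoupling P G π₀ π₁ K T) (hr : r ≤ K)
    (hUI : DataUI P G T fun n ω => ‖(G n).rootR M (W n) r ω‖ₑ ^ p) :
    RootClose M μ₀ p P G W T K r := by
  obtain ⟨m, hm, hmint, hmb, hmc⟩ := h.exists_majorant
  intro ε hε
  have hε2 : ε / 2 ≠ 0 := by simp [hε]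
  obtain ⟨η, hη0, -, hη⟩ := exists_mul_le (hmint r) hε2
  obtain ⟨e, he0, he1, hme⟩ := hmc η hη0
  obtain ⟨ε₁, hε₁0, hε₁ε, hε₁⟩ := exists_mul_le (C := 4 ^ p * 2)
    (ENNReal.mul_ne_top (four_rpow_ne_top p h.one_le) (by simp)) hε2
  have hε₁2 : ε₁ / 2 ≠ 0 := by simp [hε₁0]
  obtain ⟨δ₁, hδ₁0, hδ₁⟩ := hUI ε₁ hε₁0
  obtain ⟨L, hL⟩ := exists_lintegral_tsub_le (hm r) (hmint r) hε₁2
  obtain ⟨δ₂, hδ₂0, -, hδ₂⟩ := exists_mul_le (C := (L : ℝ≥0∞)) (by simp) hε₁2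
  filter_upwards [hT.eventually_bad_le hs he0 he1 (δ := min δ₁ δ₂) (by simp [hδ₁0, hδ₂0]), hδ₁]
    with n hbad ⟨S, hS, hSc, hSE⟩
  refine ⟨S, hS, hSc.trans (hε₁ε.trans ENNReal.half_le_self), ?_⟩
  have hb : ∀ᵐ t ∂(gwLaw π₀ π₁),
      ∫⁻ w, ‖treeR M t w r []‖ₑ ^ p ∂(M.noiseLaw μ₀ (List ℕ) (List ℕ)) ≤ m r t := by
    filter_upwards [hmb] with t ht using ht r
  refine ((hs n).setLIntegral_sub_le h.meas h.meas_g h.one_le hr he1 (hm r) hb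
    (by filter_upwards [hme] with t ht X hN hX using ht X K hN hX r hr) hS).trans ?_
  have h1 := hSE _ (measurableSet_goodData K e).compl (hbad.trans (min_le_left _ _))
  have h2 : ∫⁻ ω in couplingData (G n) (T n) ⁻¹' (goodData (Fin (n + 1)) K e)ᶜ,
      m r ((T n).node ω) ∂P n ≤ ε₁ := by
    have h3 := setLIntegral_le_tsub_add (μ := P n) (fun ω => m r ((T n).node ω)) L Set.univ
      (couplingData (G n) (T n) ⁻¹' (goodData (Fin (n + 1)) K e)ᶜ)
    rw [Set.univ_inter, Measure.restrict_univ] at h3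
    have h4 : ∫⁻ ω, m r ((T n).node ω) - L ∂P n = ∫⁻ t, m r t - L ∂(gwLaw π₀ π₁) := by
      rw [← (hs n).map_node]
      exact (lintegral_map ((hm r).sub measurable_const) (hs n).measurable_node).symm
    rw [h4] at h3
    refine h3.trans ((add_le_add hL ((mul_le_mul_right (hbad.trans (min_le_right _ _)) _).trans
      hδ₂)).trans (ENNReal.add_halves ε₁).le)
  calc _ ≤ ε / 2 + 4 ^ p * (ε₁ + ε₁) := by
        refine add_le_add ?_ (mul_le_mul_right (add_le_add h1 h2) _)
        rw [mul_comm]; exact hη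
    _ ≤ ε / 2 + ε / 2 := by
        rw [← two_mul, ← mul_assoc]
        exact add_le_add le_rfl hε₁
    _ = ε := ENNReal.add_halves ε

/-- The tree value has a fixed law with finite `p`-th moment, and closeness transfers its uniform
integrability to the graph. The events are now arbitrary and may involve the noises, which is the
gain over `DataUI`. -/
theorem Regular.condUI_rootR (h : Regular M B p μ₀ π₀ π₁)
    (hs : ∀ n, IsCoupledSystem M μ₀ π₀ π₁ (P n) (G n) (W n) (T n))
    (hc : RootClose M μ₀ p P G W T K r) :
    CondUI P (fun n => (G n).att) fun n ω => ‖(G n).rootR M (W n) r ω‖ₑ ^ p := by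
  obtain ⟨m, hm, hmint, hmb, -⟩ := h.exists_majorant
  have hp := h.one_le
  have hmR : Measurable fun q : (List ℕ → ℕ × Mark A) × NoiseSpace (List ℕ) (List ℕ) Z Ξ =>
      ‖treeR M q.1 q.2 r []‖ₑ ^ p := (measurable_treeR h.meas h.meas_g r []).enorm.pow_const p
  have hfin : ∫⁻ q, ‖treeR M q.1 q.2 r []‖ₑ ^ p
      ∂((gwLaw π₀ π₁).prod (M.noiseLaw μ₀ (List ℕ) (List ℕ))) ≠ ∞ := by
    rw [lintegral_prod _ hmR.aemeasurable]
    refine ne_top_of_le_ne_top (hmint r) (lintegral_mono_ae ?_)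
    filter_upwards [hmb] with t ht using ht r
  have hUI := condUI_of_law (P := fun n => (P n).prod (M.noiseLaw μ₀ (List ℕ) (List ℕ)))
    (X := fun n q => (G n).att q.1) hmR hfin fun n => (hs n).measurePreserving_node_treeNoise K
  intro ε hε
  obtain ⟨ε₁, hε₁0, -, hε₁⟩ := exists_mul_le (C := 4 ^ p * 2 + 2)
    (ENNReal.add_ne_top.2 ⟨ENNReal.mul_ne_top (four_rpow_ne_top p hp) (by simp), by simp⟩) hε
  obtain ⟨δ, hδ0, hδ⟩ := hUI ε₁ hε₁0
  refine ⟨δ, hδ0, ?_⟩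
  filter_upwards [hδ, hc ε₁ hε₁0] with n ⟨S₁, hS₁, hS₁c, hS₁B⟩ ⟨S₂, hS₂, hS₂c, hS₂B⟩
  have hatt := (hs n).rooted.measurable_att
  have hR := (hs n).measurable_rootR h.meas h.meas_g r
  have hTr := (hs n).measurable_treeR_treeNoise h.meas h.meas_g K r
  have hfst := measurePreserving_fst (μ := P n) (ν := M.noiseLaw μ₀ (List ℕ) (List ℕ))
  refine ⟨S₁ ∩ S₂, hS₁.inter hS₂, ?_, fun E hE hEδ => ?_⟩
  · have h1 : P n ((G n).att ⁻¹' S₁ᶜ) ≤ ε₁ := by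
      rw [← hfst.measure_preimage (hatt hS₁.compl).nullMeasurableSet]
      exact hS₁c
    rw [Set.compl_inter, Set.preimage_union]
    calc _ ≤ ε₁ + ε₁ := (measure_union_le _ _).trans (add_le_add h1 hS₂c)
      _ = 2 * ε₁ := (two_mul _).symm
      _ ≤ (4 ^ p * 2 + 2) * ε₁ := mul_le_mul_left le_add_self _
      _ ≤ ε := hε₁
  · have hm1 : Measurable fun q : Ω n × NoiseSpace (List ℕ) (List ℕ) Z Ξ =>
      ‖(G n).rootR M (W n) r q.1 - treeR M ((T n).node q.1) (treeNoise (T n) (W n) K q) r []‖ₑ ^ p :=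
      ((hR.comp measurable_fst).sub hTr).enorm.pow_const p
    have h1 : ∫⁻ ω in (G n).att ⁻¹' (S₁ ∩ S₂) ∩ E, ‖(G n).rootR M (W n) r ω‖ₑ ^ p ∂P n =
        ∫⁻ q in Prod.fst ⁻¹' ((G n).att ⁻¹' (S₁ ∩ S₂) ∩ E), ‖(G n).rootR M (W n) r q.1‖ₑ ^ p
        ∂((P n).prod (M.noiseLaw μ₀ (List ℕ) (List ℕ))) :=
      (hfst.setLIntegral_comp_preimage ((hatt (hS₁.inter hS₂)).inter hE) (hR.enorm.pow_const p)).symm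
    rw [h1]
    calc _ ≤ ∫⁻ q in Prod.fst ⁻¹' ((G n).att ⁻¹' (S₁ ∩ S₂) ∩ E),
          4 ^ p * (‖(G n).rootR M (W n) r q.1 -
            treeR M ((T n).node q.1) (treeNoise (T n) (W n) K q) r []‖ₑ ^ p +
            ‖treeR M ((T n).node q.1) (treeNoise (T n) (W n) K q) r []‖ₑ ^ p)
          ∂((P n).prod (M.noiseLaw μ₀ (List ℕ) (List ℕ))) := by
          refine lintegral_mono fun q => ?_
          refine le_trans (ENNReal.rpow_le_rpow ?_ (by linarith)) (add_rpow_le hp _ _)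
          refine le_trans (le_of_eq ?_) (enorm_add_le _ _)
          rw [sub_add_cancel]
      _ ≤ 4 ^ p * (ε₁ + ε₁) := by
          rw [lintegral_const_mul' _ _ (four_rpow_ne_top p hp), lintegral_add_left hm1]
          refine mul_le_mul_right (add_le_add ?_ ?_) _
          · refine (lintegral_mono_set ?_).trans hS₂B
            exact Set.preimage_mono fun ω hω => hω.1.2
          · have h2 := hS₁B (Prod.fst ⁻¹' E) (measurable_fst hE)
              (by rw [hfst.measure_preimage hE.nullMeasurableSet]; exact hEδ)
            refine (lintegral_mono_set ?_).trans h2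
            exact fun q hq => ⟨hq.1.1, hq.2⟩
      _ ≤ (4 ^ p * 2 + 2) * ε₁ := by
          rw [← two_mul, ← mul_assoc]
          exact mul_le_mul_left le_self_add _
      _ ≤ ε := hε₁

theorem exists_measure_enorm_gt_le {ρ : Measure ℝ} [IsFiniteMeasure ρ] {ε : ℝ≥0∞} (hε : ε ≠ 0) :
    ∃ L : ℕ, ρ {x | (L : ℝ≥0∞) < ‖x‖ₑ} ≤ ε := by
  have hlim := tendsto_measure_iInter_atTop (μ := ρ) (s := fun L : ℕ => {x : ℝ | (L : ℝ≥0∞) < ‖x‖ₑ})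
    (fun L => (measurableSet_lt measurable_const measurable_enorm).nullMeasurableSet)
    (fun L L' hL x hx => lt_of_le_of_lt (Nat.cast_le.2 hL : (L : ℝ≥0∞) ≤ L') hx) ⟨0, measure_ne_top _ _⟩
  have e : ⋂ L : ℕ, {x : ℝ | (L : ℝ≥0∞) < ‖x‖ₑ} = ∅ := by
    refine Set.eq_empty_iff_forall_notMem.2 fun x hx => ?_
    rw [Set.mem_iInter] at hx
    obtain ⟨L, hL⟩ := ENNReal.exists_nat_gt (enorm_ne_top (x := x))
    exact (hx L).not_gt hL
  rw [e, measure_empty] at hlim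
  exact (ENNReal.tendsto_nhds_zero.1 hlim ε (pos_iff_ne_zero.2 hε)).exists

/-- A value above `1 + L` at `I` requires a tree value above `L`, improbable by the fixed law, or a
difference of at least `1`, improbable by Markov's inequality. -/
theorem Regular.exists_tight_rootR (h : Regular M B p μ₀ π₀ π₁)
    (hs : ∀ n, IsCoupledSystem M μ₀ π₀ π₁ (P n) (G n) (W n) (T n))
    (hc : RootClose M μ₀ p P G W T K r) {ε : ℝ≥0∞} (hε : ε ≠ 0) :
    ∃ L : ℕ, ∀ᶠ n in atTop, P n {ω | (L : ℝ≥0∞) < ‖(G n).rootR M (W n) r ω‖ₑ} ≤ ε := by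
  have hp := h.one_le
  obtain ⟨ε₁, hε₁0, -, hε₁⟩ := exists_mul_le (C := 3) (by simp) hε
  have hfin : IsProbabilityMeasure (rootLaw M μ₀ π₀ π₁ r) :=
    Measure.isProbabilityMeasure_map (measurable_treeR h.meas h.meas_g r []).aemeasurable
  obtain ⟨L, hL⟩ := exists_measure_enorm_gt_le (ρ := rootLaw M μ₀ π₀ π₁ r) hε₁0
  refine ⟨1 + L, ?_⟩
  filter_upwards [hc ε₁ hε₁0] with n ⟨S, hS, hSc, hSB⟩
  have hatt := (hs n).rooted.measurable_att
  have hR := (hs n).measurable_rootR h.meas h.meas_g r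
  have hTr := (hs n).measurable_treeR_treeNoise h.meas h.meas_g K r
  have hfst := measurePreserving_fst (μ := P n) (ν := M.noiseLaw μ₀ (List ℕ) (List ℕ))
  have hmp : MeasurePreserving (fun q : (List ℕ → ℕ × Mark A) × NoiseSpace (List ℕ) (List ℕ) Z Ξ =>
      treeR M q.1 q.2 r []) ((gwLaw π₀ π₁).prod (M.noiseLaw μ₀ (List ℕ) (List ℕ)))
      (rootLaw M μ₀ π₀ π₁ r) := ⟨measurable_treeR h.meas h.meas_g r [], rfl⟩
  have hmp' := hmp.comp ((hs n).measurePreserving_node_treeNoise K)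
  have hm1 : Measurable fun q : Ω n × NoiseSpace (List ℕ) (List ℕ) Z Ξ =>
      ‖(G n).rootR M (W n) r q.1 - treeR M ((T n).node q.1) (treeNoise (T n) (W n) K q) r []‖ₑ :=
    ((hR.comp measurable_fst).sub hTr).enorm
  have hL1 : MeasurableSet {x : ℝ | (L : ℝ≥0∞) < ‖x‖ₑ} :=
    measurableSet_lt measurable_const measurable_enorm
  have hR1 : MeasurableSet {ω | ((1 + L : ℕ) : ℝ≥0∞) < ‖(G n).rootR M (W n) r ω‖ₑ} :=
    measurableSet_lt measurable_const hR.enorm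
  rw [← hfst.measure_preimage hR1.nullMeasurableSet]
  set D : Set (Ω n × NoiseSpace (List ℕ) (List ℕ) Z Ξ) := {q | 1 ≤ ‖(G n).rootR M (W n) r q.1 -
    treeR M ((T n).node q.1) (treeNoise (T n) (W n) K q) r []‖ₑ ^ p} with hD
  calc _ ≤ ((P n).prod (M.noiseLaw μ₀ (List ℕ) (List ℕ)))
        (Prod.fst ⁻¹' ((G n).att ⁻¹' Sᶜ) ∪ D ∩ Prod.fst ⁻¹' ((G n).att ⁻¹' S) ∪
          (fun q => treeR M ((T n).node q.1) (treeNoise (T n) (W n) K q) r []) ⁻¹'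
            {x : ℝ | (L : ℝ≥0∞) < ‖x‖ₑ}) := by
        refine measure_mono fun q hq => ?_
        by_contra hcon
        rw [Set.mem_union, Set.mem_union, not_or, not_or] at hcon
        obtain ⟨⟨h1, h2⟩, h3⟩ := hcon
        have hqS : q ∈ Prod.fst ⁻¹' ((G n).att ⁻¹' S) := by
          by_contra h4; exact h1 h4
        have h4 : ‖(G n).rootR M (W n) r q.1 -
            treeR M ((T n).node q.1) (treeNoise (T n) (W n) K q) r []‖ₑ < 1 := by
          by_contra h5
          exact h2 ⟨ENNReal.one_le_rpow (not_lt.1 h5) (by linarith), hqS⟩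
        have h5 : ‖treeR M ((T n).node q.1) (treeNoise (T n) (W n) K q) r []‖ₑ ≤ L := not_lt.1 h3
        have h6 : ((1 + L : ℕ) : ℝ≥0∞) < ‖(G n).rootR M (W n) r q.1‖ₑ := hq
        refine h6.not_ge ?_
        push_cast
        refine le_trans ?_ (add_le_add h4.le h5)
        refine le_trans (le_of_eq ?_) (enorm_add_le _ _)
        rw [sub_add_cancel]
    _ ≤ ε₁ + ε₁ + ε₁ := by
        refine (measure_union_le _ _).trans (add_le_add ((measure_union_le _ _).trans
          (add_le_add ?_ ?_)) ?_)
        · rw [hfst.measure_preimage (hatt hS.compl).nullMeasurableSet]; exact hSc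
        · refine le_trans ?_ hSB
          rw [← Measure.restrict_apply (measurableSet_le measurable_const (hm1.pow_const p))]
          have := mul_meas_ge_le_lintegral (μ := ((P n).prod (M.noiseLaw μ₀ (List ℕ) (List ℕ))).restrict
            (Prod.fst ⁻¹' ((G n).att ⁻¹' S))) (hm1.pow_const p) 1
          rwa [one_mul] at this
        · have := hmp'.measure_preimage hL1.nullMeasurableSet
          exact (le_of_eq this).trans hL
    _ = 3 * ε₁ := by ring
    _ ≤ ε := hε₁

end Sequence

/-! ### The induction on time -/

section Sequence

variable {A : Type a} {Z : Type v} {Ξ : Type w} [MeasurableSpace Z] [MeasurableSpace Ξ]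
  [MetricSpace A] [TopologicalSpace.SeparableSpace A] [MeasurableSpace A] [BorelSpace A]
  {Ω : ℕ → Type u} [∀ n, MeasurableSpace (Ω n)]
  {M : Recursion A Z Ξ} {μ₀ : ProbabilityMeasure ℝ} {B : Bounds A} {p : ℝ}
  {π₀ π₁ : ProbabilityMeasure (ℕ × Mark A)} {P : ∀ n, Measure (Ω n)}
  [∀ n, IsProbabilityMeasure (P n)] {G : ∀ n, RandomDigraph (Ω n) (Fin (n + 1)) A}
  {W : ∀ n, Ω n → NoiseSpace (Fin (n + 1)) (Fin (n + 1) × Fin (n + 1) × ℕ) Z Ξ}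
  {T : ∀ n, TreeCoupling (Ω n) (Fin (n + 1)) A} {K r : ℕ}

theorem Regular.exists_tight_g (h : Regular M B p μ₀ π₀ π₁) (hsp : Continuous B.sp)
    (hg : Continuous (M.g 0))
    (hs : ∀ n, IsCoupledSystem M μ₀ π₀ π₁ (P n) (G n) (W n) (T n))
    (hT : IsStrongCoupling P G π₀ π₁ K T)
    (hc : RootClose M μ₀ p P G W T K r) {ε : ℝ≥0∞} (hε : ε ≠ 0) :
    ∃ L : ℕ, ∀ᶠ n in atTop, P n {ω | (L : ℝ≥0∞) <
      ‖M.g ((G n).rootR M (W n) r ω) ((G n).mark ω ((G n).root ω))‖ₑ} ≤ ε := by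
  obtain ⟨ε₁, hε₁0, -, hε₁⟩ := exists_mul_le (C := 3) (by simp) hε
  obtain ⟨a, ha⟩ := h.exists_tight_rootR hs hc hε₁0
  obtain ⟨b, hb⟩ := hT.exists_tight hs hsp hε₁0
  obtain ⟨c, hc⟩ := hT.exists_tight hs hg hε₁0
  refine ⟨c + b * a, ?_⟩
  filter_upwards [ha, hb, hc] with n ha hb hc
  calc _ ≤ P n ({ω | (a : ℝ≥0∞) < ‖(G n).rootR M (W n) r ω‖ₑ} ∪
        {ω | (b : ℝ≥0∞) < ‖B.sp ((G n).mark ω ((G n).root ω))‖ₑ} ∪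
        {ω | (c : ℝ≥0∞) < ‖M.g 0 ((G n).mark ω ((G n).root ω))‖ₑ}) := by
        refine measure_mono fun ω hω => ?_
        by_contra hcon
        rw [Set.mem_union, Set.mem_union, not_or, not_or] at hcon
        obtain ⟨⟨h1, h2⟩, h3⟩ := hcon
        have h4 : ((c + b * a : ℕ) : ℝ≥0∞) <
          ‖M.g ((G n).rootR M (W n) r ω) ((G n).mark ω ((G n).root ω))‖ₑ := hω
        refine h4.not_ge ((enorm_g_le h.lip _ _).trans ?_)
        push_cast
        exact add_le_add (not_lt.1 h3) (mul_le_mul' (not_lt.1 h2) (not_lt.1 h1))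
    _ ≤ ε₁ + ε₁ + ε₁ := (measure_union_le _ _).trans
        (add_le_add ((measure_union_le _ _).trans (add_le_add ha hb)) hc)
    _ = 3 * ε₁ := by ring
    _ ≤ ε := hε₁

/-- Given graph and tree, the initial value at `I` still has law `μ₀`; the integral over an event of
the data is its probability times a finite moment. -/
theorem Regular.dataUI_zero (h : Regular M B p μ₀ π₀ π₁)
    (hs : ∀ n, IsCoupledSystem M μ₀ π₀ π₁ (P n) (G n) (W n) (T n)) :
    DataUI P G T fun n ω => ‖(G n).rootR M (W n) 0 ω‖ₑ ^ p := by
  intro ε hε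
  obtain ⟨δ, hδ0, -, hδ⟩ := exists_mul_le h.init hε
  refine ⟨δ, hδ0, Eventually.of_forall fun n => ⟨Set.univ, MeasurableSet.univ, by simp, ?_⟩⟩
  intro E hE hEδ
  rw [Set.preimage_univ, Set.univ_inter]
  have hRd : Measurable fun q : CouplingData (Fin (n + 1)) A ×
      NoiseSpace (Fin (n + 1)) (Fin (n + 1) × Fin (n + 1) × ℕ) Z Ξ =>
      ‖graphR M q.1.mark q.1.1.2.1 q.2 0 q.1.1.2.2‖ₑ ^ p :=
    (measurable_rootR_data h.meas h.meas_g 0).enorm.pow_const p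
  have h1 : ∫⁻ ω in couplingData (G n) (T n) ⁻¹' E, ‖(G n).rootR M (W n) 0 ω‖ₑ ^ p ∂P n =
      ∫⁻ ω in couplingData (G n) (T n) ⁻¹' E, ∫⁻ w,
        ‖graphR M ((G n).mark ω) ((G n).mult ω) w 0 ((G n).root ω)‖ₑ ^ p
        ∂(M.noiseLaw μ₀ (Fin (n + 1)) (Fin (n + 1) × Fin (n + 1) × ℕ)) ∂P n :=
    (hs n).setLIntegral_graph hE hRd
  have h2 : ∀ i : Fin (n + 1), ∫⁻ w : NoiseSpace (Fin (n + 1))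
      (Fin (n + 1) × Fin (n + 1) × ℕ) Z Ξ, ‖w.2.2 i‖ₑ ^ p
      ∂(M.noiseLaw μ₀ (Fin (n + 1)) (Fin (n + 1) × Fin (n + 1) × ℕ)) =
      ∫⁻ x, ‖x‖ₑ ^ p ∂(μ₀ : Measure ℝ) := by
    intro i
    have h3 : MeasurePreserving (fun w : NoiseSpace (Fin (n + 1))
      (Fin (n + 1) × Fin (n + 1) × ℕ) Z Ξ => w.2.2 i)
      (M.noiseLaw μ₀ (Fin (n + 1)) (Fin (n + 1) × Fin (n + 1) × ℕ)) (μ₀ : Measure ℝ) :=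
      (measurePreserving_eval_infinitePi (fun _ : Fin (n + 1) => (μ₀ : Measure ℝ)) i).comp
        (measurePreserving_snd.comp measurePreserving_snd)
    exact h3.lintegral_comp (f := fun x => ‖x‖ₑ ^ p) (measurable_enorm.pow_const p)
  rw [h1]
  simp only [graphR, h2]
  rw [setLIntegral_const]
  exact (mul_le_mul_right hEδ _).trans hδ

theorem Regular.dataUI_of_preservesInterval (h : Regular M B p μ₀ π₀ π₁)
    (hs : ∀ n, IsCoupledSystem M μ₀ π₀ π₁ (P n) (G n) (W n) (T n))
    (hbd : ∀ n, ∀ᵐ ω ∂(P n), BoundsOnGraph M B p ((G n).mark ω) ((G n).mult ω)) {R : ℝ}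
    (hR0 : 0 ≤ R) (hR : PreservesInterval P G M R) (hμ₀ : (μ₀ : Measure ℝ) (Set.Icc (-R) R)ᶜ = 0)
    (r : ℕ) : DataUI P G T fun n ω => ‖(G n).rootR M (W n) r ω‖ₑ ^ p := by
  have hp := h.one_le
  intro ε hε
  obtain ⟨δ, hδ0, -, hδ⟩ := exists_mul_le (C := ENNReal.ofReal R ^ p)
    (ENNReal.rpow_ne_top_of_nonneg (by linarith) ENNReal.ofReal_ne_top) hε
  refine ⟨δ, hδ0, Eventually.of_forall fun n => ⟨Set.univ, MeasurableSet.univ, by simp, ?_⟩⟩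
  intro E hE hEδ
  rw [Set.preimage_univ, Set.univ_inter]
  exact ((hs n).ae_enorm_rootR_le h.meas h.meas_g hp h.lip (hbd n)
    (hR (clampLaw R) (clampLaw_compl_Icc hR0) n) hμ₀ r hE).trans ((mul_le_mul_right hEδ _).trans hδ)

/-- The order of the choices matters: the uniform integrability of `R_I` at time `r` fixes how
improbable large values of `g` must be, tightness then fixes the level `L`, and only afterwards is
the integrability of `σ₋ D⁻` used, with an accuracy that compensates the factor `L ^ p`. -/
theorem Regular.dataUI_succ (h : Regular M B p μ₀ π₀ π₁) (hsp : Continuous B.sp)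
    (hg : Continuous (M.g 0))
    (hs : ∀ n, IsCoupledSystem M μ₀ π₀ π₁ (P n) (G n) (W n) (T n))
    (hT : IsStrongCoupling P G π₀ π₁ K T)
    (hbd : ∀ n, ∀ᵐ ω ∂(P n), BoundsOnGraph M B p ((G n).mark ω) ((G n).mult ω))
    (hmat : MatrixBounds P G M B p)
    (hdeg : CondUI P (fun n => (G n).att) fun n ω => ‖B.sm ((G n).mark ω ((G n).root ω)) *
      (((G n).mark ω ((G n).root ω)).1 : ℝ)‖ₑ ^ p)
    (hβ : CondUI P (fun n => (G n).att) fun n ω => ‖B.β ((G n).mark ω ((G n).root ω))‖ₑ ^ p)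
    (hc : RootClose M μ₀ p P G W T K r) :
    DataUI P G T fun n ω => ‖(G n).rootR M (W n) (r + 1) ω‖ₑ ^ p := by
  have hp := h.one_le
  have hp0 : 0 ≤ p := by linarith
  have h4 := four_rpow_ne_top p hp
  obtain ⟨C, C₀, hC⟩ := hmat
  have hCp : ∀ x : ℝ, ENNReal.ofReal x ^ p ≠ ∞ := fun x =>
    ENNReal.rpow_ne_top_of_nonneg hp0 ENNReal.ofReal_ne_top
  set D : ℝ≥0∞ := 4 ^ p * (1 + 4 ^ p * (ENNReal.ofReal C ^ p + ENNReal.ofReal C₀ ^ p) + 1) with hD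
  have hDtop : D ≠ ∞ := by
    refine ENNReal.mul_ne_top h4 (ENNReal.add_ne_top.2 ⟨ENNReal.add_ne_top.2 ⟨by simp,
      ENNReal.mul_ne_top h4 (ENNReal.add_ne_top.2 ⟨hCp C, hCp C₀⟩)⟩, by simp⟩)
  intro ε hε
  obtain ⟨ε₁, hε₁0, -, hε₁⟩ := exists_mul_le (C := D + 3)
    (ENNReal.add_ne_top.2 ⟨hDtop, by simp⟩) hε
  obtain ⟨δR, hδR0, hδR⟩ := h.condUI_rootR hs hc ε₁ hε₁0
  -- The event that `g` exceeds `L` depends on the noises, so uniform integrability over arbitrary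
  -- events, obtained from closeness at time `r`, is required here.
  obtain ⟨L, hL⟩ := h.exists_tight_g hsp hg hs hT hc (ε := min ε₁ δR) (by simp [hε₁0, hδR0])
  obtain ⟨ε₂, hε₂0, hε₂ε, hε₂⟩ := exists_mul_le (C := (L : ℝ≥0∞) ^ p)
    (ENNReal.rpow_ne_top_of_nonneg hp0 (by simp)) hε₁0
  obtain ⟨δ₁, hδ₁0, hδ₁⟩ := hdeg ε₂ hε₂0
  obtain ⟨δ₂, hδ₂0, hδ₂⟩ := hβ ε₁ hε₁0
  refine ⟨min δ₁ δ₂, by simp [hδ₁0, hδ₂0], ?_⟩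
  filter_upwards [hδR, hL, hδ₁, hδ₂] with n ⟨S₀, hS₀, hS₀c, hS₀B⟩ hLn ⟨S₁, hS₁, hS₁c, hS₁B⟩
    ⟨S₂, hS₂, hS₂c, hS₂B⟩
  have hdata := (hs n).measurable_data
  have hmark : Measurable fun ω => (G n).mark ω ((G n).root ω) :=
    measurable_mark_comp (d := couplingData (G n) (T n)) hdata (hs n).rooted.measurable_root
  have hU : MeasurableSet {ω | (L : ℝ≥0∞) <
      ‖M.g ((G n).rootR M (W n) r ω) ((G n).mark ω ((G n).root ω))‖ₑ} :=
    measurableSet_lt measurable_const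
      (measurable_g_comp h.meas_g ((hs n).measurable_rootR h.meas h.meas_g r) hmark).enorm
  refine ⟨S₀ ∩ S₁ ∩ S₂, (hS₀.inter hS₁).inter hS₂, ?_, fun E hE hEδ => ?_⟩
  · rw [Set.compl_inter, Set.compl_inter, Set.preimage_union, Set.preimage_union]
    calc _ ≤ ε₁ + ε₁ + ε₁ := (measure_union_le _ _).trans (add_le_add ((measure_union_le _ _).trans
          (add_le_add hS₀c (hS₁c.trans hε₂ε))) hS₂c)
      _ = 3 * ε₁ := by ring
      _ ≤ (D + 3) * ε₁ := mul_le_mul_left le_add_self _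
      _ ≤ ε := hε₁
  · refine ((hs n).setLIntegral_rootR_succ_le h.meas h.meas_g h.meas_sm h.meas_β hp h.lip (hbd n)
      (hC n) (L : ℝ≥0∞) r ((hS₀.inter hS₁).inter hS₂) hE).trans ?_
    have b0 : ∫⁻ ω in (G n).att ⁻¹' (S₀ ∩ S₁ ∩ S₂) ∩ {ω | (L : ℝ≥0∞) <
        ‖M.g ((G n).rootR M (W n) r ω) ((G n).mark ω ((G n).root ω))‖ₑ},
        ‖(G n).rootR M (W n) r ω‖ₑ ^ p ∂P n ≤ ε₁ :=
      (lintegral_mono_set (Set.inter_subset_inter_left _ fun ω hω => hω.1.1)).trans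
        (hS₀B _ hU (hLn.trans (min_le_right _ _)))
    have b1 : ∫⁻ ω in (G n).att ⁻¹' (S₀ ∩ S₁ ∩ S₂) ∩ couplingData (G n) (T n) ⁻¹' E,
        ‖B.sm ((G n).mark ω ((G n).root ω)) * (((G n).mark ω ((G n).root ω)).1 : ℝ)‖ₑ ^ p ∂P n ≤
        ε₂ :=
      (lintegral_mono_set (Set.inter_subset_inter_left _ fun ω hω => hω.1.2)).trans
        (hS₁B _ (hdata hE) (hEδ.trans (min_le_left _ _)))
    have b2 : ∫⁻ ω in (G n).att ⁻¹' (S₀ ∩ S₁ ∩ S₂) ∩ couplingData (G n) (T n) ⁻¹' E,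
        ‖B.β ((G n).mark ω ((G n).root ω))‖ₑ ^ p ∂P n ≤ ε₁ :=
      (lintegral_mono_set (Set.inter_subset_inter_left _ fun ω hω => hω.2)).trans
        (hS₂B _ (hdata hE) (hEδ.trans (min_le_right _ _)))
    calc _ ≤ 4 ^ p * ((L : ℝ≥0∞) ^ p * ε₂ + 4 ^ p * (ENNReal.ofReal C ^ p * ε₁ +
          ENNReal.ofReal C₀ ^ p * ε₁) + ε₁) := by
          refine mul_le_mul_right (add_le_add (add_le_add (mul_le_mul_right b1 _)
            (mul_le_mul_right (add_le_add (mul_le_mul_right b0 _) (mul_le_mul_right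
              (hLn.trans (min_le_left _ _)) _)) _)) b2) _
      _ ≤ 4 ^ p * (ε₁ + 4 ^ p * (ENNReal.ofReal C ^ p * ε₁ +
          ENNReal.ofReal C₀ ^ p * ε₁) + ε₁) :=
          mul_le_mul_right (add_le_add (add_le_add hε₂ le_rfl) le_rfl) _
      _ = D * ε₁ := by rw [hD]; ring
      _ ≤ (D + 3) * ε₁ := mul_le_mul_left le_self_add _
      _ ≤ ε := hε₁

/-- The recursion on the graph is close to the recursion on the coupled tree. -/
theorem Regular.rootClose (h : Regular M B p μ₀ π₀ π₁) (hK : 1 ≤ K) (hsp : Continuous B.sp)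
    (hg : Continuous (M.g 0))
    (hs : ∀ n, IsCoupledSystem M μ₀ π₀ π₁ (P n) (G n) (W n) (T n))
    (hT : IsStrongCoupling P G π₀ π₁ K T)
    (hbd : ∀ n, ∀ᵐ ω ∂(P n), BoundsOnGraph M B p ((G n).mark ω) ((G n).mult ω))
    (hinit : MatrixBounds P G M B p ∨
      ∃ R : ℝ, 0 ≤ R ∧ PreservesInterval P G M R ∧ (μ₀ : Measure ℝ) (Set.Icc (-R) R)ᶜ = 0)
    (hA : GraphAssumption P G π₀ π₁ M B p) : ∀ r ≤ K, RootClose M μ₀ p P G W T K r := by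
  have hp := h.one_le
  have hn : Measurable fun n : ℕ => (n : ℝ) := measurable_from_top
  have hmark : ∀ n, Measurable fun ω => (G n).mark ω ((G n).root ω) := fun n =>
    measurable_mark_comp (d := couplingData (G n) (T n)) (hs n).measurable_data
      (hs n).rooted.measurable_root
  have hsnd : Measurable fun y : ℕ × Mark A => y.2 := measurable_snd
  have hmf : Measurable fun y : ℕ × Mark A => B.sm y.2 * (y.2.1 : ℝ) := by
    have h1 := h.meas_sm.comp hsnd
    have h2 : Measurable fun y : ℕ × Mark A => y.2.1 := by fun_prop
    have h3 := hn.comp h2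
    have h4 := h1.mul h3
    exact h4
  have hmβ : Measurable fun y : ℕ × Mark A => B.β y.2 := by
    have h1 := h.meas_β.comp hsnd
    exact h1
  have hd : ∀ n, Measurable fun ω => B.sm ((G n).mark ω ((G n).root ω)) *
      (((G n).mark ω ((G n).root ω)).1 : ℝ) := fun n => by
    have h1 := h.meas_sm.comp (hmark n)
    have h2 := hn.comp (hmark n).fst
    have h3 := h1.mul h2
    exact h3
  have hb : ∀ n, Measurable fun ω => B.β ((G n).mark ω ((G n).root ω)) := fun n => by
    have h1 := h.meas_β.comp (hmark n)
    exact h1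
  -- The moment assumption concerns the offspring number of the root, the convergence of degrees the
  -- in-degree in its mark; under the coupling they agree almost surely.
  have hfin : ∫⁻ x, ‖x‖ₑ ^ p ∂((π₀ : Measure (ℕ × Mark A)).map fun y => B.sm y.2 * (y.2.1 : ℝ)) ≠ ∞ := by
    rw [lintegral_map (measurable_enorm.pow_const p) hmf]
    refine ne_top_of_le_ne_top h.mom.root_sm (lintegral_mono_ae ?_)
    filter_upwards [hT.ae_root_fst hK hs] with y hy
    rw [enorm_mul, Real.enorm_natCast, ENNReal.mul_rpow_of_nonneg _ _ (by linarith), hy]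
  have hfin' : ∫⁻ x, ‖x‖ₑ ^ p ∂((π₀ : Measure (ℕ × Mark A)).map fun y => B.β y.2) ≠ ∞ := by
    rw [lintegral_map (measurable_enorm.pow_const p) hmβ]
    exact h.mom.root_β
  have hdeg := condUI_of_wasserstein (fun n => (hs n).rooted.measurable_att) hp hd hfin
    hA.degree_conv
  have hβ := condUI_of_wasserstein (fun n => (hs n).rooted.measurable_att) hp hb hfin' hA.β_conv
  intro r hr
  rcases hinit with hmat | ⟨R, hR0, hR, hμ₀⟩
  · induction r with
    | zero => exact h.rootClose_of_dataUI hs hT hr (h.dataUI_zero hs)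
    | succ r ih =>
      exact h.rootClose_of_dataUI hs hT hr
        (h.dataUI_succ hsp hg hs hT hbd hmat hdeg hβ (ih (by omega)))
  · exact h.rootClose_of_dataUI hs hT hr (h.dataUI_of_preservesInterval hs hbd hR0 hR hμ₀ r)

end Sequence

/-! ### Conditional laws and the coupling they inherit -/

section CondWasserstein

variable {Ω 𝒳 : Type*} [MeasurableSpace Ω] [MeasurableSpace 𝒳] {P : Measure Ω}
  [IsProbabilityMeasure P] {X : Ω → 𝒳} {R R' : Ω → ℝ} {p : ℝ} {ρ : Measure ℝ}

/-- The conditional joint law of the two variables is a coupling. Its second marginal is `ρ` because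
`R'` is independent of `X`. -/
theorem ae_wasserstein_condDistrib_le [IsProbabilityMeasure ρ] (hp : 1 ≤ p)
    (hR : Measurable R) (hR' : Measurable R')
    (hρ : MeasurePreserving (fun ω => (X ω, R' ω)) P ((P.map X).prod ρ)) :
    ∀ᵐ x ∂(P.map X), wasserstein p (condDistrib R X P x) ρ ≤
      (∫⁻ q, ‖q.1 - q.2‖ₑ ^ p ∂(condDistrib (fun ω => (R ω, R' ω)) X P x)) ^ (1 / p) := by
  have hRR : AEMeasurable (fun ω => (R ω, R' ω)) P := (hR.prodMk hR').aemeasurable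
  have h1 := condDistrib_comp (mβ := inferInstance) (μ := P) X hRR (measurable_fst (α := ℝ) (β := ℝ))
  have h2 := condDistrib_comp (mβ := inferInstance) (μ := P) X hRR (measurable_snd (α := ℝ) (β := ℝ))
  have h3 : condDistrib R' X P =ᵐ[P.map X] Kernel.const 𝒳 ρ := by
    refine condDistrib_ae_eq_of_measure_eq_compProd X hR'.aemeasurable ?_
    rw [hρ.map_eq, Measure.compProd_const]
  filter_upwards [h1, h2, h3] with x h1 h2 h3
  refine ENNReal.rpow_le_rpow (iInf₂_le _ ⟨?_, ?_⟩) (by positivity)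
  · rw [← Kernel.map_apply _ measurable_fst, ← h1]; rfl
  · rw [← Kernel.map_apply _ measurable_snd, ← h2]
    change condDistrib R' X P x = ρ
    rw [h3, Kernel.const_apply]

theorem setLIntegral_condDistrib_sub (hX : Measurable X) (hR : Measurable R) (hR' : Measurable R')
    {S : Set 𝒳} (hS : MeasurableSet S) (p : ℝ) :
    ∫⁻ x in S, ∫⁻ q, ‖q.1 - q.2‖ₑ ^ p ∂(condDistrib (fun ω => (R ω, R' ω)) X P x) ∂(P.map X) =
      ∫⁻ ω in X ⁻¹' S, ‖R ω - R' ω‖ₑ ^ p ∂P := by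
  have := Measure.isProbabilityMeasure_map (μ := P) hX.aemeasurable
  have hRR : Measurable (fun ω => (R ω, R' ω)) := hR.prodMk hR'
  have h1 := compProd_map_condDistrib (mβ := inferInstance) (μ := P) (X := X) hRR.aemeasurable
  have hF : Measurable fun z : 𝒳 × ℝ × ℝ => ‖z.2.1 - z.2.2‖ₑ ^ p := by fun_prop
  have h2 := Measure.setLIntegral_compProd (μ := P.map X)
    (κ := condDistrib (fun ω => (R ω, R' ω)) X P) hF hS MeasurableSet.univ
  simp only [Measure.restrict_univ] at h2
  have h4 : MeasurableSet (S ×ˢ (Set.univ : Set (ℝ × ℝ))) := hS.prod MeasurableSet.univ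
  have h3 : ∫⁻ z in S ×ˢ Set.univ, ‖z.2.1 - z.2.2‖ₑ ^ p ∂(P.map fun ω => (X ω, (R ω, R' ω))) =
      ∫⁻ ω in X ⁻¹' S, ‖R ω - R' ω‖ₑ ^ p ∂P := by
    rw [setLIntegral_map h4 hF (hX.prodMk hRR)]
    congr 2
    ext; simp
  rw [← h3, ← h1, h2]

end CondWasserstein

/-! ### From closeness at the root to the statements in probability -/

section Main

variable {A : Type a} {Z : Type v} {Ξ : Type w} [MeasurableSpace Z] [MeasurableSpace Ξ]
  [MetricSpace A] [TopologicalSpace.SeparableSpace A] [MeasurableSpace A] [BorelSpace A]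
  {Ω : ℕ → Type u} [∀ n, MeasurableSpace (Ω n)]
  {M : Recursion A Z Ξ} {μ₀ : ProbabilityMeasure ℝ} {B : Bounds A} {p : ℝ}
  {π₀ π₁ : ProbabilityMeasure (ℕ × Mark A)} {P : ∀ n, Measure (Ω n)}
  [∀ n, IsProbabilityMeasure (P n)] {G : ∀ n, RandomDigraph (Ω n) (Fin (n + 1)) A}
  {W : ∀ n, Ω n → NoiseSpace (Fin (n + 1)) (Fin (n + 1) × Fin (n + 1) × ℕ) Z Ξ}
  {T : ∀ n, TreeCoupling (Ω n) (Fin (n + 1)) A} {K r : ℕ}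

theorem GraphAssumption.momentBounds (h : GraphAssumption P G π₀ π₁ M B p) (hp : 1 ≤ p) :
    MomentBounds M B p π₀ π₁ := by
  have hp0 : 0 ≤ p := by linarith
  refine ⟨?_, (lintegral_rpow_lt_top_of_memLp hp h.root_β).ne, ?_, ?_,
    (lintegral_rpow_lt_top_of_memLp hp h.node_sp).ne,
    (lintegral_rpow_lt_top_of_memLp hp h.node_g).ne⟩
  · convert (lintegral_rpow_lt_top_of_memLp hp h.root_sm).ne using 3 with y
    rw [enorm_mul, Real.enorm_natCast, ENNReal.mul_rpow_of_nonneg _ _ hp0, mul_comm]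
  · convert (lintegral_rpow_lt_top_of_memLp hp h.node_smsp).ne using 3 with y
    rw [enorm_mul, enorm_mul, Real.enorm_natCast, ENNReal.mul_rpow_of_nonneg _ _ hp0,
      ENNReal.mul_rpow_of_nonneg _ _ hp0]
    ring
  · convert (lintegral_rpow_lt_top_of_memLp hp h.node_spβ).ne using 3 with y
    rw [enorm_mul, ENNReal.mul_rpow_of_nonneg _ _ hp0]

theorem contr_eq (B : Bounds A) (hp : 0 ≤ p) (π₁ : ProbabilityMeasure (ℕ × Mark A)) :
    contr B p π₁ =
      ∫⁻ y, ‖(y.1 : ℝ) * B.sm y.2 * B.sp y.2‖ₑ ^ p ∂(π₁ : Measure (ℕ × Mark A)) := by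
  refine lintegral_congr fun y => ?_
  rw [enorm_mul, enorm_mul, Real.enorm_natCast, ENNReal.mul_rpow_of_nonneg _ _ hp,
    ENNReal.mul_rpow_of_nonneg _ _ hp, ENNReal.mul_rpow_of_nonneg _ _ hp]
  ring

theorem nonneg_of_compl_Icc {μ : ProbabilityMeasure ℝ} {R : ℝ}
    (h : (μ : Measure ℝ) (Set.Icc (-R) R)ᶜ = 0) : 0 ≤ R := by
  by_contra hR
  rw [Set.Icc_eq_empty (by linarith), Set.compl_empty, measure_univ] at h
  exact one_ne_zero h

theorem lintegral_rpow_ne_top_of_compl_Icc {μ : ProbabilityMeasure ℝ} {R : ℝ} (hp : 0 ≤ p)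
    (h : (μ : Measure ℝ) (Set.Icc (-R) R)ᶜ = 0) : ∫⁻ r, ‖r‖ₑ ^ p ∂(μ : Measure ℝ) ≠ ∞ := by
  refine ne_top_of_le_ne_top (ENNReal.rpow_ne_top_of_nonneg hp (ENNReal.ofReal_ne_top (r := R))) ?_
  calc _ ≤ ∫⁻ _, ENNReal.ofReal R ^ p ∂(μ : Measure ℝ) := by
        refine lintegral_mono_ae ?_
        have h1 : ∀ᵐ x ∂(μ : Measure ℝ), x ∈ Set.Icc (-R) R := h
        filter_upwards [h1] with x hx
        exact ENNReal.rpow_le_rpow (enorm_le_of_abs_le (abs_le.2 hx)) hp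
    _ = _ := by simp

theorem RecursionAssumption.regular (hR : RecursionAssumption P G π₀ π₁ M B p) (hp : 1 ≤ p)
    (hA : GraphAssumption P G π₀ π₁ M B p) (hμ₀ : ∫⁻ r, ‖r‖ₑ ^ p ∂(μ₀ : Measure ℝ) ≠ ∞) :
    Regular M B p μ₀ π₀ π₁ where
  one_le := hp
  meas := hR.measurable_Φ
  meas_g := by
    obtain ⟨H, Q, α, γ, -, -, -, hγ, h⟩ := hR.holder
    exact measurable_g hR.g_lipschitz hγ fun x x' hx => (h x x' hx).2
  meas_sm := by
    have : SecondCountableTopology A := UniformSpace.secondCountable_of_separable A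
    exact hR.continuous_sm.measurable
  meas_sp := by
    have : SecondCountableTopology A := UniformSpace.secondCountable_of_separable A
    exact hR.continuous_sp.measurable
  meas_β := by
    have : SecondCountableTopology A := UniformSpace.secondCountable_of_separable A
    exact hR.continuous_β.measurable
  lip := hR.g_lipschitz
  root_bounds := hR.root_bounds
  node_bounds := hR.node_bounds
  holder := hR.holder
  mom := hA.momentBounds hp
  init := hμ₀

theorem RecursionAssumption.continuous_g (hR : RecursionAssumption P G π₀ π₁ M B p) (r : ℝ) :
    Continuous (M.g r) := by
  obtain ⟨H, Q, α, γ, -, -, -, hγ, h⟩ := hR.holder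
  exact StochRec.continuous_g hγ (fun x x' hx => (h x x' hx).2) r

theorem RootClose.tendstoInProb (h : RootClose M μ₀ p P G W T K r)
    (hs : ∀ n, IsCoupledSystem M μ₀ π₀ π₁ (P n) (G n) (W n) (T n)) :
    TendstoInProb (fun n => (P n).prod (M.noiseLaw μ₀ (List ℕ) (List ℕ))) (fun n =>
      condLExp (MeasurableSpace.comap Prod.fst (G n).attAlg)
        ((P n).prod (M.noiseLaw μ₀ (List ℕ) (List ℕ))) fun q =>
        ‖(G n).rootR M (W n) r q.1 - treeR M ((T n).node q.1) (treeNoise (T n) (W n) K q) r []‖ₑ ^ p)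
      0 := by
  have hatt : ∀ n, Measurable fun q : Ω n × NoiseSpace (List ℕ) (List ℕ) Z Ξ => (G n).att q.1 :=
    fun n => (hs n).rooted.measurable_att.comp measurable_fst
  have h1 := tendstoInProb_condLExp (P := fun n => (P n).prod (M.noiseLaw μ₀ (List ℕ) (List ℕ))) hatt
    (fun n q => ‖(G n).rootR M (W n) r q.1 -
      treeR M ((T n).node q.1) (treeNoise (T n) (W n) K q) r []‖ₑ ^ p) (fun ε hε => by
      filter_upwards [h ε hε] with n ⟨S, hS, hSc, hSy⟩
      refine ⟨S, hS, ?_, hSy⟩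
      have h2 := (measurePreserving_fst (μ := P n)
        (ν := M.noiseLaw μ₀ (List ℕ) (List ℕ))).measure_preimage
        ((hs n).rooted.measurable_att hS.compl).nullMeasurableSet
      exact (le_of_eq h2).trans hSc)
  have e : ∀ n, MeasurableSpace.comap (Prod.fst : Ω n × NoiseSpace (List ℕ) (List ℕ) Z Ξ → Ω n)
      (G n).attAlg = MeasurableSpace.comap (fun q => (G n).att q.1) inferInstance := fun n =>
    MeasurableSpace.comap_comp
  simp only [e]
  exact h1

/-- The conditional law of the recursion at the root of the graph converges. -/
theorem RootClose.tendstoInProb_wasserstein (h : RootClose M μ₀ p P G W T K r) (hp : 1 ≤ p)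
    (hM : M.IsMeasurable) (hg : Measurable (Function.uncurry M.g))
    (hs : ∀ n, IsCoupledSystem M μ₀ π₀ π₁ (P n) (G n) (W n) (T n)) :
    TendstoInProb P (fun n ω => wasserstein p
      (condDistrib ((G n).rootR M (W n) r) (G n).att (P n) ((G n).att ω))
      (rootLaw M μ₀ π₀ π₁ r)) 0 := by
  have hp0 : 0 < p := by linarith
  have : IsProbabilityMeasure (rootLaw M μ₀ π₀ π₁ r) :=
    Measure.isProbabilityMeasure_map (measurable_treeR hM hg r []).aemeasurable
  rw [tendstoInProb_zero_iff]
  intro ε hε η hη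
  -- Markov's inequality needs a finite threshold.
  set ε' : ℝ≥0∞ := min ε 1 with hε'
  have hε'0 : ε' ≠ 0 := by simp [hε', hε]
  have hε'1 : ε' ≠ ∞ := ne_top_of_le_ne_top ENNReal.one_ne_top (min_le_right _ _)
  have hεp0 : ε' ^ p ≠ 0 := by
    rw [Ne, ENNReal.rpow_eq_zero_iff_of_pos hp0]; exact hε'0
  have hεp1 : ε' ^ p ≠ ∞ := ENNReal.rpow_ne_top_of_nonneg hp0.le hε'1
  have hη2 : η / 2 ≠ 0 := by simp [hη]
  filter_upwards [h (min (η / 2) (ε' ^ p * (η / 2))) (lt_min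
    (pos_iff_ne_zero.2 hη2) (pos_iff_ne_zero.2 (mul_ne_zero hεp0 hη2))).ne'] with n ⟨S, hS, hSc, hSy⟩
  have hatt := (hs n).rooted.measurable_att
  have hR := (hs n).measurable_rootR hM hg r
  have hTr := (hs n).measurable_treeR_treeNoise hM hg K r
  have hfst := measurePreserving_fst (μ := P n) (ν := M.noiseLaw μ₀ (List ℕ) (List ℕ))
  have hX : Measurable fun q : Ω n × NoiseSpace (List ℕ) (List ℕ) Z Ξ => (G n).att q.1 :=
    hatt.comp measurable_fst
  have hRq : Measurable fun q : Ω n × NoiseSpace (List ℕ) (List ℕ) Z Ξ =>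
      (G n).rootR M (W n) r q.1 := hR.comp measurable_fst
  have hmap : ((P n).prod (M.noiseLaw μ₀ (List ℕ) (List ℕ))).map (fun q => (G n).att q.1) =
      (P n).map (G n).att := by
    have h0 := Measure.map_map (μ := (P n).prod (M.noiseLaw μ₀ (List ℕ) (List ℕ))) hatt measurable_fst
    rw [hfst.map_eq] at h0
    exact h0.symm
  have hmp := (hs n).measurePreserving_att_treeR hM hg K r
  have h1 := ae_wasserstein_condDistrib_le (ρ := rootLaw M μ₀ π₀ π₁ r) hp hRq hTr
    (by rw [hmap]; exact hmp)
  have h2 := setLIntegral_condDistrib_sub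
    (P := (P n).prod (M.noiseLaw μ₀ (List ℕ) (List ℕ))) hX hRq hTr hS p
  -- The conditional law of the graph value does not change when the probability space is enlarged
  -- by the fresh noises.
  have h3 := condDistrib_fst_prod (mβ := inferInstance) (μ := P n) (Y := (G n).rootR M (W n) r) (G n).att hR.aemeasurable
    (M.noiseLaw μ₀ (List ℕ) (List ℕ))
  rw [hmap] at h1 h2
  set D : (Fin (n + 1) → A) → ℝ≥0∞ := fun x => ∫⁻ q, ‖q.1 - q.2‖ₑ ^ p
    ∂(condDistrib (fun q => ((G n).rootR M (W n) r q.1,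
      treeR M ((T n).node q.1) (treeNoise (T n) (W n) K q) r [])) (fun q => (G n).att q.1)
      ((P n).prod (M.noiseLaw μ₀ (List ℕ) (List ℕ))) x) with hD
  have hDm : Measurable D :=
    Measurable.lintegral_kernel (f := fun q : ℝ × ℝ => ‖q.1 - q.2‖ₑ ^ p) (by fun_prop)
  have h4 : (P n).map (G n).att {x | ε' ^ p ≤ D x} ≤ η / 2 + η / 2 := by
    refine measure_ge_le_of_setLIntegral hDm (S := S) ?_ hεp0 hεp1 ?_
    · rw [Measure.map_apply hatt hS.compl]
      exact hSc.trans (min_le_left _ _)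
    · exact (le_of_eq h2).trans (hSy.trans (min_le_right _ _))
  rw [ENNReal.add_halves, Measure.map_apply hatt (measurableSet_le measurable_const hDm)] at h4
  refine (measure_mono_ae ?_).trans h4
  filter_upwards [ae_of_ae_map hatt.aemeasurable h1, ae_of_ae_map hatt.aemeasurable h3]
    with ω h1 h3 hω
  have h5 : ε ≤ wasserstein p (condDistrib ((G n).rootR M (W n) r) (G n).att (P n) ((G n).att ω))
    (rootLaw M μ₀ π₀ π₁ r) := hω
  rw [← h3] at h5
  have h6 := ((min_le_left ε 1).trans h5).trans h1
  have h7 := ENNReal.rpow_le_rpow h6 hp0.le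
  rw [← ENNReal.rpow_mul, one_div_mul_cancel hp0.ne', ENNReal.rpow_one] at h7
  exact h7

end Main

theorem measurable_branch_Φ {A : Type a} {Z : Type v} {Ξ : Type w} [MeasurableSpace A]
    [MeasurableSpace Z] [MeasurableSpace Ξ] {M : Recursion A Z Ξ} (hM : M.IsMeasurable) :
    Measurable fun q : (ℕ × Mark A) × Z × (ℕ → ℝ × Ξ) =>
      M.Φ q.1.2 q.2.1 (offFamily q.1.1 q.2.2) :=
  measurable_Φ_offFamily hM (by fun_prop) (by fun_prop) (by fun_prop) fun j => by fun_prop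

end StochRec

end

theorem theorem1 {A : Type a} [MetricSpace A] [TopologicalSpace.SeparableSpace A]
    [MeasurableSpace A] [BorelSpace A] {Z : Type v} {Ξ : Type w} [MeasurableSpace Z]
    [MeasurableSpace Ξ] {Ω : ℕ → Type u} [∀ n, MeasurableSpace (Ω n)]
    (P : ∀ n, Measure (Ω n)) [∀ n, IsProbabilityMeasure (P n)]
    (p : ℝ) (hp : 1 ≤ p)
    (M : StochRec.Recursion A Z Ξ) (B : StochRec.Bounds A) (μ₀ : ProbabilityMeasure ℝ)
    (π₀ π₁ : ProbabilityMeasure (ℕ × StochRec.Mark A))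
    -- the `n`-th graph, on `n + 1` vertices, its noises and initial values, and the coupled trees
    (G : ∀ n, StochRec.RandomDigraph (Ω n) (Fin (n + 1)) A)
    (W : ∀ n, Ω n →
      StochRec.NoiseSpace (Fin (n + 1)) (Fin (n + 1) × Fin (n + 1) × ℕ) Z Ξ)
    (T : ∀ (_k : ℕ) (n : ℕ), StochRec.TreeCoupling (Ω n) (Fin (n + 1)) A)
    (hG : ∀ n, (G n).IsUniformlyRooted (P n))
    (hW : ∀ n, Measurable (W n) ∧
      HasLaw (W n) (M.noiseLaw μ₀ (Fin (n + 1)) (Fin (n + 1) × Fin (n + 1) × ℕ)) (P n))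
    (hWindep : ∀ k, 1 ≤ k → ∀ n, IndepFun (W n)
      (fun ω => (((G n).att ω, (G n).mult ω, (G n).root ω), (T k n).node ω, (T k n).θ ω)) (P n))
    -- the assumption on the recursion
    (hR : StochRec.RecursionAssumption P G π₀ π₁ M B p)
    (hinit : (StochRec.MatrixBounds P G M B p ∧ ∫⁻ r, ‖r‖ₑ ^ p ∂(μ₀ : Measure ℝ) < ∞) ∨
      ∃ K : ℝ, StochRec.PreservesInterval P G M K ∧ (μ₀ : Measure ℝ) (Set.Icc (-K) K)ᶜ = 0)
    -- the assumption on the graph sequence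
    (hT : ∀ k, 1 ≤ k → StochRec.IsStrongCoupling P G π₀ π₁ k (T k))
    (hA : StochRec.GraphAssumption P G π₀ π₁ M B p) :
    -- the coupling, on an extension `(Ω' n, P' n)` of the `n`-th probability space
    (∀ k : ℕ, ∃ (Ω' : ℕ → Type (max u v w)) (_ : ∀ n, MeasurableSpace (Ω' n))
      (P' : ∀ n, Measure (Ω' n)) (π : ∀ n, Ω' n → Ω n)
      (W' : ∀ n, Ω' n → StochRec.NoiseSpace (List ℕ) (List ℕ) Z Ξ),
      (∀ n, MeasurePreserving (π n) (P' n) (P n)) ∧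
      (∀ n, HasLaw (W' n) (M.noiseLaw μ₀ (List ℕ) (List ℕ)) (P' n)) ∧
      (∀ n, IndepFun (W' n) (fun ω => (T (max k 1) n).node (π n ω)) (P' n)) ∧
      (∀ n, ∀ r ≤ k, HasLaw
        (fun ω => StochRec.treeR M ((T (max k 1) n).node (π n ω)) (W' n ω) r [])
        (StochRec.rootLaw M μ₀ π₀ π₁ r) (P' n)) ∧
      StochRec.TendstoInProb P' (fun n ω' => (Finset.range (k + 1)).sup fun r =>
        condLExp (MeasurableSpace.comap (π n) (G n).attAlg) (P' n) (fun ω =>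
          ‖(G n).rootR M (W n) r (π n ω)
            - StochRec.treeR M ((T (max k 1) n).node (π n ω)) (W' n ω) r []‖ₑ ^ p) ω') 0) ∧
    -- convergence of the conditional law of `R_I^{(k)}`
    (∀ k : ℕ, StochRec.TendstoInProb P (fun n ω => StochRec.wasserstein p
      (condDistrib ((G n).rootR M (W n) k) (G n).att (P n) ((G n).att ω))
      (StochRec.rootLaw M μ₀ π₀ π₁ k)) 0) ∧
    -- convergence as `k → ∞`
    (∫⁻ y, ‖(y.1 : ℝ) * B.sm y.2 * B.sp y.2‖ₑ ^ p ∂(π₁ : Measure (ℕ × StochRec.Mark A)) < 1 →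
      ∃ ν η : ProbabilityMeasure ℝ,
        Tendsto (fun k => StochRec.wasserstein p (StochRec.rootLaw M μ₀ π₀ π₁ k)
          (ν : Measure ℝ)) atTop (𝓝 0) ∧
        StochRec.IsAttractingEndogenous M p π₁ η ∧
        (ν : Measure ℝ) = StochRec.branchLaw M π₀ M.Φ η) := by
  have hp0 : 0 ≤ p := by linarith
  have hμ₀ : ∫⁻ r, ‖r‖ₑ ^ p ∂(μ₀ : Measure ℝ) ≠ ∞ := by
    rcases hinit with h | ⟨R, -, hR⟩
    · exact h.2.ne
    · exact StochRec.lintegral_rpow_ne_top_of_compl_Icc hp0 hR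
  have hreg := hR.regular hp hA hμ₀
  have hinit' : StochRec.MatrixBounds P G M B p ∨
      ∃ R : ℝ, 0 ≤ R ∧ StochRec.PreservesInterval P G M R ∧
        (μ₀ : Measure ℝ) (Set.Icc (-R) R)ᶜ = 0 :=
    hinit.imp (fun h => h.1) fun ⟨R, h1, h2⟩ => ⟨R, StochRec.nonneg_of_compl_Icc h2, h1, h2⟩
  have hs : ∀ K, 1 ≤ K → ∀ n,
      StochRec.IsCoupledSystem M μ₀ π₀ π₁ (P n) (G n) (W n) (T K n) := fun K hK n =>
    { rooted := hG n
      measurable_noise := (hW n).1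
      map_noise := (hW n).2.map_eq
      indep_noise := hWindep K hK n
      measurable_node := (hT K hK).measurable_node n
      measurable_θ := (hT K hK).measurable_θ n
      map_node := ((hT K hK).law n).map_eq
      indep_node := (hT K hK).indep n }
  have hclose : ∀ K (_ : 1 ≤ K), ∀ r ≤ K, StochRec.RootClose M μ₀ p P G W (T K) K r :=
    fun K hK => hreg.rootClose hK hR.continuous_sp (hR.continuous_g 0) (hs K hK) (hT K hK)
      hR.graph_bounds hinit' hA
  refine ⟨fun k => ?_, fun k => ?_, fun hlt => ?_⟩
  · have hK : 1 ≤ max k 1 := le_max_right _ _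
    have hsK := hs _ hK
    -- The extension adds a full set of fresh tree noises. A single merging depth `max k 1` serves
    -- all times `r ≤ k`, so one family of noises works simultaneously.
    refine ⟨fun n => Ω n × StochRec.NoiseSpace (List ℕ) (List ℕ) Z Ξ, fun n => inferInstance,
      fun n => (P n).prod (M.noiseLaw μ₀ (List ℕ) (List ℕ)), fun n => Prod.fst,
      fun n => StochRec.treeNoise (T (max k 1) n) (W n) (max k 1),
      fun n => measurePreserving_fst, fun n => ?_, fun n => ?_, fun n r _ => ?_, ?_⟩
    · exact (measurePreserving_snd.comp
        ((hsK n).measurePreserving_node_treeNoise (max k 1))).hasLaw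
    · have h1 := (hsK n).measurePreserving_node_treeNoise (max k 1)
      have h2 := (measurePreserving_snd.comp h1).map_eq
      have h3 := (measurePreserving_fst.comp h1).map_eq
      have h4 := (indepFun_iff_map_prod_eq_prod_map_map
        ((hsK n).measurable_node.comp measurable_fst).aemeasurable
        ((hsK n).measurable_treeNoise (max k 1)).aemeasurable).2
        (h1.map_eq.trans (congrArg₂ Measure.prod h3.symm h2.symm))
      exact h4.symm
    · have h1 : MeasurePreserving (fun q : (List ℕ → ℕ × StochRec.Mark A) ×
          StochRec.NoiseSpace (List ℕ) (List ℕ) Z Ξ => StochRec.treeR M q.1 q.2 r [])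
          ((StochRec.gwLaw π₀ π₁).prod (M.noiseLaw μ₀ (List ℕ) (List ℕ)))
          (StochRec.rootLaw M μ₀ π₀ π₁ r) :=
        ⟨StochRec.measurable_treeR hreg.meas hreg.meas_g r [], rfl⟩
      exact (h1.comp ((hsK n).measurePreserving_node_treeNoise (max k 1))).hasLaw
    · refine StochRec.tendstoInProb_sup _ _ fun r hr => ?_
      have hrk : r ≤ max k 1 := (Finset.mem_range_succ_iff.1 hr).trans (le_max_left _ _)
      exact (hclose _ hK r hrk).tendstoInProb hsK
  · have hK : 1 ≤ max k 1 := le_max_right _ _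
    exact (hclose _ hK k (le_max_left _ _)).tendstoInProb_wasserstein hp hreg.meas hreg.meas_g
      (hs _ hK)
  · have hit : StochRec.IterationBounds M B p π₁ :=
      { one_le := hp
        meas := hreg.meas
        meas_g := hreg.meas_g
        meas_sm := hreg.meas_sm
        meas_sp := hreg.meas_sp
        meas_β := hreg.meas_β
        lip := hreg.lip
        bounds := hreg.node_bounds
        contr_lt := by rw [StochRec.contr_eq B hp0]; exact hlt
        node_spβ := hreg.mom.node_spβ
        node_g := hreg.mom.node_g
        node_sp := hreg.mom.node_sp }
    have hν : IsProbabilityMeasure (StochRec.branchLaw M π₀ M.Φ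
        (StochRec.limLaw hit.meas hit.meas_g π₁)) :=
      Measure.isProbabilityMeasure_map (StochRec.measurable_branch_Φ hreg.meas).aemeasurable
    exact ⟨⟨_, hν⟩, StochRec.limLaw hit.meas hit.meas_g π₁,
      hit.tendsto_wasserstein_rootLaw hreg.root_bounds hμ₀ hreg.mom.root_sm,
      hit.isAttractingEndogenous, rfl⟩
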